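/- Let $\gamma:\mathbb{R}\to\mathbb{R}^2$ be an injective $C^3$ curve parametrized by arc length, let $\nu(s)$ be the unit normal for which $(\gamma'(s),\nu(s))$ is a positively oriented orthonormal basis, and let the curvature $\kappa$ be defined by $\gamma''=\kappa\nu$. Assume that $\kappa(s)\to0$ as $s\to\pm\infty$ and $\kappa'\in L^\infty(\mathbb{R})$. Let $0<\varepsilon<(2\|\kappa\|_{L^\infty(\mathbb{R})})^{-1}$ (the right-hand side being $+\infty$ if $\kappa\equiv0$) be such that $\Phi_\varepsilon(s,t)=\gamma(s)+\varepsilon t\,\nu(s)$ is injective on $\mathbb{R}\times(-1,1)$, and put $\Omega_\varepsilon=\Phi_\varepsilon(\mathbb{R}\times(-1,1))$. Let $m\ge0$, let $\sigma_1=\begin{pmatrix}0&1\\1&0\end{pmatrix}$, $\sigma_2=\begin{pmatrix}0&-i\\i&0\end{pmatrix}$, $\sigma_3=\begin{pmatrix}1&0\\0&-1\end{pmatrix}$ and $\sigma\cdot v=\sigma_1v_1+\sigma_2v_2$. Consider in $L^2(\Omega_\varepsilon,\mathbb{C}^2)$ the operator $$\mathcal{D}u=-i\,\sigma\cdot\nabla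 u+m\sigma_3u$$ whose domain consists of all $u\in H^1(\Omega_\varepsilon,\mathbb{C}^2)$ with $-i\sigma_3(\sigma\cdot n)u=u$ on $\partial\Omega_\varepsilon$. Here $n$ is the outward unit normal, and the boundary values are the traces from inside $\Omega_\varepsilon$ on the two curves $s\mapsto\gamma(s)\pm\varepsilon\nu(s)$, where $n=\pm\nu(s)$. Then: (1) $\mathcal{D}$ is self-adjoint. (2) The spectrum of $\mathcal{D}$ is symmetric with respect to $0$. (3) For every $\mu\ge0$ the equation $\mu\sin(2\sqrt{E})+\sqrt{E}\cos(2\sqrt{E})=0$ has exactly one root $E=E_1(\mu)$ in $[\pi^2/16,\pi^2/4)$, and the essential spectrum of $\mathcal{D}$ (the spectrum without the isolated eigenvalues of finite multiplicity) is $$\Big(-\infty,-\sqrt{\varepsilon^{-2}E_1(m\varepsilon)+m^2}\Big]\cup\Big[\sqrt{\varepsilon^{-2}E_1(m\varepsilon)+m^2},+\infty\Big).$$ -/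

import Mathlib

open MeasureTheory Filter Topology Set
open scoped ENNReal ContDiff

noncomputable section

/-! ### Unbounded operators on a complex Hilbert space: spectrum and essential spectrum -/

namespace UnboundedOp

variable {H : Type*} [NormedAddCommGroup H] [InnerProductSpace ℂ H]

/-- The resolvent set of an unbounded operator `T`: those `z` for which `T - z` is a bijection from
the domain of `T` onto `H` with a bounded inverse `R`. -/
def resolventSet (T : H →ₗ.[ℂ] H) : Set ℂ :=
  {z | ∃ R : H →L[ℂ] H,
    (∀ f : H, ∃ h : R f ∈ T.domain, T ⟨R f, h⟩ - z • R f = f) ∧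
    ∀ u : T.domain, R (T u - z • (u : H)) = u}

/-- The spectrum of an unbounded operator. -/
def spectrum (T : H →ₗ.[ℂ] H) : Set ℂ := (resolventSet T)ᶜ

/-- The eigenspace `ker (T - z)`, as a subspace of the domain of `T`. -/
def eigenspace (T : H →ₗ.[ℂ] H) (z : ℂ) : Submodule ℂ T.domain :=
  LinearMap.ker (T.toFun - z • T.domain.subtype)

/-- The discrete spectrum (of a self-adjoint operator): the isolated points of the spectrum that
are eigenvalues of finite multiplicity. -/
def discreteSpectrum (T : H →ₗ.[ℂ] H) : Set ℂ :=
  {z | z ∈ spectrum T ∧ (∃ U ∈ 𝓝 z, U ∩ spectrum T = {z}) ∧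
    eigenspace T z ≠ ⊥ ∧ FiniteDimensional ℂ (eigenspace T z)}

/-- The essential spectrum (of a self-adjoint operator): the complement in the spectrum of the
discrete spectrum. -/
def essentialSpectrum (T : H →ₗ.[ℂ] H) : Set ℂ := spectrum T \ discreteSpectrum T

end UnboundedOp

/-! ### Planar waveguides -/

/-- The Euclidean plane `ℝ²`. -/
abbrev Plane := EuclideanSpace ℝ (Fin 2)

/-- The space of spinors `ℂ²` with its Hermitian norm. -/
abbrev Spinor := EuclideanSpace ℂ (Fin 2)

namespace Waveguide

/-- The normal of an arc-length parametrised curve: `(γ', ν)` is positively oriented. -/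
def normal (γ : ℝ → Plane) (s : ℝ) : Plane := !₂[-(deriv γ s 1), deriv γ s 0]

/-- The signed curvature `κ`, i.e. the coefficient in `γ'' = κ ν`. -/
def curvature (γ : ℝ → Plane) (s : ℝ) : ℝ := inner ℝ (normal γ s) (deriv (deriv γ) s)

/-- The map `Φ_ε (s, t) = γ(s) + ε t ν(s)`. -/
def tubeMap (γ : ℝ → Plane) (ε : ℝ) (p : ℝ × ℝ) : Plane := γ p.1 + (ε * p.2) • normal γ p.1

/-- The strip `ℝ × (-1, 1)`. -/
def strip : Set (ℝ × ℝ) := univ ×ˢ Ioo (-1) 1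

/-- The tubular neighbourhood `Ω_ε` of the curve. -/
def tube (γ : ℝ → Plane) (ε : ℝ) : Set Plane := tubeMap γ ε '' strip

/-- The standing hypotheses on the base curve `γ` and the half-width `ε`. -/
structure IsWaveguide (γ : ℝ → Plane) (ε : ℝ) : Prop where
  contDiff : ContDiff ℝ 3 γ
  injective : Function.Injective γ
  unit_speed : ∀ s, ‖deriv γ s‖ = 1
  curvature_atTop : Tendsto (curvature γ) atTop (𝓝 0)
  curvature_atBot : Tendsto (curvature γ) atBot (𝓝 0)
  deriv_curvature : MemLp (deriv (curvature γ)) ∞ volume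
  injOn : InjOn (tubeMap γ ε) strip
  pos : 0 < ε
  lt : ENNReal.ofReal ε < (2 * eLpNorm (curvature γ) ∞ volume)⁻¹

/-! ### The infinite mass Dirac operator -/

/-- The Pauli matrices `σ₁, σ₂, σ₃` (indexed by `0, 1, 2`). -/
def pauli : Fin 3 → Matrix (Fin 2) (Fin 2) ℂ :=
  ![!![0, 1; 1, 0], !![0, -Complex.I; Complex.I, 0], !![1, 0; 0, -1]]

/-- The action of the Pauli matrices on spinors. -/
def pauliMap (k : Fin 3) : Spinor →L[ℂ] Spinor := Matrix.toEuclideanCLM (𝕜 := ℂ) (pauli k)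

/-- `σ · v = v₁ σ₁ + v₂ σ₂`, acting on spinors, for `v ∈ ℝ²`. -/
def sigmaDot (v : Plane) : Spinor →L[ℂ] Spinor :=
  (v 0 : ℂ) • pauliMap 0 + (v 1 : ℂ) • pauliMap 1

/-- The Hilbert space `L²(Ω, ℂ²)`. -/
abbrev L2 (Ω : Set Plane) := Lp Spinor 2 (volume.restrict Ω)

/-- `v` is the weak partial derivative `∂_j u` in `Ω`. -/
def IsWeakDeriv (Ω : Set Plane) (j : Fin 2) (u v : Plane → Spinor) : Prop :=
  ∀ φ : Plane → ℝ, ContDiff ℝ ∞ φ → HasCompactSupport φ → tsupport φ ⊆ Ω →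
    ∫ x in Ω, (fderiv ℝ φ x (EuclideanSpace.single j 1)) • u x = - ∫ x in Ω, φ x • v x

/-- The mean over the boundary layer `{γ(s) + ε τ t ν(s) : 1 - δ < t < 1}`, in the coordinates
`(s, t)`, of the squared distance of `u` to a function `g` of `s`. -/
def layerMean (γ : ℝ → Plane) (ε τ : ℝ) (u : Plane → Spinor) (g : ℝ → Spinor) (δ : ℝ) : ℝ≥0∞ :=
  (ENNReal.ofReal δ)⁻¹ *
    ∫⁻ p in (univ ×ˢ Ioo (1 - δ) 1 : Set (ℝ × ℝ)), ‖u (tubeMap γ ε (p.1, τ * p.2)) - g p.1‖ₑ ^ 2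

/-- `g ∈ L²(ℝ, ℂ²)` is the boundary trace of `u`, taken from inside the tube, on the boundary
component `s ↦ γ(s) + ε τ ν(s)` (`τ = 1` or `τ = -1`): `u(γ(s) + ε τ t ν(s))` converges to `g(s)` in
the `L²` sense as `t → 1⁻`. It does not depend on the representative of `u`, since the tube map is a
local diffeomorphism. -/
def IsTrace (γ : ℝ → Plane) (ε τ : ℝ) (u : L2 (tube γ ε)) (g : ℝ → Spinor) : Prop :=
  MemLp g 2 volume ∧
  ∃ w : Plane → Spinor, StronglyMeasurable w ∧ u =ᵐ[volume.restrict (tube γ ε)] w ∧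
    Tendsto (layerMean γ ε τ w g) (𝓝[>] 0) (𝓝 0)

/-- The infinite mass boundary condition `-i σ₃ (σ · n) u = u` on the boundary component
`s ↦ γ(s) + ε τ ν(s)`, whose outward pointing normal is `n = τ ν`. -/
def InfiniteMass (γ : ℝ → Plane) (ε τ : ℝ) (u : L2 (tube γ ε)) : Prop :=
  ∃ g : ℝ → Spinor, IsTrace γ ε τ u g ∧
    ∀ᵐ s : ℝ, (-Complex.I) • pauliMap 2 (sigmaDot (τ • normal γ s) (g s)) = g s

/-- `-i σ · ∇u + m σ₃ u`, where `v j` stands for `∂_j u`. -/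
def diracExpr (Ω : Set Plane) (m : ℝ) (u : L2 Ω) (v : Fin 2 → L2 Ω) : L2 Ω :=
  (-Complex.I) • ((pauliMap 0).compLpL 2 _ (v 0) + (pauliMap 1).compLpL 2 _ (v 1)) +
    (m : ℂ) • (pauliMap 2).compLpL 2 _ u

/-- `(u, f)` lies on the graph of the Dirac operator: `u ∈ H¹(Ω_ε, ℂ²)` (with weak gradient `v`)
satisfies the boundary condition on both boundary components, and `f = -i σ · ∇u + m σ₃ u`. -/
def MemDiracGraph (γ : ℝ → Plane) (ε m : ℝ) (u f : L2 (tube γ ε)) : Prop :=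
  ∃ v : Fin 2 → L2 (tube γ ε), (∀ j, IsWeakDeriv (tube γ ε) j u (v j)) ∧
    InfiniteMass γ ε 1 u ∧ InfiniteMass γ ε (-1) u ∧ f = diracExpr (tube γ ε) m u v

/-! Linearity of the notions above. -/

theorem integrable_test {Ω : Set Plane} {ψ : Plane → ℝ} (hψ : Continuous ψ)
    (hc : HasCompactSupport ψ) (u : L2 Ω) :
    Integrable (fun x => ψ x • u x) (volume.restrict Ω) :=
  ((Lp.memLp u).locallyIntegrable (by norm_num)).integrable_smul_left_of_hasCompactSupport hψ hc

theorem integrable_test_deriv {Ω : Set Plane} {φ : Plane → ℝ} (hφ : ContDiff ℝ ∞ φ)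
    (hc : HasCompactSupport φ) (e : Plane) (u : L2 Ω) :
    Integrable (fun x => (fderiv ℝ φ x e) • u x) (volume.restrict Ω) :=
  integrable_test (ψ := fun x => fderiv ℝ φ x e)
    ((hφ.continuous_fderiv (by simp)).clm_apply continuous_const) (hc.fderiv_apply ℝ e) u

theorem IsWeakDeriv.zero {Ω : Set Plane} {j : Fin 2} :
    IsWeakDeriv Ω j (0 : L2 Ω) (0 : L2 Ω) := by
  intro φ _ _ _
  have h : ∀ ψ : Plane → ℝ, ∫ x in Ω, ψ x • (0 : L2 Ω) x = 0 := fun ψ => by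
    rw [integral_congr_ae (g := fun _ => (0 : Spinor)), integral_zero]
    filter_upwards [Lp.coeFn_zero Spinor 2 (volume.restrict Ω)] with x hx
    rw [hx, Pi.zero_apply, smul_zero]
  rw [h, h, neg_zero]

theorem IsWeakDeriv.add {Ω : Set Plane} {j : Fin 2} {u v u' v' : L2 Ω}
    (h : IsWeakDeriv Ω j u v) (h' : IsWeakDeriv Ω j u' v') :
    IsWeakDeriv Ω j (u + u' : L2 Ω) (v + v' : L2 Ω) := by
  intro φ hφ hc hs
  have key : ∀ (ψ : Plane → ℝ) (a b : L2 Ω), Integrable (fun x => ψ x • a x) (volume.restrict Ω) →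
      Integrable (fun x => ψ x • b x) (volume.restrict Ω) →
      ∫ x in Ω, ψ x • (a + b : L2 Ω) x = (∫ x in Ω, ψ x • a x) + ∫ x in Ω, ψ x • b x := by
    intro ψ a b ha hb
    rw [← integral_add ha hb]
    refine integral_congr_ae ?_
    filter_upwards [Lp.coeFn_add a b] with x hx
    rw [hx, Pi.add_apply, smul_add]
  rw [key _ u u' (integrable_test_deriv hφ hc _ u) (integrable_test_deriv hφ hc _ u'),
    key _ v v' (integrable_test hφ.continuous hc v) (integrable_test hφ.continuous hc v'),
    h φ hφ hc hs, h' φ hφ hc hs, neg_add]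

theorem IsWeakDeriv.smul {Ω : Set Plane} {j : Fin 2} {u v : L2 Ω} (c : ℂ)
    (h : IsWeakDeriv Ω j u v) : IsWeakDeriv Ω j (c • u : L2 Ω) (c • v : L2 Ω) := by
  intro φ hφ hc hs
  have key : ∀ (ψ : Plane → ℝ) (a : L2 Ω),
      ∫ x in Ω, ψ x • (c • a : L2 Ω) x = c • ∫ x in Ω, ψ x • a x := by
    intro ψ a
    rw [← integral_smul]
    refine integral_congr_ae ?_
    filter_upwards [Lp.coeFn_smul c a] with x hx
    simp [hx, smul_comm (ψ x) c]
  rw [key, key, h φ hφ hc hs, smul_neg]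

theorem contDiff_normal {γ : ℝ → Plane} (hγ : ContDiff ℝ 3 γ) : ContDiff ℝ 2 (normal γ) := by
  have h : ContDiff ℝ 2 (deriv γ) := hγ.deriv'
  rw [contDiff_euclidean] at h ⊢
  intro i
  fin_cases i
  · simpa [normal] using (h 1).neg
  · simpa [normal] using h 0

theorem contDiff_tubeMap {γ : ℝ → Plane} (hγ : ContDiff ℝ 3 γ) (ε : ℝ) :
    ContDiff ℝ 2 (tubeMap γ ε) := by
  unfold tubeMap
  have h1 : ContDiff ℝ 2 γ := hγ.of_le (by norm_num)
  have h2 := contDiff_normal hγ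
  fun_prop

theorem InfiniteMass.zero {γ : ℝ → Plane} {ε τ : ℝ} : InfiniteMass γ ε τ 0 := by
  refine ⟨0, ⟨MemLp.zero, 0, stronglyMeasurable_zero, Lp.coeFn_zero _ _ _, ?_⟩, ?_⟩
  · have : layerMean γ ε τ 0 0 = fun _ => 0 := by
      funext δ
      simp [layerMean]
    rw [this]
    exact tendsto_const_nhds
  · simp

theorem InfiniteMass.smul {γ : ℝ → Plane} {ε τ : ℝ} {u : L2 (tube γ ε)} (c : ℂ)
    (h : InfiniteMass γ ε τ u) : InfiniteMass γ ε τ (c • u) := by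
  obtain ⟨g, ⟨hg, w, hw, huw, ht⟩, hbc⟩ := h
  refine ⟨c • g, ⟨hg.const_smul c, c • w, hw.const_smul c, ?_, ?_⟩, ?_⟩
  · filter_upwards [Lp.coeFn_smul c u, huw] with x h1 h2
    simp [h1, h2]
  · have : layerMean γ ε τ (c • w) (c • g) = fun δ => ‖c‖ₑ ^ 2 * layerMean γ ε τ w g δ := by
      funext δ
      simp only [layerMean, Pi.smul_apply, ← smul_sub, enorm_smul, mul_pow]
      rw [lintegral_const_mul' _ _ (by simp)]
      ring
    rw [this]
    simpa using ENNReal.Tendsto.const_mul ht (a := ‖c‖ₑ ^ 2) (Or.inr (by simp))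
  · filter_upwards [hbc] with s hs
    simp only [Pi.smul_apply, map_smul]
    rw [smul_comm, hs]

theorem layerMean_add_le {γ : ℝ → Plane} (hγ : ContDiff ℝ 3 γ) {ε τ : ℝ} {w w' : Plane → Spinor}
    {g g' : ℝ → Spinor} (hw : StronglyMeasurable w) (hg : AEStronglyMeasurable g volume) (δ : ℝ) :
    layerMean γ ε τ (w + w') (g + g') δ ≤
      2 * (layerMean γ ε τ w g δ + layerMean γ ε τ w' g' δ) := by
  have hc : Continuous fun p : ℝ × ℝ => tubeMap γ ε (p.1, τ * p.2) :=
    (contDiff_tubeMap hγ ε).continuous.comp (by fun_prop)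
  have hm : AEMeasurable (fun p : ℝ × ℝ => ‖w (tubeMap γ ε (p.1, τ * p.2)) - g p.1‖ₑ ^ 2)
      (volume.restrict (univ ×ˢ Ioo (1 - δ) 1)) := by
    have h1 : AEStronglyMeasurable (fun p : ℝ × ℝ => w (tubeMap γ ε (p.1, τ * p.2))) volume :=
      (hw.comp_measurable hc.measurable).aestronglyMeasurable
    have h2 : AEStronglyMeasurable (fun p : ℝ × ℝ => g p.1) volume := hg.comp_fst
    exact ((h1.sub h2).restrict.enorm).pow_const 2
  simp only [layerMean]
  rw [← mul_add, ← lintegral_add_left' hm, mul_left_comm, ← lintegral_const_mul' 2 _ (by simp)]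
  refine mul_le_mul_right (lintegral_mono fun p => ?_) _
  have e : (w + w') (tubeMap γ ε (p.1, τ * p.2)) - (g + g') p.1 =
      (w (tubeMap γ ε (p.1, τ * p.2)) - g p.1) + (w' (tubeMap γ ε (p.1, τ * p.2)) - g' p.1) := by
    simp only [Pi.add_apply]
    abel
  rw [e]
  have h := ENNReal.rpow_add_le_mul_rpow_add_rpow ‖w (tubeMap γ ε (p.1, τ * p.2)) - g p.1‖ₑ
    ‖w' (tubeMap γ ε (p.1, τ * p.2)) - g' p.1‖ₑ (p := 2) (by norm_num)
  norm_num at h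
  exact (pow_le_pow_left₀ (by simp) (enorm_add_le _ _) 2).trans h

theorem InfiniteMass.add {γ : ℝ → Plane} (hγ : ContDiff ℝ 3 γ) {ε τ : ℝ} {u u' : L2 (tube γ ε)}
    (h : InfiniteMass γ ε τ u) (h' : InfiniteMass γ ε τ u') : InfiniteMass γ ε τ (u + u') := by
  obtain ⟨g, ⟨hg, w, hw, huw, ht⟩, hbc⟩ := h
  obtain ⟨g', ⟨hg', w', hw', huw', ht'⟩, hbc'⟩ := h'
  refine ⟨g + g', ⟨hg.add hg', w + w', hw.add hw', ?_, ?_⟩, ?_⟩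
  · filter_upwards [Lp.coeFn_add u u', huw, huw'] with x h1 h2 h3
    rw [h1, Pi.add_apply, Pi.add_apply, h2, h3]
  · have hlim := ENNReal.Tendsto.const_mul (ht.add ht') (a := 2) (Or.inr (by simp))
    simp only [add_zero, mul_zero] at hlim
    exact tendsto_of_tendsto_of_tendsto_of_le_of_le tendsto_const_nhds hlim (fun _ => zero_le)
      (layerMean_add_le hγ hw hg.1)
  · filter_upwards [hbc, hbc'] with s hs hs'
    simp only [Pi.add_apply, map_add, smul_add]
    rw [hs, hs']

/-- The graph of the Dirac operator, a subspace of `L² × L²`. -/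
def diracGraph {γ : ℝ → Plane} {ε : ℝ} (hW : IsWaveguide γ ε) (m : ℝ) :
    Submodule ℂ (L2 (tube γ ε) × L2 (tube γ ε)) where
  carrier := {p | MemDiracGraph γ ε m p.1 p.2}
  zero_mem' := by
    refine ⟨0, fun j => IsWeakDeriv.zero, InfiniteMass.zero, InfiniteMass.zero, ?_⟩
    simp only [diracExpr, Prod.snd_zero, Prod.fst_zero, Pi.zero_apply,
      map_zero, smul_zero, add_zero]
  add_mem' := by
    rintro ⟨u, f⟩ ⟨u', f'⟩ ⟨v, hv, h1, h2, hf⟩ ⟨v', hv', h1', h2', hf'⟩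
    refine ⟨v + v', fun j => (hv j).add (hv' j), h1.add hW.contDiff h1', h2.add hW.contDiff h2', ?_⟩
    simp only at hf hf'
    simp only [hf, hf', diracExpr, Prod.mk_add_mk, Pi.add_apply, map_add, smul_add]
    abel
  smul_mem' := by
    rintro c ⟨u, f⟩ ⟨v, hv, h1, h2, hf⟩
    refine ⟨c • v, fun j => (hv j).smul c, h1.smul c, h2.smul c, ?_⟩
    simp only at hf
    simp only [hf, diracExpr, Prod.smul_mk, Pi.smul_apply, map_smul, smul_add]
    simp only [smul_comm c]

/-- The Dirac operator with infinite mass boundary conditions on the tube, as an unbounded operator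
in `L²(Ω_ε, ℂ²)`: the operator with graph `diracGraph` (see `diracOp_graph`). -/
def diracOp {γ : ℝ → Plane} {ε : ℝ} (hW : IsWaveguide γ ε) (m : ℝ) :
    L2 (tube γ ε) →ₗ.[ℂ] L2 (tube γ ε) := (diracGraph hW m).toLinearPMap

/-! The graph is single-valued: the tube is open, hence weak derivatives are unique. -/

theorem continuous_curvature {γ : ℝ → Plane} (hγ : ContDiff ℝ 3 γ) :
    Continuous (curvature γ) := by
  have h1 : ContDiff ℝ 2 (deriv γ) := hγ.deriv'
  have h2 : ContDiff ℝ 1 (deriv (deriv γ)) := ContDiff.deriv' h1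
  exact (contDiff_normal hγ).continuous.inner h2.continuous

theorem IsWaveguide.mul_abs_curvature_lt {γ : ℝ → Plane} {ε : ℝ} (hW : IsWaveguide γ ε) (s : ℝ) :
    ε * |curvature γ s| < 1 := by
  have hle : ‖curvature γ s‖ₑ ≤ eLpNorm (curvature γ) ∞ volume := by
    by_contra! hlt
    have hopen : IsOpen {x | eLpNorm (curvature γ) ∞ volume < ‖curvature γ x‖ₑ} :=
      isOpen_lt continuous_const (continuous_curvature hW.contDiff).enorm
    have hnull : volume {x | eLpNorm (curvature γ) ∞ volume < ‖curvature γ x‖ₑ} = 0 := by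
      have h := ae_le_eLpNormEssSup (f := curvature γ) (μ := (volume : Measure ℝ))
      rw [ae_iff] at h
      simpa [eLpNorm_exponent_top] using h
    have := hopen.eq_empty_of_measure_zero hnull
    exact (Set.mem_empty_iff_false s).1 (this ▸ hlt)
  have h2 : ENNReal.ofReal ε < (2 * ‖curvature γ s‖ₑ)⁻¹ :=
    hW.lt.trans_le (ENNReal.inv_le_inv.2 (by gcongr))
  rcases eq_or_ne (curvature γ s) 0 with h0 | h0
  · simp [h0]
  have hpos : 0 < |curvature γ s| := abs_pos.2 h0
  rw [Real.enorm_eq_ofReal_abs, show (2 : ℝ≥0∞) = ENNReal.ofReal 2 by simp,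
    ← ENNReal.ofReal_mul (by norm_num), ← ENNReal.ofReal_inv_of_pos (by positivity),
    ENNReal.ofReal_lt_ofReal_iff (by positivity),
    ← one_div, lt_div_iff₀ (by positivity)] at h2
  nlinarith [hW.pos]

theorem hasDerivAt_coord {f : ℝ → Plane} {f' : Plane} {x : ℝ} (h : HasDerivAt f f' x) (i : Fin 2) :
    HasDerivAt (fun y => f y i) (f' i) x :=
  (EuclideanSpace.proj (𝕜 := ℝ) i).hasFDerivAt.comp_hasDerivAt x h

theorem IsWaveguide.isOpen_tube {γ : ℝ → Plane} {ε : ℝ} (hW : IsWaveguide γ ε) :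
    IsOpen (tube γ ε) := by
  have hC : ContDiff ℝ 2 (tubeMap γ ε) := contDiff_tubeMap hW.contDiff ε
  have h1 : ContDiff ℝ 2 (deriv γ) := hW.contDiff.deriv'
  rw [tube, isOpen_iff_mem_nhds]
  rintro _ ⟨⟨s, t⟩, hst, rfl⟩
  have hstrip : strip ∈ 𝓝 (s, t) :=
    (isOpen_univ.prod isOpen_Ioo).mem_nhds hst
  have hF : HasStrictFDerivAt (tubeMap γ ε) (fderiv ℝ (tubeMap γ ε) (s, t)) (s, t) :=
    hC.contDiffAt.hasStrictFDerivAt (by norm_num)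
  -- the two partial derivatives in coordinates
  have hγ0 : ∀ i, HasDerivAt (fun x => γ x i) (deriv γ s i) s := fun i =>
    hasDerivAt_coord ((hW.contDiff.differentiable (by norm_num)) s).hasDerivAt i
  have hγ1 : ∀ i, HasDerivAt (fun x => deriv γ x i) (deriv (deriv γ) s i) s := fun i =>
    hasDerivAt_coord ((h1.differentiable (by norm_num)) s).hasDerivAt i
  have hps : HasDerivAt (fun x => tubeMap γ ε (x, t))
      (fderiv ℝ (tubeMap γ ε) (s, t) (1, 0)) s :=
    HasFDerivAt.comp_hasDerivAt (f := fun x => (x, t)) s hF.hasFDerivAt ((hasDerivAt_id s).prodMk (hasDerivAt_const s t))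
  have hpt : HasDerivAt (fun x => tubeMap γ ε (s, x))
      (fderiv ℝ (tubeMap γ ε) (s, t) (0, 1)) t :=
    HasFDerivAt.comp_hasDerivAt (f := fun x => (s, x)) t hF.hasFDerivAt ((hasDerivAt_const t s).prodMk (hasDerivAt_id t))
  set L := fderiv ℝ (tubeMap γ ε) (s, t) with hL
  have a0 : L (1, 0) 0 = deriv γ s 0 - ε * t * deriv (deriv γ) s 1 := by
    refine (hasDerivAt_coord hps 0).unique ?_
    convert! (hγ0 0).add ((hγ1 1).neg.const_mul (ε * t)) using 1
    ring
  have a1 : L (1, 0) 1 = deriv γ s 1 + ε * t * deriv (deriv γ) s 0 := by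
    refine (hasDerivAt_coord hps 1).unique ?_
    exact (hγ0 1).add ((hγ1 0).const_mul (ε * t))
  have b0 : L (0, 1) 0 = -(ε * deriv γ s 1) := by
    refine (hasDerivAt_coord hpt 0).unique ?_
    convert! (((hasDerivAt_id t).const_mul ε).mul_const (-(deriv γ s 1))).const_add (γ s 0) using 1
    ring
  have b1 : L (0, 1) 1 = ε * deriv γ s 0 := by
    refine (hasDerivAt_coord hpt 1).unique ?_
    convert! (((hasDerivAt_id t).const_mul ε).mul_const (deriv γ s 0)).const_add (γ s 1) using 1
    ring
  have hunit : deriv γ s 0 ^ 2 + deriv γ s 1 ^ 2 = 1 := by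
    have h := EuclideanSpace.real_norm_sq_eq (deriv γ s)
    rw [hW.unit_speed s, Fin.sum_univ_two] at h
    linarith
  have hκ : curvature γ s =
      deriv γ s 0 * deriv (deriv γ) s 1 - deriv γ s 1 * deriv (deriv γ) s 0 := by
    simp [curvature, normal, PiLp.inner_apply, Fin.sum_univ_two]
    ring
  have hdet : L (1, 0) 0 * L (0, 1) 1 - L (0, 1) 0 * L (1, 0) 1 ≠ 0 := by
    have e : L (1, 0) 0 * L (0, 1) 1 - L (0, 1) 0 * L (1, 0) 1 =
        ε * (1 - ε * t * curvature γ s) := by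
      rw [a0, a1, b0, b1, hκ]
      linear_combination ε * hunit
    rw [e]
    have hlt := hW.mul_abs_curvature_lt s
    have ht : |t| ≤ 1 := abs_le.2 ⟨hst.2.1.le, hst.2.2.le⟩
    have : ε * t * curvature γ s < 1 := by
      calc ε * t * curvature γ s ≤ |ε * t * curvature γ s| := le_abs_self _
        _ = |t| * (ε * |curvature γ s|) := by rw [abs_mul, abs_mul, abs_of_pos hW.pos]; ring
        _ ≤ 1 * (ε * |curvature γ s|) := by
          have := hW.pos
          gcongr
        _ < 1 := by linarith
    exact (mul_pos hW.pos (by linarith)).ne'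
  have hsurj : (L : ℝ × ℝ →L[ℝ] Plane).range = ⊤ := by
    rw [LinearMap.range_eq_top]
    intro y
    set D := L (1, 0) 0 * L (0, 1) 1 - L (0, 1) 0 * L (1, 0) 1 with hD
    refine ⟨((y 0 * L (0, 1) 1 - y 1 * L (0, 1) 0) / D, (L (1, 0) 0 * y 1 - L (1, 0) 1 * y 0) / D),
      ?_⟩
    have hlin : ∀ x₁ x₂ : ℝ, L (x₁, x₂) = x₁ • L (1, 0) + x₂ • L (0, 1) := by
      intro x₁ x₂
      rw [← map_smul, ← map_smul, ← map_add]
      simp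
    ext i
    change L _ i = _
    rw [hlin]
    simp only [PiLp.add_apply, PiLp.smul_apply, smul_eq_mul]
    fin_cases i
    · change _ / D * L (1, 0) 0 + _ / D * L (0, 1) 0 = y 0
      field_simp
      rw [hD]
      ring
    · change _ / D * L (1, 0) 1 + _ / D * L (0, 1) 1 = y 1
      field_simp
      rw [hD]
      ring
  rw [← hF.map_nhds_eq_of_surj hsurj]
  exact image_mem_map hstrip

theorem IsWeakDeriv.unique {Ω : Set Plane} (hΩ : IsOpen Ω) {j : Fin 2} {u v v' : L2 Ω}
    (h : IsWeakDeriv Ω j u v) (h' : IsWeakDeriv Ω j u v') : v = v' := by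
  have hd : ∀ᵐ x, x ∈ Ω → (v - v' : L2 Ω) x = 0 := by
    refine hΩ.ae_eq_zero_of_integral_contDiff_smul_eq_zero ?_ ?_
    · exact locallyIntegrableOn_of_locallyIntegrable_restrict
        ((Lp.memLp (v - v')).locallyIntegrable (by norm_num))
    · intro φ hφ hc hs
      rw [← setIntegral_eq_integral_of_forall_compl_eq_zero (s := Ω)]
      · have e := (h φ hφ hc hs).symm.trans (h' φ hφ hc hs)
        rw [neg_inj] at e
        rw [integral_congr_ae (g := fun x => φ x • v x - φ x • v' x), integral_sub
          (integrable_test hφ.continuous hc v) (integrable_test hφ.continuous hc v'), e, sub_self]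
        filter_upwards [Lp.coeFn_sub v v'] with x hx
        rw [hx, Pi.sub_apply, smul_sub]
      · intro x hx
        rw [image_eq_zero_of_notMem_tsupport (fun hx' => hx (hs hx')), zero_smul]
  rw [← ae_restrict_iff' hΩ.measurableSet] at hd
  rw [← sub_eq_zero]
  exact Lp.eq_zero_iff_ae_eq_zero.2 hd

/-- `diracOp` is the operator whose graph consists of the pairs `(u, -i σ · ∇u + m σ₃ u)`. -/
theorem diracOp_graph {γ : ℝ → Plane} {ε : ℝ} (hW : IsWaveguide γ ε) (m : ℝ) :
    (diracOp hW m).graph = diracGraph hW m := by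
  refine Submodule.toLinearPMap_graph_eq _ ?_
  rintro ⟨u, f⟩ ⟨v, hv, -, -, hf⟩ hu
  simp only at hu hf
  subst hu
  have hv0 : ∀ j, v j = 0 := fun j => (hv j).unique hW.isOpen_tube IsWeakDeriv.zero
  simp only [hf, diracExpr, hv0, map_zero, smul_zero, add_zero]

/-! ### The transverse energy -/

/-- `E` is a root of `μ sin (2√E) + √E cos (2√E) = 0` in `[π²/16, π²/4)`. -/
def IsTransverseRoot (μ E : ℝ) : Prop :=
  E ∈ Ico (Real.pi ^ 2 / 16) (Real.pi ^ 2 / 4) ∧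
    μ * Real.sin (2 * √E) + √E * Real.cos (2 * √E) = 0

end Waveguide

end

/-! ### Self-adjointness and spectrum of unbounded operators: abstract criteria. -/

noncomputable section

namespace UnboundedOp

variable {H : Type*} [NormedAddCommGroup H] [InnerProductSpace ℂ H]

open scoped InnerProductSpace

/-! Straightening. In the coordinates `(s, t)` of the tube, and after the change of spinor basis
`frame` built from the unit tangent viewed as a complex number of modulus one, the Dirac operator
becomes the expression `symbol` on the flat strip, with coefficients `1/ε`, `m`, `1/J` and `κ/(2J)`,
where `J = 1 - ε t κ` (`dirac_frame`). The boundary conditions become diagonal: component `0`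
vanishes at `t = 1` and component `1` at `t = -1` (`boundaryMap_frame`). The map `transfer` from the
strip to the tube is a bounded bijection with bounded inverse, but not unitary. Norm estimates are
therefore made on the flat strip, and symmetry is expressed on the tube.

The straight model. For `J = 1` and `κ = 0` the cross terms between the longitudinal and the
transverse parts are exact derivatives, so the square of the norm splits into `‖∂_s x‖²` and the
transverse part (`norm_straight_sq`). The transverse part is estimated slice by slice through a
one-dimensional problem with one Dirichlet and one Robin end, whose lowest eigenvalue is the root
`E` (`transverse_ineq`). This gives the threshold `Λ = √(ε⁻² E + m²)`, and it also makes the graph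
norm control the full gradient.

Self-adjointness. The criterion `isSelfAdjoint_of_core` asks three things of a core of `C²` decaying
fields. The closure of the core must lie in the graph: the graph norm controls gradient and traces,
so weak derivatives and boundary conditions pass to the limit (`closure_core_subset`). Green's
formula must hold between the core and every element of the graph: the core field is cut off, and
the boundary layer terms vanish because at each edge one component of both fields is small
(`tendsto_boundary_layer`, `green_transfer`). The ranges of `D ∓ iμ` on the core must be dense: for
the massless straight operator this follows from explicit sine and cosine modes across the strip and
the Fourier transform along it (`straight_range_dense`), and the curved operator is a perturbation
of relative bound less than one because `2 ε ‖κ‖ < 1` (`exists_curved_range_dense`).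

Symmetry of the spectrum. A charge conjugation, antilinear and pointwise isometric in the frame,
preserves the core and anticommutes with the curved expression (`symbol_chargeConj`). It carries
approximate eigenfunctions at the real number `z` to approximate eigenfunctions at `-z`.

Essential spectrum. Since `κ → 0`, far out the curved operator is a small perturbation of the
straight one. For `|λ| < Λ` the lower bound of the straight operator forces approximate
eigenfunctions to be small at infinity (`exists_norm_restrictOuter_le`). Together with a Rellich
argument (`exists_tendsto_hyperfilter`) such sequences have cluster points, and
`mem_discreteSpectrum_of_compact` makes every spectral point there an isolated eigenvalue of finite
multiplicity. For `|λ| ≥ Λ`, a transverse mode times a wide wave packet placed far out is an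
approximate eigenfunction (`mem_spectrum_of_le`). These half-lines have no isolated points, so they
are essential spectrum. -/

theorem norm_sub_smul_sq_of_symm {a e : H} (h : ⟪a, e⟫_ℂ = ⟪e, a⟫_ℂ) (μ : ℝ) :
    ‖a - (μ * Complex.I) • e‖ ^ 2 = ‖a‖ ^ 2 + μ ^ 2 * ‖e‖ ^ 2 := by
  have him : (⟪a, e⟫_ℂ).im = 0 := by
    have h1 := inner_conj_symm (𝕜 := ℂ) e a
    rw [h] at h1
    have := congrArg Complex.im h1
    rw [h]
    simp only [Complex.conj_im] at this
    have h2 : (⟪a, e⟫_ℂ).im = (⟪e, a⟫_ℂ).im := by rw [h]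
    linarith
  rw [norm_sub_sq (𝕜 := ℂ), inner_smul_right, norm_smul]
  have : RCLike.re (μ * Complex.I * ⟪a, e⟫_ℂ) = 0 := by
    change (μ * Complex.I * ⟪a, e⟫_ℂ).re = 0
    simp [him]
  rw [this]
  simp [mul_pow]

theorem exists_lower_bound {T : H →ₗ.[ℂ] H} {z : ℂ} (hz : z ∈ resolventSet T) :
    ∃ c > 0, ∀ u : T.domain, c * ‖(u : H)‖ ≤ ‖T u - z • (u : H)‖ := by
  obtain ⟨R, -, hR⟩ := hz
  refine ⟨(‖R‖ + 1)⁻¹, by positivity, fun u => ?_⟩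
  rw [inv_mul_eq_div, div_le_iff₀ (by positivity)]
  calc ‖(u : H)‖ = ‖R (T u - z • (u : H))‖ := by rw [hR]
    _ ≤ ‖R‖ * ‖T u - z • (u : H)‖ := R.le_opNorm _
    _ ≤ ‖T u - z • (u : H)‖ * (‖R‖ + 1) := by nlinarith [norm_nonneg (T u - z • (u : H))]

section Core

variable {N : Type*} [AddCommGroup N] [Module ℂ N]

/-- If `y` is orthogonal to the range of `a'`, then `|⟪y, a x⟫| ≤ q ‖y‖ ‖a x‖`. Density of the range
of `a` extends the inequality to every vector, in particular to `y` itself, and `q < 1` forces `y =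
0`. -/
theorem dense_range_of_perturbation (a a' : N →ₗ[ℂ] H) {q : ℝ} (hq : q < 1)
    (h : ∀ x, ‖a' x - a x‖ ≤ q * ‖a x‖) (hd : Dense (LinearMap.range a : Set H)) :
    ∀ y : H, (∀ x, ⟪y, a' x⟫_ℂ = 0) → y = 0 := by
  intro y hy
  have key : ∀ x, ‖⟪y, a x⟫_ℂ‖ ≤ ‖y‖ * (q * ‖a x‖) := by
    intro x
    have e1 : ⟪y, a x⟫_ℂ = - ⟪y, a' x - a x⟫_ℂ := by rw [inner_sub_right, hy x]; ring
    rw [e1, norm_neg]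
    exact (norm_inner_le_norm _ _).trans (by gcongr; exact h x)
  have hcl : IsClosed {w : H | ‖⟪y, w⟫_ℂ‖ ≤ ‖y‖ * (q * ‖w‖)} :=
    isClosed_le (by fun_prop) (by fun_prop)
  have hall : ∀ w : H, ‖⟪y, w⟫_ℂ‖ ≤ ‖y‖ * (q * ‖w‖) := by
    intro w
    have : w ∈ closure (LinearMap.range a : Set H) := hd w
    refine closure_minimal ?_ hcl this
    rintro _ ⟨x, rfl⟩
    exact key x
  have h2 := hall y
  rw [inner_self_eq_norm_sq_to_K] at h2
  simp only [norm_pow] at h2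
  have h3 : ‖((‖y‖ : ℝ) : ℂ)‖ = ‖y‖ := by simp
  by_contra hne
  have hp : 0 < ‖y‖ := norm_pos_iff.2 hne
  have h4 : ‖y‖ ^ 2 ≤ ‖y‖ * (q * ‖y‖) := by simpa using h2
  nlinarith [mul_pos hp hp]

variable [CompleteSpace H]

/-- By the identity `‖a x - iμ e x‖² = ‖a x‖² + μ² ‖e x‖²`, if the images under `a - iμ e` converge,
then both `a x` and `e x` are Cauchy. So density of the range on the core becomes surjectivity on
the closure of the core. -/
theorem exists_mem_closure_core {e a : N →ₗ[ℂ] H} (hsymm : ∀ x y, ⟪a x, e y⟫_ℂ = ⟪e x, a y⟫_ℂ) {μ : ℝ} (hμ : μ ≠ 0)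
    (hd : ∀ y : H, (∀ x, ⟪y, a x - (μ * Complex.I) • e x⟫_ℂ = 0) → y = 0) (f : H) :
    ∃ p ∈ closure (range fun x => (e x, a x)), p.2 - (μ * Complex.I) • p.1 = f := by
  set b : N →ₗ[ℂ] H := a - (μ * Complex.I : ℂ) • e with hb
  have hbx : ∀ x, b x = a x - (μ * Complex.I) • e x := fun x => rfl
  have hdense : Dense (LinearMap.range b : Set H) := by
    rw [Submodule.dense_iff_topologicalClosure_eq_top,
      Submodule.topologicalClosure_eq_top_iff, Submodule.eq_bot_iff]
    intro y hy
    refine hd y fun x => ?_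
    rw [Submodule.mem_orthogonal'] at hy
    exact hy _ ⟨x, rfl⟩
  obtain ⟨w, hw, hlim⟩ := mem_closure_iff_seq_limit.1 (hdense f)
  choose x hx using hw
  have hcau : CauchySeq w := hlim.cauchySeq
  have hn : ∀ y, ‖b y‖ ^ 2 = ‖a y‖ ^ 2 + μ ^ 2 * ‖e y‖ ^ 2 := fun y => by
    rw [hbx]; exact norm_sub_smul_sq_of_symm (hsymm y y) μ
  have hcomp : ∀ (l : N →ₗ[ℂ] H) (C : ℝ), (∀ y, ‖l y‖ ≤ C * ‖b y‖) → CauchySeq fun n => l (x n) := by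
    intro l C hC
    rw [Metric.cauchySeq_iff] at hcau ⊢
    intro η hη
    have hC' : 0 < |C| + 1 := by positivity
    obtain ⟨n0, hn0⟩ := hcau (η / (|C| + 1)) (by positivity)
    refine ⟨n0, fun m hm n hn => ?_⟩
    have h1 := hn0 m hm n hn
    rw [dist_eq_norm, ← hx m, ← hx n, ← map_sub] at h1
    rw [dist_eq_norm, ← map_sub]
    calc ‖l (x m - x n)‖ ≤ C * ‖b (x m - x n)‖ := hC _
      _ ≤ (|C| + 1) * ‖b (x m - x n)‖ := by gcongr; linarith [le_abs_self C]
      _ < (|C| + 1) * (η / (|C| + 1)) := by gcongr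
      _ = η := by field_simp
  have hea : CauchySeq fun n => a (x n) := by
    refine hcomp a 1 fun y => ?_
    rw [one_mul]
    refine le_of_sq_le_sq ?_ (norm_nonneg _)
    rw [hn]; nlinarith [sq_nonneg (μ * ‖e y‖)]
  have hee : CauchySeq fun n => e (x n) := by
    refine hcomp e |μ|⁻¹ fun y => ?_
    rw [inv_mul_eq_div, le_div_iff₀ (abs_pos.2 hμ)]
    refine le_of_sq_le_sq ?_ (norm_nonneg _)
    rw [hn, mul_pow, sq_abs]; nlinarith [sq_nonneg (‖a y‖)]
  obtain ⟨u, hu⟩ := cauchySeq_tendsto_of_complete hee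
  obtain ⟨g, hg⟩ := cauchySeq_tendsto_of_complete hea
  refine ⟨(u, g), ?_, ?_⟩
  · exact mem_closure_of_tendsto (hu.prodMk_nhds hg) (Eventually.of_forall fun n => ⟨x n, rfl⟩)
  · refine tendsto_nhds_unique ?_ hlim
    have := hg.sub (hu.const_smul (μ * Complex.I))
    refine this.congr fun n => ?_
    rw [← hx n]; rfl

/-- A criterion for self-adjointness in terms of a core `x ↦ (e x, a x)` of the graph. -/
theorem isSelfAdjoint_of_core {T : H →ₗ.[ℂ] H} {e a : N →ₗ[ℂ] H}
    (hcl : closure (range fun x => (e x, a x)) ⊆ (T.graph : Set (H × H)))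
    (hgreen : ∀ (u : T.domain) x, ⟪a x, (u : H)⟫_ℂ = ⟪e x, T u⟫_ℂ) {μ : ℝ} (hμ : μ ≠ 0)
    (hd : ∀ y : H, (∀ x, ⟪y, a x - (μ * Complex.I) • e x⟫_ℂ = 0) → y = 0)
    (hd' : ∀ y : H, (∀ x, ⟪y, a x + (μ * Complex.I) • e x⟫_ℂ = 0) → y = 0) :
    IsSelfAdjoint T ∧ ∀ u : T.domain, ((u : H), T u) ∈ closure (range fun x => (e x, a x)) := by
  have hg2 : ∀ p ∈ T.graph, ∀ x, ⟪a x, p.1⟫_ℂ = ⟪e x, p.2⟫_ℂ := by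
    intro p hp x
    obtain ⟨u, hu1, hu2⟩ := LinearPMap.mem_graph_iff _ |>.1 hp
    rw [← hu1, ← hu2]; exact hgreen u x
  have hsymm : ∀ x y, ⟪a x, e y⟫_ℂ = ⟪e x, a y⟫_ℂ := fun x y =>
    hg2 (e y, a y) (hcl (subset_closure ⟨y, rfl⟩)) x
  have hsymm2 : ∀ p ∈ closure (range fun x => (e x, a x)), ∀ q ∈ T.graph,
      ⟪p.2, q.1⟫_ℂ = ⟪p.1, q.2⟫_ℂ := by
    intro p hp q hq
    have hc : IsClosed {p : H × H | ⟪p.2, q.1⟫_ℂ = ⟪p.1, q.2⟫_ℂ} :=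
      isClosed_eq (by fun_prop) (by fun_prop)
    refine closure_minimal ?_ hc hp
    rintro _ ⟨x, rfl⟩
    exact hg2 q hq x
  have hS := exists_mem_closure_core hsymm hμ hd
  -- A pair that satisfies Green's formula against the core already lies in its closure: solve `p.2
  -- - iμ p.1 = w - iμ y` within the closure. The difference `y - p.1` is then orthogonal to the
  -- range of `a + iμ e`, hence zero, and `w = p.2` follows.
  have hkey : ∀ y w : H, (∀ x, ⟪a x, y⟫_ℂ = ⟪e x, w⟫_ℂ) →
      (y, w) ∈ closure (range fun x => (e x, a x)) := by
    intro y w hyw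
    obtain ⟨p, hp, hpf⟩ := hS (w - (μ * Complex.I) • y)
    have h0 : y - p.1 = 0 := by
      refine hd' _ fun x => ?_
      rw [← inner_conj_symm, inner_add_left, inner_smul_left, inner_sub_right, inner_sub_right, hyw x,
        hg2 p (hcl hp) x]
      have e1 : w - p.2 = (μ * Complex.I) • (y - p.1) := by
        rw [smul_sub, sub_eq_sub_iff_add_eq_add]
        rw [sub_eq_sub_iff_add_eq_add] at hpf
        rw [← hpf, add_comm]
      have e2 : ⟪e x, w⟫_ℂ - ⟪e x, p.2⟫_ℂ = (μ * Complex.I) * (⟪e x, y⟫_ℂ - ⟪e x, p.1⟫_ℂ) := by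
        rw [← inner_sub_right, e1, inner_smul_right, inner_sub_right]
      rw [e2]; simp; 
    have h1 : y = p.1 := sub_eq_zero.1 h0
    have h2 : w = p.2 := by rw [h1] at hpf; exact (sub_left_injective hpf).symm
    rw [h1, h2]; exact hp
  have hcore : ∀ p ∈ T.graph, p ∈ closure (range fun x => (e x, a x)) := fun p hp =>
    hkey p.1 p.2 (hg2 p hp)
  -- For `y` orthogonal to the domain, write `y = p.2 - iμ p.1`. Pairing with `p.1` gives `⟪p.2,
  -- p.1⟫ = -iμ ‖p.1‖²`, which symmetry makes real, so `p.1 = 0` and `y = 0`.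
  have hdense : Dense (T.domain : Set H) := by
    rw [Submodule.dense_iff_topologicalClosure_eq_top,
      Submodule.topologicalClosure_eq_top_iff, Submodule.eq_bot_iff]
    intro y hy
    obtain ⟨p, hp, hpf⟩ := hS y
    have hpT : p ∈ T.graph := hcl hp
    obtain ⟨u, hu1, hu2⟩ := LinearPMap.mem_graph_iff _ |>.1 hpT
    have h1 : ⟪y, p.1⟫_ℂ = 0 := by
      rw [Submodule.mem_orthogonal'] at hy
      rw [← hu1]; exact hy _ u.2
    have h2 := norm_sub_smul_sq_of_symm (hsymm2 p hp p hpT) μ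
    have h3 : ⟪p.2, p.1⟫_ℂ = ((-μ * Complex.I) : ℂ) * (‖p.1‖ : ℂ) ^ 2 := by
      rw [← hpf, inner_sub_left, inner_smul_left, inner_self_eq_norm_sq_to_K] at h1
      simp only [map_mul, Complex.conj_I, Complex.conj_ofReal] at h1
      rw [sub_eq_zero] at h1
      rw [h1]; simp
    have h4 : ⟪p.2, p.1⟫_ℂ = ⟪p.1, p.2⟫_ℂ := hsymm2 p hp p hpT
    have h5 : ⟪p.1, p.2⟫_ℂ = starRingEnd ℂ ⟪p.2, p.1⟫_ℂ := (inner_conj_symm _ _).symm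
    rw [h5, h3] at h4
    have h6 : μ * ‖p.1‖ ^ 2 = 0 := by
      have := congrArg Complex.im h4
      simp [← Complex.ofReal_pow] at this
      nlinarith
    have h7 : p.1 = 0 := by
      rcases mul_eq_zero.1 h6 with h | h
      · exact absurd h hμ
      · simpa using h
    have h8 : u = 0 := by ext; rw [hu1, h7]; rfl
    rw [← hpf, h7, ← hu2, h8]; simp
  refine ⟨?_, fun u => hcore _ (T.mem_graph u)⟩
  rw [LinearPMap.isSelfAdjoint_def]
  apply le_antisymm
  -- An element of the adjoint satisfies Green's formula against the core, so `hkey` puts it in the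
  -- graph of `T`. The reverse inclusion is symmetry of `T`.
  · rw [← LinearPMap.le_graph_iff]
    intro p hp
    obtain ⟨u, hu1, hu2⟩ := LinearPMap.mem_graph_iff _ |>.1 hp
    refine hcl (hkey p.1 p.2 fun x => ?_)
    have hx : (e x, a x) ∈ T.graph := hcl (subset_closure ⟨x, rfl⟩)
    obtain ⟨v, hv1, hv2⟩ := LinearPMap.mem_graph_iff _ |>.1 hx
    have := LinearPMap.adjoint_isFormalAdjoint hdense u v
    simp only at hv1 hv2
    rw [← hu1, ← hu2, ← hv1, ← hv2]
    have h9 := congrArg (starRingEnd ℂ) this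
    simpa using h9.symm
  · refine LinearPMap.IsFormalAdjoint.le_adjoint hdense fun u v => ?_
    exact hsymm2 _ (hcore _ (T.mem_graph u)) _ (T.mem_graph v)

end Core

variable [CompleteSpace H] {T : H →ₗ.[ℂ] H}

theorem _root_.IsSelfAdjoint.inner_map_comm (hT : IsSelfAdjoint T) (u v : T.domain) :
    ⟪T u, (v : H)⟫_ℂ = ⟪(u : H), T v⟫_ℂ := by
  have h := LinearPMap.adjoint_isFormalAdjoint hT.dense_domain
  rw [LinearPMap.isSelfAdjoint_def.1 hT] at h
  exact h u v

/-- The inclusion of the adjoint in `T`, in the form used below: a weak solution lies in the domain.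
It also serves as closedness of `T` in the limit arguments. -/
theorem _root_.IsSelfAdjoint.exists_mem_domain (hT : IsSelfAdjoint T) {y w : H}
    (h : ∀ v : T.domain, ⟪w, (v : H)⟫_ℂ = ⟪y, T v⟫_ℂ) : ∃ hy : y ∈ T.domain, T ⟨y, hy⟩ = w := by
  have hg : (y, w) ∈ T.adjoint.graph := by
    have hy := LinearPMap.mem_adjoint_domain_of_exists (T := T) y ⟨w, h⟩
    rw [LinearPMap.mem_graph_iff]
    exact ⟨⟨y, hy⟩, rfl, LinearPMap.adjoint_apply_eq hT.dense_domain _ h⟩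
  rw [LinearPMap.isSelfAdjoint_def.1 hT, LinearPMap.mem_graph_iff] at hg
  obtain ⟨u, hu1, hu2⟩ := hg
  simp only at hu1 hu2
  subst hu1
  exact ⟨u.2, hu2⟩

theorem _root_.IsSelfAdjoint.norm_sub_smul_ge (hT : IsSelfAdjoint T) (z : ℂ) (u : T.domain) :
    |z.im| * ‖(u : H)‖ ≤ ‖T u - z • (u : H)‖ := by
  have h1 : T u - z • (u : H) = (T u - (z.re : ℂ) • (u : H)) - ((z.im : ℝ) * Complex.I) • (u : H) := by
    rw [sub_sub, ← add_smul, Complex.re_add_im]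
  have h2 : ⟪T u - (z.re : ℂ) • (u : H), (u : H)⟫_ℂ = ⟪(u : H), T u - (z.re : ℂ) • (u : H)⟫_ℂ := by
    rw [inner_sub_left, inner_sub_right, hT.inner_map_comm, inner_smul_left, inner_smul_right]
    simp
  refine le_of_sq_le_sq ?_ (norm_nonneg _)
  rw [h1, norm_sub_smul_sq_of_symm h2, mul_pow, sq_abs]
  nlinarith [sq_nonneg ‖T u - (z.re : ℂ) • (u : H)‖]

/-- The bound at `z` gives injectivity and, by completeness, closed range. The orthogonal complement
of the range is the kernel of `T - conj z`, which the second bound makes trivial. -/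
theorem mem_resolventSet_of_bounded_below (hT : IsSelfAdjoint T) {z : ℂ} {c : ℝ} (hc : 0 < c)
    (h : ∀ u : T.domain, c * ‖(u : H)‖ ≤ ‖T u - z • (u : H)‖)
    (h' : ∀ u : T.domain, c * ‖(u : H)‖ ≤ ‖T u - (starRingEnd ℂ z) • (u : H)‖) :
    z ∈ resolventSet T := by
  set L : T.domain →ₗ[ℂ] H := T.toFun - z • T.domain.subtype with hL
  have hLx : ∀ u, L u = T u - z • (u : H) := fun u => rfl
  have hinj : Function.Injective L := by
    rw [← LinearMap.ker_eq_bot, LinearMap.ker_eq_bot']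
    intro u hu
    have := h u
    rw [← hLx, hu, norm_zero] at this
    have : ‖(u : H)‖ ≤ 0 := by nlinarith [norm_nonneg (u : H)]
    ext; simpa using this
  have hdense : Dense (LinearMap.range L : Set H) := by
    rw [Submodule.dense_iff_topologicalClosure_eq_top,
      Submodule.topologicalClosure_eq_top_iff, Submodule.eq_bot_iff]
    intro y hy
    rw [Submodule.mem_orthogonal'] at hy
    obtain ⟨hyd, hTy⟩ := hT.exists_mem_domain (y := y) (w := (starRingEnd ℂ z) • y) (fun v => by
      have h1 := hy (L v) ⟨v, rfl⟩
      rw [hLx, inner_sub_right, inner_smul_right, sub_eq_zero] at h1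
      rw [h1, inner_smul_left]; simp)
    have h2 := h' ⟨y, hyd⟩
    rw [hTy] at h2
    simp only [sub_self, norm_zero] at h2
    have : ‖y‖ ≤ 0 := by nlinarith [norm_nonneg y]
    simpa using this
  have hsurj : Function.Surjective L := by
    intro f
    obtain ⟨w, hw, hlim⟩ := mem_closure_iff_seq_limit.1 (hdense f)
    choose x hx using hw
    have hcau : CauchySeq fun n => (x n : H) := by
      have hcau : CauchySeq w := hlim.cauchySeq
      rw [Metric.cauchySeq_iff] at hcau ⊢
      intro η hη
      obtain ⟨n0, hn0⟩ := hcau (c * η) (by positivity)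
      refine ⟨n0, fun m hm n hn => ?_⟩
      have h1 := hn0 m hm n hn
      have h2 := h (x m - x n)
      rw [← hLx, map_sub, hx, hx, ← dist_eq_norm] at h2
      rw [dist_eq_norm]
      simp only [Submodule.coe_sub] at h2
      nlinarith
    obtain ⟨u, hu⟩ := cauchySeq_tendsto_of_complete hcau
    have hTx : Tendsto (fun n => T (x n)) atTop (𝓝 (f + z • u)) := by
      have := hlim.add (hu.const_smul z)
      refine this.congr fun n => ?_
      rw [← hx n, hLx]; simp
    obtain ⟨hud, hTu⟩ := hT.exists_mem_domain (y := u) (w := f + z • u) (fun v => by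
      refine tendsto_nhds_unique (f := fun n => ⟪T (x n), (v : H)⟫_ℂ) (l := atTop)
        (hTx.inner tendsto_const_nhds) ?_
      simp only [hT.inner_map_comm]
      exact hu.inner tendsto_const_nhds)
    exact ⟨⟨u, hud⟩, by rw [hLx, hTu]; simp⟩
  let E := LinearEquiv.ofBijective L ⟨hinj, hsurj⟩
  have hE : ∀ f, L (E.symm f) = f := fun f => E.apply_symm_apply f
  let R : H →L[ℂ] H := LinearMap.mkContinuous (T.domain.subtype ∘ₗ E.symm.toLinearMap) c⁻¹ (by
    intro f
    have := h (E.symm f)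
    rw [← hLx, hE] at this
    rw [inv_mul_eq_div, le_div_iff₀ hc, mul_comm]
    exact this)
  refine ⟨R, fun f => ⟨(E.symm f).2, hE f⟩, fun u => ?_⟩
  change ((E.symm (L u) : T.domain) : H) = u
  rw [show E.symm (L u) = u from E.symm_apply_apply u]

theorem mem_resolventSet_of_im_ne_zero (hT : IsSelfAdjoint T) {z : ℂ} (hz : z.im ≠ 0) :
    z ∈ resolventSet T :=
  mem_resolventSet_of_bounded_below hT (abs_pos.2 hz) (hT.norm_sub_smul_ge z)
    (fun u => by simpa using hT.norm_sub_smul_ge (starRingEnd ℂ z) u)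

/-- Weyl's criterion. At a real point the two lower bounds of `mem_resolventSet_of_bounded_below`
coincide, and off the real axis they hold automatically. -/
theorem mem_spectrum_iff (hT : IsSelfAdjoint T) {z : ℂ} :
    z ∈ spectrum T ↔ z.im = 0 ∧ ∀ c > 0, ∃ u : T.domain, ‖T u - z • (u : H)‖ < c * ‖(u : H)‖ := by
  constructor
  · intro h
    have him : z.im = 0 := by
      by_contra hne
      exact h (mem_resolventSet_of_im_ne_zero hT hne)
    refine ⟨him, fun c hc => ?_⟩
    by_contra! hno
    refine h (mem_resolventSet_of_bounded_below hT hc hno ?_)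
    rwa [Complex.conj_eq_iff_im.2 him]
  · rintro ⟨-, h⟩ hz
    obtain ⟨c, hc, hb⟩ := exists_lower_bound hz
    obtain ⟨u, hu⟩ := h c hc
    exact absurd (hb u) (not_le.2 hu)

/-- If bounded approximate eigenvectors at `lam` always have a cluster point, the eigenspace is
finite dimensional, and `T - lam` is bounded below on its orthogonal complement. The splitting
reduces `T`, so a punctured neighbourhood of `lam` consists of regular points. -/
theorem mem_discreteSpectrum_of_compact (hT : IsSelfAdjoint T) {lam : ℝ}
    (hcomp : ∀ (u : ℕ → T.domain) (C : ℝ), (∀ n, ‖(u n : H)‖ ≤ C) →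
      Tendsto (fun n => T (u n) - (lam : ℂ) • (u n : H)) atTop (𝓝 0) →
      ∃ v, MapClusterPt v atTop fun n => (u n : H))
    (h : (lam : ℂ) ∈ spectrum T) : (lam : ℂ) ∈ discreteSpectrum T := by
  have hmem : ∀ u : T.domain, u ∈ eigenspace T lam ↔ T u - (lam : ℂ) • (u : H) = 0 := fun u =>
    LinearMap.mem_ker
  have hsub : ∀ (u : ℕ → T.domain) (C : ℝ), (∀ n, ‖(u n : H)‖ ≤ C) →
      Tendsto (fun n => T (u n) - (lam : ℂ) • (u n : H)) atTop (𝓝 0) →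
      ∃ v, ∃ φ : ℕ → ℕ, StrictMono φ ∧ Tendsto (fun n => (u (φ n) : H)) atTop (𝓝 v) := by
    intro u C h1 h2
    obtain ⟨v, hv⟩ := hcomp u C h1 h2
    obtain ⟨φ, hφ, hl⟩ := MapClusterPt.tendsto_subseq hv
    exact ⟨v, φ, hφ, hl⟩
  -- Riesz: an infinite dimensional eigenspace contains a bounded sequence with mutual distances at
  -- least one, and such a sequence has no convergent subsequence.
  have hfin : FiniteDimensional ℂ (eigenspace T lam) := by
    by_contra hinf
    obtain ⟨R, f, -, hR, hsep⟩ := exists_seq_norm_le_one_le_norm_sub hinf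
    obtain ⟨v, φ, hφ, hl⟩ := hsub (fun n => (f n : T.domain)) R (fun n => hR n) (by
      refine tendsto_const_nhds.congr fun n => ?_
      exact ((hmem _).1 (f n).2).symm)
    obtain ⟨n0, hn0⟩ := Metric.cauchySeq_iff.1 hl.cauchySeq 1 one_pos
    have h1 := hn0 n0 le_rfl (n0 + 1) (by omega)
    rw [dist_eq_norm] at h1
    have h2 := hsep (hφ (Nat.lt_succ_self n0)).ne
    exact absurd h1 (not_lt.2 h2)
  set M : Submodule ℂ H := (eigenspace T lam).map T.domain.subtype with hM
  have hMfin : FiniteDimensional ℂ M := inferInstance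
  have hMmem : ∀ y ∈ M, ∃ hy : y ∈ T.domain, T ⟨y, hy⟩ = (lam : ℂ) • y := by
    rintro _ ⟨u, hu, rfl⟩
    exact ⟨u.2, sub_eq_zero.1 ((hmem u).1 hu)⟩
  -- Otherwise there are normalised approximate eigenvectors orthogonal to the eigenspace. Their
  -- limit is a unit vector that is an eigenvector and also orthogonal to all eigenvectors.
  obtain ⟨c, hc, hlow⟩ : ∃ c > 0, ∀ u : T.domain, (u : H) ∈ Mᗮ →
      c * ‖(u : H)‖ ≤ ‖T u - (lam : ℂ) • (u : H)‖ := by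
    by_contra! hno
    have hno' : ∀ n : ℕ, ∃ u : T.domain, (u : H) ∈ Mᗮ ∧ ‖(u : H)‖ = 1 ∧
        ‖T u - (lam : ℂ) • (u : H)‖ ≤ 1 / ((n : ℝ) + 1) := by
      intro n
      obtain ⟨u, hu, hlt⟩ := hno (1 / ((n : ℝ) + 1)) (by positivity)
      have hpos : 0 < ‖(u : H)‖ := by
        by_contra hneg
        have : ‖(u : H)‖ = 0 := le_antisymm (not_lt.1 hneg) (norm_nonneg _)
        rw [this] at hlt
        have := norm_nonneg (T u - (lam : ℂ) • (u : H))
        linarith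
      have hn : ‖((‖(u : H)‖⁻¹ : ℝ) : ℂ)‖ = ‖(u : H)‖⁻¹ := by simp
      refine ⟨((‖(u : H)‖⁻¹ : ℝ) : ℂ) • u, Submodule.smul_mem _ _ hu, ?_, ?_⟩
      · rw [Submodule.coe_smul, norm_smul, hn, inv_mul_cancel₀ hpos.ne']
      · rw [LinearPMap.map_smul, Submodule.coe_smul, smul_comm, ← smul_sub, norm_smul, hn,
          inv_mul_eq_div, div_le_iff₀ hpos]
        exact hlt.le
    choose u hu hu1 hu2 using hno'
    have hlim0 : Tendsto (fun n => T (u n) - (lam : ℂ) • (u n : H)) atTop (𝓝 0) :=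
      squeeze_zero_norm hu2 tendsto_one_div_add_atTop_nhds_zero_nat
    obtain ⟨v, φ, hφ, hl⟩ := hsub u 1 (fun n => (hu1 n).le) hlim0
    have hTl : Tendsto (fun n => T (u (φ n))) atTop (𝓝 ((lam : ℂ) • v)) := by
      have := (hlim0.comp hφ.tendsto_atTop).add (hl.const_smul (lam : ℂ))
      simpa using this
    obtain ⟨hvd, hTv⟩ := hT.exists_mem_domain (y := v) (w := (lam : ℂ) • v) (fun w => by
      refine tendsto_nhds_unique (f := fun n => ⟪T (u (φ n)), (w : H)⟫_ℂ) (l := atTop)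
        (hTl.inner tendsto_const_nhds) ?_
      simp only [hT.inner_map_comm]
      exact hl.inner tendsto_const_nhds)
    have hvM : v ∈ M := ⟨⟨v, hvd⟩, (hmem _).2 (by rw [hTv, sub_self]), rfl⟩
    have hvM' : v ∈ Mᗮ :=
      M.isClosed_orthogonal.mem_of_tendsto hl (Eventually.of_forall fun n => hu _)
    have hv0 : v = 0 := by
      have := Submodule.inner_right_of_mem_orthogonal hvM hvM'
      exact inner_self_eq_zero.1 this
    have hv1 : ‖v‖ = 1 := tendsto_nhds_unique hl.norm (by simp [hu1])
    rw [hv0, norm_zero] at hv1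
    exact zero_ne_one hv1
  -- On the eigenspace `T - μ` acts as `lam - μ`; on the complement its lower bound is at least `c -
  -- |μ - lam|`. The two images are orthogonal, so the smaller of the two constants works for the
  -- sum.
  have hgap : ∀ μ : ℝ, μ ≠ lam → |μ - lam| < c → (μ : ℂ) ∈ resolventSet T := by
    intro μ hne hlt
    have hpos : 0 < |μ - lam| := abs_pos.2 (sub_ne_zero.2 hne)
    set d := min |μ - lam| (c - |μ - lam|) with hd
    have hd0 : 0 < d := lt_min hpos (by linarith)
    have hb : ∀ u : T.domain, d * ‖(u : H)‖ ≤ ‖T u - (μ : ℂ) • (u : H)‖ := by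
      intro u
      set y : H := M.starProjection (u : H) with hy
      have hyM : y ∈ M := M.starProjection_apply_mem _
      obtain ⟨hyd, hTy⟩ := hMmem y hyM
      set w : T.domain := u - ⟨y, hyd⟩ with hw
      have hwc : (w : H) = (u : H) - y := rfl
      have hwM : (w : H) ∈ Mᗮ := M.sub_starProjection_mem_orthogonal _
      have hu : (u : H) = y + w := by rw [hwc]; abel
      have hTu : T u = (lam : ℂ) • y + T w := by rw [hw, LinearPMap.map_sub, hTy]; abel
      have e1 : T u - (μ : ℂ) • (u : H) = ((lam - μ : ℝ) : ℂ) • y + (T w - (μ : ℂ) • (w : H)) := by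
        rw [hTu, hu]; push_cast; rw [sub_smul, smul_add]; abel
      have horth : ⟪y, (w : H)⟫_ℂ = 0 := Submodule.inner_right_of_mem_orthogonal hyM hwM
      have horth2 : ⟪((lam - μ : ℝ) : ℂ) • y, T w - (μ : ℂ) • (w : H)⟫_ℂ = 0 := by
        have := hT.inner_map_comm ⟨y, hyd⟩ w
        rw [hTy, inner_smul_left, horth, mul_zero] at this
        rw [inner_smul_left, inner_sub_right, inner_smul_right, horth, ← this]; simp
      have n1 : ‖(u : H)‖ ^ 2 = ‖y‖ ^ 2 + ‖(w : H)‖ ^ 2 := by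
        rw [hu]
        have := norm_add_sq_eq_norm_sq_add_norm_sq_of_inner_eq_zero _ _ horth
        simpa only [sq] using this
      have n2 : ‖T u - (μ : ℂ) • (u : H)‖ ^ 2 =
          (|μ - lam| * ‖y‖) ^ 2 + ‖T w - (μ : ℂ) • (w : H)‖ ^ 2 := by
        rw [e1]
        have := norm_add_sq_eq_norm_sq_add_norm_sq_of_inner_eq_zero _ _ horth2
        rw [norm_smul, Complex.norm_real, Real.norm_eq_abs, abs_sub_comm] at this
        simpa only [sq] using this
      have n3 : (c - |μ - lam|) * ‖(w : H)‖ ≤ ‖T w - (μ : ℂ) • (w : H)‖ := by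
        have h1 := hlow w hwM
        have h2 : T w - (lam : ℂ) • (w : H) =
            (T w - (μ : ℂ) • (w : H)) + ((μ - lam : ℝ) : ℂ) • (w : H) := by
          push_cast; rw [sub_smul]; abel
        have h3 := norm_add_le (T w - (μ : ℂ) • (w : H)) (((μ - lam : ℝ) : ℂ) • (w : H))
        rw [← h2, norm_smul, Complex.norm_real, Real.norm_eq_abs] at h3
        linarith
      refine le_of_sq_le_sq ?_ (norm_nonneg _)
      rw [n2, mul_pow, n1, mul_add]
      have m1 : d * ‖y‖ ≤ |μ - lam| * ‖y‖ := by gcongr; exact min_le_left _ _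
      have m2 : d * ‖(w : H)‖ ≤ ‖T w - (μ : ℂ) • (w : H)‖ := by
        refine le_trans ?_ n3
        gcongr; exact min_le_right _ _
      have m3 := pow_le_pow_left₀ (by positivity) m1 2
      have m4 := pow_le_pow_left₀ (by positivity) m2 2
      rw [mul_pow] at m3 m4
      linarith
    exact mem_resolventSet_of_bounded_below hT hd0 hb (by simpa using hb)
  refine ⟨h, ⟨Metric.ball (lam : ℂ) c, Metric.ball_mem_nhds _ hc, ?_⟩, ?_, hfin⟩
  · refine Subset.antisymm ?_ (singleton_subset_iff.2 ⟨Metric.mem_ball_self hc, h⟩)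
    rintro z ⟨hz, hzs⟩
    have him := ((mem_spectrum_iff hT).1 hzs).1
    have hzr : z = (z.re : ℂ) := Complex.ext rfl (by simp [him])
    by_contra hne
    rw [hzr] at hzs hz
    refine hzs (hgap z.re ?_ ?_)
    · rintro hh
      exact hne (by rw [mem_singleton_iff, hzr, hh])
    · rw [Metric.mem_ball, Complex.dist_of_im_eq (by simp)] at hz
      simpa [Real.dist_eq] using hz
  -- Without eigenvectors the bound `hlow` would hold on the whole domain, and `lam` would be a
  -- regular point.
  · intro hbot
    have hM0 : M = ⊥ := by rw [hM, hbot, Submodule.map_bot]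
    have hb : ∀ u : T.domain, c * ‖(u : H)‖ ≤ ‖T u - (lam : ℂ) • (u : H)‖ := fun u =>
      hlow u (by rw [hM0, Submodule.bot_orthogonal_eq_top]; trivial)
    exact h (mem_resolventSet_of_bounded_below hT hc hb (by simpa using hb))

end UnboundedOp
end

/-! ### The transverse root and the one-dimensional inequality behind the threshold. -/

noncomputable section

namespace Waveguide

open Real in
-- With `a = √E` the admissible interval for `E` becomes `[π/4, π/2)`. In the interior `cos (2a) < 0
-- < sin (2a)`, so every term of the derivative `2μ cos (2a) + cos (2a) - 2a sin (2a)` is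
-- nonpositive and the last two are negative. The end values are `μ ≥ 0` and `-π/2`, which gives
-- existence and uniqueness of the root.
theorem strictAntiOn_transverse {μ : ℝ} (hμ : 0 ≤ μ) :
    StrictAntiOn (fun a : ℝ => μ * sin (2 * a) + a * cos (2 * a)) (Icc (π / 4) (π / 2)) := by
  have hd : ∀ a : ℝ, HasDerivAt (fun a : ℝ => μ * sin (2 * a) + a * cos (2 * a))
      (μ * (cos (2 * a) * 2) + (1 * cos (2 * a) + a * (-sin (2 * a) * 2))) a := by
    intro a
    have h2 : HasDerivAt (fun a : ℝ => 2 * a) 2 a := by simpa using (hasDerivAt_id a).const_mul 2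
    exact (h2.sin.const_mul μ).add ((hasDerivAt_id a).mul h2.cos)
  refine strictAntiOn_of_deriv_neg (convex_Icc _ _) (fun a _ => (hd a).continuousAt.continuousWithinAt)
    fun a ha => ?_
  rw [interior_Icc] at ha
  rw [(hd a).deriv]
  have hc : cos (2 * a) < 0 := cos_neg_of_pi_div_two_lt_of_lt (by linarith [ha.1]) (by
    have := pi_pos; linarith [ha.2])
  have hs : 0 < sin (2 * a) := sin_pos_of_pos_of_lt_pi (by have := pi_pos; linarith [ha.1])
    (by linarith [ha.2])
  have ha0 : 0 < a := by have := pi_pos; linarith [ha.1]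
  nlinarith [mul_pos ha0 hs, mul_nonneg hμ (neg_nonneg.2 hc.le)]

open Real in
theorem existsUnique_transverseRoot {μ : ℝ} (hμ : 0 ≤ μ) : ∃! E : ℝ, IsTransverseRoot μ E := by
  have hpi := pi_pos
  have hanti := strictAntiOn_transverse hμ
  have hcont : ContinuousOn (fun a : ℝ => μ * sin (2 * a) + a * cos (2 * a)) (Icc (π / 4) (π / 2)) := by
    fun_prop
  have h1 : μ * sin (2 * (π / 4)) + π / 4 * cos (2 * (π / 4)) = μ := by
    rw [show 2 * (π / 4) = π / 2 by ring]; simp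
  have h2 : μ * sin (2 * (π / 2)) + π / 2 * cos (2 * (π / 2)) = -(π / 2) := by
    rw [show 2 * (π / 2) = π by ring]; simp
  obtain ⟨a, ha, ha0⟩ := intermediate_value_Icc' (by linarith) hcont
    (show (0 : ℝ) ∈ Icc _ _ by simp only [h1, h2]; exact ⟨by linarith, hμ⟩)
  have ha0' : μ * sin (2 * a) + a * cos (2 * a) = 0 := ha0
  have halt : a < π / 2 := by
    refine lt_of_le_of_ne ha.2 fun h => ?_
    rw [h, h2] at ha0'; linarith
  have hapos : 0 < a := by linarith [ha.1]
  refine ⟨a ^ 2, ⟨⟨by nlinarith [ha.1], by nlinarith⟩, by rw [sqrt_sq hapos.le]; exact ha0⟩, ?_⟩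
  rintro E ⟨⟨hE1, hE2⟩, hE⟩
  have hE0 : 0 ≤ E := le_trans (by positivity) hE1
  have hs : √E ∈ Icc (π / 4) (π / 2) := by
    constructor
    · exact le_sqrt_of_sq_le (by linarith)
    · exact sqrt_le_iff.2 ⟨by positivity, by linarith⟩
  have : √E = a := hanti.injOn hs ha (by simp only [hE, ha0])
  rw [← this, sq_sqrt hE0]

theorem IsTransverseRoot.sqrt_mem {μ E : ℝ} (h : IsTransverseRoot μ E) :
    0 < √E ∧ 2 * √E < Real.pi ∧ 0 < Real.sin (2 * √E) ∧ √E ^ 2 = E := by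
  have hpi := Real.pi_pos
  have hE0 : 0 < E := lt_of_lt_of_le (by positivity) h.1.1
  have h0 : 0 < √E := Real.sqrt_pos.2 hE0
  have h1 : √E < Real.pi / 2 := (Real.sqrt_lt' (by positivity)).2 (by linarith [h.1.2])
  exact ⟨h0, by linarith, Real.sin_pos_of_pos_of_lt_pi (by linarith) (by linarith),
    Real.sq_sqrt hE0.le⟩

section Transverse

variable {F : Type*} [NormedAddCommGroup F] [InnerProductSpace ℝ F]

/-- Picone's identity with the comparison function `sin (a (1 + η - t))`. -/
theorem picone_sin {a η : ℝ} (ha : 0 < a) (hη : 0 < η) (hlt : a * (2 + η) < Real.pi) {h h' : ℝ → F}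
    (hd : ∀ t, HasDerivAt h (h' t) t) (hc : Continuous h') (h1 : h 1 = 0) :
    a ^ 2 * ∫ t in (-1)..1, ‖h t‖ ^ 2 ≤ (∫ t in (-1)..1, ‖h' t‖ ^ 2) -
      a * Real.cos (a * (2 + η)) / Real.sin (a * (2 + η)) * ‖h (-1)‖ ^ 2 := by
  have hcont : Continuous h := continuous_iff_continuousAt.2 fun t => (hd t).continuousAt
  -- `v` is the logarithmic derivative of `sin (a (1 + η - t))` and solves the Riccati equation `v'
  -- = -a² - v²`. The shift `η > 0` keeps the sine positive at `t = 1`.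
  set v : ℝ → ℝ := fun t => -(a * Real.cos (a * (1 + η - t)) / Real.sin (a * (1 + η - t))) with hv
  have hsin : ∀ t ∈ Icc (-1 : ℝ) 1, 0 < Real.sin (a * (1 + η - t)) := fun t ht =>
    Real.sin_pos_of_pos_of_lt_pi (mul_pos ha (by linarith [ht.2]))
      (lt_of_le_of_lt (by gcongr; linarith [ht.1]) hlt)
  have hvd : ∀ t ∈ Icc (-1 : ℝ) 1, HasDerivAt v (-a ^ 2 - v t ^ 2) t := by
    intro t ht
    have hl : HasDerivAt (fun t : ℝ => a * (1 + η - t)) (-a) t := by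
      simpa using ((hasDerivAt_id t).const_sub (1 + η)).const_mul a
    have := ((hl.cos.const_mul a).div hl.sin (hsin t ht).ne').neg
    convert! this using 1
    have hs := (hsin t ht).ne'
    simp only [hv]
    field_simp
    nlinarith [Real.sin_sq_add_cos_sq (a * (1 + η - t))]
  have hvc : ContinuousOn v (Icc (-1) 1) := fun t ht => (hvd t ht).continuousAt.continuousWithinAt
  have hnd : ∀ t ∈ uIcc (-1 : ℝ) 1, HasDerivAt (fun t => v t * ‖h t‖ ^ 2)
      ((-a ^ 2 - v t ^ 2) * ‖h t‖ ^ 2 + v t * (2 * inner ℝ (h t) (h' t))) t := by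
    intro t ht
    rw [uIcc_of_le (by norm_num)] at ht
    exact (hvd t ht).mul (hd t).norm_sq
  have hint : ∀ {g : ℝ → ℝ}, ContinuousOn g (Icc (-1) 1) → IntervalIntegrable g volume (-1) 1 :=
    fun hg => ContinuousOn.intervalIntegrable (by rwa [uIcc_of_le (by norm_num)])
  have hin : Continuous fun t => inner ℝ (h t) (h' t) := hcont.inner hc
  have i1 : IntervalIntegrable (fun t => (-a ^ 2 - v t ^ 2) * ‖h t‖ ^ 2 +
      v t * (2 * inner ℝ (h t) (h' t))) volume (-1) 1 := hint (by fun_prop)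
  have hftc := intervalIntegral.integral_eq_sub_of_hasDerivAt hnd i1
  have i2 : IntervalIntegrable (fun t => ‖h' t‖ ^ 2 - a ^ 2 * ‖h t‖ ^ 2) volume (-1) 1 :=
    hint (by fun_prop)
  -- Pointwise, `‖h' - v h‖² ≥ 0` says that the derivative of `v ‖h‖²` is at most `‖h'‖² - a² ‖h‖²`.
  have hmono := intervalIntegral.integral_mono_on (by norm_num) i1 i2 (fun t _ => by
    have h0 := sq_nonneg ‖h' t - v t • h t‖
    rw [norm_sub_sq_real, inner_smul_right, norm_smul, mul_pow, Real.norm_eq_abs, sq_abs,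
      real_inner_comm] at h0
    nlinarith)
  rw [hftc, h1, norm_zero, intervalIntegral.integral_sub (hint (by fun_prop)) (hint (by fun_prop)),
    intervalIntegral.integral_const_mul] at hmono
  have e1 : v (-1) = -(a * Real.cos (a * (2 + η)) / Real.sin (a * (2 + η))) := by
    simp only [hv]; ring_nf
  rw [e1] at hmono
  linarith

/-- `E` is the lowest eigenvalue of `-h''` with `h(1) = 0` and the Robin condition `h'(-1) = μ
h(-1)`, with ground state `sin (√E (1 - t))`. The equation for the root says `μ = -a cot (2a)` with
`a = √E`, which is the boundary coefficient in `picone_sin` at `η = 0`. Since that comparison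
function vanishes at `t = 1`, the value is reached by the limit `η → 0`. -/
theorem transverse_ineq {μ E : ℝ} (hE : IsTransverseRoot μ E) {h h' : ℝ → F}
    (hd : ∀ t, HasDerivAt h (h' t) t) (hc : Continuous h') (h1 : h 1 = 0) :
    E * ∫ t in (-1)..1, ‖h t‖ ^ 2 ≤ (∫ t in (-1)..1, ‖h' t‖ ^ 2) + μ * ‖h (-1)‖ ^ 2 := by
  obtain ⟨ha, hlt, hs, hsq⟩ := hE.sqrt_mem
  set a := √E with hadef
  have hroot : μ = -(a * Real.cos (a * (2 + 0)) / Real.sin (a * (2 + 0))) := by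
    have := hE.2
    rw [← hadef] at this
    rw [show a * (2 + 0) = 2 * a by ring, ← neg_div, eq_div_iff hs.ne']
    linarith
  have hne : Real.sin (a * (2 + 0)) ≠ 0 := by rw [show a * (2 + 0) = 2 * a by ring]; exact hs.ne'
  have hlim : Tendsto (fun η : ℝ => (∫ t in (-1)..1, ‖h' t‖ ^ 2) -
      a * Real.cos (a * (2 + η)) / Real.sin (a * (2 + η)) * ‖h (-1)‖ ^ 2) (𝓝[>] 0)
      (𝓝 ((∫ t in (-1)..1, ‖h' t‖ ^ 2) + μ * ‖h (-1)‖ ^ 2)) := by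
    have hca : ContinuousAt (fun η : ℝ => (∫ t in (-1)..1, ‖h' t‖ ^ 2) -
      a * Real.cos (a * (2 + η)) / Real.sin (a * (2 + η)) * ‖h (-1)‖ ^ 2) 0 := by
      refine continuousAt_const.sub (ContinuousAt.mul (ContinuousAt.div ?_ ?_ hne) continuousAt_const)
      · fun_prop
      · fun_prop
    have := hca.tendsto.mono_left (nhdsWithin_le_nhds (s := Ioi 0))
    rw [hroot]
    convert this using 2
    ring
  rw [← hsq]
  refine ge_of_tendsto hlim ?_
  have hev : ∀ᶠ η : ℝ in 𝓝[>] 0, a * (2 + η) < Real.pi := by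
    refine nhdsWithin_le_nhds (ContinuousAt.eventually_lt (f := fun η : ℝ => a * (2 + η))
      (g := fun _ => Real.pi) (by fun_prop) continuousAt_const ?_)
    linarith
  filter_upwards [hev, self_mem_nhdsWithin] with η hη1 hη2
  exact picone_sin ha hη2 hη1 hd hc h1

theorem transverse_ineq' {μ E : ℝ} (hE : IsTransverseRoot μ E) {h h' : ℝ → F}
    (hd : ∀ t, HasDerivAt h (h' t) t) (hc : Continuous h') (h1 : h (-1) = 0) :
    E * ∫ t in (-1)..1, ‖h t‖ ^ 2 ≤ (∫ t in (-1)..1, ‖h' t‖ ^ 2) + μ * ‖h 1‖ ^ 2 := by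
  have := transverse_ineq hE (h := fun t => h (-t)) (h' := fun t => -h' (-t))
    (fun t => by
      have := (hd (-t)).scomp t (hasDerivAt_neg t)
      rwa [neg_smul, one_smul] at this) (by fun_prop) h1
  simp only [norm_neg, neg_neg] at this
  rw [intervalIntegral.integral_comp_neg (fun t => ‖h t‖ ^ 2),
    intervalIntegral.integral_comp_neg (fun t => ‖h' t‖ ^ 2), neg_neg] at this
  exact this

end Transverse

end Waveguide
end

noncomputable section

/-! ### Spinors by components -/

/-- The spinor with the given components. -/
def sp (a b : ℂ) : Spinor := !₂[a, b]

@[simp] theorem sp_zero (a b : ℂ) : sp a b 0 = a := rfl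
@[simp] theorem sp_one (a b : ℂ) : sp a b 1 = b := rfl

theorem spinor_ext {x y : Spinor} (h0 : x 0 = y 0) (h1 : x 1 = y 1) : x = y := by
  ext i; fin_cases i <;> assumption

theorem sp_add (a b c d : ℂ) : sp a b + sp c d = sp (a + c) (b + d) := spinor_ext rfl rfl
theorem sp_smul (c a b : ℂ) : c • sp a b = sp (c * a) (c * b) := spinor_ext rfl rfl

theorem norm_sq_spinor (y : Spinor) : ‖y‖ ^ 2 = ‖y 0‖ ^ 2 + ‖y 1‖ ^ 2 := by
  rw [EuclideanSpace.norm_sq_eq, Fin.sum_univ_two]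

theorem inner_spinor (x y : Spinor) :
    inner ℂ x y = starRingEnd ℂ (x 0) * y 0 + starRingEnd ℂ (x 1) * y 1 := by
  rw [PiLp.inner_apply, Fin.sum_univ_two]
  simp [mul_comm]

theorem norm_spinor_apply_le (y : Spinor) (i : Fin 2) : ‖y i‖ ≤ ‖y‖ := PiLp.norm_apply_le y i

theorem sp_eq (a b : ℂ) : sp a b = a • sp 1 0 + b • sp 0 1 := by
  apply spinor_ext <;> simp

theorem norm_sp_le (a b : ℂ) : ‖sp a b‖ ≤ ‖a‖ + ‖b‖ := by
  refine le_of_sq_le_sq ?_ (by positivity)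
  rw [norm_sq_spinor, sp_zero, sp_one]
  nlinarith [norm_nonneg a, norm_nonneg b]

theorem continuous_coord (i : Fin 2) : Continuous fun y : Spinor => y i :=
  (EuclideanSpace.proj (𝕜 := ℂ) i).continuous

section

variable {X : Type*}

@[fun_prop]
theorem Continuous.sp [TopologicalSpace X] {a b : X → ℂ} (ha : Continuous a) (hb : Continuous b) :
    Continuous fun x => sp (a x) (b x) := by
  simp only [sp_eq (a _) (b _)]; fun_prop

@[fun_prop]
theorem ContDiff.sp [NormedAddCommGroup X] [NormedSpace ℝ X] {n : WithTop ℕ∞} {a b : X → ℂ}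
    (ha : ContDiff ℝ n a) (hb : ContDiff ℝ n b) : ContDiff ℝ n fun x => sp (a x) (b x) := by
  simp only [sp_eq (a _) (b _)]; fun_prop

theorem HasDerivAt.sp {a b : ℝ → ℂ} {a' b' : ℂ} {t : ℝ} (ha : HasDerivAt a a' t)
    (hb : HasDerivAt b b' t) : HasDerivAt (fun x => sp (a x) (b x)) (sp a' b') t := by
  simp only [sp_eq (a _) (b _), sp_eq a' b']
  exact (ha.smul_const _).add (hb.smul_const _)

theorem MeasureTheory.AEStronglyMeasurable.sp [MeasurableSpace X] {μ : Measure X} {a b : X → ℂ}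
    (ha : AEStronglyMeasurable a μ) (hb : AEStronglyMeasurable b μ) :
    AEStronglyMeasurable (fun x => sp (a x) (b x)) μ := by
  simp only [sp_eq (a _) (b _)]
  exact (ha.smul aestronglyMeasurable_const).add (hb.smul aestronglyMeasurable_const)

theorem MeasureTheory.AEStronglyMeasurable.coord [MeasurableSpace X] {μ : Measure X} {f : X → Spinor}
    (hf : AEStronglyMeasurable f μ) (i : Fin 2) : AEStronglyMeasurable (fun x => f x i) μ :=
  (continuous_coord i).comp_aestronglyMeasurable hf

theorem ContDiff.coord [NormedAddCommGroup X] [NormedSpace ℝ X] {n : WithTop ℕ∞} {f : X → Spinor}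
    (hf : ContDiff ℝ n f) (i : Fin 2) : ContDiff ℝ n fun x => f x i :=
  ((EuclideanSpace.proj (𝕜 := ℂ) i).restrictScalars ℝ).contDiff.comp hf

theorem HasDerivAt.coord {f : ℝ → Spinor} {f' : Spinor} {t : ℝ} (hf : HasDerivAt f f' t)
    (i : Fin 2) : HasDerivAt (fun x => f x i) (f' i) t :=
  ((EuclideanSpace.proj (𝕜 := ℂ) i).restrictScalars ℝ).hasFDerivAt.comp_hasDerivAt t hf

end

namespace Waveguide

theorem pauliMap_zero (y : Spinor) : pauliMap 0 y = sp (y 1) (y 0) := by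
  apply spinor_ext <;>
  simp [pauliMap, pauli, Matrix.ofLp_toEuclideanCLM, sp, Matrix.vecHead, Matrix.vecTail]

theorem pauliMap_one (y : Spinor) : pauliMap 1 y = sp (-Complex.I * y 1) (Complex.I * y 0) := by
  apply spinor_ext <;>
  simp [pauliMap, pauli, Matrix.ofLp_toEuclideanCLM, sp, Matrix.vecHead, Matrix.vecTail]

theorem pauliMap_two (y : Spinor) : pauliMap 2 y = sp (y 0) (-y 1) := by
  apply spinor_ext <;>
  simp [pauliMap, pauli, Matrix.ofLp_toEuclideanCLM, sp, Matrix.vecHead, Matrix.vecTail]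

/-! ### The moving frame -/

/-- The unit tangent as a complex number. -/
def tang (γ : ℝ → Plane) (s : ℝ) : ℂ := ⟨deriv γ s 0, deriv γ s 1⟩

/-- The change of spinor basis that diagonalises the boundary conditions. -/
def frame (z : ℂ) (y : Spinor) : Spinor := sp (y 0 + y 1) (z * (y 0 - y 1))

/-- The inverse of `frame`. -/
def unframe (z : ℂ) (y : Spinor) : Spinor :=
  sp ((y 0 + starRingEnd ℂ z * y 1) / 2) ((y 0 - starRingEnd ℂ z * y 1) / 2)

theorem frame_unframe {z : ℂ} (hz : ‖z‖ = 1) (y : Spinor) : frame z (unframe z y) = y := by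
  have h : z * starRingEnd ℂ z = 1 := by rw [Complex.mul_conj, Complex.normSq_eq_norm_sq, hz]; simp
  apply spinor_ext
  · simp only [frame, unframe, sp_zero, sp_one]; ring
  · simp only [frame, unframe, sp_zero, sp_one]
    linear_combination (y 1) * h

theorem norm_sq_frame {z : ℂ} (hz : ‖z‖ = 1) (y : Spinor) : ‖frame z y‖ ^ 2 = 2 * ‖y‖ ^ 2 := by
  rw [norm_sq_spinor, norm_sq_spinor y]
  simp only [frame, sp_zero, sp_one, norm_mul, hz, one_mul]
  have := parallelogram_law_with_norm ℝ (y 0) (y 1)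
  nlinarith

theorem inner_frame {z : ℂ} (hz : ‖z‖ = 1) (x y : Spinor) :
    inner ℂ (frame z x) (frame z y) = 2 * inner ℂ x y := by
  have h : z * starRingEnd ℂ z = 1 := by rw [Complex.mul_conj, Complex.normSq_eq_norm_sq, hz]; simp
  rw [inner_spinor, inner_spinor]
  simp only [frame, sp_zero, sp_one, map_add, map_mul, map_sub]
  linear_combination (starRingEnd ℂ (x 0) - starRingEnd ℂ (x 1)) * (y 0 - y 1) * h

theorem frame_add (z : ℂ) (x y : Spinor) : frame z (x + y) = frame z x + frame z y := by
  apply spinor_ext <;> simp [frame] <;> ring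

theorem frame_sub (z : ℂ) (x y : Spinor) : frame z (x - y) = frame z x - frame z y := by
  apply spinor_ext <;> simp [frame] <;> ring

theorem frame_smul (z c : ℂ) (x : Spinor) : frame z (c • x) = c • frame z x := by
  apply spinor_ext <;> simp [frame] <;> ring

theorem enorm_sq_frame {z : ℂ} (hz : ‖z‖ = 1) (y : Spinor) : ‖frame z y‖ₑ ^ 2 = 2 * ‖y‖ₑ ^ 2 := by
  have h := norm_sq_frame hz y
  rw [← ofReal_norm, ← ofReal_norm, ← ENNReal.ofReal_pow (norm_nonneg _), h,
    ENNReal.ofReal_mul (by norm_num), ENNReal.ofReal_pow (norm_nonneg _)]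
  simp

/-- The Jacobian `1 - ε t κ(s)`. -/
def jac (γ : ℝ → Plane) (ε : ℝ) (p : ℝ × ℝ) : ℝ := 1 - ε * p.2 * curvature γ p.1

/-- The inverse of the tube map. -/
def tubeInv (γ : ℝ → Plane) (ε : ℝ) (y : Plane) : ℝ × ℝ :=
  open Classical in if y ∈ tube γ ε then Function.invFunOn (tubeMap γ ε) strip y else 0

theorem isOpen_strip : IsOpen strip := isOpen_univ.prod isOpen_Ioo

namespace IsWaveguide

variable {γ : ℝ → Plane} {ε : ℝ} (hW : IsWaveguide γ ε)
include hW

theorem sq_add_sq (s : ℝ) : deriv γ s 0 ^ 2 + deriv γ s 1 ^ 2 = 1 := by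
  have h := EuclideanSpace.real_norm_sq_eq (deriv γ s)
  rw [hW.unit_speed s, Fin.sum_univ_two] at h
  linarith

theorem norm_tang (s : ℝ) : ‖tang γ s‖ = 1 := by
  have := hW.sq_add_sq s
  rw [← sq_eq_sq₀ (norm_nonneg _) zero_le_one, ← Complex.normSq_eq_norm_sq, Complex.normSq_apply]
  simp only [tang]
  nlinarith

theorem contDiff_deriv : ContDiff ℝ 2 (deriv γ) := hW.contDiff.deriv'

theorem deriv_deriv (s : ℝ) : deriv (deriv γ) s = curvature γ s • normal γ s := by
  have hd : ∀ i, HasDerivAt (fun x => deriv γ x i) (deriv (deriv γ) s i) s := fun i =>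
    hasDerivAt_coord ((hW.contDiff_deriv.differentiable (by norm_num)) s).hasDerivAt i
  have h0 : deriv γ s 0 * deriv (deriv γ) s 0 + deriv γ s 1 * deriv (deriv γ) s 1 = 0 := by
    have h1 := ((hd 0).pow 2).add ((hd 1).pow 2)
    have h2 : HasDerivAt (fun x => deriv γ x 0 ^ 2 + deriv γ x 1 ^ 2) 0 s := by
      simp only [hW.sq_add_sq]; exact hasDerivAt_const _ _
    have := h1.unique h2
    norm_num at this
    linarith
  have hκ : curvature γ s =
      deriv γ s 0 * deriv (deriv γ) s 1 - deriv γ s 1 * deriv (deriv γ) s 0 := by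
    simp [curvature, normal, PiLp.inner_apply, Fin.sum_univ_two]
    ring
  have hu := hW.sq_add_sq s
  ext i
  fin_cases i
  · simp only [hκ, normal, PiLp.smul_apply, smul_eq_mul]
    simp
    linear_combination (-deriv (deriv γ) s 0) * hu + deriv γ s 0 * h0
  · simp only [hκ, normal, PiLp.smul_apply, smul_eq_mul]
    simp
    linear_combination (-deriv (deriv γ) s 1) * hu + deriv γ s 1 * h0

theorem hasDerivAt_tang (s : ℝ) :
    HasDerivAt (tang γ) (Complex.I * curvature γ s * tang γ s) s := by
  have hd : ∀ i, HasDerivAt (fun x => deriv γ x i) (deriv (deriv γ) s i) s := fun i =>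
    hasDerivAt_coord ((hW.contDiff_deriv.differentiable (by norm_num)) s).hasDerivAt i
  have h := ((hd 0).ofReal_comp).add (((hd 1).ofReal_comp).mul_const Complex.I)
  have e : tang γ = fun x => ((deriv γ x 0 : ℝ) : ℂ) + ((deriv γ x 1 : ℝ) : ℂ) * Complex.I := by
    funext x; exact Complex.mk_eq_add_mul_I _ _
  rw [e]
  convert! h using 1
  simp only [hW.deriv_deriv, normal, PiLp.smul_apply, smul_eq_mul]
  simp
  linear_combination (curvature γ s : ℂ) * (deriv γ s 1) * Complex.I_mul_I

theorem contDiff_tang : ContDiff ℝ 2 (tang γ) := by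
  have e : tang γ = fun x => ((deriv γ x 0 : ℝ) : ℂ) + ((deriv γ x 1 : ℝ) : ℂ) * Complex.I := by
    funext x; exact Complex.mk_eq_add_mul_I _ _
  have h := hW.contDiff_deriv
  rw [contDiff_euclidean] at h
  rw [e]
  have h0 := Complex.ofRealCLM.contDiff.comp (h 0)
  have h1 := Complex.ofRealCLM.contDiff.comp (h 1)
  exact h0.add (h1.mul contDiff_const)

/-- The factor `2` is what keeps the Jacobian between `1/2` and `3/2`, and what later makes the
relative bound `εK / (1 - εK)` less than one. -/
theorem exists_curvature_bound : ∃ K : ℝ, 0 ≤ K ∧ (∀ s, |curvature γ s| ≤ K) ∧ 2 * (ε * K) < 1 := by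
  have hfin : eLpNorm (curvature γ) ∞ volume ≠ ⊤ := by
    intro h
    have := hW.lt
    rw [h] at this
    simp at this
  refine ⟨(eLpNorm (curvature γ) ∞ volume).toReal, ENNReal.toReal_nonneg, ?_, ?_⟩
  · intro s
    have hle : ‖curvature γ s‖ₑ ≤ eLpNorm (curvature γ) ∞ volume := by
      -- By continuity, the set where `|κ|` exceeds its essential supremum is open. It is also null,
      -- hence empty.
      by_contra! hlt
      have hopen : IsOpen {x | eLpNorm (curvature γ) ∞ volume < ‖curvature γ x‖ₑ} :=
        isOpen_lt continuous_const (continuous_curvature hW.contDiff).enorm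
      have hnull : volume {x | eLpNorm (curvature γ) ∞ volume < ‖curvature γ x‖ₑ} = 0 := by
        have h := ae_le_eLpNormEssSup (f := curvature γ) (μ := (volume : Measure ℝ))
        rw [ae_iff] at h
        simpa [eLpNorm_exponent_top] using h
      have := hopen.eq_empty_of_measure_zero hnull
      exact (Set.mem_empty_iff_false s).1 (this ▸ hlt)
    have := ENNReal.toReal_mono hfin hle
    simpa using this
  · have h := hW.lt
    rcases eq_or_ne (eLpNorm (curvature γ) ∞ volume) 0 with h0 | h0
    · simp [h0]
    rw [← ENNReal.ofReal_toReal hfin, show (2 : ℝ≥0∞) = ENNReal.ofReal 2 by simp,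
      ← ENNReal.ofReal_mul (by norm_num)] at h
    have hp : 0 < (eLpNorm (curvature γ) ∞ volume).toReal := ENNReal.toReal_pos h0 hfin
    rw [← ENNReal.ofReal_inv_of_pos (by positivity), ENNReal.ofReal_lt_ofReal_iff (by positivity),
      ← one_div, lt_div_iff₀ (by positivity)] at h
    linarith

theorem continuous_jac : Continuous (jac γ ε) := by
  have := continuous_curvature hW.contDiff
  unfold jac; fun_prop

theorem jac_bounds {p : ℝ × ℝ} (hp : |p.2| ≤ 1) : 1 / 2 < jac γ ε p ∧ jac γ ε p < 3 / 2 := by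
  obtain ⟨K, hK0, hK, hlt⟩ := hW.exists_curvature_bound
  have h1 : |ε * p.2 * curvature γ p.1| ≤ ε * K := by
    rw [abs_mul, abs_mul, abs_of_pos hW.pos]
    have := hW.pos
    calc ε * |p.2| * |curvature γ p.1| ≤ ε * 1 * K := by gcongr; exact hK _
      _ = ε * K := by ring
  have := abs_le.1 h1
  unfold jac
  constructor <;> linarith

omit hW in
theorem abs_le_of_mem_strip {p : ℝ × ℝ} (hp : p ∈ strip) : |p.2| ≤ 1 :=
  abs_le.2 ⟨hp.2.1.le, hp.2.2.le⟩

theorem jac_pos {p : ℝ × ℝ} (hp : p ∈ strip) : 0 < jac γ ε p := by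
  linarith [(hW.jac_bounds (abs_le_of_mem_strip hp)).1]

theorem hasDerivAt_normal (s : ℝ) :
    HasDerivAt (normal γ) (-(curvature γ s) • deriv γ s) s := by
  have hd := ((contDiff_normal hW.contDiff).differentiable (by norm_num) s).hasDerivAt
  have hd' : ∀ i, HasDerivAt (fun x => deriv γ x i) (deriv (deriv γ) s i) s := fun i =>
    hasDerivAt_coord ((hW.contDiff_deriv.differentiable (by norm_num)) s).hasDerivAt i
  have e : deriv (normal γ) s = -(curvature γ s) • deriv γ s := by
    ext i
    refine (hasDerivAt_coord hd i).unique ?_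
    fin_cases i
    · have := (hd' 1).neg
      rw [hW.deriv_deriv] at this
      convert! this using 1
      simp [normal]
    · have := hd' 0
      rw [hW.deriv_deriv] at this
      convert! this using 1
      simp [normal]
  rwa [e] at hd

omit hW in
/-- The derivative of the tube map. -/
def _root_.Waveguide.tubeDeriv (γ : ℝ → Plane) (ε : ℝ) (p : ℝ × ℝ) : ℝ × ℝ →L[ℝ] Plane :=
  (ContinuousLinearMap.fst ℝ ℝ ℝ).smulRight (jac γ ε p • deriv γ p.1) +
    (ContinuousLinearMap.snd ℝ ℝ ℝ).smulRight (ε • normal γ p.1)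

theorem hasFDerivAt_tubeMap (p : ℝ × ℝ) : HasFDerivAt (tubeMap γ ε) (tubeDeriv γ ε p) p := by
  have h1 : HasFDerivAt (fun p : ℝ × ℝ => γ p.1) _ p :=
    ((hW.contDiff.differentiable (by norm_num)) p.1).hasDerivAt.hasFDerivAt.comp p
      (hasFDerivAt_fst (𝕜 := ℝ))
  have h2 : HasFDerivAt (fun p : ℝ × ℝ => normal γ p.1) _ p :=
    (hW.hasDerivAt_normal p.1).hasFDerivAt.comp p (hasFDerivAt_fst (𝕜 := ℝ))
  have h3 : HasFDerivAt (fun p : ℝ × ℝ => ε * p.2) _ p :=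
    (hasFDerivAt_snd (𝕜 := ℝ) (p := p)).const_mul ε
  convert! h1.add (h3.smul h2) using 1
  ext i <;> simp [tubeDeriv, jac]
  ring

end IsWaveguide


/-- The identification of `ℝ × ℝ` with the Euclidean plane. -/
def planeEquiv : Plane ≃L[ℝ] ℝ × ℝ :=
  (EuclideanSpace.equiv (Fin 2) ℝ).trans (ContinuousLinearEquiv.finTwoArrow ℝ ℝ)

theorem planeEquiv_apply (y : Plane) : planeEquiv y = (y 0, y 1) := rfl

theorem measurePreserving_planeEquiv : MeasurePreserving planeEquiv volume volume :=
  (volume_preserving_finTwoArrow ℝ).comp (PiLp.volume_preserving_ofLp (Fin 2))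

namespace IsWaveguide

variable {γ : ℝ → Plane} {ε : ℝ} (hW : IsWaveguide γ ε)
include hW

theorem exists_equiv_tubeDeriv {p : ℝ × ℝ} (hp : p ∈ strip) :
    ∃ e : (ℝ × ℝ) ≃L[ℝ] Plane, (e : ℝ × ℝ →L[ℝ] Plane) = tubeDeriv γ ε p := by
  have hJ := (hW.jac_pos hp).ne'
  have hε := hW.pos.ne'
  have hu := hW.sq_add_sq p.1
  let g : Plane →L[ℝ] ℝ × ℝ := ((jac γ ε p)⁻¹ • innerSL ℝ (deriv γ p.1)).prod
    (ε⁻¹ • innerSL ℝ (normal γ p.1))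
  refine ⟨ContinuousLinearEquiv.equivOfInverse (tubeDeriv γ ε p) g ?_ ?_, rfl⟩
  · rintro ⟨a, b⟩
    ext
    · simp [g, tubeDeriv, PiLp.inner_apply, Fin.sum_univ_two, normal]
      field_simp
      linear_combination a * jac γ ε p * hu
    · simp [g, tubeDeriv, PiLp.inner_apply, Fin.sum_univ_two, normal]
      field_simp
      linear_combination b * ε * hu
  · intro y
    ext i
    fin_cases i
    · simp [g, tubeDeriv, PiLp.inner_apply, Fin.sum_univ_two, normal]
      field_simp
      linear_combination y 0 * hu
    · simp [g, tubeDeriv, PiLp.inner_apply, Fin.sum_univ_two, normal]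
      field_simp
      linear_combination y 1 * hu

theorem tubeInv_tubeMap {p : ℝ × ℝ} (hp : p ∈ strip) : tubeInv γ ε (tubeMap γ ε p) = p := by
  have hmem : tubeMap γ ε p ∈ tube γ ε := mem_image_of_mem _ hp
  rw [tubeInv, if_pos hmem]
  exact hW.injOn.leftInvOn_invFunOn hp

omit hW in
theorem tubeMap_tubeInv {y : Plane} (hy : y ∈ tube γ ε) : tubeMap γ ε (tubeInv γ ε y) = y := by
  rw [tubeInv, if_pos hy]
  exact Function.invFunOn_eq hy

/-- The inverse function theorem provides a smooth local inverse, and injectivity on the strip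
identifies it with the global inverse near the image point. -/
theorem contDiffAt_tubeInv {p : ℝ × ℝ} (hp : p ∈ strip) :
    ContDiffAt ℝ 2 (tubeInv γ ε) (tubeMap γ ε p) := by
  obtain ⟨e, he⟩ := hW.exists_equiv_tubeDeriv hp
  have hC : ContDiffAt ℝ 2 (tubeMap γ ε) p := (contDiff_tubeMap hW.contDiff ε).contDiffAt
  have hd : HasFDerivAt (tubeMap γ ε) (e : ℝ × ℝ →L[ℝ] Plane) p := by
    rw [he]; exact hW.hasFDerivAt_tubeMap p
  have hs := hC.hasStrictFDerivAt' hd (by norm_num)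
  have hg := hC.to_localInverse hd (by norm_num)
  refine hg.congr_of_eventuallyEq ?_
  have h1 := hs.eventually_right_inverse
  have h2 : ∀ᶠ y in 𝓝 (tubeMap γ ε p), hs.localInverse (tubeMap γ ε) e p y ∈ strip := by
    have hc := hs.localInverse_continuousAt
    refine hc.eventually_mem ?_
    rw [hs.localInverse_apply_image]
    exact isOpen_strip.mem_nhds hp
  filter_upwards [h1, h2] with y hy1 hy2
  conv_lhs => rw [← hy1]
  exact hW.tubeInv_tubeMap hy2

theorem measurable_tubeInv : Measurable (tubeInv γ ε) := by
  classical
  have hc : ContinuousOn (tubeInv γ ε) (tube γ ε) := by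
    rintro _ ⟨p, hp, rfl⟩
    exact (hW.contDiffAt_tubeInv hp).continuousAt.continuousWithinAt
  have e : tubeInv γ ε = (tube γ ε).piecewise (tubeInv γ ε) 0 := by
    funext y
    by_cases hy : y ∈ tube γ ε
    · simp [hy]
    · simp [hy, tubeInv]
  rw [e]
  exact hc.measurable_piecewise continuousOn_const hW.isOpen_tube.measurableSet

omit hW in
theorem abs_det_tubeDeriv (hW : IsWaveguide γ ε) {p : ℝ × ℝ} (hp : p ∈ strip) :
    |((planeEquiv : Plane →L[ℝ] ℝ × ℝ).comp (tubeDeriv γ ε p)).det| = ε * jac γ ε p := by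
  have hu := hW.sq_add_sq p.1
  have h : ((planeEquiv : Plane →L[ℝ] ℝ × ℝ).comp (tubeDeriv γ ε p)).det = ε * jac γ ε p := by
    rw [ContinuousLinearMap.det, ← LinearMap.det_toMatrix (Module.Basis.finTwoProd ℝ),
      Matrix.det_fin_two]
    simp [LinearMap.toMatrix_apply, planeEquiv_apply, tubeDeriv, normal]
    linear_combination ε * jac γ ε p * hu
  rw [h, abs_of_pos (mul_pos hW.pos (hW.jac_pos hp))]

omit hW in
theorem image_planeEquiv_tubeMap :
    (fun p => planeEquiv (tubeMap γ ε p)) '' strip = planeEquiv.symm ⁻¹' (tube γ ε) := by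
  rw [tube, ← ContinuousLinearEquiv.image_eq_preimage_symm, image_image]

theorem hasFDerivWithinAt_planeEquiv (p : ℝ × ℝ) :
    HasFDerivWithinAt (fun p => planeEquiv (tubeMap γ ε p))
      ((planeEquiv : Plane →L[ℝ] ℝ × ℝ).comp (tubeDeriv γ ε p)) strip p :=
  (planeEquiv.hasFDerivAt.comp p (hW.hasFDerivAt_tubeMap p)).hasFDerivWithinAt

theorem injOn_planeEquiv : InjOn (fun p => planeEquiv (tubeMap γ ε p)) strip :=
  planeEquiv.injective.comp_injOn hW.injOn

theorem lintegral_tube (G : Plane → ℝ≥0∞) :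
    ∫⁻ y in tube γ ε, G y = ∫⁻ p in strip, ENNReal.ofReal (ε * jac γ ε p) * G (tubeMap γ ε p) := by
  have h := lintegral_image_eq_lintegral_abs_det_fderiv_mul volume isOpen_strip.measurableSet
    (fun p _ => hW.hasFDerivWithinAt_planeEquiv p) hW.injOn_planeEquiv (fun q => G (planeEquiv.symm q))
  rw [image_planeEquiv_tubeMap] at h
  have h2 := (measurePreserving_planeEquiv.symm planeEquiv.toHomeomorph.toMeasurableEquiv).setLIntegral_comp_preimage_emb
    planeEquiv.symm.toHomeomorph.measurableEmbedding G (tube γ ε)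
  have h3 : ∫⁻ y in tube γ ε, G y = ∫⁻ q in planeEquiv.symm ⁻¹' (tube γ ε), G (planeEquiv.symm q) :=
    h2.symm
  rw [h3, h]
  refine setLIntegral_congr_fun isOpen_strip.measurableSet fun p hp => ?_
  simp only [hW.abs_det_tubeDeriv hp, ContinuousLinearEquiv.symm_apply_apply]

theorem integral_tube {F : Type*} [NormedAddCommGroup F] [NormedSpace ℝ F] (G : Plane → F) :
    ∫ y in tube γ ε, G y = ∫ p in strip, (ε * jac γ ε p) • G (tubeMap γ ε p) := by
  have h := integral_image_eq_integral_abs_det_fderiv_smul volume isOpen_strip.measurableSet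
    (fun p _ => hW.hasFDerivWithinAt_planeEquiv p) hW.injOn_planeEquiv (fun q => G (planeEquiv.symm q))
  rw [image_planeEquiv_tubeMap] at h
  have h2 := (measurePreserving_planeEquiv.symm planeEquiv.toHomeomorph.toMeasurableEquiv).setIntegral_preimage_emb
    planeEquiv.symm.toHomeomorph.measurableEmbedding G (tube γ ε)
  have h3 : ∫ y in tube γ ε, G y = ∫ q in planeEquiv.symm ⁻¹' (tube γ ε), G (planeEquiv.symm q) :=
    h2.symm
  rw [h3, h]
  refine setIntegral_congr_fun isOpen_strip.measurableSet fun p hp => ?_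
  simp only [hW.abs_det_tubeDeriv hp, ContinuousLinearEquiv.symm_apply_apply]

theorem quasiMeasurePreserving_tubeMap :
    Measure.QuasiMeasurePreserving (tubeMap γ ε) (volume.restrict strip)
      (volume.restrict (tube γ ε)) := by
  have hm : Measurable (tubeMap γ ε) := (contDiff_tubeMap hW.contDiff ε).continuous.measurable
  refine ⟨hm, Measure.AbsolutelyContinuous.mk fun A hA h0 => ?_⟩
  rw [Measure.map_apply hm hA]
  rw [← lintegral_indicator_one hA, hW.lintegral_tube, lintegral_eq_zero_iff'] at h0
  · have h1 : ∀ᵐ p ∂volume.restrict strip, p ∉ tubeMap γ ε ⁻¹' A := by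
      filter_upwards [h0, ae_restrict_mem isOpen_strip.measurableSet] with p hp hps hpA
      have : ENNReal.ofReal (ε * jac γ ε p) ≠ 0 := by
        simpa using mul_pos hW.pos (hW.jac_pos hps)
      simp only [Pi.zero_apply, mul_eq_zero, this, false_or] at hp
      rw [indicator_of_mem (show tubeMap γ ε p ∈ A from hpA)] at hp
      exact one_ne_zero hp
    exact measure_eq_zero_iff_ae_notMem.2 h1
  · have hJ := hW.continuous_jac
    exact (AEMeasurable.mul (by fun_prop)
      ((measurable_one.indicator hA).comp hm).aemeasurable)

theorem quasiMeasurePreserving_tubeInv :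
    Measure.QuasiMeasurePreserving (tubeInv γ ε) (volume.restrict (tube γ ε))
      (volume.restrict strip) := by
  refine ⟨hW.measurable_tubeInv, Measure.AbsolutelyContinuous.mk fun A hA h0 => ?_⟩
  rw [Measure.map_apply hW.measurable_tubeInv hA, ← lintegral_indicator_one
    (hW.measurable_tubeInv hA), hW.lintegral_tube]
  have h1 : ∀ᵐ p ∂volume.restrict strip, p ∉ A := measure_eq_zero_iff_ae_notMem.1 h0
  rw [lintegral_congr_ae (g := 0), Pi.zero_def, lintegral_zero]
  filter_upwards [h1, ae_restrict_mem isOpen_strip.measurableSet] with p hp hps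
  rw [indicator_of_notMem, mul_zero, Pi.zero_apply]
  rw [mem_preimage, hW.tubeInv_tubeMap hps]
  exact hp

theorem ae_tube_iff {P : Plane → Prop} :
    (∀ᵐ y ∂volume.restrict (tube γ ε), P y) ↔ ∀ᵐ p ∂volume.restrict strip, P (tubeMap γ ε p) := by
  refine ⟨fun h => hW.quasiMeasurePreserving_tubeMap.ae h, fun h => ?_⟩
  filter_upwards [hW.quasiMeasurePreserving_tubeInv.ae h,
    ae_restrict_mem hW.isOpen_tube.measurableSet] with y hy hyt
  rwa [tubeMap_tubeInv hyt] at hy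

end IsWaveguide

end Waveguide
end

/-! ### Transfer of `L²` between the tube and the strip, and the core. -/

noncomputable section

theorem eLpNorm_two_sq {X F : Type*} [MeasurableSpace X] [NormedAddCommGroup F] (f : X → F)
    (μ : Measure X) : eLpNorm f 2 μ ^ 2 = ∫⁻ x, ‖f x‖ₑ ^ 2 ∂μ := by
  have := eLpNorm_nnreal_pow_eq_lintegral (f := f) (μ := μ) (p := 2) (by norm_num)
  simpa using this

theorem enorm_Lp_sq {X F : Type*} [MeasurableSpace X] [NormedAddCommGroup F] {μ : Measure X}
    (f : Lp F 2 μ) : ‖f‖ₑ ^ 2 = ∫⁻ x, ‖f x‖ₑ ^ 2 ∂μ := by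
  rw [Lp.enorm_def, eLpNorm_two_sq]

theorem norm_Lp_sq {X F : Type*} [MeasurableSpace X] [NormedAddCommGroup F] {μ : Measure X}
    (f : Lp F 2 μ) : ENNReal.ofReal (‖f‖ ^ 2) = ∫⁻ x, ‖f x‖ₑ ^ 2 ∂μ := by
  rw [← enorm_Lp_sq, ENNReal.ofReal_pow (norm_nonneg _), ofReal_norm]

theorem norm_toLp_sq {X F : Type*} [MeasurableSpace X] [NormedAddCommGroup F] {μ : Measure X}
    {f : X → F} (hf : MemLp f 2 μ) : ‖hf.toLp f‖ ^ 2 = ∫ x, ‖f x‖ ^ 2 ∂μ := by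
  rw [integral_eq_lintegral_of_nonneg_ae (Eventually.of_forall fun x => by positivity)
    (hf.1.norm.aemeasurable.pow_const 2).aestronglyMeasurable, Lp.norm_toLp, ← ENNReal.toReal_pow, eLpNorm_two_sq]
  congr 1
  refine lintegral_congr fun x => ?_
  rw [ENNReal.ofReal_pow (norm_nonneg _), ofReal_norm]

theorem memLp_two_of_lintegral {X F : Type*} [MeasurableSpace X] [NormedAddCommGroup F]
    {μ : Measure X} {f : X → F} (hf : AEStronglyMeasurable f μ) (h : ∫⁻ x, ‖f x‖ₑ ^ 2 ∂μ < ⊤) :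
    MemLp f 2 μ := by
  refine ⟨hf, ?_⟩
  rw [← eLpNorm_two_sq] at h
  by_contra hne
  rw [not_lt, top_le_iff] at hne
  simp [hne] at h

namespace Waveguide

/-- The Hilbert space on the straight strip. -/
abbrev StripL2 := Lp Spinor 2 (volume.restrict strip)

namespace IsWaveguide

variable {γ : ℝ → Plane} {ε : ℝ} (hW : IsWaveguide γ ε)
include hW

theorem aestronglyMeasurable_frame {μ : Measure (ℝ × ℝ)} {F : ℝ × ℝ → Spinor}
    (hF : AEStronglyMeasurable F μ) :
    AEStronglyMeasurable (fun p => frame (tang γ p.1) (F p)) μ := by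
  have hz : Continuous fun p : ℝ × ℝ => tang γ p.1 := hW.contDiff_tang.continuous.comp continuous_fst
  exact ((hF.coord 0).add (hF.coord 1)).sp
    (hz.aestronglyMeasurable.mul ((hF.coord 0).sub (hF.coord 1)))

theorem aestronglyMeasurable_unframe {μ : Measure (ℝ × ℝ)} {F : ℝ × ℝ → Spinor}
    (hF : AEStronglyMeasurable F μ) :
    AEStronglyMeasurable (fun p => unframe (tang γ p.1) (F p)) μ := by
  have hz : Continuous fun p : ℝ × ℝ => starRingEnd ℂ (tang γ p.1) :=
    Complex.continuous_conj.comp (hW.contDiff_tang.continuous.comp continuous_fst)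
  have h1 := hz.aestronglyMeasurable.mul (hF.coord 1) (μ := μ)
  simp only [unframe, div_eq_mul_inv]
  exact (((hF.coord 0).add h1).mul_const _).sp (((hF.coord 0).sub h1).mul_const _)

omit hW in
/-- `u` and `F` represent the same spinor field, on the tube and in the frame on the strip. -/
def _root_.Waveguide.Corresponds (γ : ℝ → Plane) (ε : ℝ) (u : Plane → Spinor)
    (F : ℝ × ℝ → Spinor) : Prop :=
  ∀ᵐ p ∂volume.restrict strip, u (tubeMap γ ε p) = frame (tang γ p.1) (F p)

/-- The weight is `2 ε J`: the factor `2` because `frame` multiplies norms by `√2`, and `ε J` from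
the change of variables. It lies between `ε` and `3ε`, whence the two-sided bounds for `transfer`.
-/
theorem lintegral_of_corresponds {u : Plane → Spinor} {F : ℝ × ℝ → Spinor}
    (h : Corresponds γ ε u F) : ∫⁻ y in tube γ ε, ‖u y‖ₑ ^ 2 =
      ∫⁻ p in strip, ENNReal.ofReal (ε * jac γ ε p) * (2 * ‖F p‖ₑ ^ 2) := by
  rw [hW.lintegral_tube]
  refine lintegral_congr_ae ?_
  filter_upwards [h] with p hp
  rw [hp, enorm_sq_frame (hW.norm_tang _)]

theorem lintegral_le_of_corresponds {u : Plane → Spinor} {F : ℝ × ℝ → Spinor}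
    (h : Corresponds γ ε u F) : ∫⁻ y in tube γ ε, ‖u y‖ₑ ^ 2 ≤
      ENNReal.ofReal (3 * ε) * ∫⁻ p in strip, ‖F p‖ₑ ^ 2 := by
  rw [hW.lintegral_of_corresponds h, ← lintegral_const_mul' _ _ ENNReal.ofReal_ne_top]
  refine setLIntegral_mono_ae' isOpen_strip.measurableSet (Eventually.of_forall fun p hp => ?_)
  rw [← mul_assoc]
  gcongr
  rw [show (2 : ℝ≥0∞) = ENNReal.ofReal 2 by simp, ← ENNReal.ofReal_mul' (by norm_num)]
  refine ENNReal.ofReal_le_ofReal ?_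
  have := (hW.jac_bounds (abs_le_of_mem_strip hp)).2
  nlinarith [hW.pos]

theorem le_lintegral_of_corresponds {u : Plane → Spinor} {F : ℝ × ℝ → Spinor}
    (h : Corresponds γ ε u F) : ENNReal.ofReal ε * ∫⁻ p in strip, ‖F p‖ₑ ^ 2 ≤
      ∫⁻ y in tube γ ε, ‖u y‖ₑ ^ 2 := by
  rw [hW.lintegral_of_corresponds h, ← lintegral_const_mul' _ _ ENNReal.ofReal_ne_top]
  refine setLIntegral_mono_ae' isOpen_strip.measurableSet (Eventually.of_forall fun p hp => ?_)
  rw [← mul_assoc]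
  gcongr
  rw [show (2 : ℝ≥0∞) = ENNReal.ofReal 2 by simp, ← ENNReal.ofReal_mul' (by norm_num)]
  refine ENNReal.ofReal_le_ofReal ?_
  have := (hW.jac_bounds (abs_le_of_mem_strip hp)).1
  nlinarith [hW.pos]

theorem norm_sq_le_of_corresponds {u : L2 (tube γ ε)} {X : StripL2} (h : Corresponds γ ε u X) :
    ‖u‖ ^ 2 ≤ 3 * ε * ‖X‖ ^ 2 := by
  have := hW.pos
  rw [← ENNReal.ofReal_le_ofReal_iff (by positivity), ENNReal.ofReal_mul (by positivity),
    norm_Lp_sq, norm_Lp_sq]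
  exact hW.lintegral_le_of_corresponds h

theorem norm_sq_ge_of_corresponds {u : L2 (tube γ ε)} {X : StripL2} (h : Corresponds γ ε u X) :
    ε * ‖X‖ ^ 2 ≤ ‖u‖ ^ 2 := by
  have := hW.pos
  rw [← ENNReal.ofReal_le_ofReal_iff (by positivity), ENNReal.ofReal_mul (by positivity),
    norm_Lp_sq, norm_Lp_sq]
  exact hW.le_lintegral_of_corresponds h

omit hW in
/-- The field on the tube given by a field in the frame on the strip. -/
def _root_.Waveguide.pushField (γ : ℝ → Plane) (ε : ℝ) (F : ℝ × ℝ → Spinor) (y : Plane) : Spinor :=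
  frame (tang γ (tubeInv γ ε y).1) (F (tubeInv γ ε y))

theorem corresponds_pushField (F : ℝ × ℝ → Spinor) : Corresponds γ ε (pushField γ ε F) F := by
  filter_upwards [ae_restrict_mem isOpen_strip.measurableSet] with p hp
  rw [pushField, hW.tubeInv_tubeMap hp]

theorem memLp_pushField {F : ℝ × ℝ → Spinor} (hF : MemLp F 2 (volume.restrict strip)) :
    MemLp (pushField γ ε F) 2 (volume.restrict (tube γ ε)) := by
  refine memLp_two_of_lintegral ((hW.aestronglyMeasurable_frame hF.1).comp_quasiMeasurePreserving
    hW.quasiMeasurePreserving_tubeInv) ?_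
  refine (hW.lintegral_le_of_corresponds (hW.corresponds_pushField F)).trans_lt ?_
  rw [← eLpNorm_two_sq]
  exact ENNReal.mul_lt_top ENNReal.ofReal_lt_top (ENNReal.pow_lt_top hF.2)

theorem corresponds_congr {u u' : Plane → Spinor} {F F' : ℝ × ℝ → Spinor}
    (h : Corresponds γ ε u F) (hu : u =ᵐ[volume.restrict (tube γ ε)] u')
    (hF : F =ᵐ[volume.restrict strip] F') : Corresponds γ ε u' F' := by
  filter_upwards [h, hW.ae_tube_iff.1 hu, hF] with p h1 h2 h3
  rw [← h2, h1, h3]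

theorem eq_of_corresponds {u u' : L2 (tube γ ε)} {F : ℝ × ℝ → Spinor}
    (h : Corresponds γ ε u F) (h' : Corresponds γ ε u' F) : u = u' := by
  refine Lp.ext (hW.ae_tube_iff.2 ?_)
  filter_upwards [h, h'] with p h1 h2
  rw [h1, h2]

/-- The function underlying `transfer`. -/
def transferFun (X : StripL2) : L2 (tube γ ε) := (hW.memLp_pushField (Lp.memLp X)).toLp _

theorem corresponds_transferFun (X : StripL2) : Corresponds γ ε (hW.transferFun X) X :=
  hW.corresponds_congr (hW.corresponds_pushField X)
    (MemLp.coeFn_toLp (hW.memLp_pushField (Lp.memLp X))).symm EventuallyEq.rfl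

theorem transferFun_add (X Y : StripL2) :
    hW.transferFun (X + Y) = hW.transferFun X + hW.transferFun Y := by
  refine hW.eq_of_corresponds (hW.corresponds_transferFun (X + Y)) ?_
  filter_upwards [hW.ae_tube_iff.1 (Lp.coeFn_add (hW.transferFun X) (hW.transferFun Y)),
    hW.corresponds_transferFun X, hW.corresponds_transferFun Y, Lp.coeFn_add X Y] with p h1 h2 h3 h4
  rw [h1, h4, Pi.add_apply, Pi.add_apply, h2, h3, frame_add]

theorem transferFun_smul (c : ℂ) (X : StripL2) :
    hW.transferFun (c • X) = c • hW.transferFun X := by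
  refine hW.eq_of_corresponds (hW.corresponds_transferFun (c • X)) ?_
  filter_upwards [hW.ae_tube_iff.1 (Lp.coeFn_smul c (hW.transferFun X)),
    hW.corresponds_transferFun X, Lp.coeFn_smul c X] with p h1 h2 h3
  rw [h1, h3, Pi.smul_apply, Pi.smul_apply, h2, frame_smul]

/-- The isomorphism between the Hilbert spaces on the strip and on the tube. -/
def transfer : StripL2 →L[ℂ] L2 (tube γ ε) :=
  LinearMap.mkContinuous
    { toFun := hW.transferFun
      map_add' := hW.transferFun_add
      map_smul' := hW.transferFun_smul }
    (√(3 * ε)) (fun X => by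
      have := hW.pos
      refine le_of_sq_le_sq ?_ (by positivity)
      rw [mul_pow, Real.sq_sqrt (by positivity)]
      exact hW.norm_sq_le_of_corresponds (hW.corresponds_transferFun X))

theorem corresponds_transfer (X : StripL2) : Corresponds γ ε (hW.transfer X) X :=
  hW.corresponds_transferFun X

theorem norm_transfer_sq_le (X : StripL2) : ‖hW.transfer X‖ ^ 2 ≤ 3 * ε * ‖X‖ ^ 2 :=
  hW.norm_sq_le_of_corresponds (hW.corresponds_transfer X)

theorem norm_transfer_sq_ge (X : StripL2) : ε * ‖X‖ ^ 2 ≤ ‖hW.transfer X‖ ^ 2 :=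
  hW.norm_sq_ge_of_corresponds (hW.corresponds_transfer X)

theorem transfer_surjective : Function.Surjective hW.transfer := by
  intro u
  set F : ℝ × ℝ → Spinor := fun p => unframe (tang γ p.1) (u (tubeMap γ ε p)) with hF
  have hc : Corresponds γ ε u F := Eventually.of_forall fun p =>
    (frame_unframe (hW.norm_tang _) _).symm
  have hm : MemLp F 2 (volume.restrict strip) := by
    refine memLp_two_of_lintegral (hW.aestronglyMeasurable_unframe
      ((Lp.aestronglyMeasurable u).comp_quasiMeasurePreserving
        hW.quasiMeasurePreserving_tubeMap)) ?_
    have h1 := hW.le_lintegral_of_corresponds hc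
    rw [← enorm_Lp_sq] at h1
    by_contra hne
    rw [not_lt, top_le_iff] at hne
    rw [hne, ENNReal.mul_top (by simpa using hW.pos), top_le_iff] at h1
    simp at h1
  refine ⟨hm.toLp F, ?_⟩
  exact hW.eq_of_corresponds (hW.corresponds_congr (hW.corresponds_transfer _) EventuallyEq.rfl
    (MemLp.coeFn_toLp hm)) hc

theorem inner_of_corresponds {u v : L2 (tube γ ε)} {F G : ℝ × ℝ → Spinor}
    (hu : Corresponds γ ε u F) (hv : Corresponds γ ε v G) :
    inner ℂ u v = ∫ p in strip, ((2 * ε * jac γ ε p : ℝ) : ℂ) * inner ℂ (F p) (G p) := by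
  rw [MeasureTheory.L2.inner_def, hW.integral_tube]
  refine integral_congr_ae ?_
  filter_upwards [hu, hv] with p h1 h2
  rw [h1, h2, inner_frame (hW.norm_tang _), Complex.real_smul]
  push_cast; ring

end IsWaveguide


/-- The derivative along the strip. -/
def dS (x : ℝ × ℝ → Spinor) (p : ℝ × ℝ) : Spinor := fderiv ℝ x p (1, 0)

/-- The derivative across the strip. -/
def dT (x : ℝ × ℝ → Spinor) (p : ℝ × ℝ) : Spinor := fderiv ℝ x p (0, 1)

/-- Uniform decay along the closed strip. -/
def Decay {F : Type*} [NormedAddCommGroup F] (f : ℝ × ℝ → F) : Prop :=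
  ∃ C, 0 ≤ C ∧ ∀ p : ℝ × ℝ, |p.2| ≤ 1 → ‖f p‖ ≤ C / (1 + p.1 ^ 2)

theorem Decay.add {F : Type*} [NormedAddCommGroup F] {f g : ℝ × ℝ → F} (hf : Decay f)
    (hg : Decay g) : Decay (fun p => f p + g p) := by
  obtain ⟨C, hC0, hC⟩ := hf
  obtain ⟨D, hD0, hD⟩ := hg
  refine ⟨C + D, by positivity, fun p hp => ?_⟩
  rw [add_div]
  exact (norm_add_le _ _).trans (add_le_add (hC p hp) (hD p hp))

theorem Decay.of_le {F G : Type*} [NormedAddCommGroup F] [NormedAddCommGroup G] {f : ℝ × ℝ → F}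
    {g : ℝ × ℝ → G} (hf : Decay f) {B : ℝ} (h : ∀ p : ℝ × ℝ, |p.2| ≤ 1 → ‖g p‖ ≤ B * ‖f p‖) :
    Decay g := by
  obtain ⟨C, hC0, hC⟩ := hf
  refine ⟨|B| * C, by positivity, fun p hp => (h p hp).trans ?_⟩
  rw [mul_div_assoc]
  calc B * ‖f p‖ ≤ |B| * ‖f p‖ := by gcongr; exact le_abs_self B
    _ ≤ |B| * (C / (1 + p.1 ^ 2)) := by gcongr; exact hC p hp

theorem hasDerivAt_fst {x : ℝ × ℝ → Spinor} (hx : Differentiable ℝ x) (s t : ℝ) :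
    HasDerivAt (fun s => x (s, t)) (dS x (s, t)) s :=
  HasFDerivAt.comp_hasDerivAt (f := fun s => (s, t)) s (hx (s, t)).hasFDerivAt
    ((hasDerivAt_id s).prodMk (hasDerivAt_const s t))

theorem hasDerivAt_snd {x : ℝ × ℝ → Spinor} (hx : Differentiable ℝ x) (s t : ℝ) :
    HasDerivAt (fun t => x (s, t)) (dT x (s, t)) t :=
  HasFDerivAt.comp_hasDerivAt (f := fun t => (s, t)) t (hx (s, t)).hasFDerivAt
    ((hasDerivAt_const t s).prodMk (hasDerivAt_id t))

theorem fderiv_apply_eq (x : ℝ × ℝ → Spinor) (p : ℝ × ℝ) (a b : ℝ) :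
    fderiv ℝ x p (a, b) = a • dS x p + b • dT x p := by
  rw [dS, dT, ← map_smul, ← map_smul, ← map_add]; simp

theorem contDiff_dS {x : ℝ × ℝ → Spinor} (hx : ContDiff ℝ 2 x) : ContDiff ℝ 1 (dS x) :=
  (hx.fderiv_right (m := 1) (by norm_num)).clm_apply contDiff_const

theorem contDiff_dT {x : ℝ × ℝ → Spinor} (hx : ContDiff ℝ 2 x) : ContDiff ℝ 1 (dT x) :=
  (hx.fderiv_right (m := 1) (by norm_num)).clm_apply contDiff_const

theorem dS_dT_comm {x : ℝ × ℝ → Spinor} (hx : ContDiff ℝ 2 x) (p : ℝ × ℝ) :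
    dS (dT x) p = dT (dS x) p := by
  have hd : DifferentiableAt ℝ (fderiv ℝ x) p :=
    ((hx.fderiv_right (m := 1) (by norm_num)).differentiable (by norm_num)) p
  have hsymm : IsSymmSndFDerivAt ℝ x p := hx.contDiffAt.isSymmSndFDerivAt (by simp)
  have e : ∀ v w : ℝ × ℝ, fderiv ℝ (fun q => fderiv ℝ x q v) p w = fderiv ℝ (fderiv ℝ x) p w v := by
    intro v w
    rw [fderiv_clm_apply hd (differentiableAt_const v)]
    simp
  unfold dS dT
  rw [e, e]
  exact hsymm _ _

theorem dS_add {x y : ℝ × ℝ → Spinor} (hx : Differentiable ℝ x) (hy : Differentiable ℝ y) :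
    dS (x + y) = dS x + dS y := by
  funext p; simp [dS, fderiv_add (hx p) (hy p)]

theorem dT_add {x y : ℝ × ℝ → Spinor} (hx : Differentiable ℝ x) (hy : Differentiable ℝ y) :
    dT (x + y) = dT x + dT y := by
  funext p; simp [dT, fderiv_add (hx p) (hy p)]

theorem dS_smul {x : ℝ × ℝ → Spinor} (hx : Differentiable ℝ x) (c : ℂ) :
    dS (c • x) = c • dS x := by
  funext p; simp [dS, fderiv_const_smul (hx p)]

theorem dT_smul {x : ℝ × ℝ → Spinor} (hx : Differentiable ℝ x) (c : ℂ) :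
    dT (c • x) = c • dT x := by
  funext p; simp [dT, fderiv_const_smul (hx p)]

/-- The core of the Dirac operator, in the frame on the strip: `C²` spinor fields with decay that
satisfy the boundary conditions. -/
def core : Submodule ℂ (ℝ × ℝ → Spinor) where
  -- The last two conditions are the infinite mass conditions in the frame, by `boundaryMap_frame`.
  -- Decay of the mixed derivative is required because it occurs in the exact derivatives integrated
  -- in `norm_straight_sq`.
  carrier := {x | ContDiff ℝ 2 x ∧ Decay x ∧ Decay (dS x) ∧ Decay (dT x) ∧ Decay (dT (dS x)) ∧
    (∀ s, x (s, 1) 0 = 0) ∧ ∀ s, x (s, -1) 1 = 0}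
  zero_mem' := by
    have h0 : dS 0 = 0 := by funext p; simp [dS]
    have h1 : dT 0 = 0 := by funext p; simp [dT]
    have h2 : Decay (0 : ℝ × ℝ → Spinor) := ⟨0, le_rfl, fun p _ => by simp⟩
    refine ⟨contDiff_const, h2, ?_, ?_, ?_, fun s => rfl, fun s => rfl⟩
    · rwa [h0]
    · rwa [h1]
    · rwa [h0, h1]
  add_mem' := by
    rintro x y ⟨h1, h2, h3, h4, h5, h6, h7⟩ ⟨k1, k2, k3, k4, k5, k6, k7⟩
    have hd := h1.differentiable (by norm_num)
    have kd := k1.differentiable (by norm_num)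
    refine ⟨h1.add k1, h2.add k2, ?_, ?_, ?_, fun s => ?_, fun s => ?_⟩
    · rw [dS_add hd kd]; exact h3.add k3
    · rw [dT_add hd kd]; exact h4.add k4
    · rw [dS_add hd kd, dT_add ((contDiff_dS h1).differentiable (by norm_num))
        ((contDiff_dS k1).differentiable (by norm_num))]
      exact h5.add k5
    · simp [h6, k6]
    · simp [h7, k7]
  smul_mem' := by
    rintro c x ⟨h1, h2, h3, h4, h5, h6, h7⟩
    have hd := h1.differentiable (by norm_num)
    have key : ∀ f : ℝ × ℝ → Spinor, Decay f → Decay (c • f) := fun f hf =>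
      hf.of_le (B := ‖c‖) fun p _ => by simp [norm_smul]
    refine ⟨h1.const_smul c, key _ h2, ?_, ?_, ?_, fun s => ?_, fun s => ?_⟩
    · rw [dS_smul hd]; exact key _ h3
    · rw [dT_smul hd]; exact key _ h4
    · rw [dS_smul hd, dT_smul ((contDiff_dS h1).differentiable (by norm_num))]
      exact key _ h5
    · simp [h6]
    · simp [h7]

namespace core

variable (x : core)

theorem contDiff : ContDiff ℝ 2 (x : ℝ × ℝ → Spinor) := x.2.1
theorem differentiable : Differentiable ℝ (x : ℝ × ℝ → Spinor) := x.2.1.differentiable (by norm_num)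
theorem decay : Decay (x : ℝ × ℝ → Spinor) := x.2.2.1
theorem decay_dS : Decay (dS x) := x.2.2.2.1
theorem decay_dT : Decay (dT x) := x.2.2.2.2.1
theorem decay_dT_dS : Decay (dT (dS x)) := x.2.2.2.2.2.1
theorem top (s : ℝ) : (x : ℝ × ℝ → Spinor) (s, 1) 0 = 0 := x.2.2.2.2.2.2.1 s
theorem bot (s : ℝ) : (x : ℝ × ℝ → Spinor) (s, -1) 1 = 0 := x.2.2.2.2.2.2.2 s
theorem continuous : Continuous (x : ℝ × ℝ → Spinor) := x.2.1.continuous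
theorem continuous_dS : Continuous (dS x) := (contDiff_dS x.2.1).continuous
theorem continuous_dT : Continuous (dT x) := (contDiff_dT x.2.1).continuous

end core

/-! ### Integration over the strip -/

theorem volume_restrict_strip :
    (volume.restrict strip : Measure (ℝ × ℝ)) =
      (volume : Measure ℝ).prod (volume.restrict (Ioo (-1) 1)) := by
  rw [strip, Measure.volume_eq_prod, ← Measure.prod_restrict, Measure.restrict_univ]

theorem integrable_strip_of_fst {f : ℝ → ℝ} (hf : Integrable f) :
    Integrable (fun p : ℝ × ℝ => f p.1) (volume.restrict strip) := by
  rw [volume_restrict_strip]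
  exact hf.comp_fst _

theorem integrable_strip_of_bound {F : Type*} [NormedAddCommGroup F] {f : ℝ × ℝ → F}
    (hf : AEStronglyMeasurable f (volume.restrict strip)) {C : ℝ}
    (h : ∀ p ∈ strip, ‖f p‖ ≤ C / (1 + p.1 ^ 2)) : Integrable f (volume.restrict strip) := by
  refine Integrable.mono' (integrable_strip_of_fst (integrable_inv_one_add_sq.const_mul C)) hf ?_
  filter_upwards [ae_restrict_mem isOpen_strip.measurableSet] with p hp
  rw [← div_eq_mul_inv]
  exact h p hp

theorem memLp_strip_of_bound {F : Type*} [NormedAddCommGroup F] {f : ℝ × ℝ → F}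
    (hf : AEStronglyMeasurable f (volume.restrict strip)) {C : ℝ}
    (h : ∀ p ∈ strip, ‖f p‖ ≤ C / (1 + p.1 ^ 2)) : MemLp f 2 (volume.restrict strip) := by
  rw [memLp_two_iff_integrable_sq_norm hf]
  refine integrable_strip_of_bound (C := C ^ 2) (hf.norm.aemeasurable.pow_const 2).aestronglyMeasurable
    fun p hp => ?_
  have h1 := pow_le_pow_left₀ (norm_nonneg _) (h p hp) 2
  rw [norm_pow, norm_norm]
  refine h1.trans ?_
  rw [div_pow]
  have : (1 : ℝ) + p.1 ^ 2 ≤ (1 + p.1 ^ 2) ^ 2 := by nlinarith [sq_nonneg p.1]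
  gcongr

theorem Decay.memLp {F : Type*} [NormedAddCommGroup F] {f : ℝ × ℝ → F}
    (hf : AEStronglyMeasurable f (volume.restrict strip)) (h : Decay f) :
    MemLp f 2 (volume.restrict strip) := by
  obtain ⟨C, -, hC⟩ := h
  exact memLp_strip_of_bound hf fun p hp => hC p (IsWaveguide.abs_le_of_mem_strip hp)

theorem Decay.integrable {F : Type*} [NormedAddCommGroup F] {f : ℝ × ℝ → F}
    (hf : AEStronglyMeasurable f (volume.restrict strip)) (h : Decay f) :
    Integrable f (volume.restrict strip) := by
  obtain ⟨C, -, hC⟩ := h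
  exact integrable_strip_of_bound hf fun p hp => hC p (IsWaveguide.abs_le_of_mem_strip hp)

theorem Decay.bounded {F : Type*} [NormedAddCommGroup F] {f : ℝ × ℝ → F} (h : Decay f) :
    ∃ C, 0 ≤ C ∧ ∀ p : ℝ × ℝ, |p.2| ≤ 1 → ‖f p‖ ≤ C := by
  obtain ⟨C, hC0, hC⟩ := h
  refine ⟨C, hC0, fun p hp => (hC p hp).trans (div_le_self hC0 ?_)⟩
  nlinarith [sq_nonneg p.1]

theorem Decay.mul {f g : ℝ × ℝ → ℂ} (hf : Decay f) (hg : Decay g) :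
    Decay fun p => f p * g p := by
  obtain ⟨C, -, hC⟩ := hf.bounded
  exact hg.of_le (B := C) fun p hp => by rw [norm_mul]; gcongr; exact hC p hp

theorem Decay.coord {f : ℝ × ℝ → Spinor} (hf : Decay f) (i : Fin 2) : Decay fun p => f p i :=
  hf.of_le (B := 1) fun p _ => by rw [one_mul]; exact norm_spinor_apply_le _ _

theorem Decay.conj {f : ℝ × ℝ → ℂ} (hf : Decay f) : Decay fun p => starRingEnd ℂ (f p) :=
  hf.of_le (B := 1) fun p _ => by simp

theorem integral_strip {F : Type*} [NormedAddCommGroup F] [NormedSpace ℝ F] {f : ℝ × ℝ → F}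
    (hf : Integrable f (volume.restrict strip)) :
    ∫ p in strip, f p = ∫ s, ∫ t in (-1)..1, f (s, t) := by
  rw [volume_restrict_strip] at hf ⊢
  rw [integral_prod f hf]
  refine integral_congr_ae (Eventually.of_forall fun s => ?_)
  simp only
  rw [intervalIntegral.integral_of_le (by norm_num), integral_Ioc_eq_integral_Ioo]

theorem integral_strip' {F : Type*} [NormedAddCommGroup F] [NormedSpace ℝ F] {f : ℝ × ℝ → F}
    (hf : Integrable f (volume.restrict strip)) :
    ∫ p in strip, f p = ∫ t in (-1)..1, ∫ s, f (s, t) := by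
  rw [volume_restrict_strip] at hf ⊢
  rw [integral_prod_symm f hf, intervalIntegral.integral_of_le (by norm_num),
    integral_Ioc_eq_integral_Ioo]

/-- The integral of a derivative along the strip vanishes. -/
theorem integral_strip_deriv_fst {f f' : ℝ × ℝ → ℂ} (hf : Continuous f) (hf' : Continuous f')
    (h : Decay f) (h' : Decay f') (hd : ∀ s t, HasDerivAt (fun s => f (s, t)) (f' (s, t)) s) :
    ∫ p in strip, f' p = 0 := by
  have hint : ∀ {g : ℝ × ℝ → ℂ}, Continuous g → Decay g → ∀ t : ℝ, |t| ≤ 1 →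
      Integrable fun s => g (s, t) := by
    rintro g hg ⟨C, -, hC⟩ t ht
    refine Integrable.mono' (integrable_inv_one_add_sq.const_mul C)
      (by fun_prop : Continuous fun s => g (s, t)).aestronglyMeasurable
      (Eventually.of_forall fun s => ?_)
    rw [← div_eq_mul_inv]
    exact hC (s, t) ht
  rw [integral_strip' (h'.integrable hf'.aestronglyMeasurable)]
  rw [intervalIntegral.integral_congr (g := fun _ => (0 : ℂ)), intervalIntegral.integral_zero]
  intro t ht
  rw [uIcc_of_le (by norm_num)] at ht
  have ht' : |t| ≤ 1 := abs_le.2 ht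
  exact integral_eq_zero_of_hasDerivAt_of_integrable (fun s => hd s t) (hint hf' h' t ht')
    (hint hf h t ht')

/-- The integral of a derivative across the strip. -/
theorem integral_strip_deriv_snd {f f' : ℝ × ℝ → ℂ} (hf' : Continuous f')
    (h' : Decay f') (hd : ∀ s t, HasDerivAt (fun t => f (s, t)) (f' (s, t)) t) :
    ∫ p in strip, f' p = ∫ s, (f (s, 1) - f (s, -1)) := by
  rw [integral_strip (h'.integrable hf'.aestronglyMeasurable)]
  refine integral_congr_ae (Eventually.of_forall fun s => ?_)
  simp only
  exact intervalIntegral.integral_eq_sub_of_hasDerivAt (fun t _ => hd s t)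
    ((by fun_prop : Continuous fun t => f' (s, t)).intervalIntegrable _ _)

/-! ### Linear maps on the core -/

/-- A linear map from the core into the functions on the strip, with square integrable values. -/
def liftL2 (Φ : core →ₗ[ℂ] (ℝ × ℝ → Spinor)) (h : ∀ x, MemLp (Φ x) 2 (volume.restrict strip)) :
    core →ₗ[ℂ] StripL2 where
  toFun x := (h x).toLp (Φ x)
  map_add' x y := by
    rw [← MemLp.toLp_add (h x) (h y)]
    simp only [map_add]
  map_smul' c x := by
    simp only [map_smul, RingHom.id_apply]
    rw [← MemLp.toLp_const_smul c (h x)]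

theorem norm_liftL2_sq (Φ : core →ₗ[ℂ] (ℝ × ℝ → Spinor))
    (h : ∀ x, MemLp (Φ x) 2 (volume.restrict strip)) (x : core) :
    ‖liftL2 Φ h x‖ ^ 2 = ∫ p in strip, ‖Φ x p‖ ^ 2 := norm_toLp_sq (h x)

theorem coeFn_liftL2 (Φ : core →ₗ[ℂ] (ℝ × ℝ → Spinor))
    (h : ∀ x, MemLp (Φ x) 2 (volume.restrict strip)) (x : core) :
    liftL2 Φ h x =ᵐ[volume.restrict strip] Φ x := MemLp.coeFn_toLp (h x)

/-- The inclusion of the core into the Hilbert space. -/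
def incl : core →ₗ[ℂ] StripL2 :=
  liftL2 core.subtype fun x => (core.decay x).memLp (core.continuous x).aestronglyMeasurable

/-- `dS` as a linear map on the core. -/
def dSLin : core →ₗ[ℂ] (ℝ × ℝ → Spinor) where
  toFun x := dS x
  map_add' x y := dS_add (core.differentiable x) (core.differentiable y)
  map_smul' c x := dS_smul (core.differentiable x) c

/-- `dT` as a linear map on the core. -/
def dTLin : core →ₗ[ℂ] (ℝ × ℝ → Spinor) where
  toFun x := dT x
  map_add' x y := dT_add (core.differentiable x) (core.differentiable y)
  map_smul' c x := dT_smul (core.differentiable x) c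

/-- `dS` as a map into the Hilbert space. -/
def inclS : core →ₗ[ℂ] StripL2 :=
  liftL2 dSLin fun x => (core.decay_dS x).memLp (core.continuous_dS x).aestronglyMeasurable

/-- `dT` as a map into the Hilbert space. -/
def inclT : core →ₗ[ℂ] StripL2 :=
  liftL2 dTLin fun x => (core.decay_dT x).memLp (core.continuous_dT x).aestronglyMeasurable

/-- The Dirac expression in the frame on the strip. -/
def symbol (α m j c : ℝ) (y ys yt : Spinor) : Spinor :=
  sp (-Complex.I * j * ys 0 + α * yt 1 + m * y 1 + c * (y 0 - y 1))
    (Complex.I * j * ys 1 - α * yt 0 + m * y 0 + c * (y 0 - y 1))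

/-- `symbol` with variable coefficients, as a linear map on the core. -/
def symbolLin (α m : ℝ) (j c : ℝ × ℝ → ℝ) : core →ₗ[ℂ] (ℝ × ℝ → Spinor) where
  toFun x p := symbol α m (j p) (c p) ((x : ℝ × ℝ → Spinor) p) (dS x p) (dT x p)
  map_add' x y := by
    funext p
    have h1 : dS (x + y : core) = dS x + dS y := dSLin.map_add x y
    have h2 : dT (x + y : core) = dT x + dT y := dTLin.map_add x y
    rw [h1, h2]
    apply spinor_ext <;> simp [symbol] <;> ring
  map_smul' a x := by
    funext p
    have h1 : dS (a • x : core) = a • dS x := dSLin.map_smul a x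
    have h2 : dT (a • x : core) = a • dT x := dTLin.map_smul a x
    rw [h1, h2]
    apply spinor_ext <;> simp [symbol] <;> ring

theorem norm_symbol_le (α m j c : ℝ) (y ys yt : Spinor) :
    ‖symbol α m j c y ys yt‖ ≤ 2 * (|j| * ‖ys‖ + |α| * ‖yt‖ + (|m| + 2 * |c|) * ‖y‖) := by
  have hb : ∀ (a : ℝ) (w : Spinor) (i : Fin 2), ‖(a : ℂ) * w i‖ ≤ |a| * ‖w‖ := fun a w i => by
    rw [norm_mul, Complex.norm_real, Real.norm_eq_abs]
    gcongr
    exact norm_spinor_apply_le w i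
  have hc : ‖(c : ℂ) * (y 0 - y 1)‖ ≤ 2 * |c| * ‖y‖ := by
    rw [mul_sub]
    refine (norm_sub_le _ _).trans ?_
    linarith [hb c y 0, hb c y 1]
  have h0 : ‖-Complex.I * j * ys 0‖ ≤ |j| * ‖ys‖ := by
    rw [mul_assoc, norm_mul]; simpa using hb j ys 0
  have h1 : ‖Complex.I * j * ys 1‖ ≤ |j| * ‖ys‖ := by
    rw [mul_assoc, norm_mul]; simpa using hb j ys 1
  refine (norm_sp_le _ _).trans ?_
  have e0 := norm_add₄_le (a := -Complex.I * j * ys 0) (b := (α : ℂ) * yt 1) (c := (m : ℂ) * y 1)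
    (d := (c : ℂ) * (y 0 - y 1))
  have e1 := norm_add₄_le (a := Complex.I * j * ys 1) (b := -((α : ℂ) * yt 0)) (c := (m : ℂ) * y 0)
    (d := (c : ℂ) * (y 0 - y 1))
  rw [← sub_eq_add_neg, norm_neg] at e1
  linarith [hb α yt 1, hb α yt 0, hb m y 0, hb m y 1]

theorem memLp_symbolLin (α m : ℝ) {j c : ℝ × ℝ → ℝ} (hj : Measurable j) (hc : Measurable c)
    {B : ℝ} (hjb : ∀ p ∈ strip, |j p| ≤ B) (hcb : ∀ p ∈ strip, |c p| ≤ B) (x : core) :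
    MemLp (symbolLin α m j c x) 2 (volume.restrict strip) := by
  obtain ⟨C, hC0, hC⟩ := (core.decay x)
  obtain ⟨Cs, hCs0, hCs⟩ := (core.decay_dS x)
  obtain ⟨Ct, hCt0, hCt⟩ := (core.decay_dT x)
  have hB : 0 ≤ B := (abs_nonneg _).trans (hjb (0, 0) ⟨trivial, by norm_num, by norm_num⟩)
  have hx := fun i => ((core.continuous x).aestronglyMeasurable (μ := volume.restrict strip)).coord i
  have hxs := fun i => ((core.continuous_dS x).aestronglyMeasurable (μ := volume.restrict strip)).coord i
  have hxt := fun i => ((core.continuous_dT x).aestronglyMeasurable (μ := volume.restrict strip)).coord i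
  have hj' : AEStronglyMeasurable (fun p => (j p : ℂ)) (volume.restrict strip) :=
    (Complex.measurable_ofReal.comp hj).aestronglyMeasurable
  have hc' : AEStronglyMeasurable (fun p => (c p : ℂ)) (volume.restrict strip) :=
    (Complex.measurable_ofReal.comp hc).aestronglyMeasurable
  refine memLp_strip_of_bound (C := 2 * (B * Cs + |α| * Ct + (|m| + 2 * B) * C)) ?_ fun p hp => ?_
  · refine AEStronglyMeasurable.sp ?_ ?_
    · exact (((hj'.const_mul _).mul (hxs 0)).add ((hxt 1).const_mul _)).add ((hx 1).const_mul _)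
        |>.add (hc'.mul ((hx 0).sub (hx 1)))
    · exact (((hj'.const_mul _).mul (hxs 1)).sub ((hxt 0).const_mul _)).add ((hx 0).const_mul _)
        |>.add (hc'.mul ((hx 0).sub (hx 1)))
  · have hp' := IsWaveguide.abs_le_of_mem_strip hp
    refine (norm_symbol_le _ _ _ _ _ _ _).trans ?_
    have e : 2 * (B * Cs + |α| * Ct + (|m| + 2 * B) * C) / (1 + p.1 ^ 2) =
        2 * (B * (Cs / (1 + p.1 ^ 2)) + |α| * (Ct / (1 + p.1 ^ 2)) +
          (|m| + 2 * B) * (C / (1 + p.1 ^ 2))) := by ring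
    rw [e]
    have := hC p hp'
    have := hCs p hp'
    have := hCt p hp'
    have := hjb p hp
    have := hcb p hp
    gcongr

/-- The straight Dirac operator on the core. -/
def straight (α m : ℝ) : core →ₗ[ℂ] StripL2 :=
  liftL2 (symbolLin α m (fun _ => 1) fun _ => 0) (memLp_symbolLin α m measurable_const
    measurable_const (B := 1) (by simp) (by simp))

end Waveguide
end

/-! ### The straight operator: splitting of the norm, symmetry, transverse lower bounds. -/

noncomputable section

theorem HasDerivAt.complex_conj {f : ℝ → ℂ} {f' : ℂ} {t : ℝ} (hf : HasDerivAt f f' t) :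
    HasDerivAt (fun t => starRingEnd ℂ (f t)) (starRingEnd ℂ f') t :=
  (Complex.conjCLE : ℂ →L[ℝ] ℂ).hasFDerivAt.comp_hasDerivAt t hf

namespace Waveguide

/-- The transverse part of the straight Dirac operator. -/
def transversal (α m : ℝ) : core →ₗ[ℂ] StripL2 :=
  liftL2 (symbolLin α m (fun _ => 0) fun _ => 0) (memLp_symbolLin α m measurable_const
    measurable_const (B := 1) (by simp) (by simp))

section

variable (x : core)

theorem hasDerivAt_core_fst (i : Fin 2) (s t : ℝ) :
    HasDerivAt (fun s => (x : ℝ × ℝ → Spinor) (s, t) i) (dS x (s, t) i) s :=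
  (hasDerivAt_fst (core.differentiable x) s t).coord i

theorem hasDerivAt_core_snd (i : Fin 2) (s t : ℝ) :
    HasDerivAt (fun t => (x : ℝ × ℝ → Spinor) (s, t) i) (dT x (s, t) i) t :=
  (hasDerivAt_snd (core.differentiable x) s t).coord i

theorem dS_core_top (s : ℝ) : dS x (s, 1) 0 = 0 := by
  have h := hasDerivAt_core_fst x 0 s 1
  simp only [core.top x] at h
  exact h.unique (hasDerivAt_const _ _)

theorem integrable_norm_sq_of_memLp {f : ℝ × ℝ → Spinor} (hf : MemLp f 2 (volume.restrict strip)) :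
    Integrable (fun p => ‖f p‖ ^ 2) (volume.restrict strip) :=
  (memLp_two_iff_integrable_sq_norm hf.1).1 hf

/-- The cross terms are grouped as one imaginary part, because the expression under it is a
combination of exact derivatives and integrates to zero on the core. -/
theorem norm_sq_symbol (α m : ℝ) (y ys yt : Spinor) : ‖symbol α m 1 0 y ys yt‖ ^ 2 =
    ‖ys‖ ^ 2 + ‖symbol α m 0 0 y ys yt‖ ^ 2 +
      (2 * α * (ys 0 * starRingEnd ℂ (yt 1) - yt 0 * starRingEnd ℂ (ys 1)) +
        2 * m * (ys 0 * starRingEnd ℂ (y 1) + y 0 * starRingEnd ℂ (ys 1))).im := by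
  rw [norm_sq_spinor, norm_sq_spinor ys, norm_sq_spinor (symbol α m 0 0 y ys yt)]
  simp only [symbol, sp_zero, sp_one, ← Complex.normSq_eq_norm_sq, Complex.normSq_apply]
  simp
  ring

/-- The longitudinal and the transverse parts of the straight operator anticommute up to exact
derivatives. The term in `α` is `∂_t (∂_s y₀ conj y₁) - ∂_s (∂_t y₀ conj y₁)` and the term in `m` is
`∂_s (y₀ conj y₁)`. The derivatives in `s` integrate to zero by decay. The derivative in `t` does so
because `∂_s y₀` vanishes at `t = 1` and `y₁` at `t = -1`. -/
theorem norm_straight_sq (α m : ℝ) :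
    ‖straight α m x‖ ^ 2 = ‖inclS x‖ ^ 2 + ‖transversal α m x‖ ^ 2 := by
  have hc := core.continuous x
  have hcs := core.continuous_dS x
  have hct := core.continuous_dT x
  have hcst : Continuous (dT (dS x)) :=
    ((contDiff_dS (core.contDiff x)).continuous_fderiv (by norm_num)).clm_apply continuous_const
  have hco : ∀ {f : ℝ × ℝ → Spinor} (i : Fin 2), Continuous f → Continuous fun p => f p i :=
    fun i hf => (continuous_coord i).comp hf
  have hcj : ∀ {f : ℝ × ℝ → ℂ}, Continuous f → Continuous fun p => starRingEnd ℂ (f p) :=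
    fun hf => Complex.continuous_conj.comp hf
  have hd := core.decay x
  have hds := core.decay_dS x
  have hdt := core.decay_dT x
  have hdst := core.decay_dT_dS x
  have dconj := fun (i : Fin 2) s t => (hasDerivAt_core_snd x i s t).complex_conj
  have dconj' := fun (i : Fin 2) s t => (hasDerivAt_core_fst x i s t).complex_conj
  have ds_t : ∀ i s t, HasDerivAt (fun t => dS x (s, t) i) (dT (dS x) (s, t) i) t := fun i s t =>
    (hasDerivAt_snd ((contDiff_dS (core.contDiff x)).differentiable (by norm_num)) s t).coord i
  have dt_s : ∀ i s t, HasDerivAt (fun s => dT x (s, t) i) (dT (dS x) (s, t) i) s := fun i s t => by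
    rw [← dS_dT_comm (core.contDiff x)]
    exact (hasDerivAt_fst ((contDiff_dT (core.contDiff x)).differentiable (by norm_num)) s t).coord i
  -- the three exact derivatives
  let y : ℝ × ℝ → Spinor := x
  let q1 : ℝ × ℝ → ℂ := fun p => dT (dS x) p 0 * starRingEnd ℂ (y p 1) +
    dS x p 0 * starRingEnd ℂ (dT x p 1)
  let q2 : ℝ × ℝ → ℂ := fun p => dT (dS x) p 0 * starRingEnd ℂ (y p 1) +
    dT x p 0 * starRingEnd ℂ (dS x p 1)
  let q3 : ℝ × ℝ → ℂ := fun p => dS x p 0 * starRingEnd ℂ (y p 1) +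
    y p 0 * starRingEnd ℂ (dS x p 1)
  have c1 : Continuous q1 := ((hco 0 hcst).mul (hcj (hco 1 hc))).add
    ((hco 0 hcs).mul (hcj (hco 1 hct)))
  have c2 : Continuous q2 := ((hco 0 hcst).mul (hcj (hco 1 hc))).add
    ((hco 0 hct).mul (hcj (hco 1 hcs)))
  have c3 : Continuous q3 := ((hco 0 hcs).mul (hcj (hco 1 hc))).add
    ((hco 0 hc).mul (hcj (hco 1 hcs)))
  have e1 : Decay q1 := ((hdst.coord 0).mul (hd.coord 1).conj).add
    ((hds.coord 0).mul (hdt.coord 1).conj)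
  have e2 : Decay q2 := ((hdst.coord 0).mul (hd.coord 1).conj).add
    ((hdt.coord 0).mul (hds.coord 1).conj)
  have e3 : Decay q3 := ((hds.coord 0).mul (hd.coord 1).conj).add
    ((hd.coord 0).mul (hds.coord 1).conj)
  have i1 : ∫ p in strip, q1 p = 0 := by
    rw [integral_strip_deriv_snd (f := fun p => dS x p 0 * starRingEnd ℂ (y p 1)) c1 e1
      fun s t => (ds_t 0 s t).mul (dconj 1 s t)]
    simp only [y, dS_core_top x, core.bot x]
    simp
  have i2 : ∫ p in strip, q2 p = 0 :=
    integral_strip_deriv_fst (f := fun p => dT x p 0 * starRingEnd ℂ (y p 1))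
      ((hco 0 hct).mul (hcj (hco 1 hc))) c2
      ((hdt.coord 0).mul (hd.coord 1).conj) e2 fun s t => (dt_s 0 s t).mul (dconj' 1 s t)
  have i3 : ∫ p in strip, q3 p = 0 :=
    integral_strip_deriv_fst (f := fun p => y p 0 * starRingEnd ℂ (y p 1))
      ((hco 0 hc).mul (hcj (hco 1 hc))) c3 ((hd.coord 0).mul (hd.coord 1).conj) e3
      fun s t => (hasDerivAt_core_fst x 0 s t).mul (dconj' 1 s t)
  have n1 := e1.integrable c1.aestronglyMeasurable
  have n2 := e2.integrable c2.aestronglyMeasurable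
  have n3 := e3.integrable c3.aestronglyMeasurable
  let g : ℝ × ℝ → ℂ := fun p => 2 * α * (q1 p - q2 p) + 2 * m * q3 p
  have hg : Integrable g (volume.restrict strip) := ((n1.sub n2).const_mul _).add (n3.const_mul _)
  have hg0 : ∫ p in strip, g p = 0 := by
    have : ∫ p in strip, g p = 2 * α * ((∫ p in strip, q1 p) - ∫ p in strip, q2 p) +
        2 * m * ∫ p in strip, q3 p := by
      rw [← integral_sub n1 n2, ← integral_const_mul, ← integral_const_mul]
      exact integral_add ((n1.sub n2).const_mul _) (n3.const_mul _)
    rw [this, i1, i2, i3]; simp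
  have hgim : ∫ p in strip, (g p).im = 0 := by
    have : ∫ p in strip, (g p).im = (∫ p in strip, g p).im := integral_im hg
    rw [this, hg0, Complex.zero_im]
  have m1 := memLp_symbolLin α m (j := fun _ => 0) (c := fun _ => 0) measurable_const
    measurable_const (B := 1) (by simp) (by simp) x
  have m2 := hds.memLp (hcs.aestronglyMeasurable (μ := volume.restrict strip))
  rw [straight, transversal, inclS, norm_liftL2_sq, norm_liftL2_sq, norm_liftL2_sq]
  have e : ∀ p, ‖symbolLin α m (fun _ => 1) (fun _ => 0) x p‖ ^ 2 =
      ‖dSLin x p‖ ^ 2 + ‖symbolLin α m (fun _ => 0) (fun _ => 0) x p‖ ^ 2 + (g p).im := by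
    intro p
    refine (norm_sq_symbol α m (y p) (dS x p) (dT x p)).trans ?_
    congr 2
    simp only [g, q1, q2, q3]
    ring
  simp only [e]
  have f1 := integrable_norm_sq_of_memLp m2
  have f2 := integrable_norm_sq_of_memLp m1
  have key := integral_add (f1.add f2) hg.im
  have hgim' : ∫ p in strip, RCLike.im (g p) = 0 := hgim
  rw [hgim', add_zero] at key
  exact key.trans (integral_add f1 f2)

theorem im_inner_symbol (α m : ℝ) (y ys yt : Spinor) :
    (inner ℂ y (symbol α m 1 0 y ys yt)).im =
      -((starRingEnd ℂ (y 0) * ys 0).re) + (starRingEnd ℂ (y 1) * ys 1).re +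
        α * (starRingEnd ℂ (y 0) * yt 1 + starRingEnd ℂ (yt 0) * y 1).im := by
  rw [inner_spinor]
  simp [symbol]
  ring

theorem inner_straight_comm (α m : ℝ) :
    inner ℂ (straight α m x) (incl x) = inner ℂ (incl x) (straight α m x) := by
  have hc := core.continuous x
  have hcs := core.continuous_dS x
  have hct := core.continuous_dT x
  have hco : ∀ {f : ℝ × ℝ → Spinor} (i : Fin 2), Continuous f → Continuous fun p => f p i :=
    fun i hf => (continuous_coord i).comp hf
  have hcj : ∀ {f : ℝ × ℝ → ℂ}, Continuous f → Continuous fun p => starRingEnd ℂ (f p) :=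
    fun hf => Complex.continuous_conj.comp hf
  have hd := core.decay x
  have hds := core.decay_dS x
  have hdt := core.decay_dT x
  have dconj := fun (i : Fin 2) s t => (hasDerivAt_core_snd x i s t).complex_conj
  have dconj' := fun (i : Fin 2) s t => (hasDerivAt_core_fst x i s t).complex_conj
  let y : ℝ × ℝ → Spinor := x
  let q : Fin 2 → ℝ × ℝ → ℂ := fun i p => starRingEnd ℂ (dS x p i) * y p i +
    starRingEnd ℂ (y p i) * dS x p i
  let q3 : ℝ × ℝ → ℂ := fun p => starRingEnd ℂ (dT x p 0) * y p 1 +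
    starRingEnd ℂ (y p 0) * dT x p 1
  have c : ∀ i, Continuous (q i) := fun i => ((hcj (hco i hcs)).mul (hco i hc)).add
    ((hcj (hco i hc)).mul (hco i hcs))
  have c3 : Continuous q3 := ((hcj (hco 0 hct)).mul (hco 1 hc)).add ((hcj (hco 0 hc)).mul (hco 1 hct))
  have e : ∀ i, Decay (q i) := fun i => ((hds.coord i).conj.mul (hd.coord i)).add
    ((hd.coord i).conj.mul (hds.coord i))
  have e3 : Decay q3 := ((hdt.coord 0).conj.mul (hd.coord 1)).add
    ((hd.coord 0).conj.mul (hdt.coord 1))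
  have i1 : ∀ i, ∫ p in strip, q i p = 0 := fun i =>
    integral_strip_deriv_fst (f := fun p => starRingEnd ℂ (y p i) * y p i)
      ((hcj (hco i hc)).mul (hco i hc)) (c i) ((hd.coord i).conj.mul (hd.coord i)) (e i)
      fun s t => (dconj' i s t).mul (hasDerivAt_core_fst x i s t)
  have i3 : ∫ p in strip, q3 p = 0 := by
    rw [integral_strip_deriv_snd (f := fun p => starRingEnd ℂ (y p 0) * y p 1) c3 e3
      fun s t => (dconj 0 s t).mul (hasDerivAt_core_snd x 1 s t)]
    simp only [y, core.top x, core.bot x]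
    simp
  have n := fun i => (e i).integrable (c i).aestronglyMeasurable
  have n3 := e3.integrable c3.aestronglyMeasurable
  have him : (inner ℂ (incl x) (straight α m x)).im = 0 := by
    have hi : Integrable (fun p => inner ℂ (incl x p) (straight α m x p)) (volume.restrict strip) :=
      L2.integrable_inner _ _
    have h1 : (inner ℂ (incl x) (straight α m x)).im =
        ∫ p in strip, (inner ℂ (incl x p) (straight α m x p)).im := by
      rw [L2.inner_def]; exact (integral_im hi).symm
    rw [h1]
    -- Each `q i` is twice the real part of `conj (y i) · ∂_s (y i)`. The factors `∓ i/2` turn these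
    -- real parts into the imaginary parts that appear in `im_inner_symbol`.
    let g : ℝ × ℝ → ℂ := fun p => -(2⁻¹ * Complex.I) * q 0 p + 2⁻¹ * Complex.I * q 1 p + α * q3 p
    have hg : Integrable g (volume.restrict strip) :=
      (((n 0).const_mul _).add ((n 1).const_mul _)).add (n3.const_mul _)
    have hg0 : ∫ p in strip, g p = 0 := by
      have : ∫ p in strip, g p = (∫ p in strip, -(2⁻¹ * Complex.I) * q 0 p) +
          (∫ p in strip, 2⁻¹ * Complex.I * q 1 p) + ∫ p in strip, α * q3 p := by
        rw [← integral_add ((n 0).const_mul _) ((n 1).const_mul _)]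
        exact integral_add (((n 0).const_mul _).add ((n 1).const_mul _)) (n3.const_mul _)
      rw [this, integral_const_mul, integral_const_mul, integral_const_mul, i1, i1, i3]; simp
    have hgim : ∫ p in strip, (g p).im = 0 := by
      have : ∫ p in strip, (g p).im = (∫ p in strip, g p).im := integral_im hg
      rw [this, hg0, Complex.zero_im]
    rw [← hgim]
    refine integral_congr_ae ?_
    filter_upwards [coeFn_liftL2 core.subtype (fun x => (core.decay x).memLp
      (core.continuous x).aestronglyMeasurable) x, coeFn_liftL2 (symbolLin α m (fun _ => 1) fun _ => 0)
      (memLp_symbolLin α m measurable_const measurable_const (B := 1) (by simp) (by simp)) x]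
      with p h1 h2
    have h1' : incl x p = y p := h1
    have h2' : straight α m x p = symbol α m 1 0 (y p) (dS x p) (dT x p) := h2
    rw [h1', h2', im_inner_symbol]
    simp [g, q, q3]
    ring
  rw [← inner_conj_symm (𝕜 := ℂ)]
  exact Complex.conj_eq_iff_im.2 him

/-- The norm of the transverse operator on a slice. -/
theorem integral_norm_sq_transversal (α m : ℝ) {h k h' k' : ℝ → ℂ}
    (hh : ∀ t, HasDerivAt h (h' t) t) (hk : ∀ t, HasDerivAt k (k' t) t) (hh' : Continuous h')
    (hk' : Continuous k') (h1 : h 1 = 0) (k1 : k (-1) = 0) :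
    ∫ t in (-1)..1, (‖α * k' t + m * k t‖ ^ 2 + ‖-(α * h' t) + m * h t‖ ^ 2) =
      α ^ 2 * ((∫ t in (-1)..1, ‖h' t‖ ^ 2) + ∫ t in (-1)..1, ‖k' t‖ ^ 2) +
      m ^ 2 * ((∫ t in (-1)..1, ‖h t‖ ^ 2) + ∫ t in (-1)..1, ‖k t‖ ^ 2) +
      α * m * (‖h (-1)‖ ^ 2 + ‖k 1‖ ^ 2) := by
  have ch : Continuous h := continuous_iff_continuousAt.2 fun t => (hh t).continuousAt
  have ck : Continuous k := continuous_iff_continuousAt.2 fun t => (hk t).continuousAt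
  have hint : ∀ {g : ℝ → ℝ}, Continuous g → IntervalIntegrable g volume (-1) 1 :=
    fun hg => hg.intervalIntegrable _ _
  have d : ∀ t, HasDerivAt (fun t => ‖k t‖ ^ 2 - ‖h t‖ ^ 2)
      (2 * inner ℝ (k t) (k' t) - 2 * inner ℝ (h t) (h' t)) t := fun t =>
    (hk t).norm_sq.sub (hh t).norm_sq
  have cd : Continuous fun t => 2 * inner ℝ (k t) (k' t) - 2 * inner ℝ (h t) (h' t) := by fun_prop
  have hftc := intervalIntegral.integral_eq_sub_of_hasDerivAt (fun t _ => d t)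
    (cd.intervalIntegrable (-1) 1)
  have e : ∀ t, ‖α * k' t + m * k t‖ ^ 2 + ‖-(α * h' t) + m * h t‖ ^ 2 =
      α ^ 2 * (‖h' t‖ ^ 2 + ‖k' t‖ ^ 2) + m ^ 2 * (‖h t‖ ^ 2 + ‖k t‖ ^ 2) +
      α * m * (2 * inner ℝ (k t) (k' t) - 2 * inner ℝ (h t) (h' t)) := by
    intro t
    simp only [← Complex.normSq_eq_norm_sq, Complex.normSq_apply, Complex.inner]
    simp
    ring
  simp only [e]
  rw [intervalIntegral.integral_add (hint (by fun_prop)) (hint (by fun_prop)),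
    intervalIntegral.integral_add (hint (by fun_prop)) (hint (by fun_prop)),
    intervalIntegral.integral_const_mul, intervalIntegral.integral_const_mul,
    intervalIntegral.integral_const_mul, hftc,
    intervalIntegral.integral_add (hint (by fun_prop)) (hint (by fun_prop)),
    intervalIntegral.integral_add (hint (by fun_prop)) (hint (by fun_prop)), h1, k1,
    norm_zero]
  ring

theorem symbol_zero (α m : ℝ) (y ys yt : Spinor) : symbol α m 0 0 y ys yt =
    sp (α * yt 1 + m * y 1) (-(α * yt 0) + m * y 0) := by
  apply spinor_ext <;> simp [symbol]

theorem integral_strip_mono {f g : ℝ × ℝ → ℝ} (hf : Integrable f (volume.restrict strip))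
    (hg : Integrable g (volume.restrict strip))
    (h : ∀ s, ∫ t in (-1)..1, f (s, t) ≤ ∫ t in (-1)..1, g (s, t)) :
    ∫ p in strip, f p ≤ ∫ p in strip, g p := by
  have key : ∀ {f : ℝ × ℝ → ℝ}, Integrable f (volume.restrict strip) →
      Integrable fun s => ∫ t in (-1)..1, f (s, t) := by
    intro f hf
    rw [volume_restrict_strip] at hf
    refine hf.integral_prod_left.congr (Eventually.of_forall fun s => ?_)
    simp only
    rw [intervalIntegral.integral_of_le (by norm_num), integral_Ioc_eq_integral_Ioo]
  rw [integral_strip hf, integral_strip hg]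
  exact integral_mono (key hf) (key hg) h

theorem slice_transversal (α m s : ℝ) :
    ∫ t in (-1)..1, ‖symbolLin α m (fun _ => 0) (fun _ => 0) x (s, t)‖ ^ 2 =
      α ^ 2 * ((∫ t in (-1)..1, ‖dT x (s, t) 0‖ ^ 2) + ∫ t in (-1)..1, ‖dT x (s, t) 1‖ ^ 2) +
      m ^ 2 * ((∫ t in (-1)..1, ‖(x : ℝ × ℝ → Spinor) (s, t) 0‖ ^ 2) +
        ∫ t in (-1)..1, ‖(x : ℝ × ℝ → Spinor) (s, t) 1‖ ^ 2) +
      α * m * (‖(x : ℝ × ℝ → Spinor) (s, -1) 0‖ ^ 2 + ‖(x : ℝ × ℝ → Spinor) (s, 1) 1‖ ^ 2) := by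
  have hct : ∀ i, Continuous fun t => dT x (s, t) i := fun i =>
    (continuous_coord i).comp ((core.continuous_dT x).comp (by fun_prop))
  rw [← integral_norm_sq_transversal α m (fun t => hasDerivAt_core_snd x 0 s t)
    (fun t => hasDerivAt_core_snd x 1 s t) (hct 0) (hct 1) (core.top x s) (core.bot x s)]
  refine intervalIntegral.integral_congr fun t _ => ?_
  have : symbolLin α m (fun _ => 0) (fun _ => 0) x (s, t) =
      symbol α m 0 0 ((x : ℝ × ℝ → Spinor) (s, t)) (dS x (s, t)) (dT x (s, t)) := rfl
  simp only
  rw [this, symbol_zero, norm_sq_spinor, sp_zero, sp_one]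

theorem slice_norm_sq {f : ℝ × ℝ → Spinor} (hf : Continuous f) (s : ℝ) :
    ∫ t in (-1)..1, ‖f (s, t)‖ ^ 2 =
      (∫ t in (-1)..1, ‖f (s, t) 0‖ ^ 2) + ∫ t in (-1)..1, ‖f (s, t) 1‖ ^ 2 := by
  have hct : ∀ i, Continuous fun t => f (s, t) i := fun i =>
    (continuous_coord i).comp (hf.comp (by fun_prop))
  have h0 := hct 0
  have h1 := hct 1
  rw [← intervalIntegral.integral_add ((by fun_prop : Continuous _).intervalIntegrable _ _)
    ((by fun_prop : Continuous _).intervalIntegrable _ _)]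
  simp only [norm_sq_spinor]

theorem integrable_transversal (α m : ℝ) :
    Integrable (fun p => ‖symbolLin α m (fun _ => 0) (fun _ => 0) x p‖ ^ 2)
      (volume.restrict strip) :=
  integrable_norm_sq_of_memLp (memLp_symbolLin α m (j := fun _ => 0) (c := fun _ => 0)
    measurable_const measurable_const (B := 1) (by simp) (by simp) x)

/-- On every slice the mass terms and the boundary terms are nonnegative when `m ≥ 0`, so they can
be dropped. This gives control of the transverse derivative by the graph norm. -/
theorem norm_transversal_ge_dT {α m : ℝ} (hα : 0 ≤ α) (hm : 0 ≤ m) :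
    α ^ 2 * ‖inclT x‖ ^ 2 ≤ ‖transversal α m x‖ ^ 2 := by
  rw [transversal, inclT, norm_liftL2_sq, norm_liftL2_sq, ← integral_const_mul]
  refine integral_strip_mono ((integrable_norm_sq_of_memLp ((core.decay_dT x).memLp
    (core.continuous_dT x).aestronglyMeasurable)).const_mul _) (integrable_transversal x α m) fun s => ?_
  rw [slice_transversal, intervalIntegral.integral_const_mul]
  have : ∫ t in (-1)..1, ‖dTLin x (s, t)‖ ^ 2 = _ := slice_norm_sq (core.continuous_dT x) s
  rw [this]
  have h0 : 0 ≤ ∫ t in (-1)..1, ‖(x : ℝ × ℝ → Spinor) (s, t) 0‖ ^ 2 :=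
    intervalIntegral.integral_nonneg (by norm_num) fun t _ => by positivity
  have h1 : 0 ≤ ∫ t in (-1)..1, ‖(x : ℝ × ℝ → Spinor) (s, t) 1‖ ^ 2 :=
    intervalIntegral.integral_nonneg (by norm_num) fun t _ => by positivity
  have : 0 ≤ m ^ 2 * ((∫ t in (-1)..1, ‖(x : ℝ × ℝ → Spinor) (s, t) 0‖ ^ 2) +
        ∫ t in (-1)..1, ‖(x : ℝ × ℝ → Spinor) (s, t) 1‖ ^ 2) +
      α * m * (‖(x : ℝ × ℝ → Spinor) (s, -1) 0‖ ^ 2 + ‖(x : ℝ × ℝ → Spinor) (s, 1) 1‖ ^ 2) := by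
    positivity
  linarith

/-- Component `0` vanishes at `t = 1` and component `1` at `t = -1`, so the one-dimensional
inequality applies to one and its reflection to the other. The Robin constant is `m/α` because the
boundary terms carry the factor `α m = α² (m/α)`. -/
theorem norm_transversal_ge {α m E : ℝ} (hα : 0 < α) (hE : IsTransverseRoot (m / α) E) :
    (α ^ 2 * E + m ^ 2) * ‖incl x‖ ^ 2 ≤ ‖transversal α m x‖ ^ 2 := by
  rw [transversal, incl, norm_liftL2_sq, norm_liftL2_sq, ← integral_const_mul]
  refine integral_strip_mono ((integrable_norm_sq_of_memLp ((core.decay x).memLp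
    (core.continuous x).aestronglyMeasurable)).const_mul _) (integrable_transversal x α m) fun s => ?_
  rw [slice_transversal, intervalIntegral.integral_const_mul]
  have : ∫ t in (-1)..1, ‖core.subtype x (s, t)‖ ^ 2 = _ := slice_norm_sq (core.continuous x) s
  rw [this]
  have hct : ∀ i, Continuous fun t => dT x (s, t) i := fun i =>
    (continuous_coord i).comp ((core.continuous_dT x).comp (by fun_prop))
  have h0 := transverse_ineq hE (fun t => hasDerivAt_core_snd x 0 s t) (hct 0) (core.top x s)
  have h1 := transverse_ineq' hE (fun t => hasDerivAt_core_snd x 1 s t) (hct 1) (core.bot x s)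
  have e : α * m = α ^ 2 * (m / α) := by field_simp
  rw [e]
  nlinarith [mul_le_mul_of_nonneg_left (add_le_add h0 h1) (sq_nonneg α)]

end

end Waveguide
end

/-! ### The resolvent along the strip and completeness of the transverse modes. -/

noncomputable section

open scoped SchwartzMap FourierTransform LineDeriv

namespace Waveguide

theorem hasTemperateGrowth_resolvent {k : ℝ} (hk : 0 < k) :
    (fun ξ : ℝ => (k ^ 2 + (2 * Real.pi * ξ) ^ 2)⁻¹).HasTemperateGrowth := by
  have h := Function.hasTemperateGrowth_one_add_norm_sq_rpow (H := ℝ) (-1)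
  have h2 := (h.comp ((2 * Real.pi / k) • (ContinuousLinearMap.id ℝ ℝ)).hasTemperateGrowth)
  have h3 := (Function.HasTemperateGrowth.const (E := ℝ) ((k ^ 2)⁻¹)).mul h2
  have e : (fun ξ : ℝ => (k ^ 2 + (2 * Real.pi * ξ) ^ 2)⁻¹) = (fun _ : ℝ => (k ^ 2)⁻¹) *
      ((fun x : ℝ => (1 + ‖x‖ ^ 2) ^ (-1 : ℝ)) ∘
        ((2 * Real.pi / k) • (ContinuousLinearMap.id ℝ ℝ))) := by
    funext ξ
    simp only [Function.comp, Pi.mul_apply]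
    rw [Real.rpow_neg_one, ← mul_inv]
    congr 1
    simp only [smul_apply, ContinuousLinearMap.id_apply, smul_eq_mul,
      Real.norm_eq_abs, sq_abs]
    field_simp
  rw [e]
  exact h3

/-- On the Fourier side one divides by `k² + (2πξ)²`. The reciprocal is smooth of temperate growth,
so multiplication by it preserves Schwartz functions. -/
theorem exists_schwartz_resolvent {k : ℝ} (hk : 0 < k) (c : 𝓢(ℝ, ℂ)) :
    ∃ d : 𝓢(ℝ, ℂ), ∀ s, -deriv (deriv d) s + (k ^ 2 : ℂ) * d s = c s := by
  have hg := hasTemperateGrowth_resolvent hk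
  set g : ℝ → ℝ := fun ξ : ℝ => (k ^ 2 + (2 * Real.pi * ξ) ^ 2)⁻¹ with hgdef
  refine ⟨𝓕⁻ (SchwartzMap.smulLeftCLM ℂ g (𝓕 c)), ?_⟩
  set d : 𝓢(ℝ, ℂ) := 𝓕⁻ (SchwartzMap.smulLeftCLM ℂ g (𝓕 c)) with hd
  have hFd : 𝓕 d = SchwartzMap.smulLeftCLM ℂ g (𝓕 c) := by rw [hd, FourierTransform.fourier_fourierInv_eq]
  have key : -(∂_{(1 : ℝ)} (∂_{(1 : ℝ)} d)) + (k ^ 2 : ℂ) • d = c := by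
    apply (FourierTransform.fourierCLE ℂ 𝓢(ℝ, ℂ)).injective
    have hi : (fun x : ℝ => inner ℝ x (1 : ℝ)).HasTemperateGrowth := by fun_prop
    rw [map_add, map_neg, map_smul]
    simp only [FourierTransform.fourierCLE_apply]
    rw [SchwartzMap.fourier_lineDerivOp_eq, SchwartzMap.fourier_lineDerivOp_eq, hFd]
    ext ξ
    have hi' : (fun x : ℝ => x).HasTemperateGrowth := by fun_prop
    have hinner : (fun x : ℝ => inner ℝ x (1 : ℝ)) = fun x => x := by funext x; simp
    simp only [hinner]
    simp only [add_apply, neg_apply, smul_apply,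
      SchwartzMap.smulLeftCLM_apply_apply hi', SchwartzMap.smulLeftCLM_apply_apply hg]
    have hne : ((k : ℂ) ^ 2 + (2 * Real.pi * ξ) ^ 2) ≠ 0 := by
      have : (k ^ 2 + (2 * Real.pi * ξ) ^ 2) ≠ 0 := by positivity
      exact_mod_cast this
    generalize (𝓕 c) ξ = w
    simp only [hgdef, smul_eq_mul, Complex.real_smul]
    push_cast
    have hinv := mul_inv_cancel₀ hne
    linear_combination w * hinv - 4 * Real.pi ^ 2 * ξ ^ 2 *
      ((k : ℂ) ^ 2 + (2 * Real.pi * ξ) ^ 2)⁻¹ * w * Complex.I_sq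
  intro s
  have e := congrArg (fun f : 𝓢(ℝ, ℂ) => f s) key
  have h1 : ∀ f : 𝓢(ℝ, ℂ), ∂_{(1 : ℝ)} f = SchwartzMap.derivCLM ℂ ℂ f := fun f => by
    ext x; rw [SchwartzMap.lineDerivOp_apply_eq_fderiv]; simp
  have h2 : (SchwartzMap.derivCLM ℂ ℂ d : ℝ → ℂ) = deriv d := by funext x; simp
  rw [← e, h1, h1]
  simp [h2]

/-- The functions `sin ((2n+1) π (1 - t) / 4)` form a complete system on `(-1, 1)`. -/
theorem ae_eq_zero_of_integral_sin {f : ℝ → ℂ} (hf : MemLp f 2 (volume.restrict (Ioo (-1) 1)))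
    (h : ∀ n : ℕ, ∫ t in Ioo (-1 : ℝ) 1,
      f t * (Real.sin ((2 * n + 1) * Real.pi / 4 * (1 - t)) : ℂ) = 0) :
    ∀ᵐ t ∂volume.restrict (Ioo (-1) 1), f t = 0 := by
  -- transport to `(0, 2)`
  have mp : MeasurePreserving (fun r : ℝ => 1 - r) (volume.restrict (Ioo 0 2))
      (volume.restrict (Ioo (-1) 1)) := by
    have h1 := (Measure.measurePreserving_sub_left volume (1 : ℝ)).restrict_preimage
      (s := Ioo (-1) 1) measurableSet_Ioo
    convert h1 using 2
    ext r; simp only [mem_Ioo, mem_preimage]; constructor <;> rintro ⟨a, b⟩ <;> constructor <;> linarith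
  have me : MeasurableEmbedding fun r : ℝ => 1 - r :=
    (Homeomorph.subLeft (1 : ℝ)).measurableEmbedding
  -- Consecutive sines differ by `2 cos ((n+1)πr/2) sin (πr/4)`. Multiplying `f` by `sin (πr/4)`,
  -- which is positive on `(0, 2)`, therefore converts orthogonality to the sines of odd multiples
  -- of `πr/4` into orthogonality to all cosines `cos (nπr/2)`.
  set g : ℝ → ℂ := fun r => f (1 - r) * (Real.sin (Real.pi / 4 * r) : ℂ) with hg
  have hf1 : MemLp (fun r => f (1 - r)) 2 (volume.restrict (Ioo 0 2)) := hf.comp_measurePreserving mp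
  have hgm : MemLp g 2 (volume.restrict (Ioo 0 2)) := by
    refine hf1.of_le_mul (c := 1) (hf1.1.mul
      (by fun_prop : Continuous fun r : ℝ => (Real.sin (Real.pi / 4 * r) : ℂ)).aestronglyMeasurable)
      (Eventually.of_forall fun r => ?_)
    rw [norm_mul, mul_comm]
    gcongr
    rw [Complex.norm_real]
    exact Real.abs_sin_le_one _
  have hsin : ∀ n : ℕ, ∫ r in Ioo (0 : ℝ) 2,
      f (1 - r) * (Real.sin ((2 * n + 1) * Real.pi / 4 * r) : ℂ) = 0 := by
    intro n
    rw [← h n, ← mp.integral_comp me]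
    simp
  have hint : ∀ b : ℝ, IntegrableOn (fun r => f (1 - r) * (Real.sin (b * r) : ℂ)) (Ioo 0 2) := by
    intro b
    refine (hf1.integrable (by norm_num)).mul_bdd (c := 1)
      (by fun_prop : Continuous fun r : ℝ => (Real.sin (b * r) : ℂ)).aestronglyMeasurable
      (Eventually.of_forall fun r => ?_)
    rw [Complex.norm_real]
    exact Real.abs_sin_le_one _
  have hcos : ∀ n : ℕ, ∫ r in Ioo (0 : ℝ) 2, g r * (Real.cos (n * (Real.pi / 2) * r) : ℂ) = 0 := by
    intro n
    rcases n with _ | n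
    · rw [← hsin 0]
      refine integral_congr_ae (Eventually.of_forall fun r => ?_)
      simp [hg]
    · have e : ∀ r : ℝ, g r * (Real.cos ((n + 1 : ℕ) * (Real.pi / 2) * r) : ℂ) =
          2⁻¹ * (f (1 - r) * (Real.sin ((2 * (n + 1 : ℕ) + 1) * Real.pi / 4 * r) : ℂ)) -
          2⁻¹ * (f (1 - r) * (Real.sin ((2 * n + 1) * Real.pi / 4 * r) : ℂ)) := by
        intro r
        have e1 : (2 * ((n + 1 : ℕ) : ℝ) + 1) * Real.pi / 4 * r =
            (n + 1 : ℕ) * (Real.pi / 2) * r + Real.pi / 4 * r := by push_cast; ring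
        have e2 : (2 * (n : ℝ) + 1) * Real.pi / 4 * r =
            (n + 1 : ℕ) * (Real.pi / 2) * r - Real.pi / 4 * r := by push_cast; ring
        rw [e1, e2, Real.sin_add, Real.sin_sub]
        simp only [hg]
        push_cast
        ring
      simp only [e]
      rw [integral_sub ((hint _).const_mul _) ((hint _).const_mul _), integral_const_mul,
        integral_const_mul, hsin, hsin]
      simp
  -- Even extension of `g` to `(-2, 2]`: its Fourier coefficients on this interval only see the
  -- cosines.
  set F0 : ℝ → ℂ := (Ioo (0 : ℝ) 2).indicator g with hF0
  have hF0m : MemLp F0 2 volume := (memLp_indicator_iff_restrict measurableSet_Ioo).2 hgm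
  have hF0i : Integrable F0 := (integrable_indicator_iff measurableSet_Ioo).2
    (hgm.integrable (by norm_num))
  have hF0n : MemLp (fun r => F0 (-r)) 2 volume :=
    hF0m.comp_measurePreserving (Measure.measurePreserving_neg volume)
  set F : ℝ → ℂ := fun r => F0 r + F0 (-r) with hF
  have hFm : MemLp F 2 volume := hF0m.add hF0n
  have hFsupp : ∀ r, r ∉ Ioc (-2 : ℝ) 2 → F r = 0 := by
    intro r hr
    have h1 : r ∉ Ioo (0 : ℝ) 2 := fun h => hr ⟨by linarith [h.1], h.2.le⟩
    have h2 : -r ∉ Ioo (0 : ℝ) 2 := fun h => hr ⟨by linarith [h.2], by linarith [h.1]⟩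
    simp [hF, hF0, h1, h2]
  have hab : (-2 : ℝ) < 2 := by norm_num
  have hcoef : ∀ n : ℤ, fourierCoeffOn hab F n = 0 := by
    intro n
    rw [fourierCoeffOn_eq_integral, intervalIntegral.integral_of_le hab.le,
      setIntegral_eq_integral_of_forall_compl_eq_zero (fun r hr => by rw [hFsupp r hr, smul_zero])]
    set e : ℝ → ℂ := fun r => Complex.exp (-(n * (Real.pi / 2) * r : ℝ) * Complex.I) with he
    have hfe : ∀ r : ℝ, (fourier (-n) (r : AddCircle (2 - (-2 : ℝ))) : ℂ) = e r := by
      intro r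
      rw [fourier_coe_apply, he]
      congr 1
      push_cast
      ring
    have hec : Continuous e := by simp only [he]; fun_prop
    have hen : ∀ r, ‖e r‖ ≤ 1 := fun r => by
      simp only [he]
      rw [← Complex.ofReal_neg, Complex.norm_exp_ofReal_mul_I]
    have i1 : Integrable fun r => e r * F0 r :=
      hF0i.bdd_mul hec.aestronglyMeasurable (Eventually.of_forall hen)
    have i2 : Integrable fun r => e (-r) * F0 r :=
      hF0i.bdd_mul (c := 1) (hec.comp continuous_neg).aestronglyMeasurable
        (Eventually.of_forall fun r => hen _)
    have i3 : Integrable fun r => e r * F0 (-r) := by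
      have := i2.comp_neg
      simpa using this
    have e1 : ∫ r : ℝ, (fourier (-n) (r : AddCircle (2 - (-2 : ℝ))) : ℂ) • F r =
        (∫ r, e r * F0 r) + ∫ r, e r * F0 (-r) := by
      rw [← integral_add i1 i3]
      refine integral_congr_ae (Eventually.of_forall fun r => ?_)
      simp only [hfe, smul_eq_mul, hF]
      ring
    have e2 : ∫ r, e r * F0 (-r) = ∫ r, e (-r) * F0 r := by
      rw [← integral_neg_eq_self]
      simp
    rw [e1, e2, ← integral_add i1 i2]
    have e3 : ∫ r, (e r * F0 r + e (-r) * F0 r) =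
        ∫ r in Ioo (0 : ℝ) 2, 2 * (g r * (Real.cos (n.natAbs * (Real.pi / 2) * r) : ℂ)) := by
      rw [← integral_indicator measurableSet_Ioo]
      refine integral_congr_ae (Eventually.of_forall fun r => ?_)
      simp only [hF0, indicator_apply]
      split_ifs
      · have h1 : Real.cos (n.natAbs * (Real.pi / 2) * r) = Real.cos (n * (Real.pi / 2) * r) := by
          rw [Nat.cast_natAbs]
          rcases abs_choice n with h | h
          · rw [h]
          · rw [h, Int.cast_neg, neg_mul, neg_mul, Real.cos_neg]
        have h2 : e r + e (-r) = 2 * (Real.cos (n * (Real.pi / 2) * r) : ℂ) := by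
          simp only [he]
          rw [Complex.ofReal_cos, Complex.two_cos]
          push_cast
          ring_nf
        rw [h1, ← add_mul, h2]
        ring
      · simp
    rw [e3, integral_const_mul, hcos]
    simp
  -- All Fourier coefficients vanish, so by Parseval the even extension vanishes almost everywhere.
  have hpars := hasSum_sq_fourierCoeffOn hab (hFm.restrict (Ioc (-2) 2))
  simp only [hcoef, norm_zero, ne_eq, OfNat.ofNat_ne_zero, not_false_eq_true, zero_pow] at hpars
  have h0 := hpars.unique hasSum_zero
  have h1 : ∫ r in (-2 : ℝ)..2, ‖F r‖ ^ 2 = 0 := by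
    rcases smul_eq_zero.1 h0 with h | h
    · norm_num at h
    · exact h
  rw [intervalIntegral.integral_of_le hab.le, integral_eq_zero_iff_of_nonneg
    (fun r => by positivity) (((memLp_two_iff_integrable_sq_norm hFm.1).1 hFm).restrict)] at h1
  have h2 : ∀ᵐ r ∂volume.restrict (Ioo (0 : ℝ) 2), f (1 - r) = 0 := by
    have h3 := ae_restrict_of_ae_restrict_of_subset
      (show Ioo (0 : ℝ) 2 ⊆ Ioc (-2) 2 from fun r hr => ⟨by linarith [hr.1], hr.2.le⟩) h1
    filter_upwards [h3, ae_restrict_mem measurableSet_Ioo] with r hr hrm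
    have h4 : F r = g r := by
      have : -r ∉ Ioo (0 : ℝ) 2 := fun h => by linarith [h.1, hrm.1]
      simp [hF, hF0, hrm, this]
    have h5 : g r = 0 := by
      rw [← h4]; simpa using hr
    simp only [hg, mul_eq_zero, Complex.ofReal_eq_zero] at h5
    rcases h5 with h5 | h5
    · exact h5
    · have := Real.sin_pos_of_pos_of_lt_pi (x := Real.pi / 4 * r)
        (by have := Real.pi_pos; nlinarith [hrm.1]) (by have := Real.pi_pos; nlinarith [hrm.2])
      exact absurd h5 this.ne'
  have mp' : MeasurePreserving (fun r : ℝ => 1 - r) (volume.restrict (Ioo (-1) 1))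
      (volume.restrict (Ioo 0 2)) := by
    have h1 := (Measure.measurePreserving_sub_left volume (1 : ℝ)).restrict_preimage
      (s := Ioo 0 2) measurableSet_Ioo
    convert h1 using 2
    ext r; simp only [mem_Ioo, mem_preimage]; constructor <;> rintro ⟨a, b⟩ <;> constructor <;> linarith
  have := mp'.quasiMeasurePreserving.ae h2
  simpa using this

end Waveguide
end

/-! ### Density of the range of the massless straight operator; weak derivatives. -/

noncomputable section

open scoped SchwartzMap

namespace Waveguide

/-- A complete system in the transverse variable yields a complete system on the strip. -/
theorem ae_eq_zero_of_integral_tensor {φ : ℕ → ℝ → ℝ} (hφ : ∀ n, Continuous (φ n))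
    (hφ1 : ∀ n t, |φ n t| ≤ 1)
    (hcomplete : ∀ f : ℝ → ℂ, MemLp f 2 (volume.restrict (Ioo (-1) 1)) →
      (∀ n, ∫ t in Ioo (-1 : ℝ) 1, f t * (φ n t : ℂ) = 0) →
      ∀ᵐ t ∂volume.restrict (Ioo (-1) 1), f t = 0)
    {g : ℝ × ℝ → ℂ} (hg : MemLp g 2 (volume.restrict strip))
    (h : ∀ (c : 𝓢(ℝ, ℂ)) (n : ℕ), ∫ p in strip, g p * (c p.1 * (φ n p.2 : ℂ)) = 0) :
    ∀ᵐ p ∂volume.restrict strip, g p = 0 := by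
  -- `g` is only square integrable on an unbounded strip. The weight makes `g w` integrable, as
  -- Fubini requires, and it is absorbed in the tests: `χ(s) / (1 + s²)` is again a Schwartz
  -- function when `χ` is a smooth function of compact support.
  set w : ℝ × ℝ → ℂ := fun p => (((1 : ℝ) + p.1 ^ 2)⁻¹ : ℝ) with hw
  have hwc : Continuous w := by
    simp only [hw]
    refine Complex.continuous_ofReal.comp (Continuous.inv₀ (by fun_prop) fun p => ?_)
    positivity
  have hwm : MemLp w 2 (volume.restrict strip) := by
    refine memLp_strip_of_bound (C := 1) hwc.aestronglyMeasurable fun p _ => ?_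
    simp only [hw, Complex.norm_real, one_div]
    rw [Real.norm_of_nonneg (by positivity)]
  have hgw : Integrable (fun p => g p * w p) (volume.restrict strip) := hg.integrable_mul hwm
  have hgwφ : ∀ n, Integrable (fun p => g p * w p * (φ n p.2 : ℂ)) (volume.restrict strip) := by
    intro n
    refine hgw.mul_bdd (c := 1) ?_ (Eventually.of_forall fun p => ?_)
    · have := hφ n
      exact (by fun_prop : Continuous fun p : ℝ × ℝ => (φ n p.2 : ℂ)).aestronglyMeasurable
    · rw [Complex.norm_real]; exact hφ1 n p.2
  rw [volume_restrict_strip] at *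
  have hH : ∀ n, ∀ᵐ s : ℝ, ∫ t in Ioo (-1 : ℝ) 1, g (s, t) * w (s, t) * (φ n t : ℂ) = 0 := by
    intro n
    have hi := (hgwφ n).integral_prod_left
    refine ae_eq_zero_of_integral_contDiff_smul_eq_zero hi.locallyIntegrable ?_
    intro χ hχ hχc
    have hsm : ContDiff ℝ ∞ fun s : ℝ => ((χ s * (1 + s ^ 2)⁻¹ : ℝ) : ℂ) := by
      refine Complex.ofRealCLM.contDiff.comp (hχ.mul (ContDiff.inv (by fun_prop) fun s => by positivity))
    have hcs : HasCompactSupport fun s : ℝ => ((χ s * (1 + s ^ 2)⁻¹ : ℝ) : ℂ) :=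
      (hχc.mul_right (f' := fun s : ℝ => (1 + s ^ 2)⁻¹)).comp_left (g := fun x : ℝ => (x : ℂ)) (by simp)
    have e := h (hcs.toSchwartzMap hsm) n
    have hχb : ∃ B, ∀ s, ‖χ s‖ ≤ B := hχ.continuous.bounded_above_of_compact_support hχc
    obtain ⟨B, hB⟩ := hχb
    have hint : Integrable (fun p : ℝ × ℝ => (χ p.1 : ℂ) * (g p * w p * (φ n p.2 : ℂ)))
        ((volume : Measure ℝ).prod (volume.restrict (Ioo (-1) 1))) := by
      refine (hgwφ n).bdd_mul (c := B) ?_ (Eventually.of_forall fun p => ?_)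
      · have := hχ.continuous
        exact (by fun_prop : Continuous fun p : ℝ × ℝ => (χ p.1 : ℂ)).aestronglyMeasurable
      · rw [Complex.norm_real]; exact hB _
    have e2 : ∀ p : ℝ × ℝ, g p * ((hcs.toSchwartzMap hsm) p.1 * (φ n p.2 : ℂ)) =
        (χ p.1 : ℂ) * (g p * w p * (φ n p.2 : ℂ)) := by
      intro p
      change g p * (((χ p.1 * (1 + p.1 ^ 2)⁻¹ : ℝ) : ℂ) * (φ n p.2 : ℂ)) = _
      simp only [hw]
      push_cast
      ring
    simp only [e2] at e
    rw [integral_prod _ hint] at e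
    rw [← e]
    refine integral_congr_ae (Eventually.of_forall fun s => ?_)
    simp only
    rw [integral_const_mul]
    simp
  have hsq := (memLp_two_iff_integrable_sq_norm hg.1).1 hg
  have h0 : ∀ᵐ s : ℝ, ∀ᵐ t ∂volume.restrict (Ioo (-1) 1), g (s, t) = 0 := by
    filter_upwards [ae_all_iff.2 hH, hsq.prod_right_ae, hg.1.prodMk_left] with s hs hs2 hs3
    refine hcomplete (fun t => g (s, t)) ((memLp_two_iff_integrable_sq_norm hs3).2 hs2) fun n => ?_
    have e := hs n
    have e2 : ∀ t : ℝ, g (s, t) * w (s, t) * (φ n t : ℂ) = w (s, 0) * (g (s, t) * (φ n t : ℂ)) := by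
      intro t; simp only [hw]; ring
    simp only [e2] at e
    rw [integral_const_mul] at e
    refine (mul_eq_zero.1 e).resolve_left ?_
    simp only [hw, Complex.ofReal_eq_zero]
    positivity
  have h1 : ∫⁻ p, ‖g p‖ₑ ∂((volume : Measure ℝ).prod (volume.restrict (Ioo (-1) 1))) = 0 := by
    rw [lintegral_prod _ hg.1.enorm]
    rw [lintegral_congr_ae (g := fun _ => 0), lintegral_zero]
    filter_upwards [h0] with s hs
    rw [lintegral_congr_ae (g := fun _ => 0), lintegral_zero]
    filter_upwards [hs] with t ht
    simp [ht]
  rw [lintegral_eq_zero_iff' hg.1.enorm] at h1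
  filter_upwards [h1] with p hp
  simpa using hp

theorem decay_tensor {a : ℝ → ℂ} {φ : ℝ → ℂ} (ha : ∃ C, ∀ s, ‖a s‖ * (1 + s ^ 2) ≤ C)
    (hφ : Continuous φ) : Decay fun p : ℝ × ℝ => a p.1 * φ p.2 := by
  obtain ⟨C, hC⟩ := ha
  obtain ⟨B, hB⟩ := (isCompact_Icc (a := (-1 : ℝ)) (b := 1)).exists_bound_of_continuousOn
    hφ.continuousOn
  have hC0 : 0 ≤ C := (by positivity : (0 : ℝ) ≤ _).trans (hC 0)
  have hB0 : 0 ≤ B := (norm_nonneg _).trans (hB 0 (by norm_num))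
  refine ⟨C * B, by positivity, fun p hp => ?_⟩
  rw [le_div_iff₀ (by positivity), norm_mul]
  have h1 := hC p.1
  have h2 := hB p.2 (abs_le.1 hp)
  calc ‖a p.1‖ * ‖φ p.2‖ * (1 + p.1 ^ 2) = (‖a p.1‖ * (1 + p.1 ^ 2)) * ‖φ p.2‖ := by ring
    _ ≤ C * B := by gcongr

theorem SchwartzMap.exists_decay_bound (a : 𝓢(ℝ, ℂ)) : ∃ C, ∀ s, ‖a s‖ * (1 + s ^ 2) ≤ C := by
  obtain ⟨C0, hC0⟩ := a.decay 0 0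
  obtain ⟨C2, hC2⟩ := a.decay 2 0
  refine ⟨C0 + C2, fun s => ?_⟩
  have h0 := hC0.2 s
  have h2 := hC2.2 s
  simp only [pow_zero, norm_iteratedFDeriv_zero, one_mul, Real.norm_eq_abs, sq_abs] at h0 h2
  linarith

/-- The tensor product of longitudinal and transverse functions. -/
def tensor (a b φ ψ : ℝ → ℂ) (p : ℝ × ℝ) : Spinor := sp (a p.1 * φ p.2) (b p.1 * ψ p.2)

theorem contDiff_tensor {a b φ ψ : ℝ → ℂ} {n : WithTop ℕ∞} (ha : ContDiff ℝ n a)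
    (hb : ContDiff ℝ n b) (hφ : ContDiff ℝ n φ) (hψ : ContDiff ℝ n ψ) :
    ContDiff ℝ n (tensor a b φ ψ) := by
  unfold tensor
  exact ContDiff.sp ((ha.comp contDiff_fst).mul (hφ.comp contDiff_snd))
    ((hb.comp contDiff_fst).mul (hψ.comp contDiff_snd))

theorem dS_tensor {a b φ ψ : ℝ → ℂ} (ha : ContDiff ℝ 1 a) (hb : ContDiff ℝ 1 b)
    (hφ : ContDiff ℝ 1 φ) (hψ : ContDiff ℝ 1 ψ) :
    dS (tensor a b φ ψ) = tensor (deriv a) (deriv b) φ ψ := by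
  funext p
  refine (hasDerivAt_fst ((contDiff_tensor ha hb hφ hψ).differentiable (by norm_num))
    p.1 p.2).unique ?_
  exact HasDerivAt.sp (a := fun s => a s * φ p.2) (b := fun s => b s * ψ p.2)
    ((ha.differentiable (by norm_num) _).hasDerivAt.mul_const _)
    ((hb.differentiable (by norm_num) _).hasDerivAt.mul_const _)

theorem dT_tensor {a b φ ψ : ℝ → ℂ} (ha : ContDiff ℝ 1 a) (hb : ContDiff ℝ 1 b)
    (hφ : ContDiff ℝ 1 φ) (hψ : ContDiff ℝ 1 ψ) :
    dT (tensor a b φ ψ) = tensor a b (deriv φ) (deriv ψ) := by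
  funext p
  refine (hasDerivAt_snd ((contDiff_tensor ha hb hφ hψ).differentiable (by norm_num))
    p.1 p.2).unique ?_
  exact HasDerivAt.sp (a := fun t => a p.1 * φ t) (b := fun t => b p.1 * ψ t)
    ((hφ.differentiable (by norm_num) _).hasDerivAt.const_mul _)
    ((hψ.differentiable (by norm_num) _).hasDerivAt.const_mul _)

theorem decay_tensor_spinor {a b φ ψ : ℝ → ℂ} (ha : ∃ C, ∀ s, ‖a s‖ * (1 + s ^ 2) ≤ C)
    (hb : ∃ C, ∀ s, ‖b s‖ * (1 + s ^ 2) ≤ C) (hφ : Continuous φ) (hψ : Continuous ψ) :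
    Decay (tensor a b φ ψ) := by
  obtain ⟨C, hC0, hC⟩ := decay_tensor ha hφ
  obtain ⟨D, hD0, hD⟩ := decay_tensor hb hψ
  refine ⟨C + D, by positivity, fun p hp => (norm_sp_le _ _).trans ?_⟩
  rw [add_div]
  exact add_le_add (hC p hp) (hD p hp)

theorem tensor_mem_core {a b φ ψ : ℝ → ℂ} (ha : ContDiff ℝ 2 a) (hb : ContDiff ℝ 2 b)
    (hφ : ContDiff ℝ 2 φ) (hψ : ContDiff ℝ 2 ψ) (hda : ∃ C, ∀ s, ‖a s‖ * (1 + s ^ 2) ≤ C)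
    (hda' : ∃ C, ∀ s, ‖deriv a s‖ * (1 + s ^ 2) ≤ C)
    (hdb : ∃ C, ∀ s, ‖b s‖ * (1 + s ^ 2) ≤ C)
    (hdb' : ∃ C, ∀ s, ‖deriv b s‖ * (1 + s ^ 2) ≤ C) (h1 : φ 1 = 0) (h2 : ψ (-1) = 0) :
    tensor a b φ ψ ∈ core := by
  have ha1 : ContDiff ℝ 1 a := ha.of_le (by norm_num)
  have hb1 : ContDiff ℝ 1 b := hb.of_le (by norm_num)
  have hφ1 : ContDiff ℝ 1 φ := hφ.of_le (by norm_num)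
  have hψ1 : ContDiff ℝ 1 ψ := hψ.of_le (by norm_num)
  have ha' : ContDiff ℝ 1 (deriv a) := ha.deriv'
  have hb' : ContDiff ℝ 1 (deriv b) := hb.deriv'
  have hφ' : ContDiff ℝ 1 (deriv φ) := hφ.deriv'
  have hψ' : ContDiff ℝ 1 (deriv ψ) := hψ.deriv'
  refine ⟨contDiff_tensor ha hb hφ hψ, decay_tensor_spinor hda hdb hφ.continuous hψ.continuous,
    ?_, ?_, ?_, fun s => by simp [tensor, h1], fun s => by simp [tensor, h2]⟩
  · rw [dS_tensor ha1 hb1 hφ1 hψ1]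
    exact decay_tensor_spinor hda' hdb' hφ.continuous hψ.continuous
  · rw [dT_tensor ha1 hb1 hφ1 hψ1]
    exact decay_tensor_spinor hda hdb hφ'.continuous hψ'.continuous
  · rw [dS_tensor ha1 hb1 hφ1 hψ1, dT_tensor ha' hb' hφ1 hψ1]
    exact decay_tensor_spinor hda' hdb' hφ'.continuous hψ'.continuous

theorem cos_mode_eq (n : ℕ) (t : ℝ) :
    Real.cos ((2 * n + 1) * Real.pi / 4 * (1 - t)) =
      (-1) ^ n * Real.sin ((2 * n + 1) * Real.pi / 4 * (1 + t)) := by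
  have e : (2 * n + 1) * Real.pi / 4 * (1 - t) =
      n * Real.pi + (Real.pi / 2 - (2 * n + 1) * Real.pi / 4 * (1 + t)) := by ring
  rw [e, add_comm, Real.cos_add_nat_mul_pi, Real.cos_pi_div_two_sub]

/-- The functions `cos ((2n+1) π (1 - t) / 4)` form a complete system on `(-1, 1)`. -/
theorem ae_eq_zero_of_integral_cos {f : ℝ → ℂ} (hf : MemLp f 2 (volume.restrict (Ioo (-1) 1)))
    (h : ∀ n : ℕ, ∫ t in Ioo (-1 : ℝ) 1,
      f t * (Real.cos ((2 * n + 1) * Real.pi / 4 * (1 - t)) : ℂ) = 0) :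
    ∀ᵐ t ∂volume.restrict (Ioo (-1) 1), f t = 0 := by
  have mp : MeasurePreserving (fun r : ℝ => -r) (volume.restrict (Ioo (-1) 1))
      (volume.restrict (Ioo (-1) 1)) := by
    have h1 := (Measure.measurePreserving_neg (volume : Measure ℝ)).restrict_preimage
      (s := Ioo (-1) 1) measurableSet_Ioo
    convert h1 using 2
    ext r; simp only [mem_Ioo, mem_preimage]; constructor <;> rintro ⟨a, b⟩ <;> constructor <;> linarith
  have me : MeasurableEmbedding fun r : ℝ => -r := (Homeomorph.neg ℝ).measurableEmbedding
  have h2 := ae_eq_zero_of_integral_sin (hf.comp_measurePreserving mp) fun n => by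
    have e := h n
    rw [← mp.integral_comp me] at e
    simp only [sub_neg_eq_add] at e
    have e2 : ∀ t : ℝ, Real.cos ((2 * n + 1) * Real.pi / 4 * (1 + t)) =
        (-1) ^ n * Real.sin ((2 * n + 1) * Real.pi / 4 * (1 - t)) := fun t => by
      have := cos_mode_eq n (-t)
      simpa [sub_eq_add_neg] using this
    simp only [e2, Complex.ofReal_mul, mul_left_comm _ (((-1 : ℝ) ^ n : ℝ) : ℂ)] at e
    rw [integral_const_mul] at e
    refine (mul_eq_zero.1 e).resolve_left ?_
    simp
  have := mp.quasiMeasurePreserving.ae h2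
  simpa using this


theorem contDiff_ofReal_comp {f : ℝ → ℝ} {n : WithTop ℕ∞} (hf : ContDiff ℝ n f) :
    ContDiff ℝ n fun t => (f t : ℂ) := Complex.ofRealCLM.contDiff.comp hf

theorem schwartz_mode_mem_core (a b : 𝓢(ℝ, ℂ)) (n : ℕ) :
    tensor a b (fun t => (Real.sin ((2 * n + 1) * Real.pi / 4 * (1 - t)) : ℂ))
      (fun t => (Real.cos ((2 * n + 1) * Real.pi / 4 * (1 - t)) : ℂ)) ∈ core := by
  have hD : ∀ a : 𝓢(ℝ, ℂ), ∃ C, ∀ s, ‖deriv a s‖ * (1 + s ^ 2) ≤ C := fun a => by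
    have := SchwartzMap.exists_decay_bound (SchwartzMap.derivCLM ℂ ℂ a)
    simpa using this
  refine tensor_mem_core (a.smooth 2) (b.smooth 2) ?_ ?_ (SchwartzMap.exists_decay_bound a) (hD a)
    (SchwartzMap.exists_decay_bound b) (hD b) (by simp) ?_
  · exact contDiff_ofReal_comp (by fun_prop)
  · exact contDiff_ofReal_comp (by fun_prop)
  · have e : ((2 * (n : ℝ) + 1) * Real.pi / 4 * (1 - -1)) = n * Real.pi + Real.pi / 2 := by ring
    rw [e, add_comm, Real.cos_add_nat_mul_pi]
    simp

/-- The action of the straight massless operator on the modes. -/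
theorem straight_mode (α μ : ℝ) (a b : 𝓢(ℝ, ℂ)) (n : ℕ) :
    (straight α 0 ⟨_, schwartz_mode_mem_core a b n⟩ -
      (μ * Complex.I : ℂ) • incl ⟨_, schwartz_mode_mem_core a b n⟩ : StripL2)
      =ᵐ[volume.restrict strip]
    tensor (fun s => -Complex.I * deriv a s + α * ((2 * n + 1) * Real.pi / 4) * b s
        - μ * Complex.I * a s)
      (fun s => Complex.I * deriv b s + α * ((2 * n + 1) * Real.pi / 4) * a s
        - μ * Complex.I * b s)
      (fun t => (Real.sin ((2 * n + 1) * Real.pi / 4 * (1 - t)) : ℂ))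
      (fun t => (Real.cos ((2 * n + 1) * Real.pi / 4 * (1 - t)) : ℂ)) := by
  set w0 : ℝ := (2 * n + 1) * Real.pi / 4 with hw0
  set x : core := ⟨_, schwartz_mode_mem_core a b n⟩ with hx
  have hsin : ContDiff ℝ 1 fun t : ℝ => (Real.sin (w0 * (1 - t)) : ℂ) :=
    contDiff_ofReal_comp (by fun_prop)
  have hcos : ContDiff ℝ 1 fun t : ℝ => (Real.cos (w0 * (1 - t)) : ℂ) :=
    contDiff_ofReal_comp (by fun_prop)
  have hxe : (x : ℝ × ℝ → Spinor) = tensor a b (fun t => (Real.sin (w0 * (1 - t)) : ℂ))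
      (fun t => (Real.cos (w0 * (1 - t)) : ℂ)) := rfl
  have hlin : ∀ t : ℝ, HasDerivAt (fun t : ℝ => w0 * (1 - t)) (-w0) t := fun t => by
    simpa using ((hasDerivAt_id t).const_sub 1).const_mul w0
  have hds : ∀ t : ℝ, deriv (fun t : ℝ => (Real.sin (w0 * (1 - t)) : ℂ)) t =
      -w0 * (Real.cos (w0 * (1 - t)) : ℂ) := fun t => by
    have := ((hlin t).sin.ofReal_comp).deriv
    rw [this]; push_cast; ring
  have hdc : ∀ t : ℝ, deriv (fun t : ℝ => (Real.cos (w0 * (1 - t)) : ℂ)) t =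
      w0 * (Real.sin (w0 * (1 - t)) : ℂ) := fun t => by
    have := ((hlin t).cos.ofReal_comp).deriv
    rw [this]; push_cast; ring
  have h1 : dS x = tensor (deriv a) (deriv b) (fun t => (Real.sin (w0 * (1 - t)) : ℂ))
      (fun t => (Real.cos (w0 * (1 - t)) : ℂ)) := by
    rw [hxe]; exact dS_tensor (a.smooth 1) (b.smooth 1) hsin hcos
  have h2 : dT x = tensor a b (fun t => -w0 * (Real.cos (w0 * (1 - t)) : ℂ))
      (fun t => w0 * (Real.sin (w0 * (1 - t)) : ℂ)) := by
    rw [hxe, dT_tensor (a.smooth 1) (b.smooth 1) hsin hcos]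
    funext p
    simp only [tensor, hds, hdc]
  filter_upwards [Lp.coeFn_sub (straight α 0 x) ((μ * Complex.I : ℂ) • incl x),
    Lp.coeFn_smul (μ * Complex.I : ℂ) (incl x),
    coeFn_liftL2 _ (memLp_symbolLin α 0 (j := fun _ => 1) (c := fun _ => 0) measurable_const
      measurable_const (B := 1) (by simp) (by simp)) x,
    coeFn_liftL2 core.subtype
      (fun x => (core.decay x).memLp (core.continuous x).aestronglyMeasurable) x] with p e1 e2 e3 e4
  have e3' : straight α 0 x p = symbol α 0 1 0 ((x : ℝ × ℝ → Spinor) p) (dS x p) (dT x p) := e3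
  have e4' : incl x p = (x : ℝ × ℝ → Spinor) p := e4
  rw [e1, Pi.sub_apply, e2, Pi.smul_apply, e3', e4', h1, h2, hxe]
  have hw0c : (w0 : ℂ) = (2 * n + 1) * Real.pi / 4 := by rw [hw0]; push_cast; ring
  rw [← hw0c]
  apply spinor_ext
  · simp only [symbol, tensor, sp_zero, sp_one, PiLp.sub_apply, PiLp.smul_apply, smul_eq_mul, ← hw0]
    push_cast; ring
  · simp only [symbol, tensor, sp_zero, sp_one, PiLp.sub_apply, PiLp.smul_apply, smul_eq_mul, ← hw0]
    push_cast; ring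

/-- The range of the straight massless operator, shifted by a non-zero imaginary number, is dense. -/
theorem straight_range_dense {α μ : ℝ} (hμ : μ ≠ 0) (y : StripL2)
    (h : ∀ x : core, inner ℂ y (straight α 0 x - (μ * Complex.I : ℂ) • incl x) = 0) : y = 0 := by
  have hy := Lp.memLp y
  have hyi : ∀ i : Fin 2, MemLp (fun p => starRingEnd ℂ (y p i)) 2 (volume.restrict strip) := by
    intro i
    refine hy.of_le (Complex.continuous_conj.comp_aestronglyMeasurable (hy.1.coord i))
      (Eventually.of_forall fun p => ?_)
    simpa using norm_spinor_apply_le (y p) i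
  have hk : ∀ n : ℕ, 0 < √((α * ((2 * n + 1) * Real.pi / 4)) ^ 2 + μ ^ 2) := fun n =>
    Real.sqrt_pos.2 (by positivity)
  have hk2 : ∀ n : ℕ, ((√((α * ((2 * n + 1) * Real.pi / 4)) ^ 2 + μ ^ 2) : ℝ) : ℂ) ^ 2 =
      (α * ((2 * n + 1) * Real.pi / 4)) ^ 2 + μ ^ 2 := fun n => by
    rw [← Complex.ofReal_pow, Real.sq_sqrt (by positivity)]
    push_cast; ring
  have hder : ∀ (d : 𝓢(ℝ, ℂ)) s, HasDerivAt d (deriv d s) s := fun d s =>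
    (d.differentiableAt).hasDerivAt
  have hder2 : ∀ (d : 𝓢(ℝ, ℂ)) s, HasDerivAt (deriv d) (deriv (deriv d) s) s := fun d s =>
    by
    have h2 : ContDiff ℝ 2 d := d.smooth 2
    have h1 : ContDiff ℝ 1 (deriv d) := h2.deriv'
    exact (h1.differentiable (by norm_num) s).hasDerivAt
  have h0 : ∀ᵐ p ∂volume.restrict strip, starRingEnd ℂ (y p 0) = 0 := by
    refine ae_eq_zero_of_integral_tensor
      (φ := fun n t => Real.sin ((2 * n + 1) * Real.pi / 4 * (1 - t))) (fun n => by fun_prop)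
      (fun n t => Real.abs_sin_le_one _) (fun f hf => ae_eq_zero_of_integral_sin hf) (hyi 0) ?_
    intro c n
    obtain ⟨d, hd⟩ := exists_schwartz_resolvent (hk n) c
    simp only [hk2] at hd
    have hda : ∀ s, HasDerivAt (fun s => -Complex.I * deriv d s + Complex.I * μ * d s)
        (-Complex.I * deriv (deriv d) s + Complex.I * μ * deriv d s) s := fun s =>
      ((hder2 d s).const_mul _).add ((hder d s).const_mul _)
    -- On the `n`-th mode the square of the operator acts as `-d²/ds²` plus a constant. The pair
    -- `(a, b)` is `D + iμ` applied to `(d, 0)`. Then `D - iμ` sends it to `(D² + μ²)(d, 0) = (c,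
    -- 0)`, with `d` from the scalar resolvent.
    let a : 𝓢(ℝ, ℂ) := (-Complex.I) • SchwartzMap.derivCLM ℂ ℂ d + (Complex.I * μ) • d
    let b : 𝓢(ℝ, ℂ) := (α * ((2 * n + 1) * Real.pi / 4) : ℂ) • d
    have ha : (a : ℝ → ℂ) = fun s => -Complex.I * deriv d s + Complex.I * μ * d s := by
      funext s; simp [a]
    have hb : (b : ℝ → ℂ) = fun s => (α * ((2 * n + 1) * Real.pi / 4) : ℂ) * d s := by
      funext s; simp [b]
    have e := h ⟨_, schwartz_mode_mem_core a b n⟩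
    rw [L2.inner_def] at e
    rw [← e]
    refine integral_congr_ae ?_
    filter_upwards [straight_mode α μ a b n] with p hp
    rw [hp, inner_spinor]
    have hbd : deriv b p.1 = (α * ((2 * n + 1) * Real.pi / 4) : ℂ) * deriv d p.1 := by
      rw [hb]; exact ((hder d p.1).const_mul _).deriv
    have had := (hda p.1).deriv
    rw [← ha] at had
    simp only [tensor, sp_zero, sp_one, had, hbd]
    rw [← hd p.1, ha, hb]
    simp only []
    linear_combination (starRingEnd ℂ (y p 0)) * (Real.sin ((2 * n + 1) * Real.pi / 4 * (1 - p.2)) : ℂ)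
      * (- deriv (deriv d) p.1 + μ ^ 2 * d p.1 ) * Complex.I_sq
  have h1 : ∀ᵐ p ∂volume.restrict strip, starRingEnd ℂ (y p 1) = 0 := by
    refine ae_eq_zero_of_integral_tensor
      (φ := fun n t => Real.cos ((2 * n + 1) * Real.pi / 4 * (1 - t))) (fun n => by fun_prop)
      (fun n t => Real.abs_cos_le_one _) (fun f hf => ae_eq_zero_of_integral_cos hf) (hyi 1) ?_
    intro c n
    obtain ⟨d, hd⟩ := exists_schwartz_resolvent (hk n) c
    simp only [hk2] at hd
    have hdb : ∀ s, HasDerivAt (fun s => Complex.I * deriv d s + Complex.I * μ * d s)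
        (Complex.I * deriv (deriv d) s + Complex.I * μ * deriv d s) s := fun s =>
      ((hder2 d s).const_mul _).add ((hder d s).const_mul _)
    -- The same construction with `D + iμ` applied to `(0, d)`, so that the image is `(0, c)`.
    let b : 𝓢(ℝ, ℂ) := Complex.I • SchwartzMap.derivCLM ℂ ℂ d + (Complex.I * μ) • d
    let a : 𝓢(ℝ, ℂ) := (α * ((2 * n + 1) * Real.pi / 4) : ℂ) • d
    have hb : (b : ℝ → ℂ) = fun s => Complex.I * deriv d s + Complex.I * μ * d s := by
      funext s; simp [b]
    have ha : (a : ℝ → ℂ) = fun s => (α * ((2 * n + 1) * Real.pi / 4) : ℂ) * d s := by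
      funext s; simp [a]
    have e := h ⟨_, schwartz_mode_mem_core a b n⟩
    rw [L2.inner_def] at e
    rw [← e]
    refine integral_congr_ae ?_
    filter_upwards [straight_mode α μ a b n] with p hp
    rw [hp, inner_spinor]
    have had : deriv a p.1 = (α * ((2 * n + 1) * Real.pi / 4) : ℂ) * deriv d p.1 := by
      rw [ha]; exact ((hder d p.1).const_mul _).deriv
    have hbd := (hdb p.1).deriv
    rw [← hb] at hbd
    simp only [tensor, sp_zero, sp_one, had, hbd]
    rw [← hd p.1, ha, hb]
    simp only []
    linear_combination (starRingEnd ℂ (y p 1)) * (Real.cos ((2 * n + 1) * Real.pi / 4 * (1 - p.2)) : ℂ)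
      * (- deriv (deriv d) p.1 + μ ^ 2 * d p.1 ) * Complex.I_sq
  rw [Lp.eq_zero_iff_ae_eq_zero]
  filter_upwards [h0, h1] with p hp0 hp1
  refine spinor_ext ?_ ?_
  · simpa using hp0
  · simpa using hp1


/-- Approximation of a `C¹` test function by smooth test functions. -/
theorem exists_smooth_approx {Ω : Set Plane} (hΩ : IsOpen Ω) {φ : Plane → ℝ} (hφ : ContDiff ℝ 1 φ)
    (hc : HasCompactSupport φ) (hs : tsupport φ ⊆ Ω) (e : Plane) :
    ∃ K, IsCompact K ∧ K ⊆ Ω ∧ tsupport φ ⊆ K ∧ ∀ η > 0, ∃ ψ : Plane → ℝ, ContDiff ℝ ∞ ψ ∧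
      tsupport ψ ⊆ K ∧ (∀ x, |ψ x - φ x| ≤ η) ∧ ∀ x, |fderiv ℝ ψ x e - fderiv ℝ φ x e| ≤ η := by
  -- The compact set is fixed before the accuracy `η`: mollifiers of radius at most `δ` keep all
  -- supports in one thickening, over which the integrals of `‖u‖` and `‖v‖` give a constant
  -- independent of `η`.
  obtain ⟨δ, hδ, hδΩ⟩ := hc.isCompact.exists_cthickening_subset_open hΩ hs
  refine ⟨Metric.cthickening δ (tsupport φ), hc.isCompact.cthickening, hδΩ,
    Metric.self_subset_cthickening _, fun η hη => ?_⟩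
  have hdc : Continuous fun x => fderiv ℝ φ x e :=
    (hφ.continuous_fderiv (by norm_num)).clm_apply continuous_const
  have hdcs : HasCompactSupport fun x => fderiv ℝ φ x e := hc.fderiv_apply ℝ e
  have u1 := Metric.uniformContinuous_iff.1 (hc.uniformContinuous_of_continuous hφ.continuous) η hη
  have u2 := Metric.uniformContinuous_iff.1 (hdcs.uniformContinuous_of_continuous hdc) η hη
  obtain ⟨r1, hr1, h1⟩ := u1
  obtain ⟨r2, hr2, h2⟩ := u2
  have hr : 0 < min δ (min r1 r2) := by positivity
  let b : ContDiffBump (0 : Plane) := ⟨min δ (min r1 r2) / 2, min δ (min r1 r2), by positivity,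
    by linarith⟩
  have hli : LocallyIntegrable (b.normed volume) volume := b.continuous_normed.locallyIntegrable
  refine ⟨convolution (b.normed volume) φ (ContinuousLinearMap.lsmul ℝ ℝ) volume, ?_, ?_, ?_, ?_⟩
  · exact b.hasCompactSupport_normed.contDiff_convolution_left _ b.contDiff_normed
      hφ.continuous.locallyIntegrable
  · refine closure_minimal ?_ Metric.isClosed_cthickening
    refine (support_convolution_subset _).trans ?_
    rintro _ ⟨x, hx, y, hy, rfl⟩
    rw [b.support_normed_eq, mem_ball_zero_iff] at hx
    refine Metric.mem_cthickening_of_dist_le _ y _ _ (subset_tsupport _ hy) ?_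
    simp only [dist_eq_norm, add_sub_cancel_right]
    exact hx.le.trans (min_le_left _ _)
  · intro x
    rw [← Real.dist_eq]
    refine b.dist_normed_convolution_le hφ.continuous.aestronglyMeasurable fun y hy => ?_
    exact (h1 (lt_of_lt_of_le hy ((min_le_right _ _).trans (min_le_left _ _)))).le
  · intro x
    have hd := HasCompactSupport.hasFDerivAt_convolution_right (μ := volume)
      (L := ContinuousLinearMap.lsmul ℝ ℝ) hc hli hφ x
    rw [hd.fderiv, convolution_precompR_apply _ hli (hc.fderiv ℝ)
      (hφ.continuous_fderiv (by norm_num)), ← Real.dist_eq]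
    refine b.dist_normed_convolution_le hdc.aestronglyMeasurable fun y hy => ?_
    exact (h2 (lt_of_lt_of_le hy ((min_le_right _ _).trans (min_le_right _ _)))).le

/-- The weak derivative may be tested against `C¹` functions. -/
theorem IsWeakDeriv.test {Ω : Set Plane} (hΩ : IsOpen Ω) {j : Fin 2} {u v : L2 Ω}
    (h : IsWeakDeriv Ω j u v) {φ : Plane → ℝ} (hφ : ContDiff ℝ 1 φ) (hc : HasCompactSupport φ)
    (hs : tsupport φ ⊆ Ω) :
    ∫ x in Ω, (fderiv ℝ φ x (EuclideanSpace.single j 1)) • u x = - ∫ x in Ω, φ x • v x := by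
  set e : Plane := EuclideanSpace.single j 1
  obtain ⟨K, hK, hKΩ, hφK, happ⟩ := exists_smooth_approx hΩ hφ hc hs e
  have hint : ∀ w : L2 Ω, Integrable (K.indicator fun x => ‖w x‖) (volume.restrict Ω) := fun w =>
    (integrable_indicator_iff hK.measurableSet).2
      (((Lp.memLp w).locallyIntegrable (by norm_num)).integrableOn_isCompact hK).norm
  have hdc : Continuous fun x => fderiv ℝ φ x e :=
    (hφ.continuous_fderiv (by norm_num)).clm_apply continuous_const
  have hdcs : HasCompactSupport fun x => fderiv ℝ φ x e := hc.fderiv_apply ℝ e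
  have hbd : ∀ (w : L2 Ω) (f g : Plane → ℝ) (η : ℝ), Continuous f → Continuous g →
      HasCompactSupport f → HasCompactSupport g → tsupport f ⊆ K → tsupport g ⊆ K →
      (∀ x, |f x - g x| ≤ η) → ‖(∫ x in Ω, f x • w x) - ∫ x in Ω, g x • w x‖ ≤
        η * ∫ x in Ω, K.indicator (fun x => ‖w x‖) x := by
    intro w f g η hf hg hfc hgc hfK hgK hfg
    rw [← integral_sub (integrable_test hf hfc w) (integrable_test hg hgc w), ← integral_const_mul]
    refine norm_integral_le_of_norm_le ((hint w).const_mul η) (Eventually.of_forall fun x => ?_)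
    by_cases hx : x ∈ K
    · rw [indicator_of_mem hx, ← sub_smul, norm_smul]
      gcongr
      exact hfg x
    · rw [indicator_of_notMem hx, image_eq_zero_of_notMem_tsupport fun h => hx (hfK h),
        image_eq_zero_of_notMem_tsupport fun h => hx (hgK h)]
      simp
  set C := (∫ x in Ω, K.indicator (fun x => ‖u x‖) x) + ∫ x in Ω, K.indicator (fun x => ‖v x‖) x
    with hC
  have hC0 : 0 ≤ C := add_nonneg
    (integral_nonneg fun x => indicator_nonneg (fun _ _ => norm_nonneg _) x)
    (integral_nonneg fun x => indicator_nonneg (fun _ _ => norm_nonneg _) x)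
  rw [eq_neg_iff_add_eq_zero, ← norm_le_zero_iff]
  refine le_of_forall_pos_le_add fun η hη => ?_
  obtain ⟨ψ, hψ, hψK, h1, h2⟩ := happ (η / (C + 1)) (by positivity)
  have hψc : HasCompactSupport ψ := hK.of_isClosed_subset (isClosed_tsupport _) hψK
  have e1 := h ψ hψ hψc (hψK.trans hKΩ)
  have b1 := hbd u (fun x => fderiv ℝ ψ x e) (fun x => fderiv ℝ φ x e) _
    ((hψ.continuous_fderiv (by simp)).clm_apply continuous_const) hdc (hψc.fderiv_apply ℝ e) hdcs
    ((tsupport_fderiv_apply_subset ℝ e).trans hψK) ((tsupport_fderiv_apply_subset ℝ e).trans hφK) h2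
  have b2 := hbd v ψ φ _ hψ.continuous hφ.continuous hψc hc hψK hφK h1
  have e2 : (∫ x in Ω, fderiv ℝ φ x e • u x) + ∫ x in Ω, φ x • v x =
      -(((∫ x in Ω, fderiv ℝ ψ x e • u x) - ∫ x in Ω, fderiv ℝ φ x e • u x) +
        ((∫ x in Ω, ψ x • v x) - ∫ x in Ω, φ x • v x)) := by
    rw [e1]; abel
  rw [e2, norm_neg, zero_add]
  refine (norm_add_le _ _).trans ((add_le_add b1 b2).trans ?_)
  rw [← mul_add, ← hC, div_mul_eq_mul_div, div_le_iff₀ (by positivity)]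
  nlinarith

/-- Integration by parts of a weak derivative against a `C¹` spinor field. -/
theorem IsWeakDeriv.integral_inner {Ω : Set Plane} (hΩ : IsOpen Ω) {j : Fin 2} {u v : L2 Ω}
    (h : IsWeakDeriv Ω j u v) {W : Plane → Spinor} (hW : ContDiff ℝ 1 W) (hc : HasCompactSupport W)
    (hs : tsupport W ⊆ Ω) :
    ∫ x in Ω, inner ℂ (fderiv ℝ W x (EuclideanSpace.single j 1)) (u x) =
      - ∫ x in Ω, inner ℂ (W x) (v x) := by
  set e : Plane := EuclideanSpace.single j 1 with he
  -- real valued components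
  have key : ∀ (L : Spinor →L[ℝ] ℝ) (i : Fin 2),
      Integrable (fun x => (L (fderiv ℝ W x e) : ℂ) * u x i) (volume.restrict Ω) ∧
      Integrable (fun x => (L (W x) : ℂ) * v x i) (volume.restrict Ω) ∧
      ∫ x in Ω, (L (fderiv ℝ W x e) : ℂ) * u x i = -∫ x in Ω, (L (W x) : ℂ) * v x i := by
    intro L i
    have hφ : ContDiff ℝ 1 fun x => L (W x) := L.contDiff.comp hW
    have hφc : HasCompactSupport fun x => L (W x) := hc.comp_left (map_zero L)
    have hφs : tsupport (fun x => L (W x)) ⊆ Ω :=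
      (closure_mono (Function.support_comp_subset (map_zero L) W)).trans hs
    have hfd : ∀ x, fderiv ℝ (fun x => L (W x)) x e = L (fderiv ℝ W x e) := fun x => by
      have := (L.hasFDerivAt.comp x (hW.differentiable (by norm_num) x).hasFDerivAt).fderiv
      change fderiv ℝ (⇑L ∘ W) x e = _
      rw [this]; rfl
    have e1 := h.test hΩ hφ hφc hφs
    have i1 := integrable_test (ψ := fun x => fderiv ℝ (fun x => L (W x)) x e)
      ((hφ.continuous_fderiv (by norm_num)).clm_apply continuous_const) (hφc.fderiv_apply ℝ e) u
    have i2 := integrable_test hφ.continuous hφc v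
    simp only [← he, hfd] at e1 i1
    let P : Spinor →L[ℂ] ℂ := EuclideanSpace.proj i
    have hP : ∀ (r : ℝ) (y : Spinor), P (r • y) = (r : ℂ) * y i := fun r y => by
      simp [P]
    have j1 := P.integrable_comp i1
    have j2 := P.integrable_comp i2
    have f1 := P.integral_comp_comm i1
    have f2 := P.integral_comp_comm i2
    simp only [hP] at j1 j2 f1 f2
    refine ⟨j1, j2, ?_⟩
    rw [f1, f2, e1, map_neg]
  let R : Fin 2 → Spinor →L[ℝ] ℝ := fun i =>
    Complex.reCLM.comp ((EuclideanSpace.proj (𝕜 := ℂ) i).restrictScalars ℝ)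
  let I : Fin 2 → Spinor →L[ℝ] ℝ := fun i =>
    Complex.imCLM.comp ((EuclideanSpace.proj (𝕜 := ℂ) i).restrictScalars ℝ)
  have hin : ∀ y z : Spinor, inner ℂ y z = ((R 0 y : ℂ) * z 0 - Complex.I * ((I 0 y : ℂ) * z 0)) +
      ((R 1 y : ℂ) * z 1 - Complex.I * ((I 1 y : ℂ) * z 1)) := by
    intro y z
    rw [inner_spinor]
    have hconj : ∀ w : ℂ, starRingEnd ℂ w = w.re - Complex.I * w.im := fun w => by
      apply Complex.ext <;> simp
    have r : ∀ i, R i y = (y i).re := fun i => rfl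
    have r' : ∀ i, I i y = (y i).im := fun i => rfl
    rw [hconj, hconj, r, r, r', r']
    ring
  simp only [hin]
  have gen : ∀ {a b c d : Plane → ℂ}, Integrable a (volume.restrict Ω) →
      Integrable b (volume.restrict Ω) → Integrable c (volume.restrict Ω) →
      Integrable d (volume.restrict Ω) →
      ∫ x in Ω, (a x - Complex.I * b x + (c x - Complex.I * d x)) =
        (∫ x in Ω, a x) - Complex.I * (∫ x in Ω, b x) +
          ((∫ x in Ω, c x) - Complex.I * ∫ x in Ω, d x) := by
    intro a b c d ha hb hc hd
    rw [← integral_const_mul, ← integral_const_mul, ← integral_sub ha (hb.const_mul _),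
      ← integral_sub hc (hd.const_mul _)]
    exact integral_add (ha.sub (hb.const_mul _)) (hc.sub (hd.const_mul _))
  refine (gen (key (R 0) 0).1 (key (I 0) 0).1 (key (R 1) 1).1 (key (I 1) 1).1).trans
    (Eq.trans ?_ (congrArg Neg.neg (gen (key (R 0) 0).2.1 (key (I 0) 0).2.1 (key (R 1) 1).2.1
      (key (I 1) 1).2.1)).symm)
  rw [(key (R 0) 0).2.2, (key (I 0) 0).2.2, (key (R 1) 1).2.2, (key (I 1) 1).2.2]
  ring

theorem IsWeakDeriv.congr_ae {Ω : Set Plane} {j : Fin 2} {u v u' v' : Plane → Spinor}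
    (h : IsWeakDeriv Ω j u v) (hu : u =ᵐ[volume.restrict Ω] u')
    (hv : v =ᵐ[volume.restrict Ω] v') : IsWeakDeriv Ω j u' v' := by
  intro φ hφ hc hs
  have e1 : ∫ x in Ω, (fderiv ℝ φ x (EuclideanSpace.single j 1)) • u' x =
      ∫ x in Ω, (fderiv ℝ φ x (EuclideanSpace.single j 1)) • u x :=
    integral_congr_ae (hu.mono fun x hx => by simp only [hx])
  have e2 : ∫ x in Ω, φ x • v' x = ∫ x in Ω, φ x • v x :=
    integral_congr_ae (hv.mono fun x hx => by simp only [hx])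
  rw [e1, e2]
  exact h φ hφ hc hs

/-- A classical derivative is a weak derivative. -/
theorem isWeakDeriv_of_contDiffAt {Ω : Set Plane} {W : Plane → Spinor}
    (hW : ∀ x ∈ Ω, ContDiffAt ℝ 1 W x) (j : Fin 2) :
    IsWeakDeriv Ω j W fun x => fderiv ℝ W x (EuclideanSpace.single j 1) := by
  intro φ hφ hc hs
  set e : Plane := EuclideanSpace.single j 1 with he
  have hφ' : ∀ x ∉ tsupport φ, φ x = 0 := fun x hx => image_eq_zero_of_notMem_tsupport hx
  have hdφ' : ∀ x ∉ tsupport φ, fderiv ℝ φ x e = 0 := fun x hx =>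
    image_eq_zero_of_notMem_tsupport (f := fun x => fderiv ℝ φ x e)
      fun h => hx (tsupport_fderiv_apply_subset ℝ e h)
  -- products of test functions with functions continuous on `Ω`
  have hcont : ∀ (ψ : Plane → ℝ) (G : Plane → Spinor), Continuous ψ → tsupport ψ ⊆ tsupport φ →
      (∀ x ∈ Ω, ContinuousAt G x) → Integrable fun x => ψ x • G x := by
    intro ψ G hψ hψs hG
    have hts : tsupport (fun x => ψ x • G x) ⊆ tsupport φ :=
      (tsupport_smul_subset_left ψ G).trans hψs
    refine Continuous.integrable_of_hasCompactSupport ?_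
      (hc.isCompact.of_isClosed_subset (isClosed_tsupport _) hts)
    rw [continuous_iff_continuousAt]
    intro x
    by_cases hx : x ∈ Ω
    · exact hψ.continuousAt.smul (hG x hx)
    · have hx' : x ∉ tsupport (fun x => ψ x • G x) := fun h => hx (hs (hts h))
      have := notMem_tsupport_iff_eventuallyEq.1 hx'
      exact this.continuousAt
  have hdW : ∀ x ∈ Ω, ContinuousAt (fun x => fderiv ℝ W x e) x := fun x hx =>
    ((hW x hx).fderiv_right (m := 0) (by norm_num)).continuousAt.clm_apply continuousAt_const
  have hWc : ∀ x ∈ Ω, ContinuousAt W x := fun x hx => (hW x hx).continuousAt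
  have hdφ : Continuous fun x => fderiv ℝ φ x e :=
    (hφ.continuous_fderiv (by simp)).clm_apply continuous_const
  have hdφs : tsupport (fun x => fderiv ℝ φ x e) ⊆ tsupport φ := tsupport_fderiv_apply_subset ℝ e
  have hIBP := integral_bilinear_hasLineDerivAt_right_eq_neg_left_of_integrable (μ := volume)
    (f := φ) (f' := fun x => fderiv ℝ φ x e) (g := W) (g' := fun x => fderiv ℝ W x e) (v := e)
    (B := ContinuousLinearMap.lsmul ℝ ℝ) (hcont _ _ hdφ hdφs hWc)
    (hcont _ _ hφ.continuous subset_rfl hdW) (hcont _ _ hφ.continuous subset_rfl hWc)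
    (fun x _ => (hφ.differentiable (by simp) x).hasFDerivAt.hasLineDerivAt e)
    (fun x hx => ((hW x (hs hx)).differentiableAt (by norm_num)).hasFDerivAt.hasLineDerivAt e)
  simp only [ContinuousLinearMap.lsmul_apply] at hIBP
  rw [setIntegral_eq_integral_of_forall_compl_eq_zero, setIntegral_eq_integral_of_forall_compl_eq_zero,
    hIBP, neg_neg]
  · intro x hx; rw [hφ' x fun h => hx (hs h), zero_smul]
  · intro x hx; rw [hdφ' x fun h => hx (hs h), zero_smul]


/-! ### Gradient and Dirac expression in the moving frame. -/

theorem abs_le_one_of_sq_add_sq {a b : ℝ} (h : a ^ 2 + b ^ 2 = 1) : |a| ≤ 1 :=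
  (sq_le_one_iff_abs_le_one a).1 (by nlinarith [sq_nonneg b])

/-- The covariant derivative along the strip of a spinor field in the moving frame. -/
def covS (κ : ℝ) (y ys : Spinor) : Spinor := ys + (Complex.I * κ / 2 * (y 0 - y 1)) • sp 1 (-1)

/-- The Cartesian partial derivatives of a spinor field in the moving frame. -/
def gradFrame (γ : ℝ → Plane) (ε : ℝ) (j : Fin 2) (x : ℝ × ℝ → Spinor) (p : ℝ × ℝ) : Spinor :=
  ((deriv γ p.1 j / jac γ ε p : ℝ) : ℂ) • covS (curvature γ p.1) (x p) (dS x p) +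
    ((normal γ p.1 j / ε : ℝ) : ℂ) • dT x p

theorem norm_covS_le (κ : ℝ) (y ys : Spinor) : ‖covS κ y ys‖ ≤ ‖ys‖ + 2 * |κ| * ‖y‖ := by
  refine (norm_add_le _ _).trans ?_
  have h1 : ‖sp 1 (-1)‖ ≤ 2 := (norm_sp_le _ _).trans (by norm_num)
  have h2 : ‖y 0 - y 1‖ ≤ 2 * ‖y‖ := (norm_sub_le _ _).trans
    (by linarith [norm_spinor_apply_le y 0, norm_spinor_apply_le y 1])
  rw [norm_smul, norm_mul]
  have h3 : ‖Complex.I * κ / 2‖ = |κ| / 2 := by simp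
  rw [h3]
  have : |κ| / 2 * ‖y 0 - y 1‖ * ‖sp 1 (-1)‖ ≤ |κ| / 2 * (2 * ‖y‖) * 2 := by gcongr
  linarith

theorem frame_covS {z : ℂ} (κ : ℝ) (y ys : Spinor) :
    frame z (covS κ y ys) = frame z ys + sp 0 (Complex.I * κ * z * (y 0 - y 1)) := by
  apply spinor_ext
  · simp [frame, covS]; ring
  · simp [frame, covS]; ring

/-- The Dirac expression in the moving frame. -/
theorem dirac_frame {c s : ℝ} (hcs : c ^ 2 + s ^ 2 = 1) {ε J : ℝ} (m κ : ℝ) (y ys yt : Spinor) :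
    (-Complex.I) • (pauliMap 0 (frame ⟨c, s⟩ (((c / J : ℝ) : ℂ) • covS κ y ys +
        ((-s / ε : ℝ) : ℂ) • yt)) +
      pauliMap 1 (frame ⟨c, s⟩ (((s / J : ℝ) : ℂ) • covS κ y ys + ((c / ε : ℝ) : ℂ) • yt))) +
      (m : ℂ) • pauliMap 2 (frame ⟨c, s⟩ y) =
    frame ⟨c, s⟩ (symbol ε⁻¹ m J⁻¹ (κ / (2 * J)) y ys yt) := by
  have h : ((c : ℂ) ^ 2 + (s : ℂ) ^ 2) = 1 := by exact_mod_cast hcs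
  have hz : (⟨c, s⟩ : ℂ) = c + s * Complex.I := Complex.mk_eq_add_mul_I _ _
  rw [hz, pauliMap_zero, pauliMap_one, pauliMap_two]
  have hI := Complex.I_sq
  apply spinor_ext
  · simp only [frame, symbol, covS, sp_zero, sp_one, PiLp.add_apply, PiLp.smul_apply, smul_eq_mul]
    push_cast
    linear_combination (Complex.I * (c + s * Complex.I) * s * (ε : ℂ)⁻¹ * (yt 0 - yt 1) +
      Complex.I * s ^ 2 * ((J : ℂ)⁻¹ * (ys 0 - ys 1 + Complex.I * κ * (y 0 - y 1)) -
        Complex.I * (ε : ℂ)⁻¹ * (yt 0 - yt 1)) - (J : ℂ)⁻¹ * κ * (y 0 - y 1) +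
        (ε : ℂ)⁻¹ * (yt 0 - yt 1)) * hI -
      Complex.I * ((J : ℂ)⁻¹ * (ys 0 - ys 1 + Complex.I * κ * (y 0 - y 1)) -
        Complex.I * (ε : ℂ)⁻¹ * (yt 0 - yt 1)) * h
  · simp only [frame, symbol, covS, sp_zero, sp_one, PiLp.add_apply, PiLp.smul_apply, smul_eq_mul]
    push_cast
    linear_combination (-(c + s * Complex.I) * (ε : ℂ)⁻¹ * (yt 0 + yt 1) +
      Complex.I * s * (ε : ℂ)⁻¹ * (yt 0 + yt 1)) * hI

theorem contDiff_frame {γ : ℝ → Plane} {ε : ℝ} (hW : IsWaveguide γ ε) {x : ℝ × ℝ → Spinor}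
    {n : WithTop ℕ∞} (hn : n ≤ 2) (hx : ContDiff ℝ n x) :
    ContDiff ℝ n fun p : ℝ × ℝ => frame (tang γ p.1) (x p) :=
  ((hx.coord 0).add (hx.coord 1)).sp
    (((hW.contDiff_tang.of_le hn).comp contDiff_fst).mul ((hx.coord 0).sub (hx.coord 1)))

namespace IsWaveguide

variable {γ : ℝ → Plane} {ε : ℝ} (hW : IsWaveguide γ ε)
include hW

theorem contDiffAt_pushField {x : ℝ × ℝ → Spinor} (hx : ContDiff ℝ 2 x) {y : Plane}
    (hy : y ∈ tube γ ε) : ContDiffAt ℝ 2 (pushField γ ε x) y := by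
  obtain ⟨p, hp, rfl⟩ := hy
  exact ((contDiff_frame hW le_rfl hx).contDiffAt).comp _ (hW.contDiffAt_tubeInv hp)

/-- The Cartesian derivatives of a field given in the moving frame. -/
theorem fderiv_pushField {x : ℝ × ℝ → Spinor} (hx : ContDiff ℝ 2 x) {p : ℝ × ℝ} (hp : p ∈ strip)
    (j : Fin 2) :
    fderiv ℝ (pushField γ ε x) (tubeMap γ ε p) (EuclideanSpace.single j 1) =
      frame (tang γ p.1) (gradFrame γ ε j x p) := by
  set F : ℝ × ℝ → Spinor := fun q => frame (tang γ q.1) (x q) with hF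
  have hFd : Differentiable ℝ F := (contDiff_frame hW le_rfl hx).differentiable (by norm_num)
  have hxd := hx.differentiable (by norm_num)
  set D := fderiv ℝ (pushField γ ε x) (tubeMap γ ε p) with hD
  have hWd : HasFDerivAt (pushField γ ε x) D (tubeMap γ ε p) :=
    ((hW.contDiffAt_pushField hx (mem_image_of_mem _ hp)).differentiableAt (by norm_num)).hasFDerivAt
  have hcomp := hWd.comp p (hW.hasFDerivAt_tubeMap p)
  have hev : pushField γ ε x ∘ tubeMap γ ε =ᶠ[𝓝 p] F := by
    filter_upwards [isOpen_strip.mem_nhds hp] with q hq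
    simp only [Function.comp, pushField, hW.tubeInv_tubeMap hq, hF]
  have h1 : fderiv ℝ F p = D.comp (tubeDeriv γ ε p) :=
    (hcomp.congr_of_eventuallyEq hev.symm).fderiv
  have hJ := (hW.jac_pos hp).ne'
  have hε := hW.pos.ne'
  have hu := hW.sq_add_sq p.1
  -- The coordinate vector is decomposed along tangent and normal, which exhibits its preimage under
  -- the derivative of the tube map. Evaluating the chain rule `h1` there gives the Cartesian
  -- derivative.
  have he : (EuclideanSpace.single j 1 : Plane) =
      tubeDeriv γ ε p (deriv γ p.1 j / jac γ ε p, normal γ p.1 j / ε) := by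
    ext i
    fin_cases j <;> fin_cases i <;> simp [tubeDeriv, normal] <;> field_simp <;>
      first | linear_combination -hu | ring
  have hS : dS F p = frame (tang γ p.1) (covS (curvature γ p.1) (x p) (dS x p)) := by
    refine (hasDerivAt_fst hFd p.1 p.2).unique ?_
    have h2 := hasDerivAt_fst hxd p.1 p.2
    have h3 := ((h2.coord 0).add (h2.coord 1)).sp
      ((hW.hasDerivAt_tang p.1).mul ((h2.coord 0).sub (h2.coord 1)))
    rw [frame_covS]
    convert! h3 using 1
    apply spinor_ext
    · simp [frame]
    · simp [frame]; ring
  have hT : dT F p = frame (tang γ p.1) (dT x p) := by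
    refine (hasDerivAt_snd hFd p.1 p.2).unique ?_
    have h2 := hasDerivAt_snd hxd p.1 p.2
    exact ((h2.coord 0).add (h2.coord 1)).sp (((h2.coord 0).sub (h2.coord 1)).const_mul (tang γ p.1))
  have h4 := fderiv_apply_eq F p (deriv γ p.1 j / jac γ ε p) (normal γ p.1 j / ε)
  rw [h1, hS, hT] at h4
  rw [he]
  refine Eq.trans h4 ?_
  rw [gradFrame, frame_add, frame_smul, frame_smul]
  simp only [Complex.coe_smul]

theorem exists_coeff_bound : ∃ B : ℝ, 1 ≤ B ∧ ∀ p ∈ strip, |(jac γ ε p)⁻¹| ≤ B ∧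
    |curvature γ p.1 / (2 * jac γ ε p)| ≤ B ∧ |curvature γ p.1| ≤ B := by
  obtain ⟨K, hK0, hK, -⟩ := hW.exists_curvature_bound
  refine ⟨2 + K, by linarith, fun p hp => ?_⟩
  have hJ := (hW.jac_bounds (abs_le_of_mem_strip hp)).1
  have hJ0 : 0 < jac γ ε p := by linarith
  have h1 : (jac γ ε p)⁻¹ ≤ 2 := by
    rw [inv_le_comm₀ hJ0 (by norm_num)]; linarith
  refine ⟨?_, ?_, (hK _).trans (by linarith)⟩
  · rw [abs_of_pos (inv_pos.2 hJ0)]; linarith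
  · rw [abs_div, abs_of_pos (by positivity : 0 < 2 * jac γ ε p), div_le_iff₀ (by positivity)]
    have := hK p.1
    nlinarith

theorem measurable_jac : Measurable (jac γ ε) := hW.continuous_jac.measurable

theorem measurable_curvature : Measurable fun p : ℝ × ℝ => curvature γ p.1 :=
  ((continuous_curvature hW.contDiff).comp continuous_fst).measurable

theorem memLp_curved (m : ℝ) (x : core) :
    MemLp (symbolLin ε⁻¹ m (fun p => (jac γ ε p)⁻¹) (fun p => curvature γ p.1 / (2 * jac γ ε p)) x) 2
      (volume.restrict strip) := by
  obtain ⟨B, hB1, hB⟩ := hW.exists_coeff_bound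
  exact memLp_symbolLin _ _ hW.measurable_jac.inv
    (hW.measurable_curvature.div (hW.measurable_jac.const_mul 2)) (fun p hp => (hB p hp).1)
    (fun p hp => (hB p hp).2.1) x

/-- The Dirac operator in the moving frame, on the core. -/
def curved (m : ℝ) : core →ₗ[ℂ] StripL2 := liftL2 _ (hW.memLp_curved m)

theorem coeFn_curved (m : ℝ) (x : core) : hW.curved m x =ᵐ[volume.restrict strip]
    fun p => symbol ε⁻¹ m (jac γ ε p)⁻¹ (curvature γ p.1 / (2 * jac γ ε p))
      ((x : ℝ × ℝ → Spinor) p) (dS x p) (dT x p) := coeFn_liftL2 _ _ x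

omit hW in
/-- `gradFrame` as a linear map on the core. -/
def _root_.Waveguide.gradLin (γ : ℝ → Plane) (ε : ℝ) (j : Fin 2) :
    core →ₗ[ℂ] (ℝ × ℝ → Spinor) where
  toFun x := gradFrame γ ε j x
  map_add' x y := by
    funext p
    have h1 : dS (x + y : core) = dS x + dS y := dSLin.map_add x y
    have h2 : dT (x + y : core) = dT x + dT y := dTLin.map_add x y
    simp only [gradFrame]
    rw [h1, h2]
    apply spinor_ext <;> simp [covS, gradFrame] <;> ring
  map_smul' a x := by
    funext p
    have h1 : dS (a • x : core) = a • dS x := dSLin.map_smul a x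
    have h2 : dT (a • x : core) = a • dT x := dTLin.map_smul a x
    simp only [gradFrame]
    rw [h1, h2]
    apply spinor_ext <;> simp [covS, gradFrame] <;> ring

theorem exists_gradFrame_bound : ∃ C : ℝ, 0 ≤ C ∧ ∀ (j : Fin 2) (x : ℝ × ℝ → Spinor), ∀ p ∈ strip,
    ‖gradFrame γ ε j x p‖ ≤ C * (‖x p‖ + ‖dS x p‖ + ‖dT x p‖) := by
  obtain ⟨B, hB1, hB⟩ := hW.exists_coeff_bound
  have hε := hW.pos
  refine ⟨B * (1 + 2 * B) + ε⁻¹, by positivity, fun j x p hp => ?_⟩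
  obtain ⟨b1, -, b3⟩ := hB p hp
  have hd : |deriv γ p.1 j| ≤ 1 := by
    have := hW.sq_add_sq p.1
    fin_cases j
    · exact abs_le_one_of_sq_add_sq this
    · exact abs_le_one_of_sq_add_sq ((add_comm _ _).trans this)
  have hn : |normal γ p.1 j| ≤ 1 := by
    have := hW.sq_add_sq p.1
    fin_cases j
    · simpa [normal] using abs_le_one_of_sq_add_sq ((add_comm _ _).trans this)
    · simpa [normal] using abs_le_one_of_sq_add_sq this
  have e1 : ‖((deriv γ p.1 j / jac γ ε p : ℝ) : ℂ)‖ ≤ B := by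
    rw [Complex.norm_real, Real.norm_eq_abs, div_eq_mul_inv, abs_mul]
    calc |deriv γ p.1 j| * |(jac γ ε p)⁻¹| ≤ 1 * B := by gcongr
      _ = B := one_mul B
  have e2 : ‖((normal γ p.1 j / ε : ℝ) : ℂ)‖ ≤ ε⁻¹ := by
    rw [Complex.norm_real, Real.norm_eq_abs, div_eq_mul_inv, abs_mul, abs_of_pos (inv_pos.2 hε)]
    exact mul_le_of_le_one_left (by positivity) hn
  refine (norm_add_le _ _).trans ?_
  rw [norm_smul, norm_smul]
  have e3 := norm_covS_le (curvature γ p.1) (x p) (dS x p)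
  have e4 : ‖covS (curvature γ p.1) (x p) (dS x p)‖ ≤ (1 + 2 * B) * (‖x p‖ + ‖dS x p‖) := by
    refine e3.trans ?_
    have : |curvature γ p.1| * ‖x p‖ ≤ B * ‖x p‖ := by gcongr
    nlinarith [norm_nonneg (x p), norm_nonneg (dS x p)]
  calc _ ≤ B * ((1 + 2 * B) * (‖x p‖ + ‖dS x p‖)) + ε⁻¹ * ‖dT x p‖ := by gcongr
    _ ≤ _ := by
      have h5 : 0 ≤ B * (1 + 2 * B) * ‖dT x p‖ := by positivity
      have h6 : 0 ≤ ε⁻¹ * (‖x p‖ + ‖dS x p‖) := by positivity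
      nlinarith

theorem memLp_gradLin (j : Fin 2) (x : core) :
    MemLp (gradLin γ ε j x) 2 (volume.restrict strip) := by
  obtain ⟨C, hC0, hC⟩ := hW.exists_gradFrame_bound
  have hX : MemLp (fun p => ‖(x : ℝ × ℝ → Spinor) p‖ + ‖dS x p‖ + ‖dT x p‖) 2
      (volume.restrict strip) :=
    (((core.decay x).memLp (core.continuous x).aestronglyMeasurable).norm.add
      ((core.decay_dS x).memLp (core.continuous_dS x).aestronglyMeasurable).norm).add
      ((core.decay_dT x).memLp (core.continuous_dT x).aestronglyMeasurable).norm
  refine hX.of_le_mul (c := C) ?_ ?_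
  · have m1 : AEStronglyMeasurable (fun p : ℝ × ℝ => ((deriv γ p.1 j / jac γ ε p : ℝ) : ℂ))
        (volume.restrict strip) := by
      have h := hW.contDiff_deriv.continuous
      have h0 : Measurable fun p : ℝ × ℝ => deriv γ p.1 j :=
        ((EuclideanSpace.proj (𝕜 := ℝ) j).continuous.comp (h.comp continuous_fst)).measurable
      exact (Complex.measurable_ofReal.comp (h0.div hW.measurable_jac)).aestronglyMeasurable
    have m2 : AEStronglyMeasurable (fun p : ℝ × ℝ => ((normal γ p.1 j / ε : ℝ) : ℂ))
        (volume.restrict strip) := by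
      have h := (contDiff_normal hW.contDiff).continuous
      have h0 : Continuous fun p : ℝ × ℝ => normal γ p.1 j :=
        (EuclideanSpace.proj (𝕜 := ℝ) j).continuous.comp (h.comp continuous_fst)
      exact (Complex.continuous_ofReal.comp (h0.div_const ε)).aestronglyMeasurable
    have m3 : AEStronglyMeasurable (fun p : ℝ × ℝ => (Complex.I * curvature γ p.1 / 2 *
        ((x : ℝ × ℝ → Spinor) p 0 - (x : ℝ × ℝ → Spinor) p 1)) • sp 1 (-1))
        (volume.restrict strip) := by
      have h1 := continuous_curvature hW.contDiff
      have h2 := core.continuous x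
      have h3 : ∀ i, Continuous fun p => (x : ℝ × ℝ → Spinor) p i := fun i =>
        (continuous_coord i).comp h2
      have h4 := h3 0
      have h5 := h3 1
      have h6 : Continuous fun p : ℝ × ℝ => (Complex.I * curvature γ p.1 / 2 *
        ((x : ℝ × ℝ → Spinor) p 0 - (x : ℝ × ℝ → Spinor) p 1)) :=
        ((continuous_const.mul (Complex.continuous_ofReal.comp (h1.comp continuous_fst))).div_const
          2).mul (h4.sub h5)
      exact (h6.smul continuous_const).aestronglyMeasurable
    exact (m1.smul ((core.continuous_dS x).aestronglyMeasurable.add m3)).add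
      (m2.smul (core.continuous_dT x).aestronglyMeasurable)
  · filter_upwards [ae_restrict_mem isOpen_strip.measurableSet] with p hp
    rw [Real.norm_of_nonneg (by positivity)]
    exact hC j x p hp

/-- `gradLin` with values in the Hilbert space. -/
def inclG (j : Fin 2) : core →ₗ[ℂ] StripL2 := liftL2 _ (hW.memLp_gradLin j)

theorem coeFn_inclG (j : Fin 2) (x : core) :
    hW.inclG j x =ᵐ[volume.restrict strip] gradFrame γ ε j x := coeFn_liftL2 _ _ x

omit hW in
theorem _root_.Waveguide.coeFn_incl (x : core) : incl x =ᵐ[volume.restrict strip] (x : ℝ × ℝ → Spinor) :=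
  coeFn_liftL2 _ _ x

theorem transfer_incl_ae (x : core) :
    hW.transfer (incl x) =ᵐ[volume.restrict (tube γ ε)] pushField γ ε x := by
  refine hW.ae_tube_iff.2 ?_
  filter_upwards [hW.corresponds_transfer (incl x), hW.corresponds_pushField x, coeFn_incl x]
    with p h1 h2 h3
  rw [h1, h2, h3]

theorem transfer_inclG_ae (j : Fin 2) (x : core) :
    hW.transfer (hW.inclG j x) =ᵐ[volume.restrict (tube γ ε)]
      fun y => fderiv ℝ (pushField γ ε x) y (EuclideanSpace.single j 1) := by
  refine hW.ae_tube_iff.2 ?_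
  filter_upwards [hW.corresponds_transfer (hW.inclG j x), hW.coeFn_inclG j x,
    ae_restrict_mem isOpen_strip.measurableSet] with p h1 h2 hp
  rw [h1, h2, hW.fderiv_pushField (core.contDiff x) hp]

theorem isWeakDeriv_core (j : Fin 2) (x : core) :
    IsWeakDeriv (tube γ ε) j (hW.transfer (incl x)) (hW.transfer (hW.inclG j x)) :=
  (isWeakDeriv_of_contDiffAt (fun y hy => (hW.contDiffAt_pushField (core.contDiff x) hy).of_le
    (by norm_num)) j).congr_ae (hW.transfer_incl_ae x).symm (hW.transfer_inclG_ae j x).symm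

omit hW in
theorem _root_.Waveguide.diracExpr_ae {Ω : Set Plane} (m : ℝ) (u : L2 Ω) (v : Fin 2 → L2 Ω) :
    diracExpr Ω m u v =ᵐ[volume.restrict Ω] fun y =>
      (-Complex.I) • (pauliMap 0 (v 0 y) + pauliMap 1 (v 1 y)) + (m : ℂ) • pauliMap 2 (u y) := by
  unfold diracExpr
  filter_upwards [Lp.coeFn_add ((-Complex.I) • ((pauliMap 0).compLpL 2 _ (v 0) +
      (pauliMap 1).compLpL 2 _ (v 1))) ((m : ℂ) • (pauliMap 2).compLpL 2 _ u),
    Lp.coeFn_smul (-Complex.I) ((pauliMap 0).compLpL 2 _ (v 0) + (pauliMap 1).compLpL 2 _ (v 1)),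
    Lp.coeFn_smul (m : ℂ) ((pauliMap 2).compLpL 2 _ u),
    Lp.coeFn_add ((pauliMap 0).compLpL 2 _ (v 0)) ((pauliMap 1).compLpL 2 _ (v 1)),
    (pauliMap 0).coeFn_compLpL (v 0), (pauliMap 1).coeFn_compLpL (v 1),
    (pauliMap 2).coeFn_compLpL u] with y h1 h2 h3 h4 h5 h6 h7
  rw [h1, Pi.add_apply, h2, h3, Pi.smul_apply, Pi.smul_apply, h4, Pi.add_apply, h5, h6, h7]

theorem diracExpr_core (m : ℝ) (x : core) :
    diracExpr (tube γ ε) m (hW.transfer (incl x)) (fun j => hW.transfer (hW.inclG j x)) =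
      hW.transfer (hW.curved m x) := by
  refine Lp.ext (hW.ae_tube_iff.2 ?_)
  filter_upwards [hW.ae_tube_iff.1 (diracExpr_ae m (hW.transfer (incl x))
      (fun j => hW.transfer (hW.inclG j x))), hW.corresponds_transfer (hW.inclG 0 x),
    hW.corresponds_transfer (hW.inclG 1 x), hW.coeFn_inclG 0 x, hW.coeFn_inclG 1 x,
    hW.corresponds_transfer (incl x), coeFn_incl x, hW.corresponds_transfer (hW.curved m x),
    hW.coeFn_curved m x] with p h1 h2 h3 h4 h5 h6 h7 h8 h9
  rw [h1, h2, h3, h4, h5, h6, h7, h8, h9]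
  exact dirac_frame (hW.sq_add_sq p.1) m (curvature γ p.1) _ _ _

end IsWaveguide


/-- The fundamental theorem of calculus and the Cauchy-Schwarz inequality. -/
theorem norm_sub_sq_le_integral {E : Type*} [NormedAddCommGroup E] [NormedSpace ℝ E]
    [CompleteSpace E] {f f' : ℝ → E} (hf : ∀ t, HasDerivAt f (f' t) t) (hc : Continuous f')
    {a b c d : ℝ} (ha : a ∈ Icc c d) (hb : b ∈ Icc c d) :
    ‖f b - f a‖ ^ 2 ≤ |b - a| * ∫ t in c..d, ‖f' t‖ ^ 2 := by
  wlog hab : a ≤ b generalizing a b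
  · rw [norm_sub_rev, abs_sub_comm]
    exact this hb ha (le_of_not_ge hab)
  have hQ : ∫ t in a..b, ‖f' t‖ ^ 2 ≤ ∫ t in c..d, ‖f' t‖ ^ 2 :=
    intervalIntegral.integral_mono_interval ha.1 hab hb.2
      (Eventually.of_forall fun t => by positivity)
      ((by fun_prop : Continuous fun t => ‖f' t‖ ^ 2).intervalIntegrable _ _)
  rw [abs_of_nonneg (sub_nonneg.2 hab)]
  refine le_trans ?_ (mul_le_mul_of_nonneg_left hQ (sub_nonneg.2 hab))
  rcases hab.eq_or_lt with rfl | hlt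
  · simp
  set I := ∫ t in a..b, ‖f' t‖ with hI
  set Q := ∫ t in a..b, ‖f' t‖ ^ 2
  have h1 : ‖f b - f a‖ ≤ I := by
    rw [← intervalIntegral.integral_eq_sub_of_hasDerivAt (fun t _ => hf t)
      (hc.intervalIntegrable _ _)]
    exact intervalIntegral.norm_integral_le_integral_norm hab
  have i1 : IntervalIntegrable (fun t => ‖f' t‖) volume a b := hc.norm.intervalIntegrable _ _
  have i2 : IntervalIntegrable (fun t => ‖f' t‖ ^ 2) volume a b :=
    (hc.norm.pow 2).intervalIntegrable _ _
  -- Cauchy-Schwarz through the variance: the integral of the squared deviation of `‖f'‖` from its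
  -- mean is nonnegative.
  have h2 : 0 ≤ ∫ t in a..b, (‖f' t‖ - I / (b - a)) ^ 2 :=
    intervalIntegral.integral_nonneg hab fun t _ => by positivity
  have h3 : ∫ t in a..b, (‖f' t‖ - I / (b - a)) ^ 2 = Q - I ^ 2 / (b - a) := by
    have e : ∀ t, (‖f' t‖ - I / (b - a)) ^ 2 =
        ‖f' t‖ ^ 2 - 2 * (I / (b - a)) * ‖f' t‖ + (I / (b - a)) ^ 2 := fun t => by ring
    simp only [e]
    rw [intervalIntegral.integral_add (i2.sub (i1.const_mul _)) (by simp),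
      intervalIntegral.integral_sub i2 (i1.const_mul _), intervalIntegral.integral_const_mul,
      intervalIntegral.integral_const, ← hI]
    have : b - a ≠ 0 := (sub_pos.2 hlt).ne'
    simp only [smul_eq_mul]
    field_simp
    ring
  rw [h3, sub_nonneg, div_le_iff₀ (sub_pos.2 hlt)] at h2
  have := pow_le_pow_left₀ (norm_nonneg _) h1 2
  linarith

/-! ### Boundary conditions in the frame and traces of the core. -/

theorem frame_injective {z : ℂ} (hz : ‖z‖ = 1) {x y : Spinor} (h : frame z x = frame z y) :
    x = y := by
  have h1 := norm_sq_frame hz (x - y)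
  rw [frame_sub, h, sub_self, norm_zero] at h1
  rw [← sub_eq_zero, ← norm_eq_zero]
  have h2 : ‖x - y‖ ^ 2 = 0 := by linarith
  simpa using h2

theorem sigmaDot_apply (v : Plane) (y : Spinor) :
    sigmaDot v y = sp ((v 0 - Complex.I * v 1) * y 1) ((v 0 + Complex.I * v 1) * y 0) := by
  simp only [sigmaDot, add_apply, smul_apply, pauliMap_zero, pauliMap_one, sp_smul, sp_add]
  congr 1 <;> ring

/-- This is what `frame` is made for: the boundary matrix on the side `τ` becomes `diag(-τ, τ)`.
Being fixed by it means that component `0` vanishes for `τ = 1` and component `1` for `τ = -1`. -/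
theorem boundaryMap_frame {γ : ℝ → Plane} {ε : ℝ} (hW : IsWaveguide γ ε) (τ s : ℝ) (y : Spinor) :
    (-Complex.I) • pauliMap 2 (sigmaDot (τ • normal γ s) (frame (tang γ s) y)) =
      frame (tang γ s) (sp (-τ * y 0) (τ * y 1)) := by
  have hu : ((deriv γ s 0 : ℂ)) ^ 2 + (deriv γ s 1 : ℂ) ^ 2 = 1 := by
    have h := congrArg (fun r : ℝ => (r : ℂ)) (hW.sq_add_sq s)
    push_cast at h
    exact h
  have hz : tang γ s = deriv γ s 0 + deriv γ s 1 * Complex.I := Complex.mk_eq_add_mul_I _ _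
  have hI := Complex.I_sq
  rw [sigmaDot_apply, pauliMap_two, sp_smul, hz]
  have n0 : (τ • normal γ s) 0 = -(τ * deriv γ s 1) := by simp [normal]
  have n1 : (τ • normal γ s) 1 = τ * deriv γ s 0 := by simp [normal]
  rw [n0, n1]
  apply spinor_ext
  · simp only [frame, sp_zero, sp_one]
    push_cast
    linear_combination (τ * (y 0 - y 1) * ((deriv γ s 0 : ℂ) ^ 2 + (deriv γ s 1 : ℂ) ^ 2)
      + Complex.I * τ * (y 0 - y 1) * deriv γ s 0 * deriv γ s 1) * hI - τ * (y 0 - y 1) * hu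
  · simp only [frame, sp_zero, sp_one]
    push_cast
    linear_combination (τ * (y 0 + y 1) * deriv γ s 0) * hI

/-- The trace of an element of the core. -/
def coreTrace (γ : ℝ → Plane) (τ : ℝ) (x : ℝ × ℝ → Spinor) (s : ℝ) : Spinor :=
  frame (tang γ s) (x (s, τ))

theorem coreTrace_boundary {γ : ℝ → Plane} {ε : ℝ} (hW : IsWaveguide γ ε) {τ : ℝ}
    (hτ : τ = 1 ∨ τ = -1) (x : core) (s : ℝ) :
    (-Complex.I) • pauliMap 2 (sigmaDot (τ • normal γ s) (coreTrace γ τ x s)) =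
      coreTrace γ τ x s := by
  rw [coreTrace, boundaryMap_frame hW]
  congr 1
  rcases hτ with rfl | rfl
  · exact spinor_ext (by simp [core.top x s]) (by simp)
  · exact spinor_ext (by simp) (by simp [core.bot x s])

theorem abs_eq_one_of {τ : ℝ} (hτ : τ = 1 ∨ τ = -1) : |τ| = 1 := by
  rcases hτ with rfl | rfl <;> simp

namespace IsWaveguide

variable {γ : ℝ → Plane} {ε : ℝ} (hW : IsWaveguide γ ε)
include hW

theorem continuous_coreTrace (τ : ℝ) (x : core) : Continuous (coreTrace γ τ x) := by
  have h := (contDiff_frame hW (n := 0) (by norm_num) ((core.contDiff x).of_le (by norm_num))).continuous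
  exact h.comp (by fun_prop : Continuous fun s : ℝ => (s, τ))

theorem memLp_coreTrace {τ : ℝ} (hτ : τ = 1 ∨ τ = -1) (x : core) :
    MemLp (coreTrace γ τ x) 2 volume := by
  refine (memLp_two_iff_integrable_sq_norm (hW.continuous_coreTrace τ x).aestronglyMeasurable).2 ?_
  obtain ⟨C, hC0, hC⟩ := core.decay x
  refine Integrable.mono' (integrable_inv_one_add_sq.const_mul (2 * C ^ 2))
    ((hW.continuous_coreTrace τ x).norm.pow 2).aestronglyMeasurable (Eventually.of_forall fun s => ?_)
  rw [norm_pow, norm_norm, coreTrace, norm_sq_frame (hW.norm_tang s)]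
  have h1 := pow_le_pow_left₀ (norm_nonneg _) (hC (s, τ) (abs_eq_one_of hτ).le) 2
  simp only [div_pow] at h1
  have h2 : C ^ 2 / (1 + s ^ 2) ^ 2 ≤ C ^ 2 / (1 + s ^ 2) := by
    have : (1 : ℝ) + s ^ 2 ≤ (1 + s ^ 2) ^ 2 := by nlinarith [sq_nonneg s]
    gcongr
  rw [← div_eq_mul_inv, mul_div_assoc]
  linarith

omit hW in
theorem integral_dT_slice_sq (x : core) :
    Integrable (fun s => ∫ t in (-1)..1, ‖dT x (s, t)‖ ^ 2) ∧
    ∫ s, ∫ t in (-1)..1, ‖dT x (s, t)‖ ^ 2 = ‖inclT x‖ ^ 2 := by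
  have hm := (core.decay_dT x).memLp (core.continuous_dT x).aestronglyMeasurable
  have hi := (memLp_two_iff_integrable_sq_norm hm.1).1 hm
  constructor
  · have h2 := hi
    rw [volume_restrict_strip] at h2
    refine h2.integral_prod_left.congr (Eventually.of_forall fun s => ?_)
    simp only
    rw [intervalIntegral.integral_of_le (by norm_num), integral_Ioc_eq_integral_Ioo]
  · have e : ‖inclT x‖ ^ 2 = ∫ p in strip, ‖dT x p‖ ^ 2 := norm_liftL2_sq dTLin _ x
    rw [e, integral_strip hi]

/-- On each slice `‖x(s, τt) - x(s, τ)‖² ≤ δ ∫ ‖∂_t x‖²` in the layer of width `δ`; the factor `2`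
comes from `frame`. The bound depends on `x` only through `‖inclT x‖`, so it is uniform along
sequences bounded in the graph norm. -/
theorem layerMean_core_le {τ : ℝ} (hτ : τ = 1 ∨ τ = -1) (x : core) {δ : ℝ} (hδ : 0 < δ)
    (hδ1 : δ < 1) : layerMean γ ε τ (pushField γ ε x) (coreTrace γ τ x) δ ≤
      ENNReal.ofReal (2 * δ * ‖inclT x‖ ^ 2) := by
  obtain ⟨hQi, hQ⟩ := integral_dT_slice_sq x
  set Q : ℝ → ℝ := fun s => ∫ t in (-1)..1, ‖dT x (s, t)‖ ^ 2 with hQdef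
  have hQ0 : ∀ s, 0 ≤ Q s := fun s => intervalIntegral.integral_nonneg (by norm_num)
    fun t _ => by positivity
  have h1 : ∀ p ∈ (univ ×ˢ Ioo (1 - δ) 1 : Set (ℝ × ℝ)),
      ‖pushField γ ε x (tubeMap γ ε (p.1, τ * p.2)) - coreTrace γ τ x p.1‖ₑ ^ 2 ≤
        ENNReal.ofReal (2 * δ * Q p.1) := by
    rintro ⟨s, t⟩ ⟨-, ht1, ht2⟩
    simp only at ht1 ht2
    have hτt : |τ * t| ≤ 1 := by
      rw [abs_mul, abs_eq_one_of hτ, one_mul, abs_le]; constructor <;> linarith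
    have hmem : ((s, τ * t) : ℝ × ℝ) ∈ strip := by
      refine ⟨trivial, ?_⟩
      rcases hτ with rfl | rfl <;> simp <;> constructor <;> linarith
    simp only [pushField, hW.tubeInv_tubeMap hmem, coreTrace]
    rw [← frame_sub, enorm_sq_frame (hW.norm_tang s), mul_assoc, ENNReal.ofReal_mul (by norm_num)]
    simp only [ENNReal.ofReal_ofNat]
    gcongr
    rw [← ofReal_norm, ← ENNReal.ofReal_pow (norm_nonneg _)]
    refine ENNReal.ofReal_le_ofReal ?_
    have h2 := norm_sub_sq_le_integral (f := fun t => (x : ℝ × ℝ → Spinor) (s, t))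
      (fun t => hasDerivAt_snd (core.differentiable x) s t)
      ((core.continuous_dT x).comp (by fun_prop : Continuous fun t : ℝ => (s, t)))
      (a := τ) (b := τ * t) (c := -1) (d := 1) (abs_le.1 (abs_eq_one_of hτ).le) (abs_le.1 hτt)
    refine h2.trans ?_
    have h3 : |τ * t - τ| ≤ δ := by
      rw [← mul_sub_one, abs_mul, abs_eq_one_of hτ, one_mul, abs_le]; constructor <;> linarith
    exact mul_le_mul_of_nonneg_right h3 (hQ0 s)
  have hvol : (volume.restrict (univ ×ˢ Ioo (1 - δ) 1) : Measure (ℝ × ℝ)) =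
      (volume : Measure ℝ).prod (volume.restrict (Ioo (1 - δ) 1)) := by
    rw [Measure.volume_eq_prod, ← Measure.prod_restrict, Measure.restrict_univ]
  have h2 : ∫⁻ p in (univ ×ˢ Ioo (1 - δ) 1 : Set (ℝ × ℝ)),
      ‖pushField γ ε x (tubeMap γ ε (p.1, τ * p.2)) - coreTrace γ τ x p.1‖ₑ ^ 2 ≤
        ENNReal.ofReal δ * ENNReal.ofReal (2 * δ * ‖inclT x‖ ^ 2) := by
    refine (setLIntegral_mono' (measurableSet_prod.2 (Or.inl ⟨MeasurableSet.univ, measurableSet_Ioo⟩))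
      h1).trans ?_
    rw [hvol, lintegral_prod]
    · simp only [lintegral_const, Measure.restrict_apply_univ, Real.volume_Ioo]
      rw [lintegral_mul_const' _ _ (by simp), ← ofReal_integral_eq_lintegral_ofReal
        (hQi.const_mul _) (Eventually.of_forall fun s => by have := hQ0 s; positivity), integral_const_mul, hQ]
      rw [mul_comm]
      simp
    · exact (hQi.1.aemeasurable.const_mul (2 * δ)).ennreal_ofReal.comp_fst
  rw [layerMean]
  calc _ ≤ (ENNReal.ofReal δ)⁻¹ * (ENNReal.ofReal δ * ENNReal.ofReal (2 * δ * ‖inclT x‖ ^ 2)) := by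
        gcongr
    _ = _ := by
      rw [← mul_assoc, ENNReal.inv_mul_cancel (by simpa using hδ) (by simp), one_mul]

theorem stronglyMeasurable_pushField (x : core) : StronglyMeasurable (pushField γ ε x) := by
  have h := (contDiff_frame hW (n := 0) (by norm_num) ((core.contDiff x).of_le (by norm_num))).continuous
  exact (h.measurable.comp hW.measurable_tubeInv).stronglyMeasurable

theorem isTrace_core {τ : ℝ} (hτ : τ = 1 ∨ τ = -1) (x : core) :
    IsTrace γ ε τ (hW.transfer (incl x)) (coreTrace γ τ x) := by
  refine ⟨hW.memLp_coreTrace hτ x, pushField γ ε x, hW.stronglyMeasurable_pushField x,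
    hW.transfer_incl_ae x, ?_⟩
  have hlim : Tendsto (fun δ : ℝ => ENNReal.ofReal (2 * δ * ‖inclT x‖ ^ 2)) (𝓝[>] 0) (𝓝 0) := by
    have : Tendsto (fun δ : ℝ => ENNReal.ofReal (2 * δ * ‖inclT x‖ ^ 2)) (𝓝 0)
        (𝓝 (ENNReal.ofReal (2 * 0 * ‖inclT x‖ ^ 2))) :=
      (ENNReal.continuous_ofReal.comp (by fun_prop)).tendsto _
    simp only [mul_zero, zero_mul, ENNReal.ofReal_zero] at this
    exact this.mono_left nhdsWithin_le_nhds
  refine tendsto_of_tendsto_of_tendsto_of_le_of_le' tendsto_const_nhds hlim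
    (Eventually.of_forall fun _ => zero_le) ?_
  filter_upwards [Ioo_mem_nhdsGT (zero_lt_one (α := ℝ))] with δ hδ
  exact hW.layerMean_core_le hτ x hδ.1 hδ.2

theorem infiniteMass_core {τ : ℝ} (hτ : τ = 1 ∨ τ = -1) (x : core) :
    InfiniteMass γ ε τ (hW.transfer (incl x)) :=
  ⟨_, hW.isTrace_core hτ x, Eventually.of_forall fun s => coreTrace_boundary hW hτ x s⟩

/-- The core is contained in the graph of the Dirac operator. -/
theorem core_mem_diracGraph (m : ℝ) (x : core) :
    (hW.transfer (incl x), hW.transfer (hW.curved m x)) ∈ diracGraph hW m :=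
  ⟨fun j => hW.transfer (hW.inclG j x), fun j => hW.isWeakDeriv_core j x,
    hW.infiniteMass_core (Or.inl rfl) x, hW.infiniteMass_core (Or.inr rfl) x,
    (hW.diracExpr_core m x).symm⟩

end IsWaveguide

end Waveguide
end

/-! ### Green's formula for core fields with compact support in the strip. -/

noncomputable section

open scoped InnerProductSpace

namespace Waveguide

theorem inner_pauliMap (k : Fin 3) (y z : Spinor) :
    inner ℂ (pauliMap k y) z = inner ℂ y (pauliMap k z) := by
  fin_cases k
  · change inner ℂ (pauliMap 0 y) z = inner ℂ y (pauliMap 0 z)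
    rw [pauliMap_zero, pauliMap_zero, inner_spinor, inner_spinor]
    simp; ring
  · change inner ℂ (pauliMap 1 y) z = inner ℂ y (pauliMap 1 z)
    rw [pauliMap_one, pauliMap_one, inner_spinor, inner_spinor]
    simp; ring
  · change inner ℂ (pauliMap 2 y) z = inner ℂ y (pauliMap 2 z)
    rw [pauliMap_two, pauliMap_two, inner_spinor, inner_spinor]
    simp

theorem inner_compLpL_pauliMap {Ω : Set Plane} (k : Fin 3) (a b : L2 Ω) :
    ⟪(pauliMap k).compLpL 2 _ a, b⟫_ℂ = ⟪a, (pauliMap k).compLpL 2 _ b⟫_ℂ := by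
  rw [L2.inner_def, L2.inner_def]
  refine integral_congr_ae ?_
  filter_upwards [(pauliMap k).coeFn_compLpL a, (pauliMap k).coeFn_compLpL b] with y h1 h2
  rw [h1, h2, inner_pauliMap]

namespace IsWaveguide

variable {γ : ℝ → Plane} {ε : ℝ} (hW : IsWaveguide γ ε)
include hW

/-- The extension by zero of a field with compact support in the tube is continuously
differentiable. -/
theorem contDiff_indicator_pushField {x : ℝ × ℝ → Spinor} (hx : ContDiff ℝ 2 x)
    (hc : HasCompactSupport x) (hs : tsupport x ⊆ strip) :
    ContDiff ℝ 1 ((tube γ ε).indicator (pushField γ ε x)) ∧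
    HasCompactSupport ((tube γ ε).indicator (pushField γ ε x)) ∧
    tsupport ((tube γ ε).indicator (pushField γ ε x)) ⊆ tube γ ε := by
  set W := (tube γ ε).indicator (pushField γ ε x) with hWdef
  set K := tubeMap γ ε '' tsupport x with hK
  have hKc : IsCompact K := hc.isCompact.image (contDiff_tubeMap hW.contDiff ε).continuous
  have hKt : K ⊆ tube γ ε := image_mono hs
  have hsupp : tsupport W ⊆ K := by
    refine closure_minimal (fun y hy => ?_) hKc.isClosed
    have hyt : y ∈ tube γ ε := by
      by_contra h
      exact hy (indicator_of_notMem h _)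
    refine ⟨tubeInv γ ε y, subset_tsupport _ fun h0 => hy ?_, tubeMap_tubeInv hyt⟩
    rw [hWdef, indicator_of_mem hyt, pushField, h0]
    exact spinor_ext (by simp [frame]) (by simp [frame])
  refine ⟨?_, hKc.of_isClosed_subset (isClosed_tsupport _) hsupp, hsupp.trans hKt⟩
  rw [contDiff_iff_contDiffAt]
  intro y
  by_cases hy : y ∈ tube γ ε
  · have hev : W =ᶠ[𝓝 y] pushField γ ε x := by
      filter_upwards [hW.isOpen_tube.mem_nhds hy] with y' hy'
      rw [hWdef, indicator_of_mem hy']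
    exact ((hW.contDiffAt_pushField hx hy).of_le (by norm_num)).congr_of_eventuallyEq hev
  · have hev : W =ᶠ[𝓝 y] fun _ => 0 :=
      notMem_tsupport_iff_eventuallyEq.1 fun h => hy (hKt (hsupp h))
    exact contDiffAt_const.congr_of_eventuallyEq hev

/-- Extended by zero, the pushed field is a `C¹` test field of compact support in the tube. The weak
derivative of `u` may therefore be tested against its image under a Pauli matrix. -/
theorem inner_pauliMap_inclG {u v : L2 (tube γ ε)} {j : Fin 2} (h : IsWeakDeriv (tube γ ε) j u v)
    {x : core} (hc : HasCompactSupport (x : ℝ × ℝ → Spinor))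
    (hs : tsupport (x : ℝ × ℝ → Spinor) ⊆ strip) (k : Fin 3) :
    ⟪(pauliMap k).compLpL 2 _ (hW.transfer (hW.inclG j x)), u⟫_ℂ =
      -⟪(pauliMap k).compLpL 2 _ (hW.transfer (incl x)), v⟫_ℂ := by
  obtain ⟨h1, h2, h3⟩ := hW.contDiff_indicator_pushField (core.contDiff x) hc hs
  set W := (tube γ ε).indicator (pushField γ ε x) with hWdef
  let P : Spinor →L[ℝ] Spinor := (pauliMap k).restrictScalars ℝ
  have e := h.integral_inner hW.isOpen_tube (W := fun y => P (W y)) (P.contDiff.comp h1)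
    (h2.comp_left (map_zero P))
    ((closure_mono (Function.support_comp_subset (map_zero P) W)).trans h3)
  rw [L2.inner_def, L2.inner_def]
  have e1 : ∫ y in tube γ ε, inner ℂ (fderiv ℝ (fun y => P (W y)) y (EuclideanSpace.single j 1)) (u y)
      = ∫ y in tube γ ε, ⟪(pauliMap k).compLpL 2 _ (hW.transfer (hW.inclG j x)) y, u y⟫_ℂ := by
    refine integral_congr_ae ?_
    filter_upwards [(pauliMap k).coeFn_compLpL (hW.transfer (hW.inclG j x)),
      hW.transfer_inclG_ae j x, ae_restrict_mem hW.isOpen_tube.measurableSet] with y a1 a2 hy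
    have hev : W =ᶠ[𝓝 y] pushField γ ε x := by
      filter_upwards [hW.isOpen_tube.mem_nhds hy] with y' hy'
      rw [hWdef, indicator_of_mem hy']
    have a3 := (P.hasFDerivAt.comp y (h1.differentiable (by norm_num) y).hasFDerivAt).fderiv
    rw [a1, a2]
    change inner ℂ (fderiv ℝ (⇑P ∘ W) y _) _ = _
    rw [a3, ← hev.fderiv_eq]
    rfl
  have e2 : ∫ y in tube γ ε, inner ℂ (P (W y)) (v y) =
      ∫ y in tube γ ε, ⟪(pauliMap k).compLpL 2 _ (hW.transfer (incl x)) y, v y⟫_ℂ := by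
    refine integral_congr_ae ?_
    filter_upwards [(pauliMap k).coeFn_compLpL (hW.transfer (incl x)), hW.transfer_incl_ae x,
      ae_restrict_mem hW.isOpen_tube.measurableSet] with y a1 a2 hy
    rw [a1, a2, hWdef, indicator_of_mem hy]
    rfl
  rw [← e1, ← e2, e]

/-- Green's formula for fields with compact support. -/
theorem green_of_hasCompactSupport {m : ℝ} {u : L2 (tube γ ε)} {v : Fin 2 → L2 (tube γ ε)}
    (h : ∀ j, IsWeakDeriv (tube γ ε) j u (v j)) {x : core}
    (hc : HasCompactSupport (x : ℝ × ℝ → Spinor)) (hs : tsupport (x : ℝ × ℝ → Spinor) ⊆ strip) :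
    ⟪hW.transfer (hW.curved m x), u⟫_ℂ =
      ⟪hW.transfer (incl x), diracExpr (tube γ ε) m u v⟫_ℂ := by
  rw [← hW.diracExpr_core, diracExpr, diracExpr]
  simp only [inner_add_left, inner_add_right, inner_smul_left, inner_smul_right]
  rw [hW.inner_pauliMap_inclG (h 0) hc hs, hW.inner_pauliMap_inclG (h 1) hc hs]
  simp only [inner_compLpL_pauliMap]
  simp only [map_neg, Complex.conj_I, Complex.conj_ofReal]
  ring

end IsWaveguide

end Waveguide
end

/-! ### Cutoff functions on the strip. -/

noncomputable section

open scoped InnerProductSpace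

namespace Waveguide

/-- A smooth step function: `0` on `(-∞, 1/2]` and `1` on `[1, ∞)`. -/
def step (y : ℝ) : ℝ := Real.smoothTransition (2 * y - 1)

theorem contDiff_step {n : ℕ∞} : ContDiff ℝ n step :=
  Real.smoothTransition.contDiff.comp (by fun_prop)

theorem step_of_le {y : ℝ} (h : y ≤ 1 / 2) : step y = 0 :=
  Real.smoothTransition.zero_of_nonpos (by linarith)

theorem step_of_ge {y : ℝ} (h : 1 ≤ y) : step y = 1 :=
  Real.smoothTransition.one_of_one_le (by linarith)

theorem step_nonneg (y : ℝ) : 0 ≤ step y := Real.smoothTransition.nonneg _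

theorem step_le_one (y : ℝ) : step y ≤ 1 := Real.smoothTransition.le_one _

theorem hasDerivAt_step (y : ℝ) : HasDerivAt step (deriv step y) y :=
  ((contDiff_step (n := 1)).differentiable (by norm_num) y).hasDerivAt

theorem deriv_step_of_lt {y : ℝ} (h : y < 1 / 2) : deriv step y = 0 := by
  have : step =ᶠ[𝓝 y] fun _ => 0 := by
    filter_upwards [Iio_mem_nhds h] with z hz
    exact step_of_le (le_of_lt hz)
  rw [this.deriv_eq, deriv_const]

theorem deriv_step_of_gt {y : ℝ} (h : 1 < y) : deriv step y = 0 := by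
  have : step =ᶠ[𝓝 y] fun _ => 1 := by
    filter_upwards [Ioi_mem_nhds h] with z hz
    exact step_of_ge (le_of_lt hz)
  rw [this.deriv_eq, deriv_const]

theorem exists_deriv_step_bound : ∃ M, 0 ≤ M ∧ ∀ y, |deriv step y| ≤ M := by
  have hc : Continuous (deriv step) := (contDiff_step (n := 1)).continuous_deriv (by norm_num)
  obtain ⟨M, hM⟩ := (isCompact_Icc (a := (1 / 2 : ℝ)) (b := 1)).exists_bound_of_continuousOn
    hc.continuousOn
  have hM0 : 0 ≤ M := (norm_nonneg _).trans (hM 1 (by norm_num))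
  refine ⟨M, hM0, fun y => ?_⟩
  by_cases h1 : y < 1 / 2
  · simpa [deriv_step_of_lt h1] using hM0
  · by_cases h2 : 1 < y
    · simpa [deriv_step_of_gt h2] using hM0
    · exact hM y ⟨not_lt.1 h1, not_lt.1 h2⟩

/-- Smooth cutoff functions on the strip. -/
def cutoff (N : ℝ) (p : ℝ × ℝ) : ℝ := step (2 - p.1 ^ 2 / N ^ 2) * step (N * (1 - p.2 ^ 2))

theorem contDiff_cutoff (N : ℝ) {n : ℕ∞} : ContDiff ℝ n (cutoff N) := by
  have h1 : ContDiff ℝ n fun p : ℝ × ℝ => 2 - p.1 ^ 2 / N ^ 2 := by fun_prop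
  have h2 : ContDiff ℝ n fun p : ℝ × ℝ => N * (1 - p.2 ^ 2) := by fun_prop
  exact (contDiff_step.comp h1).mul (contDiff_step.comp h2)

theorem cutoff_nonneg (N : ℝ) (p : ℝ × ℝ) : 0 ≤ cutoff N p := mul_nonneg (step_nonneg _) (step_nonneg _)

theorem cutoff_le_one (N : ℝ) (p : ℝ × ℝ) : cutoff N p ≤ 1 :=
  mul_le_one₀ (step_le_one _) (step_nonneg _) (step_le_one _)

theorem exists_tsupport_cutoff {N : ℝ} (hN : 0 < N) :
    ∃ K, IsCompact K ∧ K ⊆ strip ∧ tsupport (cutoff N) ⊆ K := by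
  have hlt : √(1 - 1 / (2 * N)) < 1 := by
    rw [Real.sqrt_lt' one_pos]
    have : 0 < 1 / (2 * N) := by positivity
    linarith
  refine ⟨Icc (-(2 * N)) (2 * N) ×ˢ Icc (-√(1 - 1 / (2 * N))) (√(1 - 1 / (2 * N))),
    isCompact_Icc.prod isCompact_Icc, ?_, ?_⟩
  · rintro p ⟨-, h2⟩
    exact ⟨trivial, by linarith [h2.1], by linarith [h2.2]⟩
  · refine closure_minimal (fun p hp => ?_) (isClosed_Icc.prod isClosed_Icc)
    have h1 : 1 / 2 < 2 - p.1 ^ 2 / N ^ 2 := by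
      by_contra! h
      exact hp (by simp [cutoff, step_of_le h])
    have h2 : 1 / 2 < N * (1 - p.2 ^ 2) := by
      by_contra! h
      exact hp (by simp [cutoff, step_of_le h])
    have h3 : p.1 ^ 2 ≤ (2 * N) ^ 2 := by
      have : p.1 ^ 2 / N ^ 2 < 2 := by linarith
      rw [div_lt_iff₀ (by positivity)] at this
      nlinarith
    have h4 : p.2 ^ 2 ≤ 1 - 1 / (2 * N) := by
      have : 1 / (2 * N) = (1 / 2) / N := by field_simp
      rw [this, le_sub_comm, div_le_iff₀ hN]
      linarith
    exact ⟨abs_le.1 (abs_le_of_sq_le_sq h3 (by positivity)), abs_le.1 (Real.abs_le_sqrt h4)⟩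

theorem hasDerivAt_cutoff_fst (N s t : ℝ) : HasDerivAt (fun s => cutoff N (s, t))
    (deriv step (2 - s ^ 2 / N ^ 2) * (-(2 * s / N ^ 2)) * step (N * (1 - t ^ 2))) s := by
  have h1 : HasDerivAt (fun s : ℝ => 2 - s ^ 2 / N ^ 2) (-(2 * s / N ^ 2)) s := by
    have := ((hasDerivAt_pow 2 s).div_const (N ^ 2)).const_sub 2
    simpa using this
  exact ((hasDerivAt_step _).comp s h1).mul_const (step (N * (1 - t ^ 2)))

theorem hasDerivAt_cutoff_snd (N s t : ℝ) : HasDerivAt (fun t => cutoff N (s, t))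
    (step (2 - s ^ 2 / N ^ 2) * (deriv step (N * (1 - t ^ 2)) * (N * (-(2 * t))))) t := by
  have h1 : HasDerivAt (fun t : ℝ => N * (1 - t ^ 2)) (N * (-(2 * t))) t := by
    have := ((hasDerivAt_pow 2 t).const_sub 1).const_mul N
    simpa using this
  exact ((hasDerivAt_step _).comp t h1).const_mul (step (2 - s ^ 2 / N ^ 2))

/-- The derivative of the cutoff function along the strip. -/
def cutoffS (N : ℝ) (p : ℝ × ℝ) : ℝ :=
  deriv step (2 - p.1 ^ 2 / N ^ 2) * (-(2 * p.1 / N ^ 2)) * step (N * (1 - p.2 ^ 2))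

/-- The derivative of the cutoff function across the strip. -/
def cutoffT (N : ℝ) (p : ℝ × ℝ) : ℝ :=
  step (2 - p.1 ^ 2 / N ^ 2) * (deriv step (N * (1 - p.2 ^ 2)) * (N * (-(2 * p.2))))

theorem continuous_cutoffS (N : ℝ) : Continuous (cutoffS N) := by
  have h1 : Continuous (deriv step) := (contDiff_step (n := 1)).continuous_deriv (by norm_num)
  have h2 : Continuous step := (contDiff_step (n := 1)).continuous
  unfold cutoffS; fun_prop

theorem continuous_cutoffT (N : ℝ) : Continuous (cutoffT N) := by
  have h1 : Continuous (deriv step) := (contDiff_step (n := 1)).continuous_deriv (by norm_num)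
  have h2 : Continuous step := (contDiff_step (n := 1)).continuous
  unfold cutoffT; fun_prop

/-- Where the derivative of `step` does not vanish, `s² ≤ 2N²`, so the inner derivative `2s/N²` is
of order `1/N`. The longitudinal commutator hence disappears in the limit. -/
theorem abs_cutoffS_le {M : ℝ} (hM : ∀ y, |deriv step y| ≤ M) {N : ℝ} (hN : 0 < N) (p : ℝ × ℝ) :
    |cutoffS N p| ≤ 4 * M / N := by
  have hM0 : 0 ≤ M := (abs_nonneg _).trans (hM 0)
  rw [cutoffS, abs_mul, abs_of_nonneg (step_nonneg _)]
  have h1 : |deriv step (2 - p.1 ^ 2 / N ^ 2) * (-(2 * p.1 / N ^ 2))| ≤ 4 * M / N := by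
    by_cases h : 2 - p.1 ^ 2 / N ^ 2 < 1 / 2
    · rw [deriv_step_of_lt h]
      simp; positivity
    · have h2 : p.1 ^ 2 / N ^ 2 < 2 := by linarith
      rw [div_lt_iff₀ (by positivity)] at h2
      have h3 : |p.1| ≤ 2 * N := abs_le_of_sq_le_sq (by nlinarith) (by positivity)
      rw [abs_mul, abs_neg, abs_div, abs_mul, abs_of_pos (by positivity : (0 : ℝ) < N ^ 2), abs_two]
      calc _ ≤ M * (2 * (2 * N) / N ^ 2) := by gcongr; exact hM _
        _ = 4 * M / N := by field_simp; ring
  calc _ ≤ 4 * M / N * 1 :=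
        mul_le_mul h1 (step_le_one _) (step_nonneg _) (by positivity)
    _ = _ := mul_one _

theorem abs_cutoffT_le {M : ℝ} (hM : ∀ y, |deriv step y| ≤ M) {N : ℝ} (hN : 1 < N) {p : ℝ × ℝ}
    (hp : |p.2| ≤ 1) : |cutoffT N p| ≤ 2 * M * N := by
  have hM0 : 0 ≤ M := (abs_nonneg _).trans (hM 0)
  rw [cutoffT, abs_mul, abs_mul, abs_mul, abs_neg, abs_mul, abs_two, abs_of_nonneg (step_nonneg _),
    abs_of_pos (by linarith : 0 < N)]
  calc _ ≤ 1 * (M * (N * (2 * 1))) := by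
        gcongr
        · exact step_le_one _
        · exact hM _
    _ = _ := by ring

/-- The transverse derivative is of order `N`, but it lives in two layers of width `1/N`. Its
integral is thus a boundary layer average of the kind in `layerMean`, which the boundary conditions
control. -/
theorem cutoffT_eq_zero {N : ℝ} (hN : 1 < N) {p : ℝ × ℝ} (hp : |p.2| ≤ 1 - 1 / N) :
    cutoffT N p = 0 := by
  have h0 : 0 < N := by linarith
  have h1 : 1 ≤ N * (1 - |p.2|) := by
    rw [← div_le_iff₀' h0]
    linarith
  have h2 : 1 < N * (1 - p.2 ^ 2) := by
    rw [← sq_abs]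
    rcases (abs_nonneg p.2).eq_or_lt with h | h
    · rw [← h]; simpa using hN
    · nlinarith
  rw [cutoffT, deriv_step_of_gt h2]
  simp

theorem tendsto_cutoff {p : ℝ × ℝ} (hp : p ∈ strip) :
    Tendsto (fun n : ℕ => cutoff ((n : ℝ) + 2) p) atTop (𝓝 1) := by
  have hpos : 0 < 1 - p.2 ^ 2 := by have := hp.2.1; have := hp.2.2; nlinarith
  have h1 : ∀ᶠ n : ℕ in atTop, |p.1| ≤ (n : ℝ) := (tendsto_natCast_atTop_atTop (R := ℝ)).eventually_ge_atTop _
  have h2 : ∀ᶠ n : ℕ in atTop, (1 - p.2 ^ 2)⁻¹ ≤ (n : ℝ) :=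
    (tendsto_natCast_atTop_atTop (R := ℝ)).eventually_ge_atTop _
  refine tendsto_const_nhds.congr' ?_
  filter_upwards [h1, h2] with n hn1 hn2
  have hn : (0 : ℝ) < (n : ℝ) + 2 := by positivity
  rw [cutoff, step_of_ge, step_of_ge, mul_one]
  · rw [← div_le_iff₀ hpos, one_div]; linarith
  · have : p.1 ^ 2 / ((n : ℝ) + 2) ^ 2 ≤ 1 := by
      rw [div_le_one (by positivity), ← sq_abs]
      have := abs_nonneg p.1
      nlinarith
    linarith

theorem decay_of_hasCompactSupport {F : Type*} [NormedAddCommGroup F] [NormedSpace ℝ F]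
    {f : ℝ × ℝ → F} (hf : Continuous f) (hc : HasCompactSupport f) : Decay f := by
  have h1 : HasCompactSupport fun p : ℝ × ℝ => (1 + p.1 ^ 2) • f p := hc.smul_left
  obtain ⟨C, hC⟩ := h1.exists_bound_of_continuous (by fun_prop)
  refine ⟨C, (norm_nonneg _).trans (hC 0), fun p _ => ?_⟩
  rw [le_div_iff₀ (by positivity), mul_comm]
  have := hC p
  rwa [norm_smul, Real.norm_of_nonneg (by positivity)] at this

theorem mem_core_of_hasCompactSupport {x : ℝ × ℝ → Spinor} (hx : ContDiff ℝ 2 x)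
    (hc : HasCompactSupport x) (hs : tsupport x ⊆ strip) : x ∈ core := by
  have h1 : HasCompactSupport (dS x) := hc.fderiv_apply ℝ (1, 0)
  have h2 : HasCompactSupport (dT x) := hc.fderiv_apply ℝ (0, 1)
  have h3 : HasCompactSupport (dT (dS x)) := h1.fderiv_apply ℝ (0, 1)
  have hb : ∀ s : ℝ, ∀ τ : ℝ, |τ| = 1 → x (s, τ) = 0 := fun s τ hτ => by
    refine image_eq_zero_of_notMem_tsupport fun h => ?_
    have := (hs h).2
    simp only [mem_Ioo, ← abs_lt, hτ, lt_self_iff_false] at this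
  refine ⟨hx, decay_of_hasCompactSupport hx.continuous hc,
    decay_of_hasCompactSupport (contDiff_dS hx).continuous h1,
    decay_of_hasCompactSupport (contDiff_dT hx).continuous h2, decay_of_hasCompactSupport ?_ h3,
    fun s => by rw [hb s 1 (by simp)]; rfl, fun s => by rw [hb s (-1) (by simp)]; rfl⟩
  exact ((contDiff_dS hx).continuous_fderiv (by norm_num)).clm_apply continuous_const

theorem hasCompactSupport_cutoff_smul {N : ℝ} (hN : 0 < N) (x : ℝ × ℝ → Spinor) :
    HasCompactSupport (fun p => cutoff N p • x p) ∧ tsupport (fun p => cutoff N p • x p) ⊆ strip := by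
  obtain ⟨K, hK, hKs, hKN⟩ := exists_tsupport_cutoff hN
  have h := (tsupport_smul_subset_left (cutoff N) x).trans hKN
  exact ⟨hK.of_isClosed_subset (isClosed_tsupport _) h, h.trans hKs⟩

theorem cutoff_smul_mem_core {N : ℝ} (hN : 0 < N) {x : ℝ × ℝ → Spinor} (hx : ContDiff ℝ 2 x) :
    (fun p => cutoff N p • x p) ∈ core :=
  mem_core_of_hasCompactSupport ((contDiff_cutoff N (n := 2)).smul hx)
    (hasCompactSupport_cutoff_smul hN x).1 (hasCompactSupport_cutoff_smul hN x).2

theorem dS_smul_eq {f f' : ℝ × ℝ → ℝ} {x : ℝ × ℝ → Spinor} (hf : ContDiff ℝ 1 f)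
    (hx : ContDiff ℝ 1 x) (h : ∀ s t, HasDerivAt (fun s => f (s, t)) (f' (s, t)) s) (p : ℝ × ℝ) :
    dS (fun p => f p • x p) p = f p • dS x p + f' p • x p :=
  (hasDerivAt_fst ((hf.smul hx).differentiable (by norm_num)) p.1 p.2).unique
    ((h p.1 p.2).smul (hasDerivAt_fst (hx.differentiable (by norm_num)) p.1 p.2))

theorem dT_smul_eq {f f' : ℝ × ℝ → ℝ} {x : ℝ × ℝ → Spinor} (hf : ContDiff ℝ 1 f)
    (hx : ContDiff ℝ 1 x) (h : ∀ s t, HasDerivAt (fun t => f (s, t)) (f' (s, t)) t) (p : ℝ × ℝ) :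
    dT (fun p => f p • x p) p = f p • dT x p + f' p • x p :=
  (hasDerivAt_snd ((hf.smul hx).differentiable (by norm_num)) p.1 p.2).unique
    ((h p.1 p.2).smul (hasDerivAt_snd (hx.differentiable (by norm_num)) p.1 p.2))

/-- Product rule: `b` and `d` stand for the two partial derivatives of a real multiplier with value
`a`, and the last two terms are the commutator of the multiplier with the operator. -/
theorem symbol_smul_add (α m j c a b d : ℝ) (y ys yt : Spinor) :
    symbol α m j c (a • y) (a • ys + b • y) (a • yt + d • y) =
      a • symbol α m j c y ys yt + (b * j) • sp (-Complex.I * y 0) (Complex.I * y 1) +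
        (d * α) • sp (y 1) (-y 0) := by
  apply spinor_ext <;> simp [symbol] <;> ring

end Waveguide
end

/-! ### Boundary layers: the boundary terms vanish under the infinite mass conditions. -/

noncomputable section

open scoped InnerProductSpace

namespace Waveguide

/-- The reflection of the strip (or the identity). -/
def flip (τ : ℝ) (p : ℝ × ℝ) : ℝ × ℝ := (p.1, τ * p.2)

theorem flip_flip {τ : ℝ} (hτ : τ = 1 ∨ τ = -1) (p : ℝ × ℝ) : flip τ (flip τ p) = p := by
  rcases hτ with rfl | rfl <;> simp [flip]

theorem measurePreserving_flip {τ : ℝ} (hτ : τ = 1 ∨ τ = -1) :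
    MeasurePreserving (flip τ) volume volume := by
  rcases hτ with rfl | rfl
  · have : flip 1 = id := by funext p; simp [flip]
    rw [this]; exact MeasurePreserving.id _
  · have h := (MeasurePreserving.id (volume : Measure ℝ)).prod
      (Measure.measurePreserving_neg (volume : Measure ℝ))
    have e : flip (-1) = Prod.map id Neg.neg := by
      funext p; exact Prod.ext rfl (by simp [flip])
    rw [e]; exact h

theorem continuous_flip (τ : ℝ) : Continuous (flip τ) := by unfold flip; fun_prop

theorem measurableEmbedding_flip {τ : ℝ} (hτ : τ = 1 ∨ τ = -1) : MeasurableEmbedding (flip τ) :=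
  (Homeomorph.mk ⟨flip τ, flip τ, flip_flip hτ, flip_flip hτ⟩ (continuous_flip τ)
    (continuous_flip τ)).measurableEmbedding

theorem flip_preimage_strip {τ : ℝ} (hτ : τ = 1 ∨ τ = -1) : flip τ ⁻¹' strip = strip := by
  ext p
  rcases hτ with rfl | rfl <;> simp [flip, strip]
  constructor <;> rintro ⟨a, b⟩ <;> constructor <;> linarith

theorem measurePreserving_flip_strip {τ : ℝ} (hτ : τ = 1 ∨ τ = -1) :
    MeasurePreserving (flip τ) (volume.restrict strip) (volume.restrict strip) := by
  have h := (measurePreserving_flip hτ).restrict_preimage isOpen_strip.measurableSet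
  rwa [flip_preimage_strip hτ] at h

/-- The boundary layer. -/
def layer (δ : ℝ) : Set (ℝ × ℝ) := univ ×ˢ Ioo (1 - δ) 1

theorem measurableSet_layer (δ : ℝ) : MeasurableSet (layer δ) :=
  MeasurableSet.univ.prod measurableSet_Ioo

theorem layer_subset_strip {δ : ℝ} (hδ : δ ≤ 1) : layer δ ⊆ strip := fun p hp =>
  ⟨trivial, by have := hp.2.1; linarith, hp.2.2⟩

theorem lintegral_layer_fst {δ : ℝ} {f : ℝ → ℝ≥0∞} (hf : Measurable f) :
    ∫⁻ p in layer δ, f p.1 = ENNReal.ofReal δ * ∫⁻ s, f s := by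
  have hvol : (volume.restrict (layer δ) : Measure (ℝ × ℝ)) =
      (volume : Measure ℝ).prod (volume.restrict (Ioo (1 - δ) 1)) := by
    rw [layer, Measure.volume_eq_prod, ← Measure.prod_restrict, Measure.restrict_univ]
  rw [hvol, lintegral_prod (fun p : ℝ × ℝ => f p.1) (hf.comp measurable_fst).aemeasurable]
  simp only [lintegral_const, Measure.restrict_apply_univ, Real.volume_Ioo]
  rw [lintegral_mul_const' _ _ (by simp), mul_comm]
  simp

theorem sq_add_le_two_mul (a b : ℝ≥0∞) : (a + b) ^ 2 ≤ 2 * (a ^ 2 + b ^ 2) := by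
  have h := ENNReal.rpow_add_le_mul_rpow_add_rpow a b (p := 2) (by norm_num)
  norm_num at h
  exact h

/-- The Cauchy-Schwarz inequality on a boundary layer. -/
theorem layer_mul_le {δ : ℝ} (hδ : 0 < δ) {f : ℝ → ℝ≥0∞} (hf : Measurable f) {g h : ℝ × ℝ → ℝ≥0∞}
    (hg : AEMeasurable g (volume.restrict (layer δ))) (hh : AEMeasurable h (volume.restrict (layer δ))) :
    (ENNReal.ofReal δ)⁻¹ * ∫⁻ p in layer δ, f p.1 * (g p + h p) ≤
      (∫⁻ s, f s ^ 2) ^ (1 / 2 : ℝ) *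
        (2 * ((ENNReal.ofReal δ)⁻¹ * (∫⁻ p in layer δ, g p ^ 2) +
          (ENNReal.ofReal δ)⁻¹ * ∫⁻ p in layer δ, h p ^ 2)) ^ (1 / 2 : ℝ) := by
  set d := ENNReal.ofReal δ with hd
  have hd0 : d ≠ 0 := by simpa [hd] using hδ
  have hdt : d ≠ ⊤ := by simp [hd]
  have h1 := ENNReal.lintegral_mul_le_Lp_mul_Lq (volume.restrict (layer δ)) Real.HolderConjugate.two_two
    (f := fun p => f p.1) (g := fun p => g p + h p) (hf.comp measurable_fst).aemeasurable (hg.add hh)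
  simp only [Pi.mul_apply, ENNReal.rpow_ofNat] at h1
  have h2 : ∫⁻ p in layer δ, (g p + h p) ^ 2 ≤
      2 * ((∫⁻ p in layer δ, g p ^ 2) + ∫⁻ p in layer δ, h p ^ 2) := by
    rw [← lintegral_add_left' (hg.pow_const 2), ← lintegral_const_mul' _ _ (by simp)]
    exact lintegral_mono fun p => sq_add_le_two_mul _ _
  have h3 : ∫⁻ p in layer δ, f p.1 ^ 2 = d * ∫⁻ s, f s ^ 2 := lintegral_layer_fst (hf.pow_const 2)
  rw [h3] at h1
  set A := ∫⁻ p in layer δ, g p ^ 2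
  set B := ∫⁻ p in layer δ, h p ^ 2
  calc _ ≤ d⁻¹ * ((d * ∫⁻ s, f s ^ 2) ^ (1 / 2 : ℝ) * (2 * (A + B)) ^ (1 / 2 : ℝ)) := by
        gcongr
        refine h1.trans ?_
        gcongr
    _ = d⁻¹ * ((d * ∫⁻ s, f s ^ 2) ^ (1 / 2 : ℝ) *
          (d * (2 * (d⁻¹ * A + d⁻¹ * B))) ^ (1 / 2 : ℝ)) := by
        congr 3
        rw [← mul_add, mul_left_comm d, ← mul_assoc d, ENNReal.mul_inv_cancel hd0 hdt, one_mul]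
    _ = (d⁻¹ * (d ^ (1 / 2 : ℝ) * d ^ (1 / 2 : ℝ))) * ((∫⁻ s, f s ^ 2) ^ (1 / 2 : ℝ) *
          (2 * (d⁻¹ * A + d⁻¹ * B)) ^ (1 / 2 : ℝ)) := by
        rw [ENNReal.mul_rpow_of_nonneg _ _ (by norm_num), ENNReal.mul_rpow_of_nonneg d _ (by norm_num)]
        ring
    _ = _ := by
        rw [← ENNReal.rpow_add _ _ hd0 hdt]
        norm_num
        rw [ENNReal.inv_mul_cancel hd0 hdt, one_mul]

theorem norm_sub_le_of_decay_dT {x : core} {C : ℝ}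
    (hC : ∀ p : ℝ × ℝ, |p.2| ≤ 1 → ‖dT x p‖ ≤ C / (1 + p.1 ^ 2)) (s : ℝ) {t t' : ℝ}
    (ht : |t| ≤ 1) (ht' : |t'| ≤ 1) :
    ‖(x : ℝ × ℝ → Spinor) (s, t') - (x : ℝ × ℝ → Spinor) (s, t)‖ ≤ C / (1 + s ^ 2) * |t' - t| :=
  (convex_Icc (-1 : ℝ) 1).norm_image_sub_le_of_norm_hasDerivWithin_le
    (f := fun t => (x : ℝ × ℝ → Spinor) (s, t))
    (fun r _ => (hasDerivAt_snd (core.differentiable x) s r).hasDerivWithinAt)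
    (fun r hr => hC (s, r) (abs_le.2 hr)) (abs_le.1 ht) (abs_le.1 ht')

namespace IsWaveguide

variable {γ : ℝ → Plane} {ε : ℝ} (hW : IsWaveguide γ ε)
include hW

theorem norm_le_norm_frame (s : ℝ) (y : Spinor) : ‖y‖ ≤ ‖frame (tang γ s) y‖ := by
  refine le_of_sq_le_sq ?_ (norm_nonneg _)
  rw [norm_sq_frame (hW.norm_tang s)]
  nlinarith [norm_nonneg y]

/-- The boundary terms in Green's formula vanish. -/
theorem tendsto_boundary_layer {τ : ℝ} (hτ : τ = 1 ∨ τ = -1) (x : core) (U : StripL2)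
    (h : InfiniteMass γ ε τ (hW.transfer U)) :
    Tendsto (fun δ : ℝ => (ENNReal.ofReal δ)⁻¹ * ∫⁻ p in layer δ,
      ‖inner ℂ (sp ((x : ℝ × ℝ → Spinor) (flip τ p) 1) (-(x : ℝ × ℝ → Spinor) (flip τ p) 0))
        (U (flip τ p))‖ₑ) (𝓝[>] 0) (𝓝 0) := by
  obtain ⟨g, ⟨hg, w, hw, huw, ht⟩, hbc⟩ := h
  obtain ⟨C0, hC00, hC0⟩ := core.decay x
  obtain ⟨C1, hC10, hC1⟩ := core.decay_dT x
  -- A square integrable majorant in `s` for both `x` and its transverse derivative. It allows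
  -- Cauchy-Schwarz on the layer against the `L²` convergence to the trace.
  set f : ℝ → ℝ≥0∞ := fun s => ENNReal.ofReal ((C0 + C1) / (1 + s ^ 2)) with hf
  have hfm : Measurable f := by
    refine ENNReal.measurable_ofReal.comp (Continuous.measurable ?_)
    exact continuous_const.div (by fun_prop) fun s => by positivity
  have hF : ∫⁻ s, f s ^ 2 ≠ ⊤ := by
    have hle : ∀ s, f s ^ 2 ≤ ENNReal.ofReal ((C0 + C1) ^ 2 * (1 + s ^ 2)⁻¹) := fun s => by
      simp only [hf]
      rw [← ENNReal.ofReal_pow (by positivity), div_pow, div_eq_mul_inv]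
      refine ENNReal.ofReal_le_ofReal ?_
      have : (1 : ℝ) + s ^ 2 ≤ (1 + s ^ 2) ^ 2 := by nlinarith [sq_nonneg s]
      gcongr
    refine ((lintegral_mono hle).trans_lt ?_).ne
    have := (integrable_inv_one_add_sq.const_mul ((C0 + C1) ^ 2)).lintegral_lt_top
    exact this
  -- the trace in the frame
  set G : ℝ → Spinor := fun s => unframe (tang γ s) (g s) with hG
  have hGg : ∀ s, frame (tang γ s) (G s) = g s := fun s => frame_unframe (hW.norm_tang s) _
  have hG0 : ∀ᵐ s : ℝ, sp (-τ * G s 0) (τ * G s 1) = G s := by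
    filter_upwards [hbc] with s hs
    rw [← hGg, boundaryMap_frame hW] at hs
    exact frame_injective (hW.norm_tang s) hs
  have hwU : ∀ᵐ p ∂volume.restrict strip, w (tubeMap γ ε p) = frame (tang γ p.1) (U p) := by
    filter_upwards [hW.ae_tube_iff.1 huw, hW.corresponds_transfer U] with p h1 h2
    rw [← h1, h2]
  have hwU' := (measurePreserving_flip_strip hτ).quasiMeasurePreserving.ae hwU
  have hUm : AEStronglyMeasurable (fun p => U (flip τ p)) (volume.restrict strip) :=
    (Lp.aestronglyMeasurable U).comp_measurePreserving (measurePreserving_flip_strip hτ)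
  have hV : ∀ δ ≤ 1, ∫⁻ p in layer δ, ‖U (flip τ p)‖ₑ ^ 2 ≤ ‖U‖ₑ ^ 2 := fun δ hδ => by
    rw [enorm_Lp_sq]
    refine (lintegral_mono_set (layer_subset_strip hδ)).trans ?_
    exact ((measurePreserving_flip_strip hτ).lintegral_comp_emb (measurableEmbedding_flip hτ)
      (fun p => ‖U p‖ₑ ^ 2)).le
  -- pointwise bound
  have hpt : ∀ δ : ℝ, δ < 1 → ∀ᵐ p ∂volume.restrict (layer δ),
      ‖inner ℂ (sp ((x : ℝ × ℝ → Spinor) (flip τ p) 1) (-(x : ℝ × ℝ → Spinor) (flip τ p) 0))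
        (U (flip τ p))‖ₑ ≤ f p.1 * (‖w (tubeMap γ ε (p.1, τ * p.2)) - g p.1‖ₑ +
          ENNReal.ofReal δ * ‖U (flip τ p)‖ₑ) := by
    intro δ hδ
    have hfst : ∀ᵐ p ∂volume.restrict (layer δ), sp (-τ * G p.1 0) (τ * G p.1 1) = G p.1 :=
      ae_restrict_of_ae (Measure.quasiMeasurePreserving_fst.ae hG0)
    filter_upwards [ae_restrict_of_ae_restrict_of_subset (layer_subset_strip hδ.le) hwU', hfst,
      ae_restrict_mem (measurableSet_layer δ)] with p h1 h2 hp
    obtain ⟨-, hp1, hp2⟩ := hp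
    have hτ1 := abs_eq_one_of hτ
    have hτt : |τ * p.2| ≤ 1 := by
      rw [abs_mul, hτ1, one_mul, abs_le]; constructor <;> linarith
    have hdist : |τ * p.2 - τ| ≤ δ := by
      rw [← mul_sub_one, abs_mul, hτ1, one_mul, abs_le]; constructor <;> linarith
    have hδ0 : 0 ≤ δ := (abs_nonneg _).trans hdist
    have b1 : ‖(x : ℝ × ℝ → Spinor) (p.1, τ * p.2) - (x : ℝ × ℝ → Spinor) (p.1, τ)‖ ≤
        C1 / (1 + p.1 ^ 2) * δ :=
      (norm_sub_le_of_decay_dT hC1 p.1 hτ1.le hτt).trans (by gcongr)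
    have b0 : ‖(x : ℝ × ℝ → Spinor) (p.1, τ * p.2)‖ ≤ C0 / (1 + p.1 ^ 2) := hC0 _ hτt
    have b2 : ‖U (flip τ p) - G p.1‖ ≤ ‖w (tubeMap γ ε (p.1, τ * p.2)) - g p.1‖ := by
      have h3 : w (tubeMap γ ε (p.1, τ * p.2)) - g p.1 = frame (tang γ p.1) (U (flip τ p) - G p.1) := by
        rw [frame_sub, hGg]; congr 1
      rw [h3]
      exact hW.norm_le_norm_frame _ _
    rw [← ofReal_norm, ← ofReal_norm, ← ofReal_norm, ← ENNReal.ofReal_mul hδ0,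
      ← ENNReal.ofReal_add (norm_nonneg _) (by positivity), ← ENNReal.ofReal_mul (by positivity)]
    refine ENNReal.ofReal_le_ofReal ?_
    set y := (x : ℝ × ℝ → Spinor) (p.1, τ * p.2) with hy
    set V := U (flip τ p)
    set r := ‖w (tubeMap γ ε (p.1, τ * p.2)) - g p.1‖
    change ‖inner ℂ (sp (y 1) (-y 0)) V‖ ≤ (C0 + C1) / (1 + p.1 ^ 2) * (r + δ * ‖V‖)
    rw [inner_spinor]
    simp only [sp_zero, sp_one]
    -- The pairing contains only the mixed products `y 1 · V 0` and `y 0 · V 1`. If the boundary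
    -- condition kills component `i`, then `y i` is of order `δ` and `V i` is bounded by the
    -- distance `r` to the trace. Each product therefore contains a small factor.
    have main : ∀ i j : Fin 2, ‖y i‖ ≤ C1 / (1 + p.1 ^ 2) * δ → ‖V i‖ ≤ r → ‖y i‖ * ‖V j‖ +
        ‖y j‖ * ‖V i‖ ≤ (C0 + C1) / (1 + p.1 ^ 2) * (r + δ * ‖V‖) := by
      intro i j hi hj
      have hV1 := norm_spinor_apply_le V j
      have hy1 := (norm_spinor_apply_le y j).trans b0
      have hr : 0 ≤ r := norm_nonneg _
      have hC0' : 0 ≤ C0 / (1 + p.1 ^ 2) := by positivity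
      have hC1' : 0 ≤ C1 / (1 + p.1 ^ 2) := by positivity
      calc _ ≤ (C1 / (1 + p.1 ^ 2) * δ) * ‖V‖ + C0 / (1 + p.1 ^ 2) * r := by gcongr
        _ ≤ _ := by
          rw [add_div]
          have := mul_nonneg hC1' hr
          have := mul_nonneg hC0' (mul_nonneg hδ0 (norm_nonneg V))
          nlinarith
    have tri : ‖starRingEnd ℂ (y 1) * V 0 + starRingEnd ℂ (-y 0) * V 1‖ ≤
        ‖y 1‖ * ‖V 0‖ + ‖y 0‖ * ‖V 1‖ := by
      refine (norm_add_le _ _).trans ?_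
      simp
    refine tri.trans ?_
    have hVi : ∀ i, ‖V i - G p.1 i‖ ≤ r := fun i => (norm_spinor_apply_le (V - G p.1) i).trans b2
    have hyi : ∀ i, ‖y i - (x : ℝ × ℝ → Spinor) (p.1, τ) i‖ ≤ C1 / (1 + p.1 ^ 2) * δ := fun i =>
      (norm_spinor_apply_le (y - (x : ℝ × ℝ → Spinor) (p.1, τ)) i).trans b1
    rcases hτ with rfl | rfl
    -- For `τ = 1` the fixed point equation reads `-G 0 = G 0` in component `0`; for `τ = -1` the
    -- same happens in component `1`.
    · have hG0' : G p.1 0 = 0 := by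
        have := congrArg (fun v : Spinor => v 0) h2
        simp only [sp_zero] at this
        push_cast at this
        linear_combination (-1 / 2 : ℂ) * this
      have e1 := hVi 0
      have e2 := hyi 0
      rw [hG0', sub_zero] at e1
      rw [core.top x, sub_zero] at e2
      rw [add_comm]
      exact main 0 1 e2 e1
    · have hG0' : G p.1 1 = 0 := by
        have := congrArg (fun v : Spinor => v 1) h2
        simp only [sp_one] at this
        push_cast at this
        linear_combination (-1 / 2 : ℂ) * this
      have e1 := hVi 1
      have e2 := hyi 1
      rw [hG0', sub_zero] at e1
      rw [core.bot x, sub_zero] at e2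
      exact main 1 0 e2 e1
  -- conclusion
  have hbound : ∀ δ ∈ Ioo (0 : ℝ) 1, (ENNReal.ofReal δ)⁻¹ * ∫⁻ p in layer δ,
      ‖inner ℂ (sp ((x : ℝ × ℝ → Spinor) (flip τ p) 1) (-(x : ℝ × ℝ → Spinor) (flip τ p) 0))
        (U (flip τ p))‖ₑ ≤ (∫⁻ s, f s ^ 2) ^ (1 / 2 : ℝ) *
          (2 * (layerMean γ ε τ w g δ + ENNReal.ofReal δ * ‖U‖ₑ ^ 2)) ^ (1 / 2 : ℝ) := by
    intro δ hδ
    have hd0 : ENNReal.ofReal δ ≠ 0 := by simpa using hδ.1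
    have hm1 : AEMeasurable (fun p : ℝ × ℝ => ‖w (tubeMap γ ε (p.1, τ * p.2)) - g p.1‖ₑ)
        (volume.restrict (layer δ)) := by
      have hc : Continuous fun p : ℝ × ℝ => tubeMap γ ε (p.1, τ * p.2) :=
        (contDiff_tubeMap hW.contDiff ε).continuous.comp (by fun_prop)
      have h1 : AEStronglyMeasurable (fun p : ℝ × ℝ => w (tubeMap γ ε (p.1, τ * p.2))) volume :=
        (hw.comp_measurable hc.measurable).aestronglyMeasurable
      have h2 : AEStronglyMeasurable (fun p : ℝ × ℝ => g p.1) volume := hg.1.comp_fst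
      exact (h1.sub h2).restrict.enorm
    have hm2 : AEMeasurable (fun p : ℝ × ℝ => ENNReal.ofReal δ * ‖U (flip τ p)‖ₑ)
        (volume.restrict (layer δ)) :=
      ((hUm.mono_measure (Measure.restrict_mono (layer_subset_strip hδ.2.le) le_rfl)).enorm).const_mul _
    calc _ ≤ (ENNReal.ofReal δ)⁻¹ * ∫⁻ p in layer δ, f p.1 *
          (‖w (tubeMap γ ε (p.1, τ * p.2)) - g p.1‖ₑ + ENNReal.ofReal δ * ‖U (flip τ p)‖ₑ) := by
          exact mul_le_mul' le_rfl (lintegral_mono_ae (hpt δ hδ.2))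
      _ ≤ _ := layer_mul_le hδ.1 hfm hm1 hm2
      _ ≤ _ := by
          refine mul_le_mul' le_rfl (ENNReal.rpow_le_rpow (mul_le_mul' le_rfl
            (add_le_add le_rfl ?_)) (by norm_num))
          simp only [mul_pow]
          rw [lintegral_const_mul' _ _ (by simp), ← mul_assoc, sq, ← mul_assoc,
            ENNReal.inv_mul_cancel hd0 (by simp), one_mul]
          exact mul_le_mul' le_rfl (hV δ hδ.2.le)
  have hlim : Tendsto (fun δ : ℝ => (∫⁻ s, f s ^ 2) ^ (1 / 2 : ℝ) *
      (2 * (layerMean γ ε τ w g δ + ENNReal.ofReal δ * ‖U‖ₑ ^ 2)) ^ (1 / 2 : ℝ)) (𝓝[>] 0) (𝓝 0) := by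
    have h1 : Tendsto (fun δ : ℝ => ENNReal.ofReal δ * ‖U‖ₑ ^ 2) (𝓝[>] 0) (𝓝 0) := by
      have h2 : Tendsto (fun δ : ℝ => ENNReal.ofReal δ) (𝓝[>] 0) (𝓝 (ENNReal.ofReal 0)) :=
        (ENNReal.continuous_ofReal.tendsto 0).mono_left nhdsWithin_le_nhds
      simpa using ENNReal.Tendsto.mul_const h2 (b := ‖U‖ₑ ^ 2) (Or.inr (by simp))
    have h2 := ENNReal.Tendsto.const_mul (ht.add h1) (a := 2) (Or.inr (by simp))
    have h3 := (ENNReal.continuous_rpow_const (y := (1 / 2 : ℝ))).tendsto _ |>.comp h2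
    have h4 := ENNReal.Tendsto.const_mul h3 (a := (∫⁻ s, f s ^ 2) ^ (1 / 2 : ℝ))
      (Or.inr (ENNReal.rpow_ne_top_of_nonneg (by norm_num) hF))
    simpa using h4
  refine tendsto_of_tendsto_of_tendsto_of_le_of_le' tendsto_const_nhds hlim
    (Eventually.of_forall fun _ => zero_le) ?_
  filter_upwards [Ioo_mem_nhdsGT (zero_lt_one (α := ℝ))] with δ hδ
  exact hbound δ hδ

end IsWaveguide

end Waveguide
end

/-! ### Green's formula between the core and the whole graph. -/

noncomputable section

open scoped InnerProductSpace

namespace Waveguide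

/-- Bounded convergence of multipliers on the strip. -/
theorem tendsto_integral_mul {φ : ℕ → ℝ × ℝ → ℝ} {φ' : ℝ} (hφ : ∀ n, Continuous (φ n)) {C : ℝ}
    (hC : ∀ n p, |φ n p| ≤ C) (hlim : ∀ p ∈ strip, Tendsto (fun n => φ n p) atTop (𝓝 φ'))
    {f : ℝ × ℝ → ℂ} (hf : Integrable f (volume.restrict strip)) :
    Tendsto (fun n => ∫ p in strip, (φ n p : ℂ) * f p) atTop (𝓝 (φ' * ∫ p in strip, f p)) := by
  rw [← integral_const_mul]
  refine tendsto_integral_of_dominated_convergence (fun p => C * ‖f p‖) (fun n => ?_)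
    (hf.norm.const_mul C) (fun n => Eventually.of_forall fun p => ?_) ?_
  · exact (Complex.continuous_ofReal.comp (hφ n)).aestronglyMeasurable.mul hf.1
  · rw [norm_mul, Complex.norm_real, Real.norm_eq_abs]
    exact mul_le_mul_of_nonneg_right (hC n p) (norm_nonneg _)
  · filter_upwards [ae_restrict_mem isOpen_strip.measurableSet] with p hp
    exact ((Complex.continuous_ofReal.tendsto _).comp (hlim p hp)).mul_const _

theorem integrable_inner_of_memLp {f : ℝ × ℝ → Spinor} (hf : MemLp f 2 (volume.restrict strip))
    (U : StripL2) : Integrable (fun p => ⟪f p, U p⟫_ℂ) (volume.restrict strip) := by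
  refine (L2.integrable_inner (𝕜 := ℂ) (hf.toLp f) U).congr ?_
  filter_upwards [hf.coeFn_toLp] with p hp
  rw [hp]

theorem lintegral_flip_preimage {τ : ℝ} (hτ : τ = 1 ∨ τ = -1) (h : ℝ × ℝ → ℝ≥0∞)
    (s : Set (ℝ × ℝ)) : ∫⁻ p in flip τ ⁻¹' s, h p = ∫⁻ p in s, h (flip τ p) := by
  have e := (measurePreserving_flip hτ).setLIntegral_comp_preimage_emb (measurableEmbedding_flip hτ)
    (fun p => h (flip τ p)) s
  simpa only [flip_flip hτ] using e

/-- `cutoffT N` is bounded by `2MN` and supported, within the strip, in the layers of width `1/N` at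
the two edges. The factor `N` is the normalisation of the layer averages. -/
theorem lintegral_cutoffT_le {M : ℝ} (hM : ∀ y, |deriv step y| ≤ M) {N : ℝ} (hN : 1 < N)
    (h : ℝ × ℝ → ℝ≥0∞) : ∫⁻ p in strip, ‖cutoffT N p‖ₑ * h p ≤
      ENNReal.ofReal (2 * M) * ((ENNReal.ofReal N⁻¹)⁻¹ * (∫⁻ p in layer N⁻¹, h (flip 1 p)) +
        (ENNReal.ofReal N⁻¹)⁻¹ * ∫⁻ p in layer N⁻¹, h (flip (-1) p)) := by
  have hM0 : 0 ≤ M := (abs_nonneg _).trans (hM 0)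
  have hN0 : 0 < N := by linarith
  set S := flip 1 ⁻¹' layer N⁻¹ ∪ flip (-1) ⁻¹' layer N⁻¹ with hS
  have hSm : MeasurableSet S := ((continuous_flip _).measurable (measurableSet_layer _)).union
    ((continuous_flip _).measurable (measurableSet_layer _))
  calc ∫⁻ p in strip, ‖cutoffT N p‖ₑ * h p
      ≤ ∫⁻ p in strip, S.indicator (fun p => ENNReal.ofReal (2 * M * N) * h p) p := by
        refine setLIntegral_mono' isOpen_strip.measurableSet fun p hp => ?_
        by_cases hpS : p ∈ S
        · rw [indicator_of_mem hpS, Real.enorm_eq_ofReal_abs]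
          exact mul_le_mul' (ENNReal.ofReal_le_ofReal (abs_cutoffT_le hM hN
            (abs_le.2 ⟨hp.2.1.le, hp.2.2.le⟩))) le_rfl
        · rw [indicator_of_notMem hpS, cutoffT_eq_zero hN]
          · simp
          by_contra! hc
          refine hpS ?_
          rw [one_div] at hc
          rcases lt_abs.1 hc with hc | hc
          · left; exact ⟨trivial, by simpa [flip] using hc, by simpa [flip] using hp.2.2⟩
          · right
            refine ⟨trivial, by simpa [flip] using hc, ?_⟩
            have := hp.2.1
            simp only [flip]; linarith
    _ ≤ ∫⁻ p, S.indicator (fun p => ENNReal.ofReal (2 * M * N) * h p) p :=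
        setLIntegral_le_lintegral _ _
    _ = ENNReal.ofReal (2 * M * N) * ∫⁻ p in S, h p := by
        rw [lintegral_indicator hSm, lintegral_const_mul' _ _ (by simp)]
    _ ≤ ENNReal.ofReal (2 * M * N) * ((∫⁻ p in layer N⁻¹, h (flip 1 p)) +
          ∫⁻ p in layer N⁻¹, h (flip (-1) p)) := by
        refine mul_le_mul' le_rfl ((lintegral_union_le _ _ _).trans_eq ?_)
        rw [lintegral_flip_preimage (Or.inl rfl), lintegral_flip_preimage (Or.inr rfl)]
    _ = _ := by
        rw [ENNReal.ofReal_mul (by positivity), ENNReal.ofReal_inv_of_pos hN0, inv_inv]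
        ring

theorem inner_smul_ofReal (r : ℝ) (y z : Spinor) : ⟪r • y, z⟫_ℂ = r * ⟪y, z⟫_ℂ := by
  simp [inner_spinor]; ring

theorem norm_sp_I (y : Spinor) : ‖sp (-Complex.I * y 0) (Complex.I * y 1)‖ = ‖y‖ := by
  rw [← sq_eq_sq₀ (norm_nonneg _) (norm_nonneg _), norm_sq_spinor, norm_sq_spinor y]
  simp

theorem norm_sp_swap (y : Spinor) : ‖sp (y 1) (-y 0)‖ = ‖y‖ := by
  rw [← sq_eq_sq₀ (norm_nonneg _) (norm_nonneg _), norm_sq_spinor, norm_sq_spinor y]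
  simp [add_comm]

/-- The core element `x` with the first derivative replaced by the commutator with a multiplier. -/
def commS (x : ℝ × ℝ → Spinor) (p : ℝ × ℝ) : Spinor := sp (-Complex.I * x p 0) (Complex.I * x p 1)

/-- The coefficient of the transverse derivative of a cutoff in its commutator with the Dirac
expression. Its pairing with `U` is the quantity estimated in `tendsto_boundary_layer`. -/
def commT (x : ℝ × ℝ → Spinor) (p : ℝ × ℝ) : Spinor := sp (x p 1) (-x p 0)

theorem core.memLp (x : core) : MemLp (x : ℝ × ℝ → Spinor) 2 (volume.restrict strip) :=
  (core.decay x).memLp (core.continuous x).aestronglyMeasurable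

theorem memLp_commS (x : core) : MemLp (commS x) 2 (volume.restrict strip) := by
  have h : ∀ i : Fin 2, Continuous fun p => (x : ℝ × ℝ → Spinor) p i := fun i =>
    (continuous_coord i).comp (core.continuous x)
  exact (core.memLp x).of_le ((continuous_const.mul (h 0)).sp
      (continuous_const.mul (h 1))).aestronglyMeasurable
      (Eventually.of_forall fun p => (norm_sp_I _).le)

theorem memLp_commT (x : core) : MemLp (commT x) 2 (volume.restrict strip) := by
  have h : ∀ i : Fin 2, Continuous fun p => (x : ℝ × ℝ → Spinor) p i := fun i =>
    (continuous_coord i).comp (core.continuous x)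
  exact (core.memLp x).of_le ((h 1).sp (h 0).neg).aestronglyMeasurable
      (Eventually.of_forall fun p => (norm_sp_swap _).le)

theorem integrable_mul_of_bound {φ : ℝ × ℝ → ℝ} {C : ℝ} (hφ : Continuous φ)
    (hC : ∀ p ∈ strip, |φ p| ≤ C) {f : ℝ × ℝ → ℂ} (hf : Integrable f (volume.restrict strip)) :
    Integrable (fun p => (φ p : ℂ) * f p) (volume.restrict strip) := by
  refine hf.bdd_mul (c := C) (Complex.continuous_ofReal.comp hφ).aestronglyMeasurable ?_
  filter_upwards [ae_restrict_mem isOpen_strip.measurableSet] with p hp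
  rw [Complex.norm_real, Real.norm_eq_abs]
  exact hC p hp

theorem abs_cutoff_le (N : ℝ) (p : ℝ × ℝ) : |cutoff N p| ≤ 1 := by
  rw [abs_of_nonneg (cutoff_nonneg _ _)]; exact cutoff_le_one _ _

theorem continuous_cutoff (N : ℝ) : Continuous (cutoff N) := (contDiff_cutoff (n := 0) _).continuous

/-- The truncation of an element of the core. -/
def truncate (x : core) (N : ℝ) (hN : 0 < N) : core :=
  ⟨fun p => cutoff N p • (x : ℝ × ℝ → Spinor) p, cutoff_smul_mem_core hN (core.contDiff x)⟩

theorem truncate_apply (x : core) {N : ℝ} (hN : 0 < N) (p : ℝ × ℝ) :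
    (truncate x N hN : ℝ × ℝ → Spinor) p = cutoff N p • (x : ℝ × ℝ → Spinor) p := rfl

theorem dS_truncate (x : core) {N : ℝ} (hN : 0 < N) (p : ℝ × ℝ) :
    dS (truncate x N hN) p = cutoff N p • dS x p + cutoffS N p • (x : ℝ × ℝ → Spinor) p :=
  dS_smul_eq (contDiff_cutoff (n := 1) _) ((core.contDiff x).of_le (by norm_num))
    (fun s t => hasDerivAt_cutoff_fst _ s t) p

theorem dT_truncate (x : core) {N : ℝ} (hN : 0 < N) (p : ℝ × ℝ) :
    dT (truncate x N hN) p = cutoff N p • dT x p + cutoffT N p • (x : ℝ × ℝ → Spinor) p :=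
  dT_smul_eq (contDiff_cutoff (n := 1) _) ((core.contDiff x).of_le (by norm_num))
    (fun s t => hasDerivAt_cutoff_snd _ s t) p

namespace IsWaveguide

variable {γ : ℝ → Plane} {ε : ℝ} (hW : IsWaveguide γ ε)
include hW

theorem integrable_jac_mul {f : ℝ × ℝ → ℂ} (hf : Integrable f (volume.restrict strip)) :
    Integrable (fun p => ((jac γ ε p : ℝ) : ℂ) * f p) (volume.restrict strip) :=
  integrable_mul_of_bound (C := 3 / 2) hW.continuous_jac (fun p hp => by
    have := hW.jac_bounds (IsWaveguide.abs_le_of_mem_strip hp)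
    rw [abs_of_pos (by linarith)]
    exact this.2.le) hf

theorem coeFn_curved_truncate (m : ℝ) (x : core) {N : ℝ} (hN : 0 < N) :
    ∀ᵐ p ∂volume.restrict strip, hW.curved m (truncate x N hN) p =
      cutoff N p • hW.curved m x p + (cutoffS N p * (jac γ ε p)⁻¹) • commS x p +
        (cutoffT N p * ε⁻¹) • commT x p := by
  filter_upwards [hW.coeFn_curved m (truncate x N hN), hW.coeFn_curved m x] with p h1 h2
  rw [h1, h2, truncate_apply, dS_truncate, dT_truncate, symbol_smul_add]
  rfl

/-- The weight `2 ε J` of the inner product cancels `J⁻¹` in the longitudinal commutator and `ε⁻¹`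
in the transverse one. The three summands are those whose limits are taken separately. -/
theorem inner_curved_truncate (m : ℝ) (x : core) {N : ℝ} (hN : 0 < N) (U : StripL2) :
    ∀ᵐ p ∂volume.restrict strip, ((2 * ε * jac γ ε p : ℝ) : ℂ) *
        ⟪hW.curved m (truncate x N hN) p, U p⟫_ℂ =
      2 * (ε * (((cutoff N p : ℝ) : ℂ) * (((jac γ ε p : ℝ) : ℂ) * ⟪hW.curved m x p, U p⟫_ℂ)) +
        (ε * (((cutoffS N p : ℝ) : ℂ) * ⟪commS x p, U p⟫_ℂ) +
        ((cutoffT N p : ℝ) : ℂ) * (((jac γ ε p : ℝ) : ℂ) * ⟪commT x p, U p⟫_ℂ))) := by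
  filter_upwards [hW.coeFn_curved_truncate m x hN,
    ae_restrict_mem isOpen_strip.measurableSet] with p h1 hp
  have hJ0 : (jac γ ε p : ℂ) ≠ 0 := by
    have := hW.jac_bounds (IsWaveguide.abs_le_of_mem_strip hp)
    exact_mod_cast (by linarith : (0 : ℝ) < jac γ ε p).ne'
  have hε0 : (ε : ℂ) ≠ 0 := by exact_mod_cast hW.pos.ne'
  rw [h1, inner_add_left, inner_add_left, inner_smul_ofReal, inner_smul_ofReal, inner_smul_ofReal]
  push_cast
  field_simp
  ring

/-- Green's formula for a truncation. -/
theorem green_truncate {m : ℝ} {U G : StripL2} {v : Fin 2 → L2 (tube γ ε)}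
    (h : ∀ j, IsWeakDeriv (tube γ ε) j (hW.transfer U) (v j))
    (hG : hW.transfer G = diracExpr (tube γ ε) m (hW.transfer U) v) (x : core) {N : ℝ} (hN : 1 < N) :
    ε * (∫ p in strip, ((cutoff N p : ℝ) : ℂ) *
        (((jac γ ε p : ℝ) : ℂ) * ⟪hW.curved m x p, U p⟫_ℂ)) +
      (ε * (∫ p in strip, ((cutoffS N p : ℝ) : ℂ) * ⟪commS x p, U p⟫_ℂ) +
      ∫ p in strip, ((cutoffT N p : ℝ) : ℂ) * (((jac γ ε p : ℝ) : ℂ) * ⟪commT x p, U p⟫_ℂ)) =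
      ε * ∫ p in strip, ((cutoff N p : ℝ) : ℂ) *
        (((jac γ ε p : ℝ) : ℂ) * ⟪(x : ℝ × ℝ → Spinor) p, G p⟫_ℂ) := by
  have hN0 : 0 < N := by linarith
  obtain ⟨M, hM0, hM⟩ := exists_deriv_step_bound
  have g := hW.green_of_hasCompactSupport (m := m) h (x := truncate x N hN0)
    (hasCompactSupport_cutoff_smul hN0 x).1 (hasCompactSupport_cutoff_smul hN0 x).2
  rw [← hG, hW.inner_of_corresponds (hW.corresponds_transfer _) (hW.corresponds_transfer _),
    hW.inner_of_corresponds (hW.corresponds_transfer _) (hW.corresponds_transfer _)] at g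
  rw [integral_congr_ae (hW.inner_curved_truncate m x hN0 U), integral_const_mul] at g
  have i1 := integrable_mul_of_bound (continuous_cutoff N) (fun p _ => abs_cutoff_le N p)
    (hW.integrable_jac_mul (L2.integrable_inner (𝕜 := ℂ) (hW.curved m x) U))
  have i2 := integrable_mul_of_bound (continuous_cutoffS N) (fun p _ => abs_cutoffS_le hM hN0 p)
    (integrable_inner_of_memLp (memLp_commS x) U)
  have i3 := integrable_mul_of_bound (continuous_cutoffT N)
    (fun p hp => abs_cutoffT_le hM hN (IsWaveguide.abs_le_of_mem_strip hp))
    (hW.integrable_jac_mul (integrable_inner_of_memLp (memLp_commT x) U))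
  have i23 : Integrable (fun p => (ε : ℂ) * (((cutoffS N p : ℝ) : ℂ) * ⟪commS x p, U p⟫_ℂ) +
      ((cutoffT N p : ℝ) : ℂ) * (((jac γ ε p : ℝ) : ℂ) * ⟪commT x p, U p⟫_ℂ))
      (volume.restrict strip) := (i2.const_mul _).add i3
  rw [integral_add (i1.const_mul _) i23, integral_add (i2.const_mul _) i3,
    integral_const_mul, integral_const_mul] at g
  have r : ∫ p in strip, ((2 * ε * jac γ ε p : ℝ) : ℂ) * ⟪incl (truncate x N hN0) p, G p⟫_ℂ =
      2 * (ε * ∫ p in strip, ((cutoff N p : ℝ) : ℂ) *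
        (((jac γ ε p : ℝ) : ℂ) * ⟪(x : ℝ × ℝ → Spinor) p, G p⟫_ℂ)) := by
    rw [← integral_const_mul, ← integral_const_mul]
    refine integral_congr_ae ?_
    filter_upwards [coeFn_incl (truncate x N hN0)] with p hp
    rw [hp, truncate_apply, inner_smul_ofReal]
    push_cast
    ring
  rw [r] at g
  exact mul_left_cancel₀ two_ne_zero g

/-- The layer limits are taken along `δ = 1/(n + 2)`. In Green's formula, this is where the boundary
conditions of `U` enter. -/
theorem tendsto_commT (x : core) (U : StripL2) (h1 : InfiniteMass γ ε 1 (hW.transfer U))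
    (h2 : InfiniteMass γ ε (-1) (hW.transfer U)) :
    Tendsto (fun n : ℕ => ∫ p in strip, ((cutoffT ((n : ℝ) + 2) p : ℝ) : ℂ) *
      (((jac γ ε p : ℝ) : ℂ) * ⟪commT x p, U p⟫_ℂ)) atTop (𝓝 0) := by
  obtain ⟨M, hM0, hM⟩ := exists_deriv_step_bound
  rw [tendsto_zero_iff_enorm_tendsto_zero]
  have t1 := hW.tendsto_boundary_layer (Or.inl rfl) x U h1
  have t2 := hW.tendsto_boundary_layer (Or.inr rfl) x U h2
  have hδ : Tendsto (fun n : ℕ => ((n : ℝ) + 2)⁻¹) atTop (𝓝[>] 0) :=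
    tendsto_nhdsWithin_iff.2 ⟨tendsto_inv_atTop_zero.comp (tendsto_atTop_add_const_right _ _
      tendsto_natCast_atTop_atTop), Eventually.of_forall fun n => mem_Ioi.2 (by positivity)⟩
  have t3 := ENNReal.Tendsto.const_mul ((t1.comp hδ).add (t2.comp hδ))
    (a := ENNReal.ofReal (3 / 2) * ENNReal.ofReal (2 * M))
    (Or.inr (ENNReal.mul_ne_top ENNReal.ofReal_ne_top ENNReal.ofReal_ne_top))
  rw [add_zero, mul_zero] at t3
  refine tendsto_of_tendsto_of_tendsto_of_le_of_le tendsto_const_nhds t3 (fun _ => zero_le)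
    fun n => ?_
  have hgt : (1 : ℝ) < n + 2 := by
    have : (0 : ℝ) ≤ n := n.cast_nonneg
    linarith
  refine (enorm_integral_le_lintegral_enorm _).trans ?_
  rw [mul_assoc]
  refine le_trans ?_ (mul_le_mul' le_rfl (lintegral_cutoffT_le hM hgt fun p => ‖⟪commT x p, U p⟫_ℂ‖ₑ))
  rw [← lintegral_const_mul' _ _ (by simp)]
  refine setLIntegral_mono' isOpen_strip.measurableSet fun p hp => ?_
  have := hW.jac_bounds (IsWaveguide.abs_le_of_mem_strip hp)
  have e1 : ‖((jac γ ε p : ℝ) : ℂ)‖ₑ ≤ ENNReal.ofReal (3 / 2) := by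
    rw [← ofReal_norm, Complex.norm_real, Real.norm_eq_abs, abs_of_pos (by linarith)]
    exact ENNReal.ofReal_le_ofReal this.2.le
  have e2 : ‖((cutoffT ((n : ℝ) + 2) p : ℝ) : ℂ)‖ₑ = ‖cutoffT ((n : ℝ) + 2) p‖ₑ := by
    rw [← ofReal_norm, Complex.norm_real, ofReal_norm]
  rw [enorm_mul, enorm_mul, e2]
  calc _ = ‖((jac γ ε p : ℝ) : ℂ)‖ₑ * (‖cutoffT ((n : ℝ) + 2) p‖ₑ * ‖⟪commT x p, U p⟫_ℂ‖ₑ) := by ring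
    _ ≤ _ := mul_le_mul' e1 le_rfl

omit hW in
theorem _root_.Waveguide.tendsto_commS (x : core) (U : StripL2) :
    Tendsto (fun n : ℕ => ∫ p in strip, ((cutoffS ((n : ℝ) + 2) p : ℝ) : ℂ) * ⟪commS x p, U p⟫_ℂ)
      atTop (𝓝 0) := by
  obtain ⟨M, hM0, hM⟩ := exists_deriv_step_bound
  have hinv : Tendsto (fun n : ℕ => ((n : ℝ) + 2)⁻¹) atTop (𝓝 0) :=
    tendsto_inv_atTop_zero.comp (tendsto_atTop_add_const_right _ _ tendsto_natCast_atTop_atTop)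
  have hSle : ∀ (n : ℕ) p, |cutoffS ((n : ℝ) + 2) p| ≤ 4 * M * ((n : ℝ) + 2)⁻¹ := fun n p => by
    have := abs_cutoffS_le hM (by positivity : (0 : ℝ) < n + 2) p
    rwa [div_eq_mul_inv] at this
  have := tendsto_integral_mul (φ := fun n : ℕ => cutoffS ((n : ℝ) + 2)) (φ' := 0)
    (fun n => continuous_cutoffS _) (C := 4 * M) (fun n p => (hSle n p).trans ?_)
    (fun p _ => ?_) (integrable_inner_of_memLp (memLp_commS x) U)
  · simpa using this
  · have hn : (0 : ℝ) ≤ n := n.cast_nonneg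
    have : ((n : ℝ) + 2)⁻¹ ≤ 1 := inv_le_one_of_one_le₀ (by linarith)
    nlinarith
  · refine squeeze_zero_norm (fun n => hSle n p) ?_
    simpa using hinv.const_mul (4 * M)

/-- Green's formula for the core and an arbitrary element of the graph. -/
theorem green_transfer {m : ℝ} {U G : StripL2} {v : Fin 2 → L2 (tube γ ε)}
    (h : ∀ j, IsWeakDeriv (tube γ ε) j (hW.transfer U) (v j))
    (hG : hW.transfer G = diracExpr (tube γ ε) m (hW.transfer U) v)
    (h1 : InfiniteMass γ ε 1 (hW.transfer U)) (h2 : InfiniteMass γ ε (-1) (hW.transfer U))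
    (x : core) : ⟪hW.transfer (hW.curved m x), hW.transfer U⟫_ℂ =
      ⟪hW.transfer (incl x), hW.transfer G⟫_ℂ := by
  have lA := tendsto_integral_mul (φ := fun n : ℕ => cutoff ((n : ℝ) + 2))
    (fun n => continuous_cutoff _) (fun n => abs_cutoff_le _) (fun p hp => tendsto_cutoff hp)
    (hW.integrable_jac_mul (L2.integrable_inner (𝕜 := ℂ) (hW.curved m x) U))
  have lG := tendsto_integral_mul (φ := fun n : ℕ => cutoff ((n : ℝ) + 2))
    (fun n => continuous_cutoff _) (fun n => abs_cutoff_le _) (fun p hp => tendsto_cutoff hp)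
    (hW.integrable_jac_mul (integrable_inner_of_memLp (core.memLp x) G))
  have l := (lA.const_mul (ε : ℂ)).add (((tendsto_commS x U).const_mul (ε : ℂ)).add
    (hW.tendsto_commT x U h1 h2))
  have e := tendsto_nhds_unique (l.congr fun n : ℕ => hW.green_truncate h hG x (by
    have : (0 : ℝ) ≤ n := n.cast_nonneg
    linarith : (1 : ℝ) < n + 2)) (lG.const_mul (ε : ℂ))
  have hε0 : (ε : ℂ) ≠ 0 := by exact_mod_cast hW.pos.ne'
  simp only [mul_zero, add_zero, Complex.ofReal_one, one_mul] at e
  rw [hW.inner_of_corresponds (hW.corresponds_transfer _) (hW.corresponds_transfer _),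
    hW.inner_of_corresponds (hW.corresponds_transfer _) (hW.corresponds_transfer _)]
  have e3 : ∀ f : ℝ × ℝ → ℂ, ∫ p in strip, ((2 * ε * jac γ ε p : ℝ) : ℂ) * f p =
      2 * (ε * ∫ p in strip, ((jac γ ε p : ℝ) : ℂ) * f p) := fun f => by
    rw [← integral_const_mul, ← integral_const_mul]
    refine integral_congr_ae (Eventually.of_forall fun p => ?_)
    push_cast
    ring
  rw [e3, e3, e]
  congr 2
  refine integral_congr_ae ?_
  filter_upwards [coeFn_incl x] with p hp
  rw [hp]

/-- Green's formula: the Dirac operator is contained in the adjoint of its restriction to the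
core. -/
theorem inner_curved_eq (m : ℝ) {u f : L2 (tube γ ε)} (h : (u, f) ∈ diracGraph hW m) (x : core) :
    ⟪hW.transfer (hW.curved m x), u⟫_ℂ = ⟪hW.transfer (incl x), f⟫_ℂ := by
  obtain ⟨v, hv, h1, h2, hf⟩ := h
  obtain ⟨U, rfl⟩ := hW.transfer_surjective u
  obtain ⟨G, rfl⟩ := hW.transfer_surjective f
  exact hW.green_transfer hv hf h1 h2 x

end IsWaveguide

end Waveguide
end

/-! ### Relative bounds: the graph norm controls gradient and traces. -/

noncomputable section

open scoped InnerProductSpace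

namespace Waveguide

theorem norm_Lp_le_of_ae {X F G H : Type*} [MeasurableSpace X] [NormedAddCommGroup F]
    [NormedAddCommGroup G] [NormedAddCommGroup H] {μ : Measure X} {f : Lp F 2 μ} {g : Lp G 2 μ}
    {h : Lp H 2 μ} {a b : ℝ} (ha : 0 ≤ a) (hb : 0 ≤ b)
    (hp : ∀ᵐ p ∂μ, ‖f p‖ ≤ a * ‖g p‖ + b * ‖h p‖) : ‖f‖ ≤ a * ‖g‖ + b * ‖h‖ := by
  set g' : Lp ℝ 2 μ := (Lp.memLp g).norm.toLp _ with hg'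
  set h' : Lp ℝ 2 μ := (Lp.memLp h).norm.toLp _ with hh'
  have e1 : ‖g'‖ = ‖g‖ := by rw [hg', Lp.norm_toLp, eLpNorm_norm, Lp.norm_def]
  have e2 : ‖h'‖ = ‖h‖ := by rw [hh', Lp.norm_toLp, eLpNorm_norm, Lp.norm_def]
  calc ‖f‖ ≤ ‖a • g' + b • h'‖ := by
        refine Lp.norm_le_norm_of_ae_le ?_
        filter_upwards [hp, Lp.coeFn_add (a • g') (b • h'), Lp.coeFn_smul a g', Lp.coeFn_smul b h',
          (Lp.memLp g).norm.coeFn_toLp, (Lp.memLp h).norm.coeFn_toLp] with p h1 h2 h3 h4 h5 h6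
        rw [h2, Pi.add_apply, h3, h4, Pi.smul_apply, Pi.smul_apply, h5, h6]
        exact h1.trans (le_abs_self _)
    _ ≤ ‖a • g'‖ + ‖b • h'‖ := norm_add_le _ _
    _ = _ := by rw [norm_smul, norm_smul, e1, e2, Real.norm_of_nonneg ha, Real.norm_of_nonneg hb]

theorem cauchySeq_of_bound {N E F : Type*} [AddCommGroup N] [Module ℂ N] [NormedAddCommGroup E]
    [NormedSpace ℂ E] [NormedAddCommGroup F] [NormedSpace ℂ F] {e a : N →ₗ[ℂ] E} {A : N →ₗ[ℂ] F}
    {C : ℝ} (h : ∀ x, ‖A x‖ ≤ C * (‖e x‖ + ‖a x‖)) {x : ℕ → N} (he : CauchySeq fun n => e (x n))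
    (ha : CauchySeq fun n => a (x n)) : CauchySeq fun n => A (x n) := by
  rw [cauchySeq_iff_tendsto_dist_atTop_0] at *
  refine squeeze_zero (fun _ => dist_nonneg) (fun n => ?_) (by simpa using (he.add ha).const_mul C)
  rw [dist_eq_norm, dist_eq_norm, dist_eq_norm, ← map_sub, ← map_sub, ← map_sub]
  exact h _

theorem norm_symbol_sub_le (α m m' j c : ℝ) (y ys yt : Spinor) :
    ‖symbol α m j c y ys yt - symbol α m' 1 0 y ys yt‖ ≤
      |j - 1| * ‖ys‖ + (4 * |c| + 2 * |m - m'|) * ‖y‖ := by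
  have e : symbol α m j c y ys yt - symbol α m' 1 0 y ys yt =
      (j - 1) • sp (-Complex.I * ys 0) (Complex.I * ys 1) +
        sp (c * (y 0 - y 1) + (m - m' : ℝ) * y 1) (c * (y 0 - y 1) + (m - m' : ℝ) * y 0) := by
    apply spinor_ext <;> simp [symbol] <;> ring
  have hi := norm_spinor_apply_le y
  have hd : ∀ i, ‖(c : ℂ) * (y 0 - y 1) + (m - m' : ℝ) * y i‖ ≤ 2 * |c| * ‖y‖ + |m - m'| * ‖y‖ := by
    intro i
    refine (norm_add_le _ _).trans ?_
    rw [norm_mul, norm_mul, Complex.norm_real, Complex.norm_real, Real.norm_eq_abs, Real.norm_eq_abs]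
    have := (norm_sub_le (y 0) (y 1)).trans (add_le_add (hi 0) (hi 1))
    calc _ ≤ |c| * (‖y‖ + ‖y‖) + |m - m'| * ‖y‖ := by gcongr; exact hi i
      _ = _ := by ring
  rw [e]
  refine (norm_add_le _ _).trans ?_
  rw [norm_smul, norm_sp_I, Real.norm_eq_abs]
  have := (norm_sp_le (c * (y 0 - y 1) + (m - m' : ℝ) * y 1)
    (c * (y 0 - y 1) + (m - m' : ℝ) * y 0)).trans (add_le_add (hd 1) (hd 0))
  linarith

theorem coeFn_straight (α m : ℝ) (x : core) : straight α m x =ᵐ[volume.restrict strip]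
    fun p => symbol α m 1 0 ((x : ℝ × ℝ → Spinor) p) (dS x p) (dT x p) := coeFn_liftL2 _ _ x

theorem coeFn_inclS (x : core) : inclS x =ᵐ[volume.restrict strip] dS x := coeFn_liftL2 _ _ x

theorem coeFn_inclT (x : core) : inclT x =ᵐ[volume.restrict strip] dT x := coeFn_liftL2 _ _ x

theorem norm_inclS_le (α m : ℝ) (x : core) : ‖inclS x‖ ≤ ‖straight α m x‖ := by
  refine le_of_sq_le_sq ?_ (norm_nonneg _)
  rw [norm_straight_sq]
  nlinarith [sq_nonneg ‖transversal α m x‖]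

theorem norm_inclT_le {α m : ℝ} (hα : 0 < α) (hm : 0 ≤ m) (x : core) :
    ‖inclT x‖ ≤ α⁻¹ * ‖straight α m x‖ := by
  rw [le_inv_mul_iff₀ hα]
  refine le_of_sq_le_sq ?_ (norm_nonneg _)
  rw [norm_straight_sq, mul_pow]
  nlinarith [norm_transversal_ge_dT x hα.le hm, sq_nonneg ‖inclS x‖]

namespace IsWaveguide

variable {γ : ℝ → Plane} {ε : ℝ} (hW : IsWaveguide γ ε)
include hW

/-- `1/J - 1 = ε t κ / J`, so `q = εK / (1 - εK)` is admissible, and it is less than one because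
`2εK < 1`. This turns the smallness of `ε` into a relative bound below one. -/
theorem exists_inv_jac_sub_one_bound : ∃ q : ℝ, 0 ≤ q ∧ q < 1 ∧
    ∀ p ∈ strip, |(jac γ ε p)⁻¹ - 1| ≤ q := by
  obtain ⟨K, hK0, hK, hlt⟩ := hW.exists_curvature_bound
  have hε := hW.pos
  have h0 : 0 ≤ ε * K := by positivity
  refine ⟨ε * K / (1 - ε * K), div_nonneg h0 (by linarith), ?_, fun p hp => ?_⟩
  · rw [div_lt_one (by linarith)]; linarith
  · have ht := abs_le_of_mem_strip hp
    have h1 : |ε * p.2 * curvature γ p.1| ≤ ε * K := by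
      rw [abs_mul, abs_mul, abs_of_pos hε]
      calc ε * |p.2| * |curvature γ p.1| ≤ ε * 1 * K := by gcongr; exact hK _
        _ = ε * K := by ring
    have hJ : 1 - ε * K ≤ jac γ ε p := by
      have := (abs_le.1 h1).2
      rw [jac]; linarith
    have hJ0 : 0 < jac γ ε p := by linarith
    have e : (jac γ ε p)⁻¹ - 1 = ε * p.2 * curvature γ p.1 / jac γ ε p := by
      rw [eq_div_iff hJ0.ne', sub_mul, inv_mul_cancel₀ hJ0.ne', jac]; ring
    rw [e, abs_div, abs_of_pos hJ0]
    exact div_le_div₀ h0 h1 (by linarith) hJ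

/-- The curved operator is a relatively bounded perturbation of the straight one. -/
theorem exists_curved_sub_straight_bound (m m' : ℝ) : ∃ q b : ℝ, 0 ≤ q ∧ q < 1 ∧ 0 ≤ b ∧
    ∀ x : core, ‖hW.curved m x - straight ε⁻¹ m' x‖ ≤ q * ‖inclS x‖ + b * ‖incl x‖ := by
  obtain ⟨q, hq0, hq1, hq⟩ := hW.exists_inv_jac_sub_one_bound
  obtain ⟨B, hB1, hB⟩ := hW.exists_coeff_bound
  refine ⟨q, 4 * B + 2 * |m - m'|, hq0, hq1, by positivity, fun x => ?_⟩
  refine norm_Lp_le_of_ae hq0 (by positivity) ?_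
  filter_upwards [Lp.coeFn_sub (hW.curved m x) (straight ε⁻¹ m' x), hW.coeFn_curved m x,
    coeFn_straight ε⁻¹ m' x, coeFn_inclS x, coeFn_incl x,
    ae_restrict_mem isOpen_strip.measurableSet] with p h1 h2 h3 h4 h5 hp
  rw [h1, Pi.sub_apply, h2, h3, h4, h5]
  refine (norm_symbol_sub_le _ _ _ _ _ _ _ _).trans ?_
  gcongr
  · exact hq p hp
  · exact (hB p hp).2.1

/-- The graph norm controls the derivatives. -/
theorem exists_graph_bound {m : ℝ} (hm : 0 ≤ m) : ∃ C : ℝ, 0 ≤ C ∧ ∀ x : core,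
    ‖inclS x‖ ≤ C * (‖incl x‖ + ‖hW.curved m x‖) ∧
    ‖inclT x‖ ≤ C * (‖incl x‖ + ‖hW.curved m x‖) := by
  obtain ⟨q, b, hq0, hq1, hb, h⟩ := hW.exists_curved_sub_straight_bound m m
  have hε := hW.pos
  have h1q : 0 < 1 - q := by linarith
  -- The straight norm is at most the curved norm plus `q` times itself plus `b ‖incl x‖`. The
  -- middle term is absorbed on the left.
  set D := (1 + b) / (1 - q) with hD
  have hD0 : 0 ≤ D := by positivity
  have key : ∀ x : core, ‖straight ε⁻¹ m x‖ ≤ D * (‖incl x‖ + ‖hW.curved m x‖) := fun x => by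
    rw [hD, div_mul_eq_mul_div, le_div_iff₀ h1q]
    have e1 : ‖straight ε⁻¹ m x‖ ≤ ‖hW.curved m x‖ + ‖hW.curved m x - straight ε⁻¹ m x‖ := by
      have := norm_sub_le (hW.curved m x) (hW.curved m x - straight ε⁻¹ m x)
      rwa [sub_sub_cancel] at this
    have e2 := h x
    have e3 := mul_le_mul_of_nonneg_left (norm_inclS_le ε⁻¹ m x) hq0
    have := mul_nonneg hb (norm_nonneg (hW.curved m x))
    nlinarith [norm_nonneg (incl x)]
  refine ⟨D + ε * D, by positivity, fun x => ⟨?_, ?_⟩⟩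
  · have := (norm_inclS_le ε⁻¹ m x).trans (key x)
    have h2 : 0 ≤ ε * D * (‖incl x‖ + ‖hW.curved m x‖) := by positivity
    linarith
  · have := norm_inclT_le (inv_pos.2 hε) hm x
    rw [inv_inv] at this
    have h3 := mul_le_mul_of_nonneg_left (key x) hε.le
    have h2 : 0 ≤ D * (‖incl x‖ + ‖hW.curved m x‖) := by positivity
    linarith

theorem exists_inclG_bound {m : ℝ} (hm : 0 ≤ m) (j : Fin 2) : ∃ C : ℝ, 0 ≤ C ∧ ∀ x : core,
    ‖hW.inclG j x‖ ≤ C * (‖incl x‖ + ‖hW.curved m x‖) := by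
  obtain ⟨C, hC0, hC⟩ := hW.exists_graph_bound hm
  obtain ⟨D, hD0, hD⟩ := hW.exists_gradFrame_bound
  refine ⟨D * (1 + C + C), by positivity, fun x => ?_⟩
  obtain ⟨h1, h2⟩ := hC x
  have hY : ‖(incl x : StripL2)‖ ≤ ‖incl x‖ := le_rfl
  set Y : Lp ℝ 2 (volume.restrict strip) := (Lp.memLp (incl x)).norm.toLp _ +
    (Lp.memLp (inclS x)).norm.toLp _ with hYdef
  have e1 : ‖Y‖ ≤ ‖incl x‖ + ‖inclS x‖ := by
    refine (norm_add_le _ _).trans_eq ?_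
    rw [Lp.norm_toLp, Lp.norm_toLp, eLpNorm_norm, eLpNorm_norm, Lp.norm_def, Lp.norm_def]
  have e2 : ‖hW.inclG j x‖ ≤ D * ‖Y‖ + D * ‖inclT x‖ := by
    refine norm_Lp_le_of_ae hD0 hD0 ?_
    filter_upwards [hW.coeFn_inclG j x, coeFn_incl x, coeFn_inclS x, coeFn_inclT x,
      (Lp.memLp (incl x)).norm.coeFn_toLp, (Lp.memLp (inclS x)).norm.coeFn_toLp,
      Lp.coeFn_add ((Lp.memLp (incl x)).norm.toLp _) ((Lp.memLp (inclS x)).norm.toLp _),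
      ae_restrict_mem isOpen_strip.measurableSet] with p g0 g1 g2 g3 g4 g5 g6 hp
    rw [g0, g3, hYdef, g6, Pi.add_apply, g4, g5, g1, g2]
    refine (hD j x p hp).trans ?_
    rw [Real.norm_of_nonneg (by positivity)]
    linarith
  have e3 := mul_le_mul_of_nonneg_left e1 hD0
  have e4 := mul_le_mul_of_nonneg_left h1 hD0
  have e5 := mul_le_mul_of_nonneg_left h2 hD0
  have := mul_nonneg hD0 (norm_nonneg (hW.curved m x))
  linarith

end IsWaveguide

/-! ### Traces -/

/-- The boundary value is compared with the value at `t` by the fundamental theorem of calculus, and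
the estimate is averaged over `t` in an interval of length `2`. -/
theorem norm_core_slice_sq_le {τ : ℝ} (hτ : |τ| ≤ 1) (x : core) (s : ℝ) :
    ‖(x : ℝ × ℝ → Spinor) (s, τ)‖ ^ 2 ≤ (∫ t in (-1)..1, ‖(x : ℝ × ℝ → Spinor) (s, t)‖ ^ 2) +
      4 * ∫ t in (-1)..1, ‖dT x (s, t)‖ ^ 2 := by
  set Q := ∫ t in (-1)..1, ‖dT x (s, t)‖ ^ 2 with hQ
  have hpt : ∀ t ∈ Icc (-1 : ℝ) 1, ‖(x : ℝ × ℝ → Spinor) (s, τ)‖ ^ 2 ≤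
      2 * ‖(x : ℝ × ℝ → Spinor) (s, t)‖ ^ 2 + 4 * Q := by
    intro t ht
    have h1 := norm_sub_sq_le_integral (f := fun t => (x : ℝ × ℝ → Spinor) (s, t))
      (hasDerivAt_snd (core.differentiable x) s)
      ((core.continuous_dT x).comp (by fun_prop : Continuous fun t : ℝ => (s, t))) ht (abs_le.1 hτ)
    have hQ0 : 0 ≤ Q := intervalIntegral.integral_nonneg (by norm_num) fun t _ => by positivity
    have h2 : |τ - t| ≤ 2 := by
      rw [abs_le]; have := abs_le.1 hτ; constructor <;> linarith [ht.1, ht.2, this.1, this.2]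
    have h3 := mul_le_mul_of_nonneg_right h2 hQ0
    have h4 : ‖(x : ℝ × ℝ → Spinor) (s, τ)‖ ≤ ‖(x : ℝ × ℝ → Spinor) (s, t)‖ +
        ‖(x : ℝ × ℝ → Spinor) (s, τ) - (x : ℝ × ℝ → Spinor) (s, t)‖ := by
      have := norm_add_le ((x : ℝ × ℝ → Spinor) (s, t))
        ((x : ℝ × ℝ → Spinor) (s, τ) - (x : ℝ × ℝ → Spinor) (s, t))
      rwa [add_sub_cancel] at this
    have h5 := pow_le_pow_left₀ (norm_nonneg _) h4 2
    have h6 : ‖(x : ℝ × ℝ → Spinor) (s, τ) - (x : ℝ × ℝ → Spinor) (s, t)‖ ^ 2 ≤ 2 * Q := by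
      linarith [h1]
    nlinarith [sq_nonneg (‖(x : ℝ × ℝ → Spinor) (s, t)‖ -
      ‖(x : ℝ × ℝ → Spinor) (s, τ) - (x : ℝ × ℝ → Spinor) (s, t)‖)]
  have hc : Continuous fun t => ‖(x : ℝ × ℝ → Spinor) (s, t)‖ ^ 2 :=
    ((core.continuous x).comp (by fun_prop : Continuous fun t : ℝ => (s, t))).norm.pow 2
  have h := intervalIntegral.integral_mono_on (μ := volume) (by norm_num : (-1 : ℝ) ≤ 1)
    (continuous_const.intervalIntegrable _ _)
    ((by fun_prop : Continuous fun t => 2 * ‖(x : ℝ × ℝ → Spinor) (s, t)‖ ^ 2 +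
      4 * Q).intervalIntegrable _ _) hpt
  rw [intervalIntegral.integral_const, intervalIntegral.integral_add
    ((by fun_prop : Continuous fun t => 2 * ‖(x : ℝ × ℝ → Spinor) (s, t)‖ ^ 2).intervalIntegrable _ _)
    (continuous_const.intervalIntegrable _ _),
    intervalIntegral.integral_const_mul, intervalIntegral.integral_const] at h
  norm_num at h
  linarith

theorem integral_slice_sq (x : core) :
    Integrable (fun s => ∫ t in (-1)..1, ‖(x : ℝ × ℝ → Spinor) (s, t)‖ ^ 2) ∧
    ∫ s, ∫ t in (-1)..1, ‖(x : ℝ × ℝ → Spinor) (s, t)‖ ^ 2 = ‖incl x‖ ^ 2 := by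
  have hi := (memLp_two_iff_integrable_sq_norm (core.memLp x).1).1 (core.memLp x)
  constructor
  · have h2 := hi
    rw [volume_restrict_strip] at h2
    refine h2.integral_prod_left.congr (Eventually.of_forall fun s => ?_)
    simp only
    rw [intervalIntegral.integral_of_le (by norm_num), integral_Ioc_eq_integral_Ioo]
  · have e : ‖incl x‖ ^ 2 = ∫ p in strip, ‖(x : ℝ × ℝ → Spinor) p‖ ^ 2 :=
      norm_liftL2_sq core.subtype _ x
    rw [e, integral_strip hi]

namespace IsWaveguide

variable {γ : ℝ → Plane} {ε : ℝ} (hW : IsWaveguide γ ε)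
include hW

/-- The boundary trace of the core. -/
def traceLin {τ : ℝ} (hτ : τ = 1 ∨ τ = -1) : core →ₗ[ℂ] Lp Spinor 2 (volume : Measure ℝ) where
  toFun x := (hW.memLp_coreTrace hτ x).toLp _
  map_add' x y := by
    rw [← MemLp.toLp_add]
    congr 1
    funext s
    exact frame_add _ _ _
  map_smul' c x := by
    rw [RingHom.id_apply, ← MemLp.toLp_const_smul]
    congr 1
    funext s
    exact frame_smul _ _ _

theorem coeFn_traceLin {τ : ℝ} (hτ : τ = 1 ∨ τ = -1) (x : core) :
    hW.traceLin hτ x =ᵐ[volume] coreTrace γ τ x := (hW.memLp_coreTrace hτ x).coeFn_toLp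

theorem norm_traceLin_sq_le {τ : ℝ} (hτ : τ = 1 ∨ τ = -1) (x : core) :
    ‖hW.traceLin hτ x‖ ^ 2 ≤ 2 * ‖incl x‖ ^ 2 + 8 * ‖inclT x‖ ^ 2 := by
  have h1 : ‖hW.traceLin hτ x‖ ^ 2 = ∫ s, ‖coreTrace γ τ x s‖ ^ 2 :=
    norm_toLp_sq (hW.memLp_coreTrace hτ x)
  obtain ⟨i1, e1⟩ := integral_slice_sq x
  obtain ⟨i2, e2⟩ := integral_dT_slice_sq x
  rw [h1, ← e1, ← e2, ← integral_const_mul, ← integral_const_mul,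
    ← integral_add (i1.const_mul _) (i2.const_mul _)]
  refine integral_mono (memLp_two_iff_integrable_sq_norm (hW.memLp_coreTrace hτ x).1 |>.1
    (hW.memLp_coreTrace hτ x)) ((i1.const_mul _).add (i2.const_mul _)) fun s => ?_
  have := norm_core_slice_sq_le (abs_eq_one_of hτ).le x s
  simp only
  rw [coreTrace, norm_sq_frame (hW.norm_tang s)]
  linarith

theorem exists_traceLin_bound {m : ℝ} (hm : 0 ≤ m) {τ : ℝ} (hτ : τ = 1 ∨ τ = -1) :
    ∃ C : ℝ, 0 ≤ C ∧ ∀ x : core, ‖hW.traceLin hτ x‖ ≤ C * (‖incl x‖ + ‖hW.curved m x‖) := by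
  obtain ⟨C, hC0, hC⟩ := hW.exists_graph_bound hm
  refine ⟨2 + 4 * C, by positivity, fun x => ?_⟩
  have h1 : ‖hW.traceLin hτ x‖ ≤ 2 * ‖incl x‖ + 4 * ‖inclT x‖ := by
    refine le_of_sq_le_sq ((hW.norm_traceLin_sq_le hτ x).trans ?_) (by positivity)
    nlinarith [mul_nonneg (norm_nonneg (incl x)) (norm_nonneg (inclT x)), sq_nonneg ‖incl x‖,
      sq_nonneg ‖inclT x‖]
  have := (hC x).2
  nlinarith [norm_nonneg (incl x), norm_nonneg (hW.curved m x)]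

end IsWaveguide

end Waveguide
end

/-! ### The closure of the core lies in the graph. -/

noncomputable section

open scoped InnerProductSpace

namespace Waveguide

theorem tendsto_integral_smul {Ω : Set Plane} {ψ : Plane → ℝ} (hψ : Continuous ψ)
    (hc : HasCompactSupport ψ) {u : ℕ → L2 Ω} {u' : L2 Ω} (h : Tendsto u atTop (𝓝 u')) :
    Tendsto (fun n => ∫ x in Ω, ψ x • u n x) atTop (𝓝 (∫ x in Ω, ψ x • u' x)) := by
  have hm : MemLp ψ 2 (volume.restrict Ω) := hψ.memLp_of_hasCompactSupport hc
  have key : ∀ w : L2 Ω, ContinuousLinearMap.lpPairing (volume.restrict Ω) 2 2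
      (ContinuousLinearMap.lsmul ℝ ℝ : ℝ →L[ℝ] Spinor →L[ℝ] Spinor) (hm.toLp ψ) w =
      ∫ x in Ω, ψ x • w x := by
    intro w
    rw [ContinuousLinearMap.lpPairing_eq_integral]
    refine integral_congr_ae ?_
    filter_upwards [hm.coeFn_toLp] with x hx
    rw [hx, ContinuousLinearMap.lsmul_apply]
  simp only [← key]
  exact ((ContinuousLinearMap.continuous _).tendsto _).comp h

theorem IsWeakDeriv.of_tendsto {Ω : Set Plane} {j : Fin 2} {u v : ℕ → L2 Ω} {u' v' : L2 Ω}
    (h : ∀ n, IsWeakDeriv Ω j (u n) (v n)) (hu : Tendsto u atTop (𝓝 u'))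
    (hv : Tendsto v atTop (𝓝 v')) : IsWeakDeriv Ω j u' v' := by
  intro φ hφ hc hs
  have l1 := tendsto_integral_smul (ψ := fun x => fderiv ℝ φ x (EuclideanSpace.single j 1))
    ((hφ.continuous_fderiv (by simp)).clm_apply continuous_const) (hc.fderiv_apply ℝ _) hu
  have l2 := (tendsto_integral_smul hφ.continuous hc hv).neg
  exact tendsto_nhds_unique (l1.congr fun n => h n φ hφ hc hs) l2

theorem tendsto_diracExpr {Ω : Set Plane} (m : ℝ) {u : ℕ → L2 Ω} {v : ℕ → Fin 2 → L2 Ω} {u' : L2 Ω}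
    {v' : Fin 2 → L2 Ω} (hu : Tendsto u atTop (𝓝 u')) (hv : ∀ j, Tendsto (fun n => v n j) atTop (𝓝 (v' j))) :
    Tendsto (fun n => diracExpr Ω m (u n) (v n)) atTop (𝓝 (diracExpr Ω m u' v')) := by
  have hp : ∀ (k : Fin 3) {w : ℕ → L2 Ω} {w' : L2 Ω}, Tendsto w atTop (𝓝 w') →
      Tendsto (fun n => (pauliMap k).compLpL 2 (volume.restrict Ω) (w n)) atTop
        (𝓝 ((pauliMap k).compLpL 2 _ w')) := fun k w w' hw =>
    ((ContinuousLinearMap.continuous _).tendsto _).comp hw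
  exact (((hp 0 (hv 0)).add (hp 1 (hv 1))).const_smul _).add ((hp 2 hu).const_smul _)

theorem layerMean_zero_left_le {γ : ℝ → Plane} {ε τ δ : ℝ} (hδ : 0 < δ) {g : ℝ → Spinor}
    (hg : StronglyMeasurable g) : layerMean γ ε τ 0 g δ ≤ ∫⁻ s, ‖g s‖ₑ ^ 2 := by
  have h : layerMean γ ε τ 0 g δ = (ENNReal.ofReal δ)⁻¹ * ∫⁻ p in layer δ, ‖g p.1‖ₑ ^ 2 := by
    simp [layerMean, layer]
  rw [h, lintegral_layer_fst (f := fun s => ‖g s‖ₑ ^ 2) (hg.enorm.pow_const 2), ← mul_assoc,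
    ENNReal.inv_mul_cancel (by simpa using hδ) (by simp), one_mul]

namespace IsWaveguide

variable {γ : ℝ → Plane} {ε : ℝ} (hW : IsWaveguide γ ε)
include hW

/-- The factor `1/δ` is harmless: the estimate is applied to the error of an approximation by the
core, which tends to zero for fixed `δ` before `δ → 0`. -/
theorem layerMean_zero_right_le {τ δ : ℝ} (hτ : τ = 1 ∨ τ = -1) (hδ : δ ≤ 1) (w : Plane → Spinor) :
    layerMean γ ε τ w 0 δ ≤
      (ENNReal.ofReal δ)⁻¹ * (2 * ((ENNReal.ofReal ε)⁻¹ * ∫⁻ y in tube γ ε, ‖w y‖ₑ ^ 2)) := by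
  refine mul_le_mul' le_rfl ?_
  set F : ℝ × ℝ → Spinor := fun p => unframe (tang γ p.1) (w (tubeMap γ ε p)) with hF
  have hc : Corresponds γ ε w F := Eventually.of_forall fun p =>
    (frame_unframe (hW.norm_tang _) _).symm
  have hε : ENNReal.ofReal ε ≠ 0 := by simpa using hW.pos
  calc ∫⁻ p in layer δ, ‖w (tubeMap γ ε (p.1, τ * p.2)) - (0 : ℝ → Spinor) p.1‖ₑ ^ 2
      ≤ ∫⁻ p in strip, ‖w (tubeMap γ ε (flip τ p))‖ₑ ^ 2 := by
        simp only [Pi.zero_apply, sub_zero]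
        exact lintegral_mono_set (layer_subset_strip hδ)
    _ = ∫⁻ p in strip, ‖w (tubeMap γ ε p)‖ₑ ^ 2 :=
        (measurePreserving_flip_strip hτ).lintegral_comp_emb (measurableEmbedding_flip hτ)
          fun p => ‖w (tubeMap γ ε p)‖ₑ ^ 2
    _ = 2 * ∫⁻ p in strip, ‖F p‖ₑ ^ 2 := by
        rw [← lintegral_const_mul' _ _ (by simp)]
        refine lintegral_congr_ae ?_
        filter_upwards [hc] with p hp
        rw [hp, enorm_sq_frame (hW.norm_tang _)]
    _ ≤ _ := by
        refine mul_le_mul' le_rfl ?_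
        have h := mul_le_mul' (le_refl (ENNReal.ofReal ε)⁻¹) (hW.le_lintegral_of_corresponds hc)
        rwa [← mul_assoc, ENNReal.inv_mul_cancel hε (by simp), one_mul] at h

/-- Limits in the graph norm of elements of the core have boundary traces. -/
theorem infiniteMass_of_tendsto {τ : ℝ} (hτ : τ = 1 ∨ τ = -1) {x : ℕ → core} {u : L2 (tube γ ε)}
    {g : Lp Spinor 2 (volume : Measure ℝ)} {M : ℝ}
    (hu : Tendsto (fun n => hW.transfer (incl (x n))) atTop (𝓝 u))
    (hg : Tendsto (fun n => hW.traceLin hτ (x n)) atTop (𝓝 g)) (hM : ∀ n, ‖inclT (x n)‖ ≤ M) :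
    InfiniteMass γ ε τ u := by
  refine ⟨g, ⟨Lp.memLp g, u, Lp.stronglyMeasurable u, ae_eq_rfl, ?_⟩, ?_⟩
  · -- convergence in the layer
    -- Split `u - g` into the error of the `n`-th core field, the error of its trace, and the layer
    -- mean of that core field. For fixed `δ` the two errors vanish as `n → ∞`; the last term is
    -- bounded uniformly in `n` through `M`.
    have hub : ∀ δ ∈ Ioo (0 : ℝ) 1, layerMean γ ε τ u g δ ≤ 2 * ENNReal.ofReal (2 * δ * M ^ 2) := by
      intro δ hδ
      have hle : ∀ n, layerMean γ ε τ u g δ ≤ 2 * (2 * ((ENNReal.ofReal δ)⁻¹ * (2 *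
          ((ENNReal.ofReal ε)⁻¹ * ‖u - hW.transfer (incl (x n))‖ₑ ^ 2)) +
          ‖g - hW.traceLin hτ (x n)‖ₑ ^ 2) + ENNReal.ofReal (2 * δ * M ^ 2)) := by
        intro n
        set w := pushField γ ε (x n) with hw
        set c := coreTrace γ τ (x n) with hc
        have hwm : StronglyMeasurable w := hW.stronglyMeasurable_pushField (x n)
        have hcm : StronglyMeasurable c := (hW.continuous_coreTrace τ (x n)).stronglyMeasurable
        have hum := Lp.stronglyMeasurable u
        have hgm := Lp.stronglyMeasurable g
        have h1 := layerMean_add_le hW.contDiff (ε := ε) (τ := τ) (w := u - w) (w' := w)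
          (g := g - c) (g' := c) (hum.sub hwm) (hgm.sub hcm).aestronglyMeasurable δ
        rw [sub_add_cancel, sub_add_cancel] at h1
        have h2 := layerMean_add_le hW.contDiff (ε := ε) (τ := τ) (w := u - w) (w' := 0)
          (g := 0) (g' := g - c) (hum.sub hwm) aestronglyMeasurable_const δ
        rw [add_zero, zero_add] at h2
        have h3 := hW.layerMean_zero_right_le hτ hδ.2.le (u - w)
        have h4 := layerMean_zero_left_le (γ := γ) (ε := ε) (τ := τ) hδ.1 (hgm.sub hcm)
        have h5 := hW.layerMean_core_le hτ (x n) hδ.1 hδ.2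
        have e3 : ∫⁻ y in tube γ ε, ‖(u - w) y‖ₑ ^ 2 = ‖u - hW.transfer (incl (x n))‖ₑ ^ 2 := by
          rw [enorm_Lp_sq]
          refine lintegral_congr_ae ?_
          filter_upwards [Lp.coeFn_sub u (hW.transfer (incl (x n))),
            hW.transfer_incl_ae (x n)] with y hy1 hy2
          rw [hy1, Pi.sub_apply, Pi.sub_apply, hy2]
        have e4 : ∫⁻ s, ‖(g - c) s‖ₑ ^ 2 = ‖g - hW.traceLin hτ (x n)‖ₑ ^ 2 := by
          rw [enorm_Lp_sq]
          refine lintegral_congr_ae ?_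
          filter_upwards [Lp.coeFn_sub g (hW.traceLin hτ (x n)),
            hW.coeFn_traceLin hτ (x n)] with y hy1 hy2
          rw [hy1, Pi.sub_apply, Pi.sub_apply, hy2]
        rw [e3] at h3
        rw [e4] at h4
        have h6 : ENNReal.ofReal (2 * δ * ‖inclT (x n)‖ ^ 2) ≤ ENNReal.ofReal (2 * δ * M ^ 2) := by
          refine ENNReal.ofReal_le_ofReal (mul_le_mul_of_nonneg_left ?_ (by linarith [hδ.1]))
          exact pow_le_pow_left₀ (norm_nonneg _) (hM n) 2
        exact h1.trans (mul_le_mul' le_rfl (add_le_add (h2.trans (mul_le_mul' le_rfl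
          (add_le_add h3 h4))) (h5.trans h6)))
      have l1 : Tendsto (fun n => ‖u - hW.transfer (incl (x n))‖ₑ ^ 2) atTop (𝓝 0) := by
        have h1 : Tendsto (fun n => u - hW.transfer (incl (x n))) atTop (𝓝 0) := by
          simpa using (tendsto_const_nhds (x := u)).sub hu
        have := ENNReal.Tendsto.pow (n := 2) ((continuous_enorm.tendsto _).comp h1)
        simpa using this
      have l2 : Tendsto (fun n => ‖g - hW.traceLin hτ (x n)‖ₑ ^ 2) atTop (𝓝 0) := by
        have h1 : Tendsto (fun n => g - hW.traceLin hτ (x n)) atTop (𝓝 0) := by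
          simpa using (tendsto_const_nhds (x := g)).sub hg
        have := ENNReal.Tendsto.pow (n := 2) ((continuous_enorm.tendsto _).comp h1)
        simpa using this
      have hδ0 : (ENNReal.ofReal δ)⁻¹ ≠ ⊤ := by simpa using hδ.1
      have hε0 : (ENNReal.ofReal ε)⁻¹ ≠ ⊤ := by simpa using hW.pos
      have l3 := ENNReal.Tendsto.const_mul (a := (ENNReal.ofReal δ)⁻¹) (ENNReal.Tendsto.const_mul
        (a := 2) (ENNReal.Tendsto.const_mul (a := (ENNReal.ofReal ε)⁻¹) l1 (Or.inr hε0))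
        (Or.inr (by simp))) (Or.inr hδ0)
      have l4 := ENNReal.Tendsto.const_mul (a := 2) ((ENNReal.Tendsto.const_mul (a := 2) (l3.add l2)
        (Or.inr (by simp))).add_const (ENNReal.ofReal (2 * δ * M ^ 2))) (Or.inr (by simp))
      simp only [mul_zero, add_zero, zero_add] at l4
      exact ge_of_tendsto' l4 hle
    have hlim : Tendsto (fun δ : ℝ => 2 * ENNReal.ofReal (2 * δ * M ^ 2)) (𝓝[>] 0) (𝓝 0) := by
      have h1 : Tendsto (fun δ : ℝ => ENNReal.ofReal (2 * δ * M ^ 2)) (𝓝 0)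
          (𝓝 (ENNReal.ofReal (2 * 0 * M ^ 2))) :=
        (ENNReal.continuous_ofReal.comp (by fun_prop)).tendsto _
      have h2 := ENNReal.Tendsto.const_mul (a := 2) (h1.mono_left
        (nhdsWithin_le_nhds (s := Ioi 0))) (Or.inr (by simp))
      simpa using h2
    refine tendsto_of_tendsto_of_tendsto_of_le_of_le' tendsto_const_nhds hlim
      (Eventually.of_forall fun _ => zero_le) ?_
    filter_upwards [Ioo_mem_nhdsGT (zero_lt_one (α := ℝ))] with δ hδ
    exact hub δ hδ
  -- The boundary condition is a pointwise linear equation, so it passes to the limit along a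
  -- subsequence of traces that converges almost everywhere.
  · obtain ⟨ns, -, hns⟩ := (tendstoInMeasure_of_tendsto_Lp hg).exists_seq_tendsto_ae
    have hall : ∀ᵐ s : ℝ, ∀ n, hW.traceLin hτ (x n) s = coreTrace γ τ (x n) s :=
      ae_all_iff.2 fun n => hW.coeFn_traceLin hτ (x n)
    filter_upwards [hns, hall] with s hs h2
    have hcont : Continuous fun y : Spinor =>
        (-Complex.I) • pauliMap 2 (sigmaDot (τ • normal γ s) y) := by fun_prop
    refine tendsto_nhds_unique (((hcont.tendsto _).comp hs).congr fun n => ?_) hs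
    simp only [Function.comp_apply]
    rw [h2]
    exact coreTrace_boundary hW hτ _ s

theorem cauchySeq_of_transfer {X : ℕ → StripL2} {u : L2 (tube γ ε)}
    (h : Tendsto (fun n => hW.transfer (X n)) atTop (𝓝 u)) : CauchySeq X := by
  have hc := h.cauchySeq
  rw [cauchySeq_iff_tendsto_dist_atTop_0] at *
  have hε := hW.pos
  refine squeeze_zero (fun _ => dist_nonneg) (fun n => ?_) (by simpa using hc.const_mul (√ε)⁻¹)
  rw [dist_eq_norm, dist_eq_norm, ← map_sub, le_inv_mul_iff₀ (Real.sqrt_pos.2 hε)]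
  refine le_of_sq_le_sq ?_ (norm_nonneg _)
  rw [mul_pow, Real.sq_sqrt hε.le]
  exact hW.norm_transfer_sq_ge _

/-- The graph of the Dirac operator contains the closure of the core. -/
theorem closure_core_subset {m : ℝ} (hm : 0 ≤ m) :
    closure (range fun x : core => (hW.transfer (incl x), hW.transfer (hW.curved m x))) ⊆
      (diracGraph hW m : Set (L2 (tube γ ε) × L2 (tube γ ε))) := by
  rintro ⟨u, f⟩ huf
  obtain ⟨p, hp, hlim⟩ := mem_closure_iff_seq_limit.1 huf
  choose x hx using hp
  have hu : Tendsto (fun n => hW.transfer (incl (x n))) atTop (𝓝 u) :=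
    ((continuous_fst.tendsto _).comp hlim).congr fun n => by simp [← hx n]
  have hf : Tendsto (fun n => hW.transfer (hW.curved m (x n))) atTop (𝓝 f) :=
    ((continuous_snd.tendsto _).comp hlim).congr fun n => by simp [← hx n]
  have c1 := hW.cauchySeq_of_transfer hu
  have c2 := hW.cauchySeq_of_transfer hf
  have hG : ∀ j, ∃ v, Tendsto (fun n => hW.inclG j (x n)) atTop (𝓝 v) := fun j => by
    obtain ⟨C, -, hC⟩ := hW.exists_inclG_bound hm j
    exact cauchySeq_tendsto_of_complete (cauchySeq_of_bound hC c1 c2)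
  choose v hv using hG
  have hTr : ∀ {τ : ℝ} (hτ : τ = 1 ∨ τ = -1), ∃ g, Tendsto (fun n => hW.traceLin hτ (x n)) atTop (𝓝 g) := by
    intro τ hτ
    obtain ⟨C, -, hC⟩ := hW.exists_traceLin_bound hm hτ
    exact cauchySeq_tendsto_of_complete (cauchySeq_of_bound hC c1 c2)
  obtain ⟨M, hM⟩ : ∃ M, ∀ n, ‖inclT (x n)‖ ≤ M := by
    obtain ⟨C, -, hC⟩ := hW.exists_graph_bound hm
    have := (cauchySeq_of_bound (A := inclT) (fun y => (hC y).2) c1 c2).isBounded_range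
    obtain ⟨M, hM⟩ := this.exists_norm_le
    exact ⟨M, fun n => hM _ (mem_range_self n)⟩
  have hv' : ∀ j, Tendsto (fun n => hW.transfer (hW.inclG j (x n))) atTop (𝓝 (hW.transfer (v j))) :=
    fun j => (hW.transfer.continuous.tendsto _).comp (hv j)
  obtain ⟨g1, hg1⟩ := hTr (Or.inl rfl : (1 : ℝ) = 1 ∨ (1 : ℝ) = -1)
  obtain ⟨g2, hg2⟩ := hTr (Or.inr rfl : (-1 : ℝ) = 1 ∨ (-1 : ℝ) = -1)
  refine ⟨fun j => hW.transfer (v j), fun j => IsWeakDeriv.of_tendsto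
    (fun n => hW.isWeakDeriv_core j (x n)) hu (hv' j), hW.infiniteMass_of_tendsto _ hu hg1 hM,
    hW.infiniteMass_of_tendsto _ hu hg2 hM, ?_⟩
  refine tendsto_nhds_unique hf ((tendsto_diracExpr m hu hv').congr fun n => ?_)
  exact hW.diracExpr_core m (x n)

end IsWaveguide

end Waveguide
end

/-! ### Self-adjointness, and the spectrum in terms of the strip. -/

noncomputable section

open scoped InnerProductSpace

namespace Waveguide

/-- Cauchy-Schwarz in the plane for `(q, b/μ)` and `(s, μe)`. For large `μ` it absorbs the bounded
part `b` of the perturbation. -/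
theorem add_mul_le_sqrt {q b μ s e : ℝ} (hμ : 0 < μ) :
    q * s + b * e ≤ √(q ^ 2 + (b / μ) ^ 2) * √(s ^ 2 + μ ^ 2 * e ^ 2) := by
  rw [← Real.sqrt_mul (by positivity)]
  refine Real.le_sqrt_of_sq_le ?_
  have e1 : (q ^ 2 + (b / μ) ^ 2) * (s ^ 2 + μ ^ 2 * e ^ 2) - (q * s + b * e) ^ 2 =
      (q * μ * e - b / μ * s) ^ 2 := by
    field_simp
    ring
  nlinarith [sq_nonneg (q * μ * e - b / μ * s)]

theorem dense_range_straight {α μ : ℝ} (hμ : μ ≠ 0) :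
    Dense (LinearMap.range (straight α 0 - (μ * Complex.I : ℂ) • incl) : Set StripL2) := by
  rw [Submodule.dense_iff_topologicalClosure_eq_top,
    Submodule.topologicalClosure_eq_top_iff, Submodule.eq_bot_iff]
  intro y hy
  rw [Submodule.mem_orthogonal'] at hy
  exact straight_range_dense (α := α) hμ y fun x => hy _ ⟨x, rfl⟩

namespace IsWaveguide

variable {γ : ℝ → Plane} {ε : ℝ} (hW : IsWaveguide γ ε)
include hW

/-- The curved operator is compared with the massless straight one, whose modes are explicit; the
mass only changes the bounded part `b`. Since `‖(S - iμ)x‖² = ‖S x‖² + μ² ‖x‖²` for the straight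
operator `S`, the perturbation relative to `S - iμ` has bound `√(q² + (b/μ)²)`, which is less than
one for large `μ`. Both signs of `μ` are needed for the criterion. -/
theorem exists_curved_range_dense (m : ℝ) : ∃ μ : ℝ, 0 < μ ∧ ∀ μ' : ℝ, |μ'| = μ → ∀ y : StripL2,
    (∀ x : core, ⟪y, hW.curved m x - (μ' * Complex.I : ℂ) • incl x⟫_ℂ = 0) → y = 0 := by
  obtain ⟨q, b, hq0, hq1, hb0, h⟩ := hW.exists_curved_sub_straight_bound m 0
  obtain ⟨μ, hμ, hlt⟩ : ∃ μ > 0, q ^ 2 + (b / μ) ^ 2 < 1 := by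
    have hlim : Tendsto (fun μ : ℝ => q ^ 2 + (b / μ) ^ 2) atTop (𝓝 (q ^ 2 + 0 ^ 2)) :=
      ((tendsto_const_nhds.div_atTop tendsto_id).pow 2).const_add _
    have h1 : q ^ 2 + 0 ^ 2 < 1 := by nlinarith
    exact ((eventually_gt_atTop 0).and (hlim.eventually_lt_const h1)).exists
  refine ⟨μ, hμ, fun μ' hμ' y hy => ?_⟩
  have hμ0 : μ' ≠ 0 := by rintro rfl; simp at hμ'; exact hμ.ne hμ'
  have hsq : μ' ^ 2 = μ ^ 2 := by rw [← hμ', sq_abs]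
  refine UnboundedOp.dense_range_of_perturbation (straight ε⁻¹ 0 - (μ' * Complex.I : ℂ) • incl)
    (hW.curved m - (μ' * Complex.I : ℂ) • incl) (q := √(q ^ 2 + (b / μ) ^ 2)) ?_ (fun x => ?_)
    (dense_range_straight hμ0) y hy
  · rw [Real.sqrt_lt' one_pos, one_pow]; exact hlt
  · simp only [LinearMap.sub_apply, LinearMap.smul_apply, sub_sub_sub_cancel_right]
    refine (h x).trans ((add_mul_le_sqrt hμ).trans (mul_le_mul_of_nonneg_left ?_ (Real.sqrt_nonneg _)))
    refine Real.sqrt_le_iff.2 ⟨norm_nonneg _, ?_⟩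
    rw [UnboundedOp.norm_sub_smul_sq_of_symm (inner_straight_comm x ε⁻¹ 0), hsq]
    have := pow_le_pow_left₀ (norm_nonneg _) (norm_inclS_le ε⁻¹ 0 x) 2
    linarith

/-- The Dirac operator is self-adjoint and the core is a core. -/
theorem isSelfAdjoint_diracOp {m : ℝ} (hm : 0 ≤ m) : IsSelfAdjoint (diracOp hW m) ∧
    ∀ u : (diracOp hW m).domain, ((u : L2 (tube γ ε)), diracOp hW m u) ∈
      closure (range fun x : core => (hW.transfer (incl x), hW.transfer (hW.curved m x))) := by
  obtain ⟨μ, hμ, hd⟩ := hW.exists_curved_range_dense m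
  -- `transfer` is not unitary, but orthogonality on the tube is orthogonality of the image under
  -- its adjoint on the strip. The adjoint is injective because `transfer` is onto.
  have key : ∀ μ' : ℝ, |μ'| = μ → ∀ y : L2 (tube γ ε), (∀ x : core, ⟪y, hW.transfer (hW.curved m x) -
      (μ' * Complex.I : ℂ) • hW.transfer (incl x)⟫_ℂ = 0) → y = 0 := by
    intro μ' hμ' y hy
    have h0 : hW.transfer.adjoint y = 0 := by
      refine hd μ' hμ' _ fun x => ?_
      rw [ContinuousLinearMap.adjoint_inner_left, map_sub, map_smul]
      exact hy x
    obtain ⟨Y, rfl⟩ := hW.transfer_surjective y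
    rw [← inner_self_eq_zero (𝕜 := ℂ), ← ContinuousLinearMap.adjoint_inner_left, h0, inner_zero_left]
  refine UnboundedOp.isSelfAdjoint_of_core (T := diracOp hW m)
    (e := hW.transfer.toLinearMap ∘ₗ incl) (a := hW.transfer.toLinearMap ∘ₗ hW.curved m)
    (μ := μ) ?_ ?_ hμ.ne' ?_ ?_
  · rw [diracOp_graph]
    exact hW.closure_core_subset hm
  · intro u x
    refine hW.inner_curved_eq m ?_ x
    rw [← diracOp_graph]
    exact LinearPMap.mem_graph _ u
  · exact fun y hy => key μ (abs_of_pos hμ) y hy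
  · refine fun y hy => key (-μ) (by rw [abs_neg, abs_of_pos hμ]) y fun x => ?_
    rw [Complex.ofReal_neg, neg_mul, neg_smul, sub_neg_eq_add]
    exact hy x

theorem core_mem_domain {m : ℝ} (x : core) :
    ∃ h : hW.transfer (incl x) ∈ (diracOp hW m).domain,
      diracOp hW m ⟨_, h⟩ = hW.transfer (hW.curved m x) := by
  have h := hW.core_mem_diracGraph m x
  rw [← diracOp_graph, LinearPMap.mem_graph_iff] at h
  obtain ⟨u, h1, h2⟩ := h
  simp only at h1 h2
  have hu : hW.transfer (incl x) ∈ (diracOp hW m).domain := h1 ▸ u.2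
  exact ⟨hu, by rw [← h2]; congr 1; exact Subtype.ext h1.symm⟩

/-- The real points of the spectrum, in terms of the core. -/
theorem mem_spectrum_diracOp_iff {m : ℝ} (hm : 0 ≤ m) {z : ℂ} :
    z ∈ UnboundedOp.spectrum (diracOp hW m) ↔ z.im = 0 ∧ ∀ c > 0, ∃ x : core,
      ‖hW.transfer (hW.curved m x - z • incl x)‖ < c * ‖hW.transfer (incl x)‖ := by
  obtain ⟨hsa, hcore⟩ := hW.isSelfAdjoint_diracOp hm
  rw [UnboundedOp.mem_spectrum_iff hsa]
  refine and_congr_right fun _ => forall₂_congr fun c hc => ⟨?_, ?_⟩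
  · rintro ⟨u, hu⟩
    have hopen : IsOpen {p : L2 (tube γ ε) × L2 (tube γ ε) | ‖p.2 - z • p.1‖ < c * ‖p.1‖} :=
      isOpen_lt (by fun_prop) (by fun_prop)
    obtain ⟨_, h1, x, rfl⟩ := mem_closure_iff.1 (hcore u) _ hopen hu
    exact ⟨x, by rw [map_sub, map_smul]; exact h1⟩
  · rintro ⟨x, hx⟩
    obtain ⟨h, e⟩ := hW.core_mem_domain (m := m) x
    refine ⟨⟨_, h⟩, ?_⟩
    rw [e]
    rwa [map_sub, map_smul] at hx

theorem norm_transfer_le (X : StripL2) : ‖hW.transfer X‖ ≤ √(3 * ε) * ‖X‖ := by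
  have hε := hW.pos
  refine le_of_sq_le_sq ?_ (by positivity)
  rw [mul_pow, Real.sq_sqrt (by positivity)]
  exact hW.norm_transfer_sq_le X

theorem norm_transfer_ge (X : StripL2) : √ε * ‖X‖ ≤ ‖hW.transfer X‖ := by
  have hε := hW.pos
  refine le_of_sq_le_sq ?_ (norm_nonneg _)
  rw [mul_pow, Real.sq_sqrt (by positivity)]
  exact hW.norm_transfer_sq_ge X

/-- The spectrum in terms of approximate eigenfunctions on the strip. -/
theorem mem_spectrum_iff_strip {m : ℝ} (hm : 0 ≤ m) {z : ℂ} :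
    z ∈ UnboundedOp.spectrum (diracOp hW m) ↔ z.im = 0 ∧ ∀ c > 0, ∃ x : core,
      ‖hW.curved m x - z • incl x‖ < c * ‖incl x‖ := by
  have h1 : 0 < √ε := Real.sqrt_pos.2 hW.pos
  have h3 : 0 < √(3 * ε) := Real.sqrt_pos.2 (by linarith [hW.pos])
  rw [hW.mem_spectrum_diracOp_iff hm]
  refine and_congr_right fun _ => ⟨fun h c hc => ?_, fun h c hc => ?_⟩
  -- The constant is `c` times the ratio of the lower and the upper norm bounds of `transfer`. It
  -- serves in both directions.
  · obtain ⟨x, hx⟩ := h (c * √ε / √(3 * ε)) (by positivity)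
    refine ⟨x, ?_⟩
    have e1 := (hW.norm_transfer_ge (hW.curved m x - z • incl x)).trans_lt hx
    have e2 := mul_le_mul_of_nonneg_left (hW.norm_transfer_le (incl x))
      (by positivity : 0 ≤ c * √ε / √(3 * ε))
    have e3 : c * √ε / √(3 * ε) * (√(3 * ε) * ‖incl x‖) = √ε * (c * ‖incl x‖) := by
      field_simp
    rw [e3] at e2
    exact lt_of_mul_lt_mul_left (e1.trans_le e2) h1.le
  · obtain ⟨x, hx⟩ := h (c * √ε / √(3 * ε)) (by positivity)
    refine ⟨x, ?_⟩
    have e1 := hW.norm_transfer_le (hW.curved m x - z • incl x)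
    have e2 := mul_lt_mul_of_pos_left hx h3
    have e3 : √(3 * ε) * (c * √ε / √(3 * ε) * ‖incl x‖) = c * (√ε * ‖incl x‖) := by
      field_simp
    rw [e3] at e2
    exact (e1.trans_lt e2).trans_le (mul_le_mul_of_nonneg_left (hW.norm_transfer_ge _) hc.le)

end IsWaveguide

end Waveguide
end

/-! ### Charge conjugation and the symmetry of the spectrum. -/

noncomputable section

open scoped InnerProductSpace

namespace Waveguide

/-- The charge conjugation in the frame. -/
def chargeConj (w : ℂ) (y : Spinor) : Spinor :=
  sp (w * starRingEnd ℂ (y 0)) (-(w * starRingEnd ℂ (y 1)))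

theorem norm_chargeConj (w : ℂ) (y : Spinor) : ‖chargeConj w y‖ = ‖w‖ * ‖y‖ := by
  rw [← sq_eq_sq₀ (norm_nonneg _) (by positivity), mul_pow, norm_sq_spinor, norm_sq_spinor y]
  simp [chargeConj]
  ring

theorem hasDerivAt_conj {f : ℝ → ℂ} {f' : ℂ} {t : ℝ} (h : HasDerivAt f f' t) :
    HasDerivAt (fun t => starRingEnd ℂ (f t)) (starRingEnd ℂ f') t :=
  Complex.conjCLE.toContinuousLinearMap.hasFDerivAt.comp_hasDerivAt t h

theorem contDiff_conj {E : Type*} [NormedAddCommGroup E] [NormedSpace ℝ E] {n : WithTop ℕ∞}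
    {f : E → ℂ} (h : ContDiff ℝ n f) : ContDiff ℝ n fun x => starRingEnd ℂ (f x) :=
  Complex.conjCLE.toContinuousLinearMap.contDiff.comp h

theorem hasDerivAt_chargeConj {w : ℝ → ℂ} {w' : ℂ} {y : ℝ → Spinor} {y' : Spinor} {t : ℝ}
    (hw : HasDerivAt w w' t) (hy : HasDerivAt y y' t) :
    HasDerivAt (fun t => chargeConj (w t) (y t)) (chargeConj (w t) y' + chargeConj w' (y t)) t := by
  have h := (hw.mul (hasDerivAt_conj (hy.coord 0))).sp (hw.mul (hasDerivAt_conj (hy.coord 1))).neg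
  refine h.congr_deriv ?_
  apply spinor_ext
  · simp [chargeConj]; ring
  · simp [chargeConj]

theorem contDiff_chargeConj {E : Type*} [NormedAddCommGroup E] [NormedSpace ℝ E] {n : WithTop ℕ∞}
    {w : E → ℂ} {y : E → Spinor} (hw : ContDiff ℝ n w) (hy : ContDiff ℝ n y) :
    ContDiff ℝ n fun x => chargeConj (w x) (y x) :=
  (hw.mul (contDiff_conj (hy.coord 0))).sp (hw.mul (contDiff_conj (hy.coord 1))).neg

theorem chargeConj_sub (w : ℂ) (x y : Spinor) :
    chargeConj w (x - y) = chargeConj w x - chargeConj w y := by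
  apply spinor_ext <;> simp [chargeConj] <;> ring

theorem chargeConj_smul (w z : ℂ) (y : Spinor) :
    chargeConj w (z • y) = starRingEnd ℂ z • chargeConj w y := by
  apply spinor_ext <;> simp [chargeConj] <;> ring

/-- Conjugation reverses the sign of the longitudinal part, and the sign change of component `1`
that of the transverse and mass parts. The curvature potential would keep its diagonal sign, but the
weight `w`, the conjugate of the tangent, has derivative `-iκw`. This contributes exactly the
missing `2c = jκ`, with `j = 1/J` and `c = κ/(2J)`. -/
theorem symbol_chargeConj {α m j c κ : ℝ} (h : j * κ = 2 * c) (w : ℂ) (y ys yt : Spinor) :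
    symbol α m j c (chargeConj w y) (chargeConj w ys + chargeConj (-Complex.I * κ * w) y)
      (chargeConj w yt) = -chargeConj w (symbol α m j c y ys yt) := by
  have hc : (j : ℂ) * κ = 2 * c := by exact_mod_cast h
  apply spinor_ext
  · simp [symbol, chargeConj]
    linear_combination (w * starRingEnd ℂ (y 0)) * (-hc + j * κ * Complex.I_sq)
  · simp [symbol, chargeConj]
    linear_combination (w * starRingEnd ℂ (y 1)) * (-hc + j * κ * Complex.I_sq)

namespace IsWaveguide

variable {γ : ℝ → Plane} {ε : ℝ} (hW : IsWaveguide γ ε)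
include hW

theorem hasDerivAt_conj_tang (s : ℝ) : HasDerivAt (fun s => starRingEnd ℂ (tang γ s))
    (-Complex.I * curvature γ s * starRingEnd ℂ (tang γ s)) s := by
  refine (hasDerivAt_conj (hW.hasDerivAt_tang s)).congr_deriv ?_
  simp

theorem norm_conj_tang (s : ℝ) : ‖starRingEnd ℂ (tang γ s)‖ = 1 := by
  rw [RCLike.norm_conj, hW.norm_tang]

/-- The charge conjugation of an element of the core. -/
theorem exists_chargeConj (x : core) : ∃ x' : core,
    (∀ p, (x' : ℝ × ℝ → Spinor) p = chargeConj (starRingEnd ℂ (tang γ p.1)) ((x : ℝ × ℝ → Spinor) p)) ∧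
    (∀ p, dS x' p = chargeConj (starRingEnd ℂ (tang γ p.1)) (dS x p) + chargeConj
      (-Complex.I * curvature γ p.1 * starRingEnd ℂ (tang γ p.1)) ((x : ℝ × ℝ → Spinor) p)) ∧
    (∀ p, dT x' p = chargeConj (starRingEnd ℂ (tang γ p.1)) (dT x p)) := by
  obtain ⟨K, hK0, hK, -⟩ := hW.exists_curvature_bound
  set f : ℝ × ℝ → Spinor := fun p =>
    chargeConj (starRingEnd ℂ (tang γ p.1)) ((x : ℝ × ℝ → Spinor) p) with hf
  have hfc : ContDiff ℝ 2 f := contDiff_chargeConj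
    (contDiff_conj (hW.contDiff_tang.comp contDiff_fst)) (core.contDiff x)
  have hfd : Differentiable ℝ f := hfc.differentiable (by norm_num)
  have hS : ∀ p, dS f p = chargeConj (starRingEnd ℂ (tang γ p.1)) (dS x p) + chargeConj
      (-Complex.I * curvature γ p.1 * starRingEnd ℂ (tang γ p.1)) ((x : ℝ × ℝ → Spinor) p) := fun p =>
    (hasDerivAt_fst hfd p.1 p.2).unique (hasDerivAt_chargeConj (hW.hasDerivAt_conj_tang p.1)
      (hasDerivAt_fst (core.differentiable x) p.1 p.2))
  have h0 : ∀ y, chargeConj 0 y = 0 := fun y => by apply spinor_ext <;> simp [chargeConj]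
  have hT : ∀ p, dT f p = chargeConj (starRingEnd ℂ (tang γ p.1)) (dT x p) := fun p => by
    have := (hasDerivAt_snd hfd p.1 p.2).unique (hasDerivAt_chargeConj
      (hasDerivAt_const p.2 (starRingEnd ℂ (tang γ p.1)))
      (hasDerivAt_snd (core.differentiable x) p.1 p.2))
    rw [h0, add_zero] at this
    exact this
  have hTS : ∀ p, dT (dS f) p = chargeConj (starRingEnd ℂ (tang γ p.1)) (dT (dS x) p) + chargeConj
      (-Complex.I * curvature γ p.1 * starRingEnd ℂ (tang γ p.1)) (dT x p) := fun p => by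
    have e : dS f = fun p => chargeConj (starRingEnd ℂ (tang γ p.1)) (dS x p) + chargeConj
      (-Complex.I * curvature γ p.1 * starRingEnd ℂ (tang γ p.1)) ((x : ℝ × ℝ → Spinor) p) :=
      funext hS
    have h1 := (hasDerivAt_chargeConj (hasDerivAt_const p.2 (starRingEnd ℂ (tang γ p.1)))
      (hasDerivAt_snd ((contDiff_dS (core.contDiff x)).differentiable (by norm_num)) p.1 p.2)).add
      (hasDerivAt_chargeConj (hasDerivAt_const p.2
        (-Complex.I * curvature γ p.1 * starRingEnd ℂ (tang γ p.1)))
      (hasDerivAt_snd (core.differentiable x) p.1 p.2))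
    simp only [h0, add_zero] at h1
    have h2 := hasDerivAt_snd ((contDiff_dS hfc).differentiable (by norm_num)) p.1 p.2
    rw [e] at h2 ⊢
    exact h2.unique h1
  have hn1 : ∀ s y, ‖chargeConj (starRingEnd ℂ (tang γ s)) y‖ = ‖y‖ := fun s y => by
    rw [norm_chargeConj, hW.norm_conj_tang, one_mul]
  have hn2 : ∀ s y, ‖chargeConj (-Complex.I * curvature γ s * starRingEnd ℂ (tang γ s)) y‖ ≤ K * ‖y‖ :=
    fun s y => by
      rw [norm_chargeConj, norm_mul, hW.norm_conj_tang, mul_one, norm_mul, norm_neg, Complex.norm_I,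
        one_mul, Complex.norm_real, Real.norm_eq_abs]
      exact mul_le_mul_of_nonneg_right (hK s) (norm_nonneg _)
  have d1 : ∀ {y : ℝ × ℝ → Spinor}, Decay y →
      Decay fun p : ℝ × ℝ => chargeConj (starRingEnd ℂ (tang γ p.1)) (y p) := fun hy =>
    hy.of_le (B := 1) fun p _ => by rw [hn1, one_mul]
  have d2 : ∀ {y : ℝ × ℝ → Spinor}, Decay y → Decay fun p : ℝ × ℝ => chargeConj
      (-Complex.I * curvature γ p.1 * starRingEnd ℂ (tang γ p.1)) (y p) := fun hy =>
    hy.of_le (B := K) fun p _ => hn2 _ _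
  refine ⟨⟨f, hfc, d1 (core.decay x), ?_, ?_, ?_, fun s => ?_, fun s => ?_⟩, fun p => rfl, hS, hT⟩
  · rw [funext hS]; exact (d1 (core.decay_dS x)).add (d2 (core.decay x))
  · rw [funext hT]; exact d1 (core.decay_dT x)
  · rw [funext hTS]; exact (d1 (core.decay_dT_dS x)).add (d2 (core.decay_dT x))
  · simp [hf, chargeConj, core.top x]
  · simp [hf, chargeConj, core.bot x]

/-- For the conjugation `C` one has `(D + z) C x = -C (D - z) x` at a spectral point `z`, which is
real, and `C` preserves norms pointwise. Approximate eigenfunctions at `z` become approximate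
eigenfunctions at `-z`. -/
theorem neg_mem_spectrum {m : ℝ} (hm : 0 ≤ m) {z : ℂ}
    (h : z ∈ UnboundedOp.spectrum (diracOp hW m)) :
    -z ∈ UnboundedOp.spectrum (diracOp hW m) := by
  rw [hW.mem_spectrum_iff_strip hm] at h ⊢
  refine ⟨by simpa using h.1, fun c hc => ?_⟩
  have hz : starRingEnd ℂ z = z := Complex.conj_eq_iff_im.2 h.1
  obtain ⟨x, hx⟩ := h.2 c hc
  obtain ⟨x', h0, hS, hT⟩ := hW.exists_chargeConj x
  refine ⟨x', ?_⟩
  have hn1 : ∀ s y, ‖chargeConj (starRingEnd ℂ (tang γ s)) y‖ = ‖y‖ := fun s y => by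
    rw [norm_chargeConj, hW.norm_conj_tang, one_mul]
  have e1 : ‖hW.curved m x' - -z • incl x'‖ ≤ ‖hW.curved m x - z • incl x‖ := by
    refine Lp.norm_le_norm_of_ae_le ?_
    filter_upwards [Lp.coeFn_sub (hW.curved m x') (-z • incl x'), Lp.coeFn_smul (-z) (incl x'),
      Lp.coeFn_sub (hW.curved m x) (z • incl x), Lp.coeFn_smul z (incl x), hW.coeFn_curved m x,
      hW.coeFn_curved m x', coeFn_incl x, coeFn_incl x',
      ae_restrict_mem isOpen_strip.measurableSet] with p h1 h2 h3 h4 h5 h6 h7 h8 hp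
    have hJ : jac γ ε p ≠ 0 := by
      have := hW.jac_bounds (abs_le_of_mem_strip hp)
      exact (by linarith : (0 : ℝ) < jac γ ε p).ne'
    rw [h1, h3, Pi.sub_apply, Pi.sub_apply, h2, h4, Pi.smul_apply, Pi.smul_apply, h5, h6, h7, h8,
      h0, hS, hT, symbol_chargeConj (κ := curvature γ p.1) (by field_simp)]
    refine le_of_eq ?_
    conv_rhs => rw [← hn1 p.1, chargeConj_sub, chargeConj_smul, hz, ← norm_neg]
    congr 1
    rw [neg_smul]
    abel
  have e2 : ‖incl x‖ ≤ ‖incl x'‖ := by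
    refine Lp.norm_le_norm_of_ae_le ?_
    filter_upwards [coeFn_incl x, coeFn_incl x'] with p h7 h8
    rw [h7, h8, h0, hn1]
  exact e1.trans_lt (hx.trans_le (mul_le_mul_of_nonneg_left e2 hc.le))

/-- The spectrum is symmetric. -/
theorem mem_spectrum_iff_neg_mem {m : ℝ} (hm : 0 ≤ m) (z : ℂ) :
    z ∈ UnboundedOp.spectrum (diracOp hW m) ↔ -z ∈ UnboundedOp.spectrum (diracOp hW m) :=
  ⟨hW.neg_mem_spectrum hm, fun h => by simpa using hW.neg_mem_spectrum hm h⟩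

end IsWaveguide

end Waveguide
end

/-! ### Poincaré inequalities on a grid. -/

noncomputable section

open scoped InnerProductSpace

namespace Waveguide

section Grid

variable {E : Type*} [NormedAddCommGroup E] [NormedSpace ℝ E] [CompleteSpace E]

theorem norm_integral_sq_le {h : ℝ → E} (hc : Continuous h) {c d : ℝ} (hcd : c ≤ d) :
    ‖∫ t in c..d, h t‖ ^ 2 ≤ (d - c) * ∫ t in c..d, ‖h t‖ ^ 2 := by
  have := norm_sub_sq_le_integral (f := fun t => ∫ u in c..t, h u) (f' := h)
    (fun t => intervalIntegral.integral_hasDerivAt_right (hc.intervalIntegrable _ _)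
      (hc.stronglyMeasurableAtFilter _ _) hc.continuousAt) hc (left_mem_Icc.2 hcd) (right_mem_Icc.2 hcd)
  simpa [abs_of_nonneg (sub_nonneg.2 hcd)] using this

/-- A Poincaré inequality on an interval. -/
theorem integral_norm_sq_le_mean {g : ℝ → E} (hg : Continuous g) {c d D : ℝ} (hcd : c < d)
    (h : ∀ a ∈ Icc c d, ∀ b ∈ Icc c d, ‖g b - g a‖ ^ 2 ≤ D) :
    ∫ t in c..d, ‖g t‖ ^ 2 ≤ 2 / (d - c) * ‖∫ t in c..d, g t‖ ^ 2 + 2 * (d - c) * D := by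
  have hl : 0 < d - c := sub_pos.2 hcd
  set A := ∫ t in c..d, g t with hA
  have hpt : ∀ t ∈ Icc c d, ‖g t‖ ^ 2 ≤ 2 / (d - c) ^ 2 * ‖A‖ ^ 2 + 2 * D := by
    intro t ht
    have e : (d - c) • g t - A = ∫ u in c..d, (g t - g u) := by
      rw [intervalIntegral.integral_sub (continuous_const.intervalIntegrable _ _)
        (hg.intervalIntegrable _ _), intervalIntegral.integral_const]
    have h1 : ‖(d - c) • g t - A‖ ^ 2 ≤ (d - c) ^ 2 * D := by
      rw [e]
      refine (norm_integral_sq_le (by fun_prop : Continuous fun u => g t - g u) hcd.le).trans ?_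
      have h2 := intervalIntegral.integral_mono_on (μ := volume) hcd.le
        ((by fun_prop : Continuous fun u => ‖g t - g u‖ ^ 2).intervalIntegrable _ _)
        (continuous_const.intervalIntegrable _ _) (fun u hu => h u hu t ht)
      rw [intervalIntegral.integral_const, smul_eq_mul] at h2
      nlinarith
    have h3 : ‖(d - c) • g t‖ ≤ ‖A‖ + ‖(d - c) • g t - A‖ := by
      have := norm_add_le A ((d - c) • g t - A)
      rwa [add_sub_cancel] at this
    rw [norm_smul, Real.norm_of_nonneg hl.le] at h3
    have h4 : (d - c) ^ 2 * ‖g t‖ ^ 2 ≤ 2 * ‖A‖ ^ 2 + 2 * ((d - c) ^ 2 * D) := by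
      have := pow_le_pow_left₀ (by positivity) h3 2
      nlinarith [sq_nonneg (‖A‖ - ‖(d - c) • g t - A‖)]
    have e5 : 2 / (d - c) ^ 2 * ‖A‖ ^ 2 + 2 * D =
        (2 * ‖A‖ ^ 2 + 2 * ((d - c) ^ 2 * D)) / (d - c) ^ 2 := by
      field_simp
    rw [e5, le_div_iff₀ (by positivity)]
    linarith
  have h6 := intervalIntegral.integral_mono_on (μ := volume) hcd.le
    ((by fun_prop : Continuous fun u => ‖g u‖ ^ 2).intervalIntegrable _ _)
    (continuous_const.intervalIntegrable _ _) hpt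
  rw [intervalIntegral.integral_const, smul_eq_mul] at h6
  refine h6.trans_eq ?_
  field_simp

/-- The division points of an interval. -/
def grid (c d : ℝ) (N i : ℕ) : ℝ := c + i * ((d - c) / N)

theorem grid_zero (c d : ℝ) (N : ℕ) : grid c d N 0 = c := by simp [grid]

theorem grid_self (c d : ℝ) {N : ℕ} (hN : N ≠ 0) : grid c d N N = d := by
  have : (N : ℝ) ≠ 0 := by exact_mod_cast hN
  rw [grid]; field_simp; ring

theorem grid_succ_sub (c d : ℝ) (N i : ℕ) : grid c d N (i + 1) - grid c d N i = (d - c) / N := by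
  simp [grid]; ring

theorem sum_integral_grid {F : Type*} [NormedAddCommGroup F] [NormedSpace ℝ F] {f : ℝ → F}
    (hf : Continuous f) (c d : ℝ) {N : ℕ} (hN : N ≠ 0) :
    ∑ i ∈ Finset.range N, ∫ t in grid c d N i..grid c d N (i + 1), f t = ∫ t in c..d, f t := by
  rw [intervalIntegral.sum_integral_adjacent_intervals fun k _ => hf.intervalIntegrable _ _,
    grid_zero, grid_self c d hN]

/-- The interval inequality is summed over the cells. The oscillation is an abstract hypothesis so
that the lemma serves twice: for a slice as a function of `t`, and for the integrals over transverse
cells as functions of `s`. -/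
theorem integral_norm_sq_le_grid {g : ℝ → E} (hg : Continuous g) {Q : ℝ → ℝ} (hQ : Continuous Q)
    (h : ∀ u v, ∀ a ∈ Icc u v, ∀ b ∈ Icc u v, ‖g b - g a‖ ^ 2 ≤ (v - u) * ∫ t in u..v, Q t)
    {c d : ℝ} (hcd : c < d) {N : ℕ} (hN : N ≠ 0) :
    ∫ t in c..d, ‖g t‖ ^ 2 ≤ 2 / ((d - c) / N) *
      (∑ i ∈ Finset.range N, ‖∫ t in grid c d N i..grid c d N (i + 1), g t‖ ^ 2) +
        2 * ((d - c) / N) ^ 2 * ∫ t in c..d, Q t := by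
  have hl : 0 < (d - c) / N := div_pos (sub_pos.2 hcd) (by exact_mod_cast Nat.pos_of_ne_zero hN)
  rw [← sum_integral_grid (by fun_prop : Continuous fun t => ‖g t‖ ^ 2) c d hN, ← sum_integral_grid hQ c d hN, Finset.mul_sum,
    Finset.mul_sum, ← Finset.sum_add_distrib]
  refine Finset.sum_le_sum fun i _ => ?_
  have e := grid_succ_sub c d N i
  have h1 := integral_norm_sq_le_mean hg (by linarith : grid c d N i < grid c d N (i + 1)) (h _ _)
  rw [e] at h1
  refine h1.trans_eq ?_
  ring

end Grid

theorem continuous_integral_fst {F : Type*} [NormedAddCommGroup F] [NormedSpace ℝ F]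
    {f : ℝ × ℝ → F} (hf : Continuous f) (a b : ℝ) : Continuous fun s => ∫ t in a..b, f (s, t) :=
  intervalIntegral.continuous_parametric_intervalIntegral_of_continuous'
    (f := fun s t => f (s, t)) (by exact hf) a b

theorem integral_interval_swap {F : Type*} [NormedAddCommGroup F] [NormedSpace ℝ F]
    {f : ℝ × ℝ → F} (hf : Continuous f) {a b c d : ℝ} (hab : a ≤ b) (hcd : c ≤ d) :
    ∫ s in a..b, ∫ t in c..d, f (s, t) = ∫ t in c..d, ∫ s in a..b, f (s, t) := by
  simp only [intervalIntegral.integral_of_le hab, intervalIntegral.integral_of_le hcd]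
  refine integral_integral_swap (f := fun s t => f (s, t)) ?_
  rw [Measure.prod_restrict]
  exact (hf.continuousOn.integrableOn_compact (isCompact_Icc.prod isCompact_Icc)).mono_set
    (prod_mono Ioc_subset_Icc_self Ioc_subset_Icc_self)

/-- The oscillation hypothesis for the transverse integrals: Cauchy-Schwarz in `t`, the fundamental
theorem of calculus in `s`, and Fubini. -/
theorem slice_sub_sq_le (x : core) {u v a b c d : ℝ} (ha : a ∈ Icc u v) (hb : b ∈ Icc u v)
    (hcd : c ≤ d) : ‖(∫ t in c..d, (x : ℝ × ℝ → Spinor) (b, t)) -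
      ∫ t in c..d, (x : ℝ × ℝ → Spinor) (a, t)‖ ^ 2 ≤
      (v - u) * ∫ s in u..v, (d - c) * ∫ t in c..d, ‖dS x (s, t)‖ ^ 2 := by
  have hx : ∀ s, Continuous fun t => (x : ℝ × ℝ → Spinor) (s, t) := fun s =>
    (core.continuous x).comp (by fun_prop)
  have hxs := core.continuous_dS x
  have huv : u ≤ v := ha.1.trans ha.2
  rw [← intervalIntegral.integral_sub ((hx b).intervalIntegrable _ _) ((hx a).intervalIntegrable _ _)]
  refine (norm_integral_sq_le (h := fun t => (x : ℝ × ℝ → Spinor) (b, t) -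
    (x : ℝ × ℝ → Spinor) (a, t)) ((hx b).sub (hx a)) hcd).trans ?_
  have h1 : ∫ t in c..d, ‖(x : ℝ × ℝ → Spinor) (b, t) - (x : ℝ × ℝ → Spinor) (a, t)‖ ^ 2 ≤
      ∫ t in c..d, (v - u) * ∫ s in u..v, ‖dS x (s, t)‖ ^ 2 := by
    refine intervalIntegral.integral_mono_on hcd
      ((((hx b).sub (hx a)).norm.pow 2).intervalIntegrable _ _)
      ((continuous_const.mul (continuous_integral_fst (f := fun p : ℝ × ℝ => ‖dS x (p.2, p.1)‖ ^ 2)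
        (by fun_prop) u v)).intervalIntegrable _ _) fun t _ => ?_
    have h2 := norm_sub_sq_le_integral (f := fun s => (x : ℝ × ℝ → Spinor) (s, t))
      (fun s => hasDerivAt_fst (core.differentiable x) s t)
      (hxs.comp (by fun_prop : Continuous fun s : ℝ => (s, t))) ha hb
    refine h2.trans (mul_le_mul_of_nonneg_right ?_ (intervalIntegral.integral_nonneg huv
      fun s _ => by positivity))
    rw [abs_le]
    constructor <;> linarith [ha.1, ha.2, hb.1, hb.2]
  rw [intervalIntegral.integral_const_mul] at h1
  rw [intervalIntegral.integral_const_mul,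
    integral_interval_swap (f := fun p => ‖dS x p‖ ^ 2) (by fun_prop) huv hcd]
  have := mul_le_mul_of_nonneg_left h1 (sub_nonneg.2 hcd)
  linarith

/-- The integrals over the cells of a grid. -/
def cell (R : ℝ) (N i j : ℕ) (x : ℝ × ℝ → Spinor) : Spinor :=
  ∫ s in grid (-R) R N i..grid (-R) R N (i + 1), ∫ t in grid (-1) 1 N j..grid (-1) 1 N (j + 1), x (s, t)

/-- A Poincaré inequality on a grid. -/
theorem integral_norm_sq_le_cells (x : core) {R : ℝ} (hR : 0 < R) {N : ℕ} (hN : N ≠ 0) :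
    ∫ s in (-R)..R, ∫ t in (-1)..1, ‖(x : ℝ × ℝ → Spinor) (s, t)‖ ^ 2 ≤
      (N * N / R) * (∑ j ∈ Finset.range N, ∑ i ∈ Finset.range N, ‖cell R N i j x‖ ^ 2) +
      (16 * R ^ 2 / N ^ 2) * (∫ s in (-R)..R, ∫ t in (-1)..1, ‖dS x (s, t)‖ ^ 2) +
      (8 / N ^ 2) * ∫ s in (-R)..R, ∫ t in (-1)..1, ‖dT x (s, t)‖ ^ 2 := by
  have hN0 : (0 : ℝ) < N := by exact_mod_cast Nat.pos_of_ne_zero hN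
  have hR2 : -R < R := by linarith
  have hx := core.continuous x
  have hxs := core.continuous_dS x
  have hxt := core.continuous_dT x
  have hslice : ∀ {f : ℝ × ℝ → Spinor}, Continuous f → ∀ s, Continuous fun t => f (s, t) :=
    fun hf s => hf.comp (by fun_prop)
  set G : ℕ → ℝ → Spinor := fun j s =>
    ∫ t in grid (-1) 1 N j..grid (-1) 1 N (j + 1), (x : ℝ × ℝ → Spinor) (s, t) with hG
  have hGc : ∀ j, Continuous (G j) := fun j => continuous_integral_fst hx _ _
  have hl : ∀ j, grid (-1) 1 N (j + 1) - grid (-1) 1 N j = 2 / N := fun j => by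
    rw [grid_succ_sub]; norm_num
  have hlpos : (0 : ℝ) < 2 / N := by positivity
  -- transverse step
  have h1 : ∀ s, ∫ t in (-1)..1, ‖(x : ℝ × ℝ → Spinor) (s, t)‖ ^ 2 ≤
      N * (∑ j ∈ Finset.range N, ‖G j s‖ ^ 2) + 8 / N ^ 2 * ∫ t in (-1)..1, ‖dT x (s, t)‖ ^ 2 := by
    intro s
    have := integral_norm_sq_le_grid (hslice hx s) (Q := fun t => ‖dT x (s, t)‖ ^ 2)
      ((hslice hxt s).norm.pow 2) (fun u v a ha b hb => ?_) (by norm_num : (-1 : ℝ) < 1) hN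
    · refine this.trans_eq ?_
      congr 1
      · congr 1
        field_simp
        norm_num
      · congr 1
        field_simp
        norm_num
    · refine (norm_sub_sq_le_integral (f := fun t => (x : ℝ × ℝ → Spinor) (s, t))
        (fun t => hasDerivAt_snd (core.differentiable x) s t) (hslice hxt s) ha hb).trans
        (mul_le_mul_of_nonneg_right ?_ (intervalIntegral.integral_nonneg (ha.1.trans ha.2)
          fun s _ => by positivity))
      rw [abs_le]
      constructor <;> linarith [ha.1, ha.2, hb.1, hb.2]
  -- longitudinal step
  have h2 : ∀ j, ∫ s in (-R)..R, ‖G j s‖ ^ 2 ≤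
      N / R * (∑ i ∈ Finset.range N, ‖cell R N i j x‖ ^ 2) +
      16 * R ^ 2 / N ^ 3 * ∫ s in (-R)..R, ∫ t in grid (-1) 1 N j..grid (-1) 1 N (j + 1),
        ‖dS x (s, t)‖ ^ 2 := by
    intro j
    have := integral_norm_sq_le_grid (hGc j) (Q := fun s => 2 / N *
      ∫ t in grid (-1) 1 N j..grid (-1) 1 N (j + 1), ‖dS x (s, t)‖ ^ 2)
      (continuous_const.mul (continuous_integral_fst (f := fun p => ‖dS x p‖ ^ 2) (by fun_prop) _ _))
      (fun u v a ha b hb => ?_) hR2 hN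
    · refine this.trans_eq ?_
      rw [intervalIntegral.integral_const_mul]
      congr 1
      · congr 1
        field_simp
        ring
      · rw [← mul_assoc]
        congr 1
        field_simp
        ring
    · have h3 := slice_sub_sq_le x ha hb (by linarith [hl j] : grid (-1) 1 N j ≤ grid (-1) 1 N (j + 1))
      rwa [hl] at h3
  -- combination
  have hS : ∀ s, ∑ j ∈ Finset.range N, ∫ t in grid (-1) 1 N j..grid (-1) 1 N (j + 1),
      ‖dS x (s, t)‖ ^ 2 = ∫ t in (-1)..1, ‖dS x (s, t)‖ ^ 2 := fun s =>
    sum_integral_grid ((hslice hxs s).norm.pow 2) _ _ hN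
  have hcT : Continuous fun s => ∫ t in (-1)..1, ‖dT x (s, t)‖ ^ 2 :=
    continuous_integral_fst (f := fun p => ‖dT x p‖ ^ 2) (by fun_prop) _ _
  have hcx : Continuous fun s => ∫ t in (-1)..1, ‖(x : ℝ × ℝ → Spinor) (s, t)‖ ^ 2 :=
    continuous_integral_fst (f := fun p => ‖(x : ℝ × ℝ → Spinor) p‖ ^ 2) (by fun_prop) _ _
  have hcG : Continuous fun s => ∑ j ∈ Finset.range N, ‖G j s‖ ^ 2 :=
    continuous_finsetSum _ fun j _ => (hGc j).norm.pow 2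
  have hcG' : Continuous fun s => (N : ℝ) * ∑ j ∈ Finset.range N, ‖G j s‖ ^ 2 :=
    continuous_const.mul hcG
  have hcT' : Continuous fun s => 8 / (N : ℝ) ^ 2 * ∫ t in (-1)..1, ‖dT x (s, t)‖ ^ 2 :=
    continuous_const.mul hcT
  have hcG2 : ∀ j, Continuous fun s => ‖G j s‖ ^ 2 := fun j => (hGc j).norm.pow 2
  calc _ ≤ ∫ s in (-R)..R, (N * (∑ j ∈ Finset.range N, ‖G j s‖ ^ 2) +
        8 / N ^ 2 * ∫ t in (-1)..1, ‖dT x (s, t)‖ ^ 2) :=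
        intervalIntegral.integral_mono_on hR2.le (hcx.intervalIntegrable _ _)
          ((hcG'.add hcT').intervalIntegrable _ _)
          fun s _ => h1 s
    _ = N * (∑ j ∈ Finset.range N, ∫ s in (-R)..R, ‖G j s‖ ^ 2) +
        8 / N ^ 2 * ∫ s in (-R)..R, ∫ t in (-1)..1, ‖dT x (s, t)‖ ^ 2 := by
        rw [intervalIntegral.integral_add (hcG'.intervalIntegrable _ _)
          (hcT'.intervalIntegrable _ _), intervalIntegral.integral_const_mul,
          intervalIntegral.integral_const_mul, intervalIntegral.integral_finsetSum fun j _ =>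
            (hcG2 j).intervalIntegrable _ _]
    _ ≤ N * (∑ j ∈ Finset.range N, (N / R * (∑ i ∈ Finset.range N, ‖cell R N i j x‖ ^ 2) +
      16 * R ^ 2 / N ^ 3 * ∫ s in (-R)..R, ∫ t in grid (-1) 1 N j..grid (-1) 1 N (j + 1),
        ‖dS x (s, t)‖ ^ 2)) + 8 / N ^ 2 * ∫ s in (-R)..R, ∫ t in (-1)..1, ‖dT x (s, t)‖ ^ 2 := by
        gcongr with j _
        exact h2 j
    _ = _ := by
        rw [Finset.sum_add_distrib, ← Finset.mul_sum, ← Finset.mul_sum,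
          ← intervalIntegral.integral_finsetSum fun j _ => (continuous_integral_fst
            (f := fun p => ‖dS x p‖ ^ 2) (by fun_prop) _ _).intervalIntegrable _ _]
        simp only [hS]
        field_simp

end Waveguide
end

/-! ### Rellich compactness. -/

noncomputable section

open scoped InnerProductSpace

namespace Waveguide

theorem integral_slice_norm_sq {f : ℝ × ℝ → Spinor} (hf : MemLp f 2 (volume.restrict strip)) :
    Integrable (fun s => ∫ t in (-1)..1, ‖f (s, t)‖ ^ 2) ∧
    ∫ s, ∫ t in (-1)..1, ‖f (s, t)‖ ^ 2 = ∫ p in strip, ‖f p‖ ^ 2 := by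
  have hi := (memLp_two_iff_integrable_sq_norm hf.1).1 hf
  refine ⟨?_, (integral_strip hi).symm⟩
  have h2 := hi
  rw [volume_restrict_strip] at h2
  refine h2.integral_prod_left.congr (Eventually.of_forall fun s => ?_)
  simp only
  rw [intervalIntegral.integral_of_le (by norm_num), integral_Ioc_eq_integral_Ioo]

theorem slice_norm_sq_nonneg (f : ℝ × ℝ → Spinor) (s : ℝ) : 0 ≤ ∫ t in (-1)..1, ‖f (s, t)‖ ^ 2 :=
  intervalIntegral.integral_nonneg (by norm_num) fun t _ => by positivity

theorem integral_interval_slice_le {f : ℝ × ℝ → Spinor} (hf : MemLp f 2 (volume.restrict strip))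
    {a b : ℝ} (hab : a ≤ b) :
    ∫ s in a..b, ∫ t in (-1)..1, ‖f (s, t)‖ ^ 2 ≤ ∫ p in strip, ‖f p‖ ^ 2 := by
  obtain ⟨h1, h2⟩ := integral_slice_norm_sq hf
  rw [← h2, intervalIntegral.integral_of_le hab]
  exact setIntegral_le_integral h1 (Eventually.of_forall fun s => slice_norm_sq_nonneg f s)

theorem norm_incl_sq (x : core) : ‖incl x‖ ^ 2 = ∫ p in strip, ‖(x : ℝ × ℝ → Spinor) p‖ ^ 2 :=
  norm_liftL2_sq core.subtype _ x

theorem norm_inclS_sq (x : core) : ‖inclS x‖ ^ 2 = ∫ p in strip, ‖dS x p‖ ^ 2 :=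
  norm_liftL2_sq dSLin _ x

theorem norm_inclT_sq (x : core) : ‖inclT x‖ ^ 2 = ∫ p in strip, ‖dT x p‖ ^ 2 :=
  norm_liftL2_sq dTLin _ x

/-- Separates a compact window, where the grid inequality applies, from the ends, where `x` agrees
with a field of small norm. -/
theorem norm_incl_sq_le {x y : core} {R : ℝ} (hR : 0 < R)
    (h : ∀ p : ℝ × ℝ, R ≤ |p.1| → (x : ℝ × ℝ → Spinor) p = (y : ℝ × ℝ → Spinor) p) :
    ‖incl x‖ ^ 2 ≤ (∫ s in (-R)..R, ∫ t in (-1)..1, ‖(x : ℝ × ℝ → Spinor) (s, t)‖ ^ 2) +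
      ‖incl y‖ ^ 2 := by
  obtain ⟨h1, h2⟩ := integral_slice_norm_sq (core.memLp x)
  obtain ⟨k1, k2⟩ := integral_slice_norm_sq (core.memLp y)
  rw [norm_incl_sq, norm_incl_sq, ← h2, ← k2, intervalIntegral.integral_of_le (by linarith),
    ← integral_indicator measurableSet_Ioc, ← integral_add (h1.indicator measurableSet_Ioc) k1]
  refine integral_mono h1 ((h1.indicator measurableSet_Ioc).add k1) fun s => ?_
  simp only
  by_cases hs : s ∈ Ioc (-R) R
  · rw [indicator_of_mem hs]
    linarith [slice_norm_sq_nonneg y s]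
  · rw [indicator_of_notMem hs, zero_add]
    refine le_of_eq (intervalIntegral.integral_congr fun t _ => ?_)
    rw [h (s, t)]
    by_contra! hlt
    exact hs ⟨(abs_lt.1 hlt).1, (abs_lt.1 hlt).2.le⟩

theorem grid_le_grid {c d : ℝ} (hcd : c ≤ d) (N : ℕ) {i j : ℕ} (hij : i ≤ j) :
    grid c d N i ≤ grid c d N j := by
  have : (0 : ℝ) ≤ (d - c) / N := div_nonneg (sub_nonneg.2 hcd) (Nat.cast_nonneg _)
  have h2 : (i : ℝ) ≤ j := by exact_mod_cast hij
  simp only [grid]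
  nlinarith

theorem cell_sub (x y : core) (R : ℝ) (N i j : ℕ) :
    cell R N i j (x - y : core) = cell R N i j x - cell R N i j y := by
  have hx := core.continuous x
  have hy := core.continuous y
  simp only [cell]
  rw [← intervalIntegral.integral_sub ((continuous_integral_fst hx _ _).intervalIntegrable _ _)
    ((continuous_integral_fst hy _ _).intervalIntegrable _ _)]
  refine intervalIntegral.integral_congr fun s _ => ?_
  rw [← intervalIntegral.integral_sub
    ((by fun_prop : Continuous fun t => (x : ℝ × ℝ → Spinor) (s, t)).intervalIntegrable _ _)
    ((by fun_prop : Continuous fun t => (y : ℝ × ℝ → Spinor) (s, t)).intervalIntegrable _ _)]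
  rfl

theorem norm_cell_sq_le (x : core) {R : ℝ} (hR : 0 < R) {N i j : ℕ} (hj : j < N) :
    ‖cell R N i j x‖ ^ 2 ≤ (2 * R / N) * (2 / N) * ‖incl x‖ ^ 2 := by
  have hx := core.continuous x
  have hi := grid_le_grid (c := -R) (d := R) (by linarith) N (Nat.le_succ i)
  have hj' := grid_le_grid (c := -1) (d := 1) (by norm_num) N (Nat.le_succ j)
  have e1 : grid (-R) R N (i + 1) - grid (-R) R N i = 2 * R / N := by
    rw [grid_succ_sub]; ring
  have e2 : grid (-1) 1 N (j + 1) - grid (-1) 1 N j = 2 / N := by rw [grid_succ_sub]; norm_num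
  have hc2 : Continuous fun s => ∫ t in (-1)..1, ‖(x : ℝ × ℝ → Spinor) (s, t)‖ ^ 2 :=
    continuous_integral_fst (f := fun p => ‖(x : ℝ × ℝ → Spinor) p‖ ^ 2) (by fun_prop) _ _
  have h1 := norm_integral_sq_le (continuous_integral_fst hx (grid (-1) 1 N j) (grid (-1) 1 N (j + 1))) hi
  have h2 : ∫ s in grid (-R) R N i..grid (-R) R N (i + 1),
      ‖∫ t in grid (-1) 1 N j..grid (-1) 1 N (j + 1), (x : ℝ × ℝ → Spinor) (s, t)‖ ^ 2 ≤
      ∫ s in grid (-R) R N i..grid (-R) R N (i + 1),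
        2 / N * ∫ t in (-1)..1, ‖(x : ℝ × ℝ → Spinor) (s, t)‖ ^ 2 := by
    refine intervalIntegral.integral_mono_on hi
      (((continuous_integral_fst hx _ _).norm.pow 2).intervalIntegrable _ _)
      ((continuous_const.mul hc2).intervalIntegrable _ _) fun s _ => ?_
    have hs : Continuous fun t => (x : ℝ × ℝ → Spinor) (s, t) := by fun_prop
    have h3 := norm_integral_sq_le hs hj'
    rw [e2] at h3
    refine h3.trans (mul_le_mul_of_nonneg_left ?_ (by positivity))
    refine intervalIntegral.integral_mono_interval ?_ hj' ?_
      (Eventually.of_forall fun t => by positivity) ((hs.norm.pow 2).intervalIntegrable _ _)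
    · have := grid_le_grid (c := -1) (d := 1) (by norm_num) N (Nat.zero_le j)
      rwa [grid_zero] at this
    · have := grid_le_grid (c := -1) (d := 1) (by norm_num) N (Nat.succ_le_of_lt hj)
      rwa [grid_self _ _ (by omega)] at this
  rw [intervalIntegral.integral_const_mul] at h2
  have h4 := integral_interval_slice_le (core.memLp x) hi
  rw [← norm_incl_sq] at h4
  rw [e1] at h1
  calc _ ≤ 2 * R / N * (2 / N * ‖incl x‖ ^ 2) := by
        refine h1.trans (mul_le_mul_of_nonneg_left (h2.trans ?_) (by positivity))
        exact mul_le_mul_of_nonneg_left h4 (by positivity)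
    _ = _ := by ring

/-- The compactness criterion of Rellich: a sequence that is bounded in `H¹` and tight at infinity
converges along an ultrafilter. -/
theorem exists_tendsto_hyperfilter {x : ℕ → core} {M : ℝ} (h0 : ∀ n, ‖incl (x n)‖ ≤ M)
    (hS : ∀ n, ‖inclS (x n)‖ ≤ M) (hT : ∀ n, ‖inclT (x n)‖ ≤ M)
    (htail : ∀ η > 0, ∃ R > 0, ∀ᶠ n in atTop, ∃ y : core, ‖incl y‖ ≤ η ∧
      ∀ p : ℝ × ℝ, R ≤ |p.1| → (x n : ℝ × ℝ → Spinor) p = (y : ℝ × ℝ → Spinor) p) :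
    ∃ v, Tendsto (fun n => incl (x n)) (hyperfilter ℕ : Filter ℕ) (𝓝 v) := by
  -- Along an ultrafilter every bounded finite dimensional quantity converges, so no diagonal choice
  -- of subsequences is needed. It remains to prove the Cauchy property.
  suffices hc : Cauchy (map (fun n => incl (x n)) (hyperfilter ℕ : Filter ℕ)) from
    cauchy_iff_exists_le_nhds.1 hc
  rw [cauchy_map_iff]
  refine ⟨inferInstance, ?_⟩
  rw [tendsto_uniformity_iff_dist_tendsto_zero, Metric.tendsto_nhds]
  intro η hη
  obtain ⟨R, hR, hev⟩ := htail (η / 4) (by positivity)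
  -- The grid is taken so fine that the gradient terms in `integral_norm_sq_le_cells` are at most
  -- `η²/4`. Differences of two terms have derivatives of norm at most `2M`, whence `64 = 16 · 4`
  -- and `32 = 8 · 4`.
  obtain ⟨N, hN⟩ := exists_nat_gt (√((64 * R ^ 2 + 32) * M ^ 2 * 4) / η)
  have hN0 : (0 : ℝ) < N := lt_of_le_of_lt (by positivity) hN
  have hNne : N ≠ 0 := by rintro rfl; simp at hN0
  have hNle : (64 * R ^ 2 + 32) * M ^ 2 / N ^ 2 ≤ η ^ 2 / 4 := by
    rw [div_lt_iff₀ hη] at hN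
    have h1 := pow_le_pow_left₀ (Real.sqrt_nonneg _) hN.le 2
    rw [Real.sq_sqrt (by positivity), mul_pow] at h1
    rw [div_le_iff₀ (by positivity)]
    linarith
  -- the cells converge
  have hcell : ∀ i j, ∃ a, j < N → Tendsto (fun n => cell R N i j (x n)) (hyperfilter ℕ : Filter ℕ) (𝓝 a) := by
    intro i j
    by_cases hj : j < N
    · have hb : ∀ n, cell R N i j (x n) ∈
          Metric.closedBall (0 : Spinor) √((2 * R / N) * (2 / N) * M ^ 2) := fun n => by
        rw [mem_closedBall_zero_iff]
        refine Real.le_sqrt_of_sq_le ((norm_cell_sq_le (x n) hR hj).trans ?_)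
        exact mul_le_mul_of_nonneg_left (pow_le_pow_left₀ (norm_nonneg _) (h0 n) 2) (by positivity)
      obtain ⟨a, -, ha⟩ := (isCompact_closedBall (0 : Spinor) _).ultrafilter_le_nhds
        ((hyperfilter ℕ).map fun n => cell R N i j (x n))
        (le_principal_iff.2 (Eventually.of_forall (f := (hyperfilter ℕ : Filter ℕ)) hb))
      exact ⟨a, fun _ => ha⟩
    · exact ⟨0, fun h => absurd h hj⟩
  choose a ha using hcell
  have hsum : Tendsto (fun p : ℕ × ℕ => N * N / R * ∑ j ∈ Finset.range N, ∑ i ∈ Finset.range N,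
      ‖cell R N i j (x p.1) - cell R N i j (x p.2)‖ ^ 2)
      ((hyperfilter ℕ : Filter ℕ) ×ˢ (hyperfilter ℕ : Filter ℕ)) (𝓝 0) := by
    have h1 : Tendsto (fun p : ℕ × ℕ => N * N / R * ∑ j ∈ Finset.range N, ∑ i ∈ Finset.range N,
      ‖cell R N i j (x p.1) - cell R N i j (x p.2)‖ ^ 2)
      ((hyperfilter ℕ : Filter ℕ) ×ˢ (hyperfilter ℕ : Filter ℕ))
      (𝓝 (N * N / R * ∑ j ∈ Finset.range N, ∑ i ∈ Finset.range N, ‖a i j - a i j‖ ^ 2)) := by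
      refine Tendsto.const_mul _ (tendsto_finsetSum _ fun j hj => tendsto_finsetSum _ fun i _ => ?_)
      have h2 := ha i j (Finset.mem_range.1 hj)
      exact (((h2.comp tendsto_fst).sub (h2.comp tendsto_snd)).norm).pow 2
    simpa using h1
  have hev' := hev.filter_mono Nat.hyperfilter_le_atTop
  -- The cells, the gradient terms and the tails contribute at most `η²/4` each, which leaves the
  -- squared distance below `η²`.
  filter_upwards [hsum.eventually_lt_const (by positivity : 0 < η ^ 2 / 4),
    hev'.prod_mk hev'] with p hp1 hp2
  obtain ⟨⟨y, hy, hxy⟩, y', hy', hxy'⟩ := hp2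
  rw [Real.dist_eq, sub_zero, abs_of_nonneg dist_nonneg, dist_eq_norm, ← map_sub]
  refine lt_of_pow_lt_pow_left₀ 2 hη.le ?_
  have key := norm_incl_sq_le (x := x p.1 - x p.2) (y := y - y') hR fun q hq => by
    change (x p.1 : ℝ × ℝ → Spinor) q - (x p.2 : ℝ × ℝ → Spinor) q =
      (y : ℝ × ℝ → Spinor) q - (y' : ℝ × ℝ → Spinor) q
    rw [hxy q hq, hxy' q hq]
  have hcells := integral_norm_sq_le_cells (x p.1 - x p.2) hR hNne
  have hS' := integral_interval_slice_le ((core.decay_dS (x p.1 - x p.2)).memLp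
    (core.continuous_dS _).aestronglyMeasurable) (by linarith : -R ≤ R)
  have hT' := integral_interval_slice_le ((core.decay_dT (x p.1 - x p.2)).memLp
    (core.continuous_dT _).aestronglyMeasurable) (by linarith : -R ≤ R)
  rw [← norm_inclS_sq, map_sub] at hS'
  rw [← norm_inclT_sq, map_sub] at hT'
  have hS2 : ‖inclS (x p.1) - inclS (x p.2)‖ ^ 2 ≤ 4 * M ^ 2 := by
    have := pow_le_pow_left₀ (norm_nonneg _)
      ((norm_sub_le _ _).trans (add_le_add (hS p.1) (hS p.2))) 2
    linarith
  have hT2 : ‖inclT (x p.1) - inclT (x p.2)‖ ^ 2 ≤ 4 * M ^ 2 := by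
    have := pow_le_pow_left₀ (norm_nonneg _)
      ((norm_sub_le _ _).trans (add_le_add (hT p.1) (hT p.2))) 2
    linarith
  have hyy : ‖incl (y - y')‖ ^ 2 ≤ η ^ 2 / 4 := by
    rw [map_sub]
    have := pow_le_pow_left₀ (norm_nonneg _)
      ((norm_sub_le _ _).trans (add_le_add hy hy')) 2
    linarith
  simp only [cell_sub] at hcells
  have e1 := mul_le_mul_of_nonneg_left (hS'.trans hS2) (by positivity : 0 ≤ 16 * R ^ 2 / N ^ 2)
  have e2 := mul_le_mul_of_nonneg_left (hT'.trans hT2) (by positivity : (0 : ℝ) ≤ 8 / N ^ 2)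
  have e3 : 16 * R ^ 2 / N ^ 2 * (4 * M ^ 2) + 8 / N ^ 2 * (4 * M ^ 2) =
      (64 * R ^ 2 + 32) * M ^ 2 / N ^ 2 := by ring
  have : 0 < η ^ 2 := by positivity
  linarith

end Waveguide
end

noncomputable section

open scoped InnerProductSpace

namespace Waveguide

/-! ### Localisation along the strip -/

theorem mul_fst_mem_core {φ φ' : ℝ → ℝ} {B : ℝ} (hφ : ContDiff ℝ 2 φ)
    (hd : ∀ s, HasDerivAt φ (φ' s) s) (hB : ∀ s, |φ s| ≤ B) (hB' : ∀ s, |φ' s| ≤ B) (x : core) :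
    (fun p : ℝ × ℝ => φ p.1 • (x : ℝ × ℝ → Spinor) p) ∈ core ∧
    (dS fun p : ℝ × ℝ => φ p.1 • (x : ℝ × ℝ → Spinor) p) =
      (fun p => φ p.1 • dS x p + φ' p.1 • (x : ℝ × ℝ → Spinor) p) ∧
    (dT fun p : ℝ × ℝ => φ p.1 • (x : ℝ × ℝ → Spinor) p) = fun p => φ p.1 • dT x p := by
  have e' : φ' = deriv φ := funext fun s => (hd s).deriv.symm
  have hφ' : ContDiff ℝ 1 φ' := by
    rw [e']
    exact hφ.deriv' (n := 1)
  have hf : ContDiff ℝ 2 fun p : ℝ × ℝ => φ p.1 := hφ.comp contDiff_fst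
  have hf' : ContDiff ℝ 1 fun p : ℝ × ℝ => φ' p.1 := hφ'.comp contDiff_fst
  have hf1 : ContDiff ℝ 1 fun p : ℝ × ℝ => φ p.1 := hf.of_le (by norm_num)
  have hx := core.contDiff x
  have hx1 : ContDiff ℝ 1 (x : ℝ × ℝ → Spinor) := hx.of_le (by norm_num)
  have hxS := contDiff_dS hx
  have hS : (dS fun p : ℝ × ℝ => φ p.1 • (x : ℝ × ℝ → Spinor) p) =
      fun p => φ p.1 • dS x p + φ' p.1 • (x : ℝ × ℝ → Spinor) p :=
    funext fun p => dS_smul_eq (f' := fun p => φ' p.1) hf1 hx1 (fun s t => hd s) p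
  have hT : ∀ {ψ : ℝ → ℝ} {z : ℝ × ℝ → Spinor}, ContDiff ℝ 1 (fun p : ℝ × ℝ => ψ p.1) →
      ContDiff ℝ 1 z → (dT fun p : ℝ × ℝ => ψ p.1 • z p) = fun p => ψ p.1 • dT z p :=
    fun {ψ z} h1 h2 => funext fun p => by
      rw [dT_smul_eq (f := fun p : ℝ × ℝ => ψ p.1) (f' := fun _ => 0) h1 h2
        (fun s t => hasDerivAt_const t (ψ s)) p, zero_smul, add_zero]
  have hdec : ∀ {ψ : ℝ → ℝ} {z : ℝ × ℝ → Spinor}, (∀ s, |ψ s| ≤ B) → Decay z →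
      Decay fun p : ℝ × ℝ => ψ p.1 • z p := fun {ψ z} h1 h2 =>
    h2.of_le (B := B) fun p _ => by
      rw [norm_smul, Real.norm_eq_abs]
      gcongr
      exact h1 _
  refine ⟨⟨hf.smul hx, hdec hB (core.decay x), ?_, ?_, ?_, fun s => ?_, fun s => ?_⟩, hS, hT hf1 hx1⟩
  · rw [hS]
    exact (hdec hB (core.decay_dS x)).add (hdec hB' (core.decay x))
  · rw [hT hf1 hx1]
    exact hdec hB (core.decay_dT x)
  · rw [hS]
    have : dT ((fun p : ℝ × ℝ => φ p.1 • dS x p) + fun p => φ' p.1 • (x : ℝ × ℝ → Spinor) p) =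
        fun p => φ p.1 • dT (dS x) p + φ' p.1 • dT x p := by
      refine (dT_add (x := fun p : ℝ × ℝ => φ p.1 • dS x p)
        (y := fun p => φ' p.1 • (x : ℝ × ℝ → Spinor) p) ((hf1.smul hxS).differentiable (by norm_num))
        ((hf'.smul hx1).differentiable (by norm_num))).trans ?_
      rw [hT hf1 hxS, hT hf' hx1]
      rfl
    rw [show (fun p : ℝ × ℝ => φ p.1 • dS x p + φ' p.1 • (x : ℝ × ℝ → Spinor) p) =
      (fun p : ℝ × ℝ => φ p.1 • dS x p) + fun p => φ' p.1 • (x : ℝ × ℝ → Spinor) p from rfl, this]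
    exact (hdec hB (core.decay_dT_dS x)).add (hdec hB' (core.decay_dT x))
  · simp [core.top x s]
  · simp [core.bot x s]

/-- A cutoff function that vanishes near the origin. -/
def outer (R s : ℝ) : ℝ := 1 - step (2 - s ^ 2 / R ^ 2)

/-- The derivative of `outer R`. -/
def outerDeriv (R s : ℝ) : ℝ := -(deriv step (2 - s ^ 2 / R ^ 2) * (-(2 * s / R ^ 2)))

theorem contDiff_outer (R : ℝ) : ContDiff ℝ 2 (outer R) := by
  have := contDiff_step (n := 2)
  unfold outer
  fun_prop

theorem hasDerivAt_outer (R s : ℝ) : HasDerivAt (outer R) (outerDeriv R s) s := by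
  have h1 : HasDerivAt (fun s : ℝ => 2 - s ^ 2 / R ^ 2) (-(2 * s / R ^ 2)) s := by
    have := ((hasDerivAt_pow 2 s).div_const (R ^ 2)).const_sub 2
    simpa using this
  exact ((hasDerivAt_step _).comp s h1).const_sub 1

theorem abs_outer_le (R s : ℝ) : |outer R s| ≤ 1 := by
  have h1 := step_nonneg (2 - s ^ 2 / R ^ 2)
  have h2 := step_le_one (2 - s ^ 2 / R ^ 2)
  rw [outer, abs_le]
  constructor <;> linarith

theorem outer_eq_zero {R s : ℝ} (hR : 0 < R) (hs : |s| ≤ R) : outer R s = 0 := by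
  have h : s ^ 2 / R ^ 2 ≤ 1 := by
    rw [div_le_one (by positivity), ← sq_abs s]
    exact pow_le_pow_left₀ (abs_nonneg _) hs 2
  rw [outer, step_of_ge (by linarith), sub_self]

theorem outer_eq_one {R s : ℝ} (hR : 0 < R) (hs : 2 * R ≤ |s|) : outer R s = 1 := by
  have h : 4 ≤ s ^ 2 / R ^ 2 := by
    rw [le_div_iff₀ (by positivity), ← sq_abs s]
    nlinarith
  rw [outer, step_of_le (by linarith), sub_zero]

theorem abs_outerDeriv_le {M : ℝ} (hM : ∀ y, |deriv step y| ≤ M) {R : ℝ} (hR : 0 < R) (s : ℝ) :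
    |outerDeriv R s| ≤ 4 * M / R := by
  have hM0 : 0 ≤ M := (abs_nonneg _).trans (hM 0)
  rw [outerDeriv, abs_neg]
  by_cases h : 2 - s ^ 2 / R ^ 2 < 1 / 2
  · rw [deriv_step_of_lt h]
    simp; positivity
  · have h2 : s ^ 2 / R ^ 2 < 2 := by linarith
    rw [div_lt_iff₀ (by positivity)] at h2
    have h3 : |s| ≤ 2 * R := abs_le_of_sq_le_sq (by nlinarith) (by positivity)
    rw [abs_mul, abs_neg, abs_div, abs_mul, abs_of_pos (by positivity : (0 : ℝ) < R ^ 2), abs_two]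
    calc _ ≤ M * (2 * (2 * R) / R ^ 2) := by gcongr; exact hM _
      _ = 4 * M / R := by field_simp; ring

theorem outer_smul_mem_core {R : ℝ} (hR : 0 < R) (x : core) :
    (fun p : ℝ × ℝ => outer R p.1 • (x : ℝ × ℝ → Spinor) p) ∈ core ∧
    (dS fun p : ℝ × ℝ => outer R p.1 • (x : ℝ × ℝ → Spinor) p) =
      (fun p => outer R p.1 • dS x p + outerDeriv R p.1 • (x : ℝ × ℝ → Spinor) p) ∧
    (dT fun p : ℝ × ℝ => outer R p.1 • (x : ℝ × ℝ → Spinor) p) =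
      fun p => outer R p.1 • dT x p := by
  obtain ⟨M, hM0, hM⟩ := exists_deriv_step_bound
  exact mul_fst_mem_core (B := max 1 (4 * M / R)) (contDiff_outer R) (hasDerivAt_outer R)
    (fun s => (abs_outer_le R s).trans (le_max_left _ _))
    (fun s => (abs_outerDeriv_le hM hR s).trans (le_max_right _ _)) x

/-- The restriction of an element of the core to the ends of the strip. -/
def restrictOuter (x : core) {R : ℝ} (hR : 0 < R) : core := ⟨_, (outer_smul_mem_core hR x).1⟩

theorem restrictOuter_apply (x : core) {R : ℝ} (hR : 0 < R) (p : ℝ × ℝ) :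
    (restrictOuter x hR : ℝ × ℝ → Spinor) p = outer R p.1 • (x : ℝ × ℝ → Spinor) p := rfl

theorem dS_eq_zero_of_vanish {y : ℝ × ℝ → Spinor} {R : ℝ} (hy : ∀ p : ℝ × ℝ, |p.1| < R → y p = 0)
    {p : ℝ × ℝ} (hp : |p.1| < R) : dS y p = 0 := by
  have h : y =ᶠ[𝓝 p] fun _ => 0 := by
    have hopen : IsOpen {q : ℝ × ℝ | |q.1| < R} := isOpen_lt (by fun_prop) continuous_const
    filter_upwards [hopen.mem_nhds hp] with q hq
    exact hy q hq
  rw [dS, h.fderiv_eq]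
  simp

namespace IsWaveguide

variable {γ : ℝ → Plane} {ε : ℝ} (hW : IsWaveguide γ ε)
include hW

/-- The curved strip is asymptotically straight. -/
theorem exists_coeff_le {η : ℝ} (hη : 0 < η) : ∃ R > 0, ∀ p ∈ strip, R ≤ |p.1| →
    |(jac γ ε p)⁻¹ - 1| ≤ η ∧ 4 * |curvature γ p.1 / (2 * jac γ ε p)| ≤ η := by
  have hε := hW.pos
  -- Chosen so that `|κ| ≤ τ` and `1/J ≤ 2` give `2ετ ≤ η` for the first coefficient and `4τ ≤ η`
  -- for the second.
  set τ := η / (2 * ε + 4) with hτ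
  have hτ0 : 0 < τ := by positivity
  have h1 := (Metric.tendsto_nhds.1 hW.curvature_atTop) τ hτ0
  have h2 := (Metric.tendsto_nhds.1 hW.curvature_atBot) τ hτ0
  obtain ⟨a, ha⟩ := eventually_atTop.1 h1
  obtain ⟨b, hb⟩ := eventually_atBot.1 h2
  refine ⟨max 1 (max a (-b)), lt_max_of_lt_left one_pos, fun p hp hR => ?_⟩
  have hκ : |curvature γ p.1| ≤ τ := by
    have h3 : a ≤ |p.1| := (le_max_left _ _).trans ((le_max_right _ _).trans hR)
    have h4 : -b ≤ |p.1| := (le_max_right _ _).trans ((le_max_right _ _).trans hR)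
    rcases abs_cases p.1 with h | h
    · have := ha p.1 (by linarith)
      rw [dist_zero_right, Real.norm_eq_abs] at this
      exact this.le
    · have := hb p.1 (by linarith)
      rw [dist_zero_right, Real.norm_eq_abs] at this
      exact this.le
  have ht := abs_le_of_mem_strip hp
  have hJ := (hW.jac_bounds ht).1
  have hJ0 : 0 < jac γ ε p := by linarith
  have hJ2 : (jac γ ε p)⁻¹ ≤ 2 := by
    rw [inv_le_comm₀ hJ0 (by norm_num)]; linarith
  have e : η = τ * (2 * ε + 4) := by rw [hτ]; field_simp
  constructor
  · have e1 : (jac γ ε p)⁻¹ - 1 = ε * p.2 * curvature γ p.1 * (jac γ ε p)⁻¹ := by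
      field_simp
      rw [jac]; ring
    rw [e1, abs_mul, abs_mul, abs_mul, abs_of_pos hε, abs_of_pos (inv_pos.2 hJ0)]
    calc ε * |p.2| * |curvature γ p.1| * (jac γ ε p)⁻¹ ≤ ε * 1 * τ * 2 := by gcongr
      _ ≤ η := by rw [e]; nlinarith
  · rw [abs_div, abs_of_pos (by positivity : 0 < 2 * jac γ ε p), div_eq_mul_inv, mul_inv]
    calc 4 * (|curvature γ p.1| * (2⁻¹ * (jac γ ε p)⁻¹)) ≤ 4 * (τ * (2⁻¹ * 2)) := by gcongr
      _ ≤ η := by rw [e]; nlinarith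

/-- For fields that vanish on `|s| < R` only the coefficients far out matter, so both constants of
the relative bound can be made as small as desired. -/
theorem norm_curved_sub_straight_le {η R : ℝ} (hη : 0 ≤ η) (hR : ∀ p ∈ strip, R ≤ |p.1| →
    |(jac γ ε p)⁻¹ - 1| ≤ η ∧ 4 * |curvature γ p.1 / (2 * jac γ ε p)| ≤ η) (m : ℝ) (y : core)
    (hy : ∀ p : ℝ × ℝ, |p.1| < R → (y : ℝ × ℝ → Spinor) p = 0) :
    ‖hW.curved m y - straight ε⁻¹ m y‖ ≤ η * ‖inclS y‖ + η * ‖incl y‖ := by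
  refine norm_Lp_le_of_ae hη hη ?_
  filter_upwards [Lp.coeFn_sub (hW.curved m y) (straight ε⁻¹ m y), hW.coeFn_curved m y,
    coeFn_straight ε⁻¹ m y, coeFn_inclS y, coeFn_incl y,
    ae_restrict_mem isOpen_strip.measurableSet] with p h1 h2 h3 h4 h5 hp
  rw [h1, Pi.sub_apply, h2, h3, h4, h5]
  refine (norm_symbol_sub_le _ _ _ _ _ _ _ _).trans ?_
  rw [sub_self, abs_zero, mul_zero, add_zero]
  rcases lt_or_ge |p.1| R with h | h
  · rw [hy p h, dS_eq_zero_of_vanish hy h]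
    simp
  · obtain ⟨k1, k2⟩ := hR p hp h
    gcongr

/-- The commutator with `outer R` involves only its derivative, of size at most `4M/R`, times `1/J ≤
2`. -/
theorem norm_curved_restrictOuter_le {M : ℝ} (hM : ∀ y, |deriv step y| ≤ M) {R : ℝ} (hR : 0 < R)
    (m : ℝ) (z : ℂ) (x : core) :
    ‖hW.curved m (restrictOuter x hR) - z • incl (restrictOuter x hR)‖ ≤
      ‖hW.curved m x - z • incl x‖ + 8 * M / R * ‖incl x‖ := by
  have hM0 : 0 ≤ M := (abs_nonneg _).trans (hM 0)
  obtain ⟨-, hS, hT⟩ := outer_smul_mem_core hR x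
  rw [← one_mul ‖hW.curved m x - z • incl x‖]
  refine norm_Lp_le_of_ae zero_le_one (by positivity) ?_
  filter_upwards [Lp.coeFn_sub (hW.curved m (restrictOuter x hR)) (z • incl (restrictOuter x hR)),
    Lp.coeFn_sub (hW.curved m x) (z • incl x), Lp.coeFn_smul z (incl x),
    Lp.coeFn_smul z (incl (restrictOuter x hR)), hW.coeFn_curved m (restrictOuter x hR),
    hW.coeFn_curved m x, coeFn_incl x, coeFn_incl (restrictOuter x hR),
    ae_restrict_mem isOpen_strip.measurableSet] with p h1 h2 h3 h4 h5 h6 h7 h8 hp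
  have hJ := (hW.jac_bounds (abs_le_of_mem_strip hp)).1
  have hJ0 : 0 < jac γ ε p := by linarith
  have hJ2 : (jac γ ε p)⁻¹ ≤ 2 := by
    rw [inv_le_comm₀ hJ0 (by norm_num)]; linarith
  have e1 : dS (restrictOuter x hR) p =
      outer R p.1 • dS x p + outerDeriv R p.1 • (x : ℝ × ℝ → Spinor) p := congrFun hS p
  have e2 : dT (restrictOuter x hR) p =
      outer R p.1 • dT x p + (0 : ℝ) • (x : ℝ × ℝ → Spinor) p := by
    rw [zero_smul, add_zero]; exact congrFun hT p
  rw [h1, h2, Pi.sub_apply, Pi.sub_apply, h3, h4, Pi.smul_apply, Pi.smul_apply, h5, h6, h7, h8, e1,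
    e2, restrictOuter_apply, symbol_smul_add, zero_mul, zero_smul, add_zero, smul_comm z (outer R p.1),
    add_sub_right_comm, ← smul_sub]
  refine (norm_add_le _ _).trans ?_
  rw [norm_smul, norm_smul, norm_sp_I, Real.norm_eq_abs, Real.norm_eq_abs, abs_mul,
    abs_of_pos (inv_pos.2 hJ0)]
  gcongr
  · exact abs_outer_le _ _
  · calc |outerDeriv R p.1| * (jac γ ε p)⁻¹ ≤ 4 * M / R * 2 := by
          gcongr
          exact abs_outerDeriv_le hM hR _
      _ = 8 * M / R := by ring

/-- Below the threshold, approximate eigenfunctions are small at infinity. -/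
theorem exists_norm_restrictOuter_le {m E lam : ℝ} (hE : IsTransverseRoot (m * ε) E)
    (hlam : |lam| < √(ε⁻¹ ^ 2 * E + m ^ 2)) : ∃ C : ℝ, 0 < C ∧ ∃ R₀ : ℝ, ∀ (R : ℝ) (hR : 0 < R), R₀ ≤ R →
    ∀ x : core, ‖incl (restrictOuter x hR)‖ ≤
      C * (‖hW.curved m x - (lam : ℂ) • incl x‖ + C / R * ‖incl x‖) := by
  obtain ⟨M, hM0, hM⟩ := exists_deriv_step_bound
  have hε := hW.pos
  set Λ := √(ε⁻¹ ^ 2 * E + m ^ 2) with hΛ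
  have hΛ0 : 0 < Λ := (abs_nonneg _).trans_lt hlam
  have hΛ2 : Λ ^ 2 = ε⁻¹ ^ 2 * E + m ^ 2 := Real.sq_sqrt (Real.sqrt_pos.1 hΛ0).le
  set δ := Λ - |lam| with hδ
  have hδ0 : 0 < δ := sub_pos.2 hlam
  have hδΛ : δ ≤ Λ := by linarith [abs_nonneg lam]
  -- The estimates below combine to `(1 - η) Λ ‖y‖ ≤ (η + |lam|) ‖y‖ + r`, so the loss is `η (Λ +
  -- 1)`. This choice leaves half of the gap `δ`.
  set η := δ / (2 * (Λ + 1)) with hη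
  have hη0 : 0 < η := by positivity
  have eη : η * (Λ + 1) = δ / 2 := by rw [hη]; field_simp
  have hη1 : η ≤ 1 := by
    rw [hη, div_le_one (by positivity)]; linarith
  obtain ⟨R₀, hR₀, hc⟩ := hW.exists_coeff_le hη0
  refine ⟨2 / δ + 8 * M, by positivity, R₀, fun R hR hRR x => ?_⟩
  set y := restrictOuter x hR with hy
  have h1 := hW.norm_curved_sub_straight_le hη0.le (R := R) (fun p hp hp' => hc p hp (hRR.trans hp'))
    m y fun p hp => by rw [hy, restrictOuter_apply, outer_eq_zero hR hp.le, zero_smul]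
  have h2 := hW.norm_curved_restrictOuter_le hM hR m lam x
  have h3 : Λ * ‖incl y‖ ≤ ‖straight ε⁻¹ m y‖ := by
    refine le_of_sq_le_sq ?_ (norm_nonneg _)
    have hE' : IsTransverseRoot (m / ε⁻¹) E := by rwa [div_inv_eq_mul]
    have := norm_transversal_ge y (inv_pos.2 hε) hE'
    rw [norm_straight_sq, mul_pow, hΛ2]
    nlinarith [sq_nonneg ‖inclS y‖]
  have h4 := norm_inclS_le ε⁻¹ m y
  set r := ‖hW.curved m y - (lam : ℂ) • incl y‖ with hr
  have h5 : ‖straight ε⁻¹ m y‖ ≤ ‖hW.curved m y - straight ε⁻¹ m y‖ + r + |lam| * ‖incl y‖ := by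
    have e1 : straight ε⁻¹ m y = -(hW.curved m y - straight ε⁻¹ m y) +
        (hW.curved m y - (lam : ℂ) • incl y) + (lam : ℂ) • incl y := by abel
    calc ‖straight ε⁻¹ m y‖ = _ := by rw [e1]
      _ ≤ _ := norm_add₃_le
      _ = _ := by rw [norm_neg, norm_smul, Complex.norm_real, Real.norm_eq_abs]
  have h6 : δ / 2 * ‖incl y‖ ≤ r := by
    have e1 := mul_le_mul_of_nonneg_left h3 (sub_nonneg.2 hη1)
    have e2 := mul_le_mul_of_nonneg_left h4 hη0.le
    have e3 : η * (Λ + 1) * ‖incl y‖ = δ / 2 * ‖incl y‖ := by rw [eη]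
    have e4 : (Λ - |lam|) * ‖incl y‖ = δ * ‖incl y‖ := rfl
    linarith
  have h7 : ‖incl y‖ ≤ 2 / δ * r := by
    rw [div_mul_eq_mul_div, le_div_iff₀ hδ0]
    linarith
  have hA := norm_nonneg (hW.curved m x - (lam : ℂ) • incl x)
  have hB := norm_nonneg (incl x)
  have hδ2 : 0 < 2 / δ := by positivity
  refine h7.trans (mul_le_mul (by linarith) (h2.trans ?_) (norm_nonneg _) (by positivity))
  gcongr
  linarith

end IsWaveguide

end Waveguide
end

/-! ### Discrete spectrum below the threshold. -/

noncomputable section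

open scoped InnerProductSpace

namespace Waveguide

namespace IsWaveguide

variable {γ : ℝ → Plane} {ε : ℝ} (hW : IsWaveguide γ ε)
include hW

theorem exists_core_near {m : ℝ} (hm : 0 ≤ m) (z : ℂ) (u : (diracOp hW m).domain) {η : ℝ} (hη : 0 < η) :
    ∃ x : core, ‖hW.transfer (incl x) - u‖ < η ∧
      ‖hW.transfer (hW.curved m x - z • incl x)‖ < ‖diracOp hW m u - z • (u : L2 (tube γ ε))‖ + η := by
  have h := (hW.isSelfAdjoint_diracOp hm).2 u
  have hopen : IsOpen {p : L2 (tube γ ε) × L2 (tube γ ε) | ‖p.1 - u‖ < η ∧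
      ‖p.2 - z • p.1‖ < ‖diracOp hW m u - z • (u : L2 (tube γ ε))‖ + η} :=
    IsOpen.and (isOpen_lt (by fun_prop) (by fun_prop)) (isOpen_lt (by fun_prop) (by fun_prop))
  obtain ⟨_, h1, x, rfl⟩ := mem_closure_iff.1 h _ hopen ⟨by simpa using hη, by simpa using hη⟩
  exact ⟨x, h1.1, by rw [map_sub, map_smul]; exact h1.2⟩

/-- Bounded approximate eigenvectors are replaced by core fields close in the graph norm. These are
bounded together with their first derivatives, and tight by `exists_norm_restrictOuter_le`, so the
Rellich criterion provides the cluster point required by `mem_discreteSpectrum_of_compact`. -/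
theorem mem_discreteSpectrum {m E lam : ℝ} (hm : 0 ≤ m) (hE : IsTransverseRoot (m * ε) E)
    (hlam : |lam| < √(ε⁻¹ ^ 2 * E + m ^ 2)) (h : (lam : ℂ) ∈ UnboundedOp.spectrum (diracOp hW m)) :
    (lam : ℂ) ∈ UnboundedOp.discreteSpectrum (diracOp hW m) := by
  refine UnboundedOp.mem_discreteSpectrum_of_compact (hW.isSelfAdjoint_diracOp hm).1 ?_ h
  intro u K hK hu
  have hε := Real.sqrt_pos.2 hW.pos
  choose x hx1 hx2 using fun n : ℕ => hW.exists_core_near hm lam (u n) (Nat.one_div_pos_of_nat (n := n) (α := ℝ))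
  have hinv : Tendsto (fun n : ℕ => 1 / ((n : ℝ) + 1)) atTop (𝓝 0) := tendsto_one_div_add_atTop_nhds_zero_nat
  have hdiff : Tendsto (fun n => hW.transfer (incl (x n)) - (u n : L2 (tube γ ε))) atTop (𝓝 0) :=
    squeeze_zero_norm (fun n => (hx1 n).le) hinv
  have hres : Tendsto (fun n => ‖hW.curved m (x n) - (lam : ℂ) • incl (x n)‖) atTop (𝓝 0) := by
    have hlim : Tendsto (fun n : ℕ => (√ε)⁻¹ * (‖diracOp hW m (u n) - (lam : ℂ) • (u n : L2 (tube γ ε))‖ +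
        1 / ((n : ℝ) + 1))) atTop (𝓝 0) := by
      simpa using (hu.norm.add hinv).const_mul (√ε)⁻¹
    refine squeeze_zero (fun _ => norm_nonneg _) (fun n => ?_) hlim
    rw [le_inv_mul_iff₀ hε]
    exact (hW.norm_transfer_ge _).trans (hx2 n).le
  -- bounds in the graph norm
  have b0 : ∀ n, ‖incl (x n)‖ ≤ (√ε)⁻¹ * (K + 1) := fun n => by
    rw [le_inv_mul_iff₀ hε]
    refine (hW.norm_transfer_ge _).trans ?_
    have e1 := norm_le_norm_add_norm_sub' (hW.transfer (incl (x n))) (u n : L2 (tube γ ε))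
    have e2 : 1 / ((n : ℝ) + 1) ≤ 1 := by
      rw [div_le_one (by positivity)]; linarith [(Nat.cast_nonneg n : (0 : ℝ) ≤ n)]
    linarith [hK n, (hx1 n).le]
  obtain ⟨r, hr⟩ : ∃ r, ∀ n, ‖hW.curved m (x n) - (lam : ℂ) • incl (x n)‖ ≤ r := by
    obtain ⟨r, hr⟩ := hres.bddAbove_range
    exact ⟨r, fun n => hr (mem_range_self n)⟩
  set B := (√ε)⁻¹ * (K + 1) with hB
  have hB0 : 0 ≤ B := (norm_nonneg _).trans (b0 0)
  have b1 : ∀ n, ‖hW.curved m (x n)‖ ≤ r + |lam| * B := fun n => by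
    have e1 := norm_le_norm_add_norm_sub' (hW.curved m (x n)) ((lam : ℂ) • incl (x n))
    rw [norm_smul, Complex.norm_real, Real.norm_eq_abs] at e1
    have e2 := mul_le_mul_of_nonneg_left (b0 n) (abs_nonneg lam)
    linarith [hr n]
  obtain ⟨C, hC0, hC⟩ := hW.exists_graph_bound hm
  have b2 : ∀ n, C * (‖incl (x n)‖ + ‖hW.curved m (x n)‖) ≤ C * (B + (r + |lam| * B)) := fun n =>
    mul_le_mul_of_nonneg_left (add_le_add (b0 n) (b1 n)) hC0
  obtain ⟨C', hC'0, R₀, htail⟩ := hW.exists_norm_restrictOuter_le hE hlam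
  obtain ⟨v, hv⟩ := exists_tendsto_hyperfilter (M := max B (C * (B + (r + |lam| * B))))
    (fun n => (b0 n).trans (le_max_left _ _))
    (fun n => ((hC (x n)).1.trans (b2 n)).trans (le_max_right _ _))
    (fun n => ((hC (x n)).2.trans (b2 n)).trans (le_max_right _ _)) (by
      intro η hη
      -- The last entry makes the commutator contribution `C'² B / R` at most `η/2`; the residual
      -- contributes the other half for large `n`.
      set R := max (max 1 R₀) (2 * C' ^ 2 * B / η) with hR
      have hR1 : 0 < R := lt_max_of_lt_left (lt_max_of_lt_left one_pos)
      refine ⟨2 * R, by positivity, ?_⟩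
      have hev := hres.eventually_lt_const (by positivity : 0 < η / (2 * C'))
      filter_upwards [hev] with n hn
      refine ⟨restrictOuter (x n) hR1, ?_, fun p hp => ?_⟩
      · refine (htail R hR1 ((le_max_right _ _).trans (le_max_left _ _)) (x n)).trans ?_
        have e1 : C' * ‖hW.curved m (x n) - (lam : ℂ) • incl (x n)‖ ≤ η / 2 := by
          rw [lt_div_iff₀ (by positivity)] at hn
          linarith
        have e2 : C' * (C' / R * ‖incl (x n)‖) ≤ η / 2 := by
          have : 2 * C' ^ 2 * B / η ≤ R := le_max_right _ _
          rw [div_le_iff₀ hη] at this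
          calc C' * (C' / R * ‖incl (x n)‖) ≤ C' * (C' / R * B) := by gcongr; exact b0 n
            _ = C' ^ 2 * B / R := by ring
            _ ≤ η / 2 := by rw [div_le_iff₀ hR1]; linarith
        rw [mul_add]
        linarith
      · rw [restrictOuter_apply, outer_eq_one hR1 hp, one_smul])
  refine ⟨hW.transfer v, ?_⟩
  have hlim : Tendsto (fun n => (u n : L2 (tube γ ε))) (hyperfilter ℕ : Filter ℕ) (𝓝 (hW.transfer v)) := by
    have := ((hW.transfer.continuous.tendsto v).comp hv).sub
      (hdiff.mono_left Nat.hyperfilter_le_atTop)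
    simpa using this
  exact hlim.mapClusterPt.mono Nat.hyperfilter_le_atTop

end IsWaveguide

end Waveguide
end

noncomputable section

open scoped InnerProductSpace

namespace Waveguide

/-! ### Weyl sequences -/

theorem integral_norm_sq_tensor (e φ ψ : ℝ → ℂ) : ∫ p in strip, ‖tensor e e φ ψ p‖ ^ 2 =
    (∫ s, ‖e s‖ ^ 2) * ∫ t in Ioo (-1 : ℝ) 1, (‖φ t‖ ^ 2 + ‖ψ t‖ ^ 2) := by
  rw [volume_restrict_strip, ← integral_prod_mul]
  refine integral_congr_ae (Eventually.of_forall fun p => ?_)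
  simp only [tensor, norm_sq_spinor, sp_zero, sp_one, norm_mul]
  ring

theorem exists_bound_of_vanish {h : ℝ → ℂ} (hc : Continuous h) {a b : ℝ}
    (h0 : ∀ s, s ∉ Icc a b → h s = 0) : ∃ C, ∀ s, ‖h s‖ * (1 + s ^ 2) ≤ C := by
  obtain ⟨C, hC⟩ := (isCompact_Icc (a := a) (b := b)).exists_bound_of_continuousOn
    (f := fun s => h s * (1 + s ^ 2 : ℝ)) (by fun_prop)
  refine ⟨max C 0, fun s => ?_⟩
  by_cases hs : s ∈ Icc a b
  · have := hC s hs
    rw [norm_mul, Complex.norm_real, Real.norm_of_nonneg (by positivity)] at this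
    exact this.trans (le_max_left _ _)
  · rw [h0 s hs]; simp

/-- A smooth bump function on the line. -/
def bump (y : ℝ) : ℝ := step (2 - y ^ 2)

theorem contDiff_bump : ContDiff ℝ 2 bump := by
  have := contDiff_step (n := 2)
  unfold bump
  fun_prop

theorem hasDerivAt_bump (y : ℝ) : HasDerivAt bump (deriv bump y) y :=
  (contDiff_bump.differentiable (by norm_num) y).hasDerivAt

theorem bump_eq_zero {y : ℝ} (hy : 2 ≤ |y|) : bump y = 0 := by
  refine step_of_le ?_
  rw [← sq_abs]
  nlinarith

theorem deriv_bump_eq_zero {y : ℝ} (hy : 2 < |y|) : deriv bump y = 0 := by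
  have hopen : IsOpen {y : ℝ | 2 < |y|} := isOpen_lt continuous_const continuous_abs
  have h : bump =ᶠ[𝓝 y] fun _ => 0 := by
    filter_upwards [hopen.mem_nhds hy] with z hz
    exact bump_eq_zero (le_of_lt hz)
  rw [h.deriv_eq, deriv_const]

theorem integral_bump_sq_pos : 0 < ∫ y, bump y ^ 2 := by
  have hc : Continuous fun y => bump y ^ 2 := contDiff_bump.continuous.pow 2
  refine hc.integral_pos_of_hasCompactSupport_nonneg_nonzero ?_ (fun y => sq_nonneg _) (x := 0) ?_
  · refine HasCompactSupport.of_support_subset_isCompact (isCompact_Icc (a := -2) (b := 2)) fun y hy => ?_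
    by_contra h
    refine hy ?_
    have : 2 ≤ |y| := by
      by_contra! h2
      exact h ⟨(abs_lt.1 h2).1.le, (abs_lt.1 h2).2.le⟩
    simp [bump_eq_zero this]
  · rw [bump, step_of_ge (by norm_num)]
    norm_num

/-- A wave packet with wave number `k`, at distance of order `N` from the origin. -/
def packet (k N : ℝ) (s : ℝ) : ℂ := bump ((s - 4 * N) / N) * Complex.exp (Complex.I * k * s)

/-- The error made by a wave packet in the eigenvalue equation of the derivative. -/
def packetError (k N : ℝ) (s : ℝ) : ℂ :=
  (deriv bump ((s - 4 * N) / N) / N : ℝ) * Complex.exp (Complex.I * k * s)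

theorem hasDerivAt_packet (k N s : ℝ) : HasDerivAt (packet k N)
    (Complex.I * k * packet k N s + packetError k N s) s := by
  have h1 : HasDerivAt (fun s : ℝ => (s - 4 * N) / N) (1 / N) s :=
    ((hasDerivAt_id s).sub_const _).div_const N
  have h2 := ((hasDerivAt_bump ((s - 4 * N) / N)).comp s h1).ofReal_comp
  have h3 : HasDerivAt (fun s : ℝ => Complex.exp (Complex.I * k * s))
      (Complex.exp (Complex.I * k * s) * (Complex.I * k * 1)) s :=
    ((hasDerivAt_id s).ofReal_comp.const_mul (Complex.I * k)).cexp
  refine (h2.mul h3).congr_deriv ?_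
  simp only [packet, packetError, Function.comp_apply]
  push_cast
  ring

theorem contDiff_packet (k N : ℝ) : ContDiff ℝ 2 (packet k N) := by
  have h1 : ContDiff ℝ 2 fun s : ℝ => ((bump ((s - 4 * N) / N) : ℝ) : ℂ) :=
    Complex.ofRealCLM.contDiff.comp (contDiff_bump.comp (by fun_prop))
  have h2 : ContDiff ℝ 2 fun s : ℝ => Complex.exp (Complex.I * k * s) :=
    (contDiff_const.mul Complex.ofRealCLM.contDiff).cexp
  exact h1.mul h2

theorem norm_exp_I_mul (k s : ℝ) : ‖Complex.exp (Complex.I * k * s)‖ = 1 := by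
  rw [show Complex.I * k * s = ((k * s : ℝ) : ℂ) * Complex.I by push_cast; ring,
    Complex.norm_exp_ofReal_mul_I]

theorem integral_norm_sq_packet (k : ℝ) {N : ℝ} (hN : 0 < N) :
    ∫ s, ‖packet k N s‖ ^ 2 = N * ∫ y, bump y ^ 2 := by
  have e : ∀ s, ‖packet k N s‖ ^ 2 = bump ((s - 4 * N) / N) ^ 2 := fun s => by
    rw [packet, norm_mul, norm_exp_I_mul, mul_one, Complex.norm_real, Real.norm_eq_abs, sq_abs]
  simp only [e]
  rw [integral_sub_right_eq_self (fun s => bump (s / N) ^ 2) (4 * N),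
    Measure.integral_comp_div (fun y => bump y ^ 2) N, abs_of_pos hN, smul_eq_mul]

/-- By scaling, the squared norm of the packet grows like `N` while that of its error decays like
`1/N`. The relative error is therefore of order `1/N`. -/
theorem integral_norm_sq_packetError (k : ℝ) {N : ℝ} (hN : 0 < N) :
    ∫ s, ‖packetError k N s‖ ^ 2 = N⁻¹ * ∫ y, deriv bump y ^ 2 := by
  have e : ∀ s, ‖packetError k N s‖ ^ 2 = (N ^ 2)⁻¹ * deriv bump ((s - 4 * N) / N) ^ 2 := fun s => by
    rw [packetError, norm_mul, norm_exp_I_mul, mul_one, Complex.norm_real, Real.norm_eq_abs, sq_abs,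
      div_pow]
    ring
  simp only [e]
  rw [integral_const_mul, integral_sub_right_eq_self (fun s => deriv bump (s / N) ^ 2) (4 * N),
    Measure.integral_comp_div (fun y => deriv bump y ^ 2) N, abs_of_pos hN, smul_eq_mul]
  field_simp

/-- The centre `4N` and half-width at most `2N` keep the packet beyond `|s| = 2N`, so it moves out
to where the strip is almost straight as it widens. -/
theorem le_abs_of_packet {N s : ℝ} (hN : 0 < N) (hs : |s| < 2 * N) : 2 < |(s - 4 * N) / N| := by
  rw [abs_div, abs_of_pos hN, lt_div_iff₀ hN, lt_abs]
  right
  linarith [(abs_lt.1 hs).2]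

theorem packet_tensor_mem_core {φ ψ : ℝ → ℂ} (hφ : ContDiff ℝ 2 φ) (hψ : ContDiff ℝ 2 ψ)
    (h1 : φ 1 = 0) (h2 : ψ (-1) = 0) (k : ℝ) {N : ℝ} (hN : 0 < N) :
    tensor (packet k N) (packet k N) φ ψ ∈ core := by
  have hc := contDiff_packet k N
  have hfar : ∀ s, s ∉ Icc (2 * N) (6 * N) → 2 < |(s - 4 * N) / N| := fun s hs => by
    rw [abs_div, abs_of_pos hN, lt_div_iff₀ hN, lt_abs]
    rw [mem_Icc, not_and_or, not_le, not_le] at hs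
    rcases hs with hs | hs
    · right; linarith
    · left; linarith
  have b1 := exists_bound_of_vanish hc.continuous (a := 2 * N) (b := 6 * N) fun s hs => by
    simp [packet, bump_eq_zero (hfar s hs).le]
  have b2 := exists_bound_of_vanish (hc.continuous_deriv (by norm_num)) (a := 2 * N) (b := 6 * N)
    fun s hs => by
      rw [(hasDerivAt_packet k N s).deriv]
      simp [packet, packetError, bump_eq_zero (hfar s hs).le, deriv_bump_eq_zero (hfar s hs)]
  exact tensor_mem_core hc hc hφ hψ b1 b2 b1 b2 h1 h2

/-- The modes of the straight waveguide. -/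
theorem exists_transverse_mode {α m E k lam : ℝ} (hα : 0 < α) (hE : IsTransverseRoot (m / α) E)
    (h : lam ^ 2 = k ^ 2 + (α ^ 2 * E + m ^ 2)) : ∃ φ ψ φ' ψ' : ℝ → ℂ, ContDiff ℝ 2 φ ∧ ContDiff ℝ 2 ψ ∧
      φ 1 = 0 ∧ ψ (-1) = 0 ∧ (∀ t, HasDerivAt φ (φ' t) t) ∧ (∀ t, HasDerivAt ψ (ψ' t) t) ∧
      (∀ t, α * ψ' t + m * ψ t = (lam - k) * φ t) ∧ (∀ t, -(α * φ' t) + m * φ t = (lam + k) * ψ t) ∧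
      0 < ∫ t in Ioo (-1 : ℝ) 1, (‖φ t‖ ^ 2 + ‖ψ t‖ ^ 2) := by
  obtain ⟨ha, hapi, -, ha2⟩ := hE.sqrt_mem
  have hroot := hE.2
  set a := √E with ha'
  have hin : ∀ t : ℝ, HasDerivAt (fun t : ℝ => a * (1 - t)) (-a) t := fun t => by
    simpa using ((hasDerivAt_id t).const_sub 1).const_mul a
  have hs := fun t => (hin t).sin
  have hc := fun t => (hin t).cos
  -- Starting from `φ = (λ + k) sin (a (1 - t))`, the second equation of the system determines `ψ`.
  -- The first equation is then the dispersion relation, and the condition at `t = -1` is the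
  -- equation of the root.
  have hφr : ContDiff ℝ 2 fun t : ℝ => (lam + k) * Real.sin (a * (1 - t)) := by fun_prop
  have hψr : ContDiff ℝ 2 fun t : ℝ =>
      α * a * Real.cos (a * (1 - t)) + m * Real.sin (a * (1 - t)) := by fun_prop
  have hφc : ContDiff ℝ 2 fun t : ℝ => (((lam + k) * Real.sin (a * (1 - t)) : ℝ) : ℂ) :=
    Complex.ofRealCLM.contDiff.comp hφr
  have hψc : ContDiff ℝ 2 fun t : ℝ =>
      ((α * a * Real.cos (a * (1 - t)) + m * Real.sin (a * (1 - t)) : ℝ) : ℂ) :=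
    Complex.ofRealCLM.contDiff.comp hψr
  refine ⟨_, _, fun t => (((lam + k) * (Real.cos (a * (1 - t)) * -a) : ℝ) : ℂ),
    fun t => ((α * a * (-Real.sin (a * (1 - t)) * -a) + m * (Real.cos (a * (1 - t)) * -a) : ℝ) : ℂ),
    hφc, hψc, by simp, ?_, fun t => ((hs t).const_mul _).ofReal_comp,
    fun t => (((hc t).const_mul _).add ((hs t).const_mul _)).ofReal_comp, fun t => ?_, fun t => ?_, ?_⟩
  · rw [show a * (1 - -1) = 2 * a by ring]
    have : α * a * Real.cos (2 * a) + m * Real.sin (2 * a) = 0 := by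
      have h3 : α * (m / α * Real.sin (2 * a) + a * Real.cos (2 * a)) =
        α * a * Real.cos (2 * a) + m * Real.sin (2 * a) := by field_simp; ring
      rw [← h3, hroot, mul_zero]
    rw [this, Complex.ofReal_zero]
  · have hC : (lam : ℂ) ^ 2 = k ^ 2 + (α ^ 2 * a ^ 2 + m ^ 2) := by exact_mod_cast ha2.symm ▸ h
    push_cast
    linear_combination (-Complex.sin (a * (1 - t))) * hC
  · push_cast
    ring
  · rw [← integral_Ioc_eq_integral_Ioo, ← intervalIntegral.integral_of_le (by norm_num)]
    have c1 := hφc.continuous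
    have c2 := hψc.continuous
    refine intervalIntegral.intervalIntegral_pos_of_pos_on
      (((c1.norm.pow 2).add (c2.norm.pow 2)).intervalIntegrable _ _) (fun t ht => ?_) (by norm_num)
    have hs0 : 0 < Real.sin (a * (1 - t)) :=
      Real.sin_pos_of_pos_of_lt_pi (mul_pos ha (by linarith [ht.2])) (by nlinarith [ht.1])
    -- `λ² - k² = α² E + m²` is positive, so the mode does not vanish identically.
    have hk : lam + k ≠ 0 := fun h0 => by
      have hE0 : 0 < E := ha2 ▸ by positivity
      have : 0 < α ^ 2 * E := by positivity
      have h2 : lam ^ 2 = k ^ 2 := by rw [eq_neg_of_add_eq_zero_left h0, neg_sq]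
      linarith [sq_nonneg m]
    have : 0 < ‖(((lam + k) * Real.sin (a * (1 - t)) : ℝ) : ℂ)‖ :=
      norm_pos_iff.2 (Complex.ofReal_ne_zero.2 (mul_ne_zero hk hs0.ne'))
    positivity

/-- Wave packets are approximate eigenfunctions of the straight operator. -/
theorem norm_straight_packet_sq {α m k lam : ℝ} {φ ψ φ' ψ' : ℝ → ℂ} (hφ : ContDiff ℝ 2 φ)
    (hψ : ContDiff ℝ 2 ψ) (hφ' : ∀ t, HasDerivAt φ (φ' t) t) (hψ' : ∀ t, HasDerivAt ψ (ψ' t) t)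
    (h1 : ∀ t, α * ψ' t + m * ψ t = (lam - k) * φ t)
    (h2 : ∀ t, -(α * φ' t) + m * φ t = (lam + k) * ψ t) {N : ℝ} {y : core}
    (hy : (y : ℝ × ℝ → Spinor) = tensor (packet k N) (packet k N) φ ψ) :
    ‖straight α m y - (lam : ℂ) • incl y‖ ^ 2 =
      ∫ p in strip, ‖tensor (packetError k N) (packetError k N) φ ψ p‖ ^ 2 := by
  have hφ1 : ContDiff ℝ 1 φ := hφ.of_le (by norm_num)
  have hψ1 : ContDiff ℝ 1 ψ := hψ.of_le (by norm_num)
  have hc : ContDiff ℝ 1 (packet k N) := (contDiff_packet k N).of_le (by norm_num)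
  have e : ∀ᵐ p ∂volume.restrict strip, ‖(straight α m y - (lam : ℂ) • incl y : StripL2) p‖ ^ 2 =
      ‖tensor (packetError k N) (packetError k N) φ ψ p‖ ^ 2 := by
    filter_upwards [Lp.coeFn_sub (straight α m y) ((lam : ℂ) • incl y), coeFn_straight α m y,
      Lp.coeFn_smul (lam : ℂ) (incl y), coeFn_incl y] with p g1 g2 g3 g4
    rw [g1, Pi.sub_apply, g2, g3, Pi.smul_apply, g4, hy, dS_tensor hc hc hφ1 hψ1,
      dT_tensor hc hc hφ1 hψ1]
    have k1 := h1 p.2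
    have k2 := h2 p.2
    have e0 : symbol α m 1 0 (tensor (packet k N) (packet k N) φ ψ p)
        (tensor (deriv (packet k N)) (deriv (packet k N)) φ ψ p)
        (tensor (packet k N) (packet k N) (deriv φ) (deriv ψ) p) -
        (lam : ℂ) • tensor (packet k N) (packet k N) φ ψ p =
        sp (-Complex.I * (packetError k N p.1 * φ p.2)) (Complex.I * (packetError k N p.1 * ψ p.2)) := by
      simp only [tensor, (hasDerivAt_packet k N p.1).deriv, (hφ' p.2).deriv, (hψ' p.2).deriv]
      apply spinor_ext
      · simp [symbol]
        linear_combination packet k N p.1 * k1 - k * packet k N p.1 * φ p.2 * Complex.I_sq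
      · simp [symbol]
        linear_combination packet k N p.1 * k2 + k * packet k N p.1 * ψ p.2 * Complex.I_sq
    rw [e0, norm_sq_spinor, norm_sq_spinor (tensor _ _ _ _ p)]
    simp [tensor]
  rw [← integral_congr_ae e, ← norm_toLp_sq (Lp.memLp _), Lp.toLp_coeFn]

end Waveguide
end

/-! ### Weyl sequences above the threshold and the essential spectrum. -/

noncomputable section

open scoped InnerProductSpace

namespace Waveguide

namespace IsWaveguide

variable {γ : ℝ → Plane} {ε : ℝ} (hW : IsWaveguide γ ε)
include hW

/-- Above the threshold, there are approximate eigenfunctions at infinity. -/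
theorem mem_spectrum_of_le {m E lam : ℝ} (hm : 0 ≤ m) (hE : IsTransverseRoot (m * ε) E)
    (hlam : √(ε⁻¹ ^ 2 * E + m ^ 2) ≤ |lam|) : (lam : ℂ) ∈ UnboundedOp.spectrum (diracOp hW m) := by
  refine (hW.mem_spectrum_iff_strip hm).2 ⟨Complex.ofReal_im lam, fun c hc => ?_⟩
  have hε := hW.pos
  have hE' : IsTransverseRoot (m / ε⁻¹) E := by rwa [div_inv_eq_mul]
  have hle : ε⁻¹ ^ 2 * E + m ^ 2 ≤ lam ^ 2 := by
    rw [← sq_abs lam]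
    exact (Real.sqrt_le_left (abs_nonneg _)).1 hlam
  set k := √(lam ^ 2 - (ε⁻¹ ^ 2 * E + m ^ 2)) with hk
  have hk2 : lam ^ 2 = k ^ 2 + (ε⁻¹ ^ 2 * E + m ^ 2) := by
    rw [hk, Real.sq_sqrt (by linarith)]; ring
  obtain ⟨φ, ψ, φ', ψ', hφ, hψ, hφ1, hψ1, hφ', hψ', h1, h2, hpos⟩ :=
    exists_transverse_mode (inv_pos.2 hε) hE' hk2
  set W := ∫ t in Ioo (-1 : ℝ) 1, (‖φ t‖ ^ 2 + ‖ψ t‖ ^ 2) with hWdef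
  set Q := ∫ y, bump y ^ 2 with hQ
  have hQ0 : 0 < Q := integral_bump_sq_pos
  set Q' := ∫ y, deriv bump y ^ 2 with hQ'
  have hQ'0 : 0 ≤ Q' := integral_nonneg fun y => sq_nonneg _
  -- Error budget: the packet costs `ρ ≤ c/4`, and the curvature costs `η (|lam| + 2) = c/4`. The
  -- bound `ρ ≤ 1` serves to control the longitudinal derivative by `(|lam| + 1) ‖incl y‖`.
  set ρ := min 1 (c / 4) with hρ
  have hρ0 : 0 < ρ := lt_min one_pos (by positivity)
  set η := c / (4 * (|lam| + 2)) with hη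
  have hη0 : 0 < η := by positivity
  have eη : η * (|lam| + 2) = c / 4 := by rw [hη]; field_simp
  obtain ⟨R, hR0, hR⟩ := hW.exists_coeff_le hη0
  -- `N` must put the packet where the coefficients are `η`-close to straight, and make the ratio of
  -- error to norm, whose square is `Q' / (Q N²)`, at most `ρ`.
  obtain ⟨N, hNR, hNQ⟩ : ∃ N : ℝ, R ≤ N ∧ Q' ≤ ρ ^ 2 * Q * N ^ 2 := by
    have hlim : Tendsto (fun N : ℝ => ρ ^ 2 * Q * N ^ 2) atTop atTop :=
      (tendsto_pow_atTop two_ne_zero).const_mul_atTop (by positivity)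
    exact ((eventually_ge_atTop R).and (hlim.eventually_ge_atTop Q')).exists
  have hN : 0 < N := hR0.trans_le hNR
  set y : core := ⟨_, packet_tensor_mem_core hφ hψ hφ1 hψ1 k hN⟩ with hy
  have n1 : ‖incl y‖ ^ 2 = N * Q * W :=
    (norm_liftL2_sq core.subtype _ y).trans ((integral_norm_sq_tensor _ _ _).trans
      (by rw [integral_norm_sq_packet k hN]))
  have n2 : ‖straight ε⁻¹ m y - (lam : ℂ) • incl y‖ ^ 2 = N⁻¹ * Q' * W := by
    rw [norm_straight_packet_sq hφ hψ hφ' hψ' h1 h2 rfl, integral_norm_sq_tensor,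
      integral_norm_sq_packetError k hN]
  have hy0 : 0 < ‖incl y‖ := by
    have : 0 < ‖incl y‖ ^ 2 := by rw [n1]; positivity
    exact (norm_nonneg _).lt_of_ne fun h => by simp [← h] at this
  have n3 : ‖straight ε⁻¹ m y - (lam : ℂ) • incl y‖ ≤ ρ * ‖incl y‖ := by
    refine le_of_sq_le_sq ?_ (by positivity)
    rw [mul_pow, n1, n2]
    calc N⁻¹ * Q' * W ≤ N⁻¹ * (ρ ^ 2 * Q * N ^ 2) * W := by gcongr
      _ = ρ ^ 2 * (N * Q * W) := by field_simp
  have n4 := hW.norm_curved_sub_straight_le hη0.le (R := N) (fun p hp hp' => hR p hp (hNR.trans hp'))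
    m y fun p hp => by
      have hb : bump ((p.1 - 4 * N) / N) = 0 :=
        bump_eq_zero (le_abs_of_packet hN (by linarith : |p.1| < 2 * N)).le
      change tensor _ _ _ _ p = 0
      simp only [tensor, packet, hb]
      apply spinor_ext <;> simp
  have n5 : ‖inclS y‖ ≤ (|lam| + 1) * ‖incl y‖ := by
    have e1 := norm_le_norm_add_norm_sub' (straight ε⁻¹ m y) ((lam : ℂ) • incl y)
    rw [norm_smul, Complex.norm_real, Real.norm_eq_abs] at e1
    have e2 : ρ * ‖incl y‖ ≤ 1 * ‖incl y‖ := by gcongr; exact min_le_left _ _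
    linarith [norm_inclS_le ε⁻¹ m y]
  refine ⟨y, ?_⟩
  have e1 : hW.curved m y - (lam : ℂ) • incl y =
      (hW.curved m y - straight ε⁻¹ m y) + (straight ε⁻¹ m y - (lam : ℂ) • incl y) := by abel
  have e2 : ρ * ‖incl y‖ ≤ c / 4 * ‖incl y‖ := by gcongr; exact min_le_right _ _
  have e3 := mul_le_mul_of_nonneg_left n5 hη0.le
  have e4 : η * (|lam| + 2) * ‖incl y‖ = c / 4 * ‖incl y‖ := by rw [eη]
  rw [e1]
  refine (norm_add_le _ _).trans_lt ?_
  have : 0 < c * ‖incl y‖ := by positivity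
  linarith

/-- Inside the gap every spectral point is discrete. On the two closed half-lines every point is
spectral, and none is isolated. -/
theorem essentialSpectrum_diracOp {m E : ℝ} (hm : 0 ≤ m) (hE : IsTransverseRoot (m * ε) E) :
    UnboundedOp.essentialSpectrum (diracOp hW m) =
      (fun x : ℝ => (x : ℂ)) '' (Iic (-√(ε⁻¹ ^ 2 * E + m ^ 2)) ∪ Ici √(ε⁻¹ ^ 2 * E + m ^ 2)) := by
  ext z
  constructor
  · rintro ⟨hz, hd⟩
    have him := ((hW.mem_spectrum_iff_strip hm).1 hz).1
    have hre : ((z.re : ℝ) : ℂ) = z := Complex.ext (by simp) (by simp [him])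
    refine ⟨z.re, ?_, hre⟩
    by_contra h
    rw [mem_union, not_or, mem_Iic, mem_Ici, not_le, not_le] at h
    rw [← hre] at hz hd
    exact hd (hW.mem_discreteSpectrum hm hE (abs_lt.2 h) hz)
  · rintro ⟨lam, hlam, rfl⟩
    refine ⟨hW.mem_spectrum_of_le hm hE ?_, ?_⟩
    · rcases hlam with h | h
      · exact le_abs.2 (Or.inr (le_neg.1 h))
      · exact le_abs.2 (Or.inl h)
    · rintro ⟨-, ⟨U, hU, hUs⟩, -⟩
      -- Moving away from the origin stays in the same half-line, so every neighbourhood of `lam`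
      -- contains other spectral points, the end points of the half-lines included.
      obtain ⟨σ, hσ, hmem⟩ : ∃ σ : ℝ, σ ≠ 0 ∧ ∀ t > 0, √(ε⁻¹ ^ 2 * E + m ^ 2) ≤ |lam + σ * t| := by
        rcases hlam with h | h
        · exact ⟨-1, by norm_num, fun t ht => le_abs.2 (Or.inr (by linarith [mem_Iic.1 h]))⟩
        · exact ⟨1, by norm_num, fun t ht => le_abs.2 (Or.inl (by linarith [mem_Ici.1 h]))⟩
      have hlim : Tendsto (fun t : ℝ => ((lam + σ * t : ℝ) : ℂ)) (𝓝[>] 0) (𝓝 (lam : ℂ)) := by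
        have : Continuous fun t : ℝ => ((lam + σ * t : ℝ) : ℂ) := by fun_prop
        have h0 := this.tendsto 0
        rw [mul_zero, add_zero] at h0
        exact h0.mono_left nhdsWithin_le_nhds
      obtain ⟨t, htU, ht⟩ := ((hlim.eventually hU).and self_mem_nhdsWithin).exists
      have h1 : ((lam + σ * t : ℝ) : ℂ) ∈ U ∩ UnboundedOp.spectrum (diracOp hW m) :=
        ⟨htU, hW.mem_spectrum_of_le hm hE (hmem t ht)⟩
      rw [hUs, mem_singleton_iff, Complex.ofReal_inj, add_eq_left, mul_eq_zero] at h1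
      exact h1.elim hσ (ne_of_gt ht)

end IsWaveguide

end Waveguide
end

theorem theorem1 (γ : ℝ → Plane) (ε m : ℝ) (hW : Waveguide.IsWaveguide γ ε) (hm : 0 ≤ m) :
    IsSelfAdjoint (Waveguide.diracOp hW m) ∧
    (∀ z : ℂ, z ∈ UnboundedOp.spectrum (Waveguide.diracOp hW m) ↔
      -z ∈ UnboundedOp.spectrum (Waveguide.diracOp hW m)) ∧
    (∀ μ : ℝ, 0 ≤ μ → ∃! E : ℝ, Waveguide.IsTransverseRoot μ E) ∧
    ∀ E : ℝ, Waveguide.IsTransverseRoot (m * ε) E →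
      UnboundedOp.essentialSpectrum (Waveguide.diracOp hW m) =
        (fun x : ℝ => (x : ℂ)) '' (Set.Iic (-√(ε⁻¹ ^ 2 * E + m ^ 2)) ∪
          Set.Ici √(ε⁻¹ ^ 2 * E + m ^ 2)) := by
  exact ⟨(hW.isSelfAdjoint_diracOp hm).1, hW.mem_spectrum_iff_neg_mem hm,
    fun _ hμ => Waveguide.existsUnique_transverseRoot hμ,
    fun _ hE => hW.essentialSpectrum_diracOp hm hE⟩
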